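/- All groups are finite and all characters are complex. For a finite group $G$, let $\mathbb{Q}_{|G|}$ be the $|G|$-th cyclotomic field. Two irreducible characters $\chi,\psi$ of $G$ are called Galois conjugate if there is $\alpha\in\mathrm{Gal}(\mathbb{Q}_{|G|}|\mathbb{Q})$ with $\psi(g)=\chi(g)^{\alpha}$ for all $g\in G$. The group $G$ is called a $\mathbf{GC}^*$-group if any two non-linear irreducible characters of $G$ of the same degree are Galois conjugate. Theorem. Let $G=KL$ be a Frobenius group with Frobenius kernel $K$ and Frobenius complement $L$, and assume that $K$ is abelian. Then $G$ is a $\mathbf{GC}^*$-group if and only if $K$ is a minimal normal subgroup of $G$, $|K|=q^n$ for a prime $q$ and an integer $n\ge 1$, and at least one of the following holds: (a) $G\cong (C_3\times C_3)\rtimes Q_8$, where the quaternion group $Q_8$ of order $8$ acts faithfully on $C_3\times C_3$ (this determines the group up to isomorphism); (b) $L$ is cyclic and $|L|=(q^n-1)/d$ for some divisor $d$ of $q-1$ that is coprime to $n$. -/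

import Mathlib

/-- `G` is a Frobenius group with Frobenius kernel `K` and Frobenius complement `L`: `G = K ⋊ L`
is an internal semidirect product of nontrivial subgroups with `K` normal, and no nontrivial element
of `L` commutes with a nontrivial element of `K`. -/
structure IsFrobeniusGroup {G : Type*} [Group G] (K L : Subgroup G) : Prop where
  normal : K.Normal
  isComplement : Subgroup.IsComplement' K L
  kernel_ne_bot : K ≠ ⊥
  complement_ne_bot : L ≠ ⊥
  fixedPointFree : ∀ k ∈ K, ∀ l ∈ L, l * k * l⁻¹ = k → k = 1 ∨ l = 1

/-- `K` is a minimal normal subgroup of `G`. -/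
structure IsMinimalNormal {G : Type*} [Group G] (K : Subgroup G) : Prop where
  normal : K.Normal
  ne_bot : K ≠ ⊥
  minimal : ∀ N : Subgroup G, N.Normal → N ≤ K → N = ⊥ ∨ N = K

/-- `χ` is a (complex) irreducible character of `G`. -/
def IsIrrChar {G : Type*} [Group G] (χ : G → ℂ) : Prop :=
  ∃ (m : ℕ) (ρ : Representation ℂ G (Fin m → ℂ)), ρ.IsIrreducible ∧ χ = ρ.character

/-- The `n`-th cyclotomic field `ℚ_n`, as a subfield of `ℂ`. -/
noncomputable def cyclotomicSubfield (n : ℕ) : IntermediateField ℚ ℂ :=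
  IntermediateField.adjoin ℚ {z : ℂ | z ^ n = 1}

/-- `χ` and `ψ` are Galois conjugate: they take values in `ℚ_n`, `n = |G|`, and
`χ ^ α = ψ` for some `α` in the Galois group of `ℚ_n` over `ℚ`. -/
def GaloisConjugate {G : Type*} [Group G] (χ ψ : G → ℂ) : Prop :=
  ∃ α : Gal(cyclotomicSubfield (Nat.card G)/ℚ), ∀ g : G,
    ∃ z : cyclotomicSubfield (Nat.card G), (z : ℂ) = χ g ∧ ((α z : _) : ℂ) = ψ g

/-- Any two non-linear irreducible characters of `G` of the same degree are Galois conjugate. -/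
def IsGCStar (G : Type*) [Group G] : Prop :=
  ∀ χ ψ : G → ℂ, IsIrrChar χ → IsIrrChar ψ → χ 1 ≠ 1 → ψ 1 ≠ 1 → χ 1 = ψ 1 →
    GaloisConjugate χ ψ

/-- `G ≅ (C₃ × C₃) ⋊ Q₈`, where `Q₈` acts faithfully on `C₃ × C₃`. (`Aut (C₃ × C₃) = GL(2, 3)` has
a single conjugacy class of subgroups isomorphic to `Q₈`, so this is one isomorphism type.) -/
def IsC3C3Q8 (G : Type*) [Group G] : Prop :=
  ∃ φ : QuaternionGroup 2 →* MulAut (Multiplicative (ZMod 3) × Multiplicative (ZMod 3)),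
    Function.Injective φ ∧
      Nonempty (G ≃* (Multiplicative (ZMod 3) × Multiplicative (ZMod 3)) ⋊[φ] QuaternionGroup 2)

/-! Since `K` is abelian and `L` acts on it without fixed points, an irreducible character of `G`
either comes from `G/K`, a copy of `L`, or is induced from a nontrivial linear character of `K` and
has degree `|L|` (`IsFrobeniusGroup.trivial_or_character_eq`). Galois automorphisms act on linear
characters of `K` by powers. The condition on `G` therefore says that `L` permutes the nontrivial
characters of `K` transitively up to powers (`exists_eq_conjHom_pow`), and that nonlinear characters
of `L` of equal degree are conjugate. The transitivity makes `K` minimal normal of prime exponent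
`q`, and its dual becomes a space over the field of `q` elements on which `L` is free on nonzero
vectors and transitive on lines. Of the condition on `L` only `RationalValuesAgree` is needed: such
characters agree wherever one of them is rational. Twisting by linear characters turns this into a
strong tool (`RationalValuesAgree.apply_eq_one`).

The core is `RationalValuesAgree.isCyclic_or_quaternion`: a complement with this property is cyclic
or the quaternion group of order eight. The fixed point free action in characteristic `q` is first
replaced by a real orthogonal one (`exists_isFixedPointFreeRep`): an idempotent modulo `q` that is
killed by all sums over subgroups of prime order is lifted modulo powers of `q`, so those sums
cannot generate a nonzero integer in the integral group ring. In the resulting representation the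
normalized trace of an element of order `k` is `μ(k)/φ(k)`.

For `x` of order three put `S = ρ x - ρ x⁻¹`, so that `S² = -3`. The Möbius values allow only `-3,
3, 1, -1, 0` as normalized traces of products of two such matrices (`skew_cases`). Elements with
value `1` form lines of four points, the elements of order three of a binary tetrahedral group up to
inversion. A point is on at most two lines (`Adj.mem_line_or_mem_line`), and any two double lines
meet. If there is more than one subgroup of order three, conjugation maps `L` onto a group
containing the alternating group on the four subgroups of order three or on five double lines. With
four points, a linear character nontrivial on an element of order three contradicts a nonzero
rational value of a nonlinear character. With five, the permutation character of degree four and a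
symmetric cube take the values `4` and `-4` at the involution.

So there is at most one subgroup of order three, and elements of `3`-power order cannot permute the
three involutions of a Klein four-group (`conj_mul_inv_pow_three`). The Sylow `2`-subgroups have a
single involution, hence are cyclic or generalized quaternion. In the cyclic case all Sylow
subgroups are cyclic, some element of prime order is central, and a linear character detecting it
forces `L` to be abelian. In the quaternion case transfer and the sign of a coset action show that
the elements of odd order form a normal subgroup `O`; induced characters of degree two with values
`2` and `-2` at the involution force `O = 1` and order eight.

The numerical condition in the cyclic case is orbit counting for `L` times the scalars: with `e =
(q^n - 1)/(q - 1)` one gets `|L| = e t`, where `t = gcd(|L|, q - 1)`, and `d = (q - 1)/t` is prime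
to `e`, equivalently to `n` because `e ≡ n` modulo `d`. In the quaternion case the same count leaves
`q = 3`, `n = 2`. Conversely, for cyclic `L` the count gives transitivity and all nonlinear
characters are induced. For the quaternion group the eight nontrivial characters of `K` form one
orbit, and the one remaining nonlinear character has a different degree. -/

namespace Representation

/-! ### Irreducible complex representations: Schur's lemma, twists, separating diagonal operators.
-/

variable {G H V : Type*} [Group G] [Group H] [AddCommGroup V] [Module ℂ V]

theorem isIrreducible_of_forall [Nontrivial V] {ρ : Representation ℂ G V}
    (h : ∀ W : Submodule ℂ V, (∀ g, ∀ v ∈ W, ρ g v ∈ W) → W ≠ ⊥ → W = ⊤) :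
    ρ.IsIrreducible where
  exists_pair_ne := ⟨⊥, ⊤, fun e => by
    have := congrArg Subrepresentation.toSubmodule e
    exact bot_ne_top (α := Submodule ℂ V) this⟩
  eq_bot_or_eq_top W := by
    by_cases hW : W.toSubmodule = ⊥
    · exact Or.inl (Subrepresentation.toSubmodule_injective hW)
    · exact Or.inr (Subrepresentation.toSubmodule_injective
        (h W.toSubmodule (fun g v hv => W.apply_mem_toSubmodule g hv) hW))

theorem IsIrreducible.nontrivial_space {ρ : Representation ℂ G V} (h : ρ.IsIrreducible) :
    Nontrivial V := by
  by_contra hV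
  rw [not_nontrivial_iff_subsingleton] at hV
  obtain ⟨a, b, hab⟩ := h.exists_pair_ne
  exact hab (Subrepresentation.toSubmodule_injective (Subsingleton.elim _ _))

theorem IsIrreducible.eq_top_of_invariant {ρ : Representation ℂ G V} (h : ρ.IsIrreducible)
    (W : Submodule ℂ V) (hW : ∀ g, ∀ v ∈ W, ρ g v ∈ W) (hne : W ≠ ⊥) : W = ⊤ := by
  rcases h.eq_bot_or_eq_top (⟨W, fun g v hv => hW g v hv⟩ : Subrepresentation ρ) with e | e
  · exact absurd (congrArg Subrepresentation.toSubmodule e) hne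
  · exact congrArg Subrepresentation.toSubmodule e

theorem IsIrreducible.comp_surjective {ρ : Representation ℂ H V} (h : ρ.IsIrreducible)
    {f : G →* H} (hf : Function.Surjective f) :
    IsIrreducible (MonoidHom.comp ρ f : Representation ℂ G V) := by
  have := h.nontrivial_space
  refine isIrreducible_of_forall fun W hW hne => h.eq_top_of_invariant W (fun g v hv => ?_) hne
  obtain ⟨g, rfl⟩ := hf g
  exact hW g v hv

/-- The twist of a representation by a linear character. -/
noncomputable def twist (l : G →* ℂˣ) (ρ : Representation ℂ G V) : Representation ℂ G V where
  toFun g := (l g : ℂ) • ρ g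
  map_one' := by simp
  map_mul' a b := by
    ext v; simp [smul_smul, mul_comm]

theorem twist_apply (l : G →* ℂˣ) (ρ : Representation ℂ G V) (g : G) :
    twist l ρ g = (l g : ℂ) • ρ g := rfl

theorem IsIrreducible.twist {ρ : Representation ℂ G V} (h : ρ.IsIrreducible) (l : G →* ℂˣ) :
    (ρ.twist l).IsIrreducible := by
  have := h.nontrivial_space
  refine isIrreducible_of_forall fun W hW hne => h.eq_top_of_invariant W (fun g v hv => ?_) hne
  have h1 := W.smul_mem ((l g)⁻¹ : ℂˣ).val (hW g v hv)
  simpa [twist_apply, smul_smul] using h1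

theorem character_twist (l : G →* ℂˣ) (ρ : Representation ℂ G V) (g : G) :
    (ρ.twist l).character g = l g * ρ.character g := by
  simp [character, twist_apply]

/-- Schur's lemma. -/
theorem IsIrreducible.exists_eq_smul [FiniteDimensional ℂ V] {ρ : Representation ℂ G V}
    (h : ρ.IsIrreducible) (f : V →ₗ[ℂ] V) (hf : ∀ g v, f (ρ g v) = ρ g (f v)) :
    ∃ c : ℂ, ∀ v, f v = c • v := by
  have := h.nontrivial_space
  obtain ⟨c, hc⟩ := Module.End.exists_eigenvalue f
  refine ⟨c, fun v => ?_⟩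
  have := h.eq_top_of_invariant (Module.End.eigenspace f c) (fun g v hv => ?_) hc
  · have hv : v ∈ Module.End.eigenspace f c := this ▸ Submodule.mem_top
    exact Module.End.mem_eigenspace_iff.1 hv
  · rw [Module.End.mem_eigenspace_iff] at hv ⊢
    rw [hf, hv, map_smul]

theorem IsIrreducible.finrank_eq_one_of_commute [FiniteDimensional ℂ V] {ρ : Representation ℂ G V}
    (h : ρ.IsIrreducible) (hc : ∀ a b, ρ (a * b) = ρ (b * a)) : Module.finrank ℂ V = 1 := by
  have := h.nontrivial_space
  obtain ⟨v, hv⟩ := exists_ne (0 : V)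
  have hs : ∀ g, ∃ c : ℂ, ∀ v, ρ g v = c • v := fun g =>
    h.exists_eq_smul (ρ g) fun a w => by
      have := LinearMap.congr_fun (hc g a) w
      simpa using this
  have := h.eq_top_of_invariant (ℂ ∙ v) (fun g w hw => ?_) (by simpa using hv)
  · exact finrank_eq_one_iff_of_nonzero v hv |>.2 this
  · obtain ⟨c, hc⟩ := hs g
    rw [hc]; exact Submodule.smul_mem _ _ hw

theorem commute_of_finrank_eq_one {ρ : Representation ℂ G V}
    (h : Module.finrank ℂ V = 1) (a b : G) : ρ (a * b) = ρ (b * a) := by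
  obtain ⟨v, hv, hs⟩ := finrank_eq_one_iff'.1 h
  obtain ⟨c, hc⟩ := hs (ρ a v)
  obtain ⟨d, hd⟩ := hs (ρ b v)
  ext w
  obtain ⟨r, rfl⟩ := hs w
  simp [← hc, ← hd, smul_smul, mul_comm]

/-- `IsIrrChar` asks for coordinate space, while most representations below live on submodules or
kernels; a basis transports them. The last clause keeps track of the kernel, which the character
alone does not show directly. -/
theorem exists_pi_isIrreducible [FiniteDimensional ℂ V] {ρ : Representation ℂ G V}
    (h : ρ.IsIrreducible) : ∃ (m : ℕ) (σ : Representation ℂ G (Fin m → ℂ)), σ.IsIrreducible ∧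
      ρ.character = σ.character ∧ ∀ g, σ g = 1 → ρ g = 1 := by
  let e := (Module.finBasis ℂ V).equivFun
  let σ : Representation ℂ G (Fin (Module.finrank ℂ V) → ℂ) :=
    { toFun g := e.conj (ρ g)
      map_one' := by simp [LinearEquiv.conj_apply]; ext; simp
      map_mul' a b := by
        ext v; simp [LinearEquiv.conj_apply] }
  have := h.nontrivial_space
  have : Nontrivial (Fin (Module.finrank ℂ V) → ℂ) := e.symm.toEquiv.nontrivial
  refine ⟨_, σ, isIrreducible_of_forall fun W hW hne => ?_, ?_, fun g hg => ?_⟩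
  · have := h.eq_top_of_invariant (W.comap e.toLinearMap) (fun g v hv => ?_) ?_
    · rw [eq_top_iff]
      intro w _
      have hw : e.symm w ∈ W.comap e.toLinearMap := this ▸ Submodule.mem_top
      simpa using hw
    · have := hW g (e v) hv
      simpa [σ, LinearEquiv.conj_apply] using this
    · obtain ⟨w, hw, hw0⟩ := W.exists_mem_ne_zero_of_ne_bot hne
      refine Submodule.ne_bot_iff _ |>.2 ⟨e.symm w, by simpa using hw, by simpa using hw0⟩
  · ext g
    exact (LinearMap.trace_conj' (ρ g) e).symm
  · refine e.conj.injective ?_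
    change σ g = _
    rw [hg]
    ext v
    simp [LinearEquiv.conj_apply]

open scoped MonoidAlgebra in
/-- A nontrivial element of a finite group acts nontrivially on some irreducible complex
representation. -/
theorem exists_isIrreducible_apply_ne_one [Finite G] {g : G} (hg : g ≠ 1) :
    ∃ (m : ℕ) (σ : Representation ℂ G (Fin m → ℂ)), σ.IsIrreducible ∧ σ g ≠ 1 := by
  classical
  by_contra! hcon
  have : Fintype G := Fintype.ofFinite G
  have : NeZero (Nat.card G : ℂ) := ⟨by simp⟩
  have hss : IsSemisimpleModule ℂ[G] ℂ[G] := inferInstance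
  -- An element acting trivially on all irreducible representations fixes every simple left ideal
  -- pointwise. By Maschke these span the group algebra, so it fixes `1`.
  have key : ∀ S : Submodule ℂ[G] ℂ[G], IsSimpleModule ℂ[G] S → ∀ s ∈ S,
      MonoidAlgebra.of ℂ G g * s = s := by
    intro S hS s hs
    let S' : Submodule ℂ ℂ[G] := S.restrictScalars ℂ
    have hS' : ∀ (a : G), ∀ s ∈ S', MonoidAlgebra.of ℂ G a * s ∈ S' := fun a s hs =>
      S.smul_mem (MonoidAlgebra.of ℂ G a) hs
    let ρ : Representation ℂ G S' :=
      { toFun a := (LinearMap.mulLeft ℂ (MonoidAlgebra.of ℂ G a)).restrict (hS' a)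
        map_one' := by ext x; simp [MonoidAlgebra.one_def.symm]
        map_mul' a b := by
          refine LinearMap.ext fun x => Subtype.ext ?_
          change MonoidAlgebra.of ℂ G (a * b) * (x : ℂ[G]) =
            MonoidAlgebra.of ℂ G a * (MonoidAlgebra.of ℂ G b * (x : ℂ[G]))
          rw [map_mul, mul_assoc] }
    have hρ : ∀ a (x : S'), (ρ a x : ℂ[G]) = MonoidAlgebra.of ℂ G a * x := fun _ _ => rfl
    have hSn : Nontrivial S' := (IsSimpleModule.nontrivial ℂ[G] S : Nontrivial S)
    have h1 : ρ.IsIrreducible := by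
      refine isIrreducible_of_forall fun W hW hne => ?_
      have hcl : ∀ (c : ℂ[G]) (x : ℂ[G]), x ∈ W.map S'.subtype → c * x ∈ W.map S'.subtype := by
        rintro c _ ⟨x, hx, rfl⟩
        induction c using MonoidAlgebra.induction_linear with
        | zero => simp
        | add a b ha hb => rw [add_mul]; exact Submodule.add_mem _ ha hb
        | single a r =>
          refine ⟨r • ρ a x, W.smul_mem _ (hW a x hx), ?_⟩
          change r • (MonoidAlgebra.of ℂ G a * (x : ℂ[G])) = _
          rw [← smul_mul_assoc]
          simp
      let W' : Submodule ℂ[G] ℂ[G] :=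
        { carrier := W.map S'.subtype
          add_mem' := fun ha hb => Submodule.add_mem _ ha hb
          zero_mem' := Submodule.zero_mem _
          smul_mem' := fun c x hx => hcl c x hx }
      have hle : W' ≤ S := by
        rintro _ ⟨x, _, rfl⟩; exact x.2
      have hat : IsAtom S := isSimpleModule_iff_isAtom.1 hS
      rcases hat.le_iff.1 hle with h | h
      · refine absurd ?_ hne
        rw [Submodule.eq_bot_iff]
        intro x hx
        have : (x : ℂ[G]) ∈ W' := ⟨x, hx, rfl⟩
        rw [h, Submodule.mem_bot] at this
        exact Subtype.ext this
      · rw [eq_top_iff]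
        intro x _
        have : (x : ℂ[G]) ∈ W' := h ▸ x.2
        obtain ⟨y, hy, hxy⟩ := this
        rwa [← Subtype.ext hxy]
    obtain ⟨m, σ, hσ, -, h2⟩ := exists_pi_isIrreducible h1
    have h3 := LinearMap.congr_fun (h2 g (hcon m σ hσ)) ⟨s, hs⟩
    exact congrArg Subtype.val h3
  have htop := IsSemisimpleModule.sSup_simples_eq_top ℂ[G] ℂ[G]
  have h1 : (1 : ℂ[G]) ∈ sSup {m : Submodule ℂ[G] ℂ[G] | IsSimpleModule ℂ[G] m} :=
    htop ▸ Submodule.mem_top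
  have h2 : MonoidAlgebra.of ℂ G g * (1 : ℂ[G]) = 1 := by
    rw [sSup_eq_iSup'] at h1
    refine Submodule.iSup_induction _ (motive := fun x => MonoidAlgebra.of ℂ G g * x = x) h1
      (fun S x hx => key S S.2 x hx) (by simp) fun x y hx hy => by rw [mul_add, hx, hy]
  rw [mul_one] at h2
  exact hg (MonoidAlgebra.of_injective (h2.trans (map_one _).symm))

/-- If a subspace of `ι → ℂ` is stable under pointwise multiplication by functions that separate
the indices, it contains the basis vectors in the supports of its elements. -/
theorem single_mem_of_separating {ι α : Type*} [Fintype ι] [DecidableEq ι]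
    (W : Submodule ℂ (ι → ℂ)) (d : α → ι → ℂ) (hd : ∀ a, ∀ f ∈ W, d a * f ∈ W)
    (hsep : ∀ i j, i ≠ j → ∃ a, d a i ≠ d a j) {f : ι → ℂ} (hf : f ∈ W) {i : ι} (hi : f i ≠ 0) :
    Pi.single i 1 ∈ W := by
  have key : ∀ s : Finset ι, i ∉ s → ∃ f' ∈ W, f' i ≠ 0 ∧ ∀ j ∈ s, f' j = 0 := by
    intro s
    induction s using Finset.induction_on with
    | empty => exact fun _ => ⟨f, hf, hi, by simp⟩
    | insert j s hj ih =>
      intro hs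
      rw [Finset.mem_insert, not_or] at hs
      obtain ⟨f', h1, h2, h3⟩ := ih hs.2
      obtain ⟨a, ha⟩ := hsep i j hs.1
      -- This kills coordinate `j`, keeps the zeros already obtained, and multiplies coordinate `i`
      -- by the nonzero number `d a i - d a j`.
      refine ⟨d a * f' - d a j • f', W.sub_mem (hd a _ h1) (W.smul_mem _ h1), ?_, ?_⟩
      · simpa [sub_eq_zero, h2] using ha
      · intro k hk
        rcases Finset.mem_insert.1 hk with rfl | hk
        · simp
        · simp [h3 k hk]
  obtain ⟨f', h1, h2, h3⟩ := key (Finset.univ.erase i) (by simp)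
  have : Pi.single i 1 = (f' i)⁻¹ • f' := by
    ext j
    by_cases hj : j = i
    · subst hj; simp [h2]
    · simp [hj, h3 j (by simp [hj])]
  rw [this]; exact W.smul_mem _ h1

end Representation

/-! ### Operations on irreducible characters. -/

section IrrChar
variable {G H V : Type*} [Group G] [Group H] [AddCommGroup V] [Module ℂ V]

open Representation

theorem IsIrrChar.of_rep [FiniteDimensional ℂ V] {ρ : Representation ℂ G V}
    (h : ρ.IsIrreducible) : IsIrrChar ρ.character := by
  obtain ⟨m, σ, h1, h2, -⟩ := exists_pi_isIrreducible h
  exact ⟨m, σ, h1, h2⟩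

theorem IsIrrChar.comp {χ : H → ℂ} (h : IsIrrChar χ) {f : G →* H}
    (hf : Function.Surjective f) : IsIrrChar (fun g => χ (f g)) := by
  obtain ⟨m, ρ, hρ, rfl⟩ := h
  exact ⟨m, _, hρ.comp_surjective hf, rfl⟩

theorem IsIrrChar.twist {χ : G → ℂ} (h : IsIrrChar χ) (l : G →* ℂˣ) :
    IsIrrChar (fun g => (l g : ℂ) * χ g) := by
  obtain ⟨m, ρ, hρ, rfl⟩ := h
  exact ⟨m, _, hρ.twist l, by ext g; rw [character_twist]⟩

/-- The commutator survives in `G ⧸ N`, so some irreducible representation of the quotient moves it.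
In dimension one commutators act trivially, so that representation is nonlinear. -/
theorem IsIrrChar.exists_of_commutator_notMem [Finite G] (N : Subgroup G) [N.Normal] {a b : G}
    (h : a * b * a⁻¹ * b⁻¹ ∉ N) : ∃ χ : G → ℂ, IsIrrChar χ ∧ χ 1 ≠ 1 ∧ ∀ n ∈ N, χ n = χ 1 := by
  have h1 : ((a * b * a⁻¹ * b⁻¹ : G) : G ⧸ N) ≠ 1 := by
    rwa [Ne, QuotientGroup.eq_one_iff]
  obtain ⟨m, σ, hσ, h2⟩ := exists_isIrreducible_apply_ne_one h1
  refine ⟨fun g => σ.character (g : G ⧸ N), IsIrrChar.comp ⟨m, σ, hσ, rfl⟩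
    (f := QuotientGroup.mk' N) (QuotientGroup.mk'_surjective N), fun h3 => h2 ?_, fun n hn => ?_⟩
  · have h4 : Module.finrank ℂ (Fin m → ℂ) = 1 := by
      have : σ.character 1 = 1 := h3
      rw [char_one] at this
      exact_mod_cast this
    have h5 := commute_of_finrank_eq_one (ρ := σ) h4 a b
    have h6 : ((a * b * a⁻¹ * b⁻¹ : G) : G ⧸ N) = ((a : G ⧸ N) * b) * ((b : G ⧸ N) * a)⁻¹ := by
      simp [mul_assoc]
    rw [h6, map_mul, h5, ← map_mul, mul_inv_cancel, map_one]
  · change σ.character (n : G ⧸ N) = σ.character 1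
    rw [(QuotientGroup.eq_one_iff n).2 hn]

end IrrChar

open Representation

/-! ### Representations induced from linear characters. -/

section Induced

variable {G ι : Type*} [Group G] [Fintype ι] [DecidableEq ι]

open Classical in
/-- A linear character of a subgroup, extended by zero. -/
noncomputable def extendByZero (H : Subgroup G) (ν : H →* ℂˣ) (g : G) : ℂ :=
  if h : g ∈ H then (ν ⟨g, h⟩ : ℂ) else 0

theorem extendByZero_of_mem {H : Subgroup G} {ν : H →* ℂˣ} {g : G} (h : g ∈ H) :
    extendByZero H ν g = ν ⟨g, h⟩ := dif_pos h

theorem extendByZero_of_notMem {H : Subgroup G} {ν : H →* ℂˣ} {g : G} (h : g ∉ H) :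
    extendByZero H ν g = 0 := dif_neg h

/-- The representation induced from a linear character `ν` of `H`, in the basis given by a
left transversal `r` of `H`. -/
noncomputable def inducedRep (H : Subgroup G) (ν : H →* ℂˣ) (r : ι → G)
    (hr : ∀ g, ∃! j, (r j)⁻¹ * g ∈ H) : Representation ℂ G (ι → ℂ) where
  toFun g := Matrix.toLin' (Matrix.of fun i j => extendByZero H ν ((r i)⁻¹ * g * r j))
  map_one' := by
    change _ = LinearMap.id
    rw [← Matrix.toLin'_one]
    congr 1
    ext i j
    by_cases hij : i = j
    · subst hij
      have : (r i)⁻¹ * 1 * r i = 1 := by group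
      simp only [Matrix.of_apply, Matrix.one_apply_eq, this]
      rw [extendByZero_of_mem H.one_mem]
      have : (⟨1, H.one_mem⟩ : H) = 1 := rfl
      rw [this, map_one]; rfl
    · rw [Matrix.of_apply, Matrix.one_apply_ne hij, extendByZero_of_notMem]
      intro h
      refine hij ((hr (r j)).unique (y₁ := i) (y₂ := j) (by simpa using h) (by simp))
  map_mul' a b := by
    change _ = Matrix.toLin' _ ∘ₗ Matrix.toLin' _
    rw [← Matrix.toLin'_mul]
    congr 1
    ext i k
    rw [Matrix.mul_apply]
    simp only [Matrix.of_apply]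
    -- The matrix of `b` is monomial: its column `k` is nonzero only in the row of the coset of `b *
    -- r k`, so the sum over `j` has a single term.
    obtain ⟨j, hj, huniq⟩ := hr (b * r k)
    rw [Finset.sum_eq_single j]
    · by_cases h : (r i)⁻¹ * a * r j ∈ H
      · have hb : (r j)⁻¹ * b * r k ∈ H := by rwa [mul_assoc]
        have hab : (r i)⁻¹ * (a * b) * r k ∈ H := by
          have := H.mul_mem h hb
          convert this using 1; group
        rw [extendByZero_of_mem h, extendByZero_of_mem hb, extendByZero_of_mem hab,
          ← Units.val_mul, ← map_mul]
        congr 3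
        group
      · rw [extendByZero_of_notMem h, zero_mul, extendByZero_of_notMem]
        intro hab
        refine h ?_
        have := H.mul_mem hab (H.inv_mem hj)
        convert this using 1; group
    · intro j' _ hj'
      rw [extendByZero_of_notMem (g := (r j')⁻¹ * b * r k), mul_zero]
      intro h
      exact hj' (huniq j' (by simpa [mul_assoc] using h))
    · simp

theorem inducedRep_apply (H : Subgroup G) (ν : H →* ℂˣ) (r : ι → G)
    (hr : ∀ g, ∃! j, (r j)⁻¹ * g ∈ H) (g : G) (f : ι → ℂ) (i : ι) :
    inducedRep H ν r hr g f i = ∑ j, extendByZero H ν ((r i)⁻¹ * g * r j) * f j := by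
  change Matrix.toLin' _ f i = _
  rw [Matrix.toLin'_apply]; rfl

theorem inducedRep_character (H : Subgroup G) (ν : H →* ℂˣ) (r : ι → G)
    (hr : ∀ g, ∃! j, (r j)⁻¹ * g ∈ H) (g : G) :
    (inducedRep H ν r hr).character g = ∑ i, extendByZero H ν ((r i)⁻¹ * g * r i) := by
  change LinearMap.trace ℂ _ (Matrix.toLin' _) = _
  rw [Matrix.trace_toLin'_eq]; rfl

/-- Mackey's criterion for a normal subgroup. Elements of `H` act diagonally through the conjugates
of `ν`; distinct conjugates separate coordinates, so an invariant subspace contains a basis vector,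
and `G` permutes the coordinate lines transitively. -/
theorem inducedRep_isIrreducible [Nonempty ι] (H : Subgroup G) [H.Normal] (ν : H →* ℂˣ) (r : ι → G)
    (hr : ∀ g, ∃! j, (r j)⁻¹ * g ∈ H)
    (hν : ∀ i j, i ≠ j → ∃ h ∈ H, extendByZero H ν ((r i)⁻¹ * h * r i) ≠
      extendByZero H ν ((r j)⁻¹ * h * r j)) :
    (inducedRep H ν r hr).IsIrreducible := by
  have hdiag : ∀ i j, i ≠ j → ∀ h ∈ H, (r i)⁻¹ * h * r j ∉ H := by
    intro i j hij h hh hm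
    refine hij ((hr (r j)).unique (y₁ := i) (y₂ := j) ?_ (by simp))
    have h1 : (r j)⁻¹ * h⁻¹ * r j ∈ H := by
      have := Subgroup.Normal.conj_mem ‹H.Normal› h⁻¹ (H.inv_mem hh) (r j)⁻¹
      simpa using this
    have := H.mul_mem hm h1
    convert this using 1; group
  refine isIrreducible_of_forall fun W hW hne => ?_
  obtain ⟨f, hf, hf0⟩ := W.exists_mem_ne_zero_of_ne_bot hne
  obtain ⟨i, hi⟩ := Function.ne_iff.1 hf0
  have hs : Pi.single i (1 : ℂ) ∈ W := by
    refine single_mem_of_separating W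
      (fun (h : H) i => extendByZero H ν ((r i)⁻¹ * h * r i)) (fun h f hf => ?_)
      (fun i j hij => ?_) hf hi
    · have := hW h f hf
      convert this using 1
      ext i
      rw [inducedRep_apply, Finset.sum_eq_single i]
      · rfl
      · intro j _ hj
        rw [extendByZero_of_notMem (hdiag i j hj.symm h h.2), zero_mul]
      · simp
    · obtain ⟨h, hh, h1⟩ := hν i j hij
      exact ⟨⟨h, hh⟩, h1⟩
  have hall : ∀ k, Pi.single k (1 : ℂ) ∈ W := by
    intro k
    have := hW (r k * (r i)⁻¹) _ hs
    convert this using 1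
    ext l
    rw [inducedRep_apply, Finset.sum_eq_single i]
    · have h1 : (r l)⁻¹ * (r k * (r i)⁻¹) * r i = (r l)⁻¹ * r k := by group
      rw [h1]
      by_cases hlk : l = k
      · subst hlk
        simp only [Pi.single_eq_same, inv_mul_cancel, mul_one]
        rw [extendByZero_of_mem H.one_mem]
        have : (⟨1, H.one_mem⟩ : H) = 1 := rfl
        rw [this, map_one]; rfl
      · rw [Pi.single_eq_of_ne hlk, extendByZero_of_notMem, zero_mul]
        intro h
        exact hlk ((hr (r k)).unique (y₁ := l) (y₂ := k) h (by simp))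
    · intro j _ hj
      rw [Pi.single_eq_of_ne hj, mul_zero]
    · simp
  rw [eq_top_iff]
  intro f _
  rw [← Finset.univ_sum_single f]
  refine W.sum_mem fun k _ => ?_
  have := W.smul_mem (f k) (hall k)
  rwa [← Pi.single_smul, smul_eq_mul, mul_one] at this

/-- Induction of a linear character from a subgroup of index two. -/
theorem IsIrrChar.induced_of_index_two (C : Subgroup G) (hC : C.index = 2) (ν : C →* ℂˣ) {t c : G}
    (ht : t ∉ C) (hc : c ∈ C)
    (hν : extendByZero C ν (t⁻¹ * c * t) ≠ extendByZero C ν c) :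
    IsIrrChar (fun g => extendByZero C ν g + extendByZero C ν (t⁻¹ * g * t)) := by
  have hn : C.Normal := Subgroup.normal_of_index_eq_two hC
  let r : Fin 2 → G := ![1, t]
  have hr : ∀ g, ∃! j, (r j)⁻¹ * g ∈ C := by
    intro g
    have h2 : t⁻¹ * g ∈ C ↔ g ∉ C := by
      rw [Subgroup.mul_mem_iff_of_index_two hC, C.inv_mem_iff]
      tauto
    by_cases hg : g ∈ C
    · refine ⟨0, by simpa [r] using hg, fun j hj => ?_⟩
      fin_cases j
      · rfl
      · exact absurd hg (h2.1 hj)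
    · refine ⟨1, h2.2 hg, fun j hj => ?_⟩
      fin_cases j
      · exact absurd (by simpa [r] using hj) hg
      · rfl
  have h := inducedRep_isIrreducible C ν r hr (fun i j hij => ⟨c, hc, ?_⟩)
  · convert IsIrrChar.of_rep h using 1
    ext g
    rw [inducedRep_character, Fin.sum_univ_two]
    simp [r]
  · fin_cases i <;> fin_cases j <;> first | exact absurd rfl hij | skip
    · simpa [r] using hν.symm
    · simpa [r] using hν

end Induced

/-! ### The sum-zero part of a permutation representation. -/

section Standard

variable {G Y : Type*} [Group G] [Fintype Y] [MulAction G Y]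

/-- The sum-zero part of a permutation representation. -/
noncomputable def standardRep (G Y : Type*) [Group G] [Fintype Y] [MulAction G Y] :
    Representation ℂ G (LinearMap.ker (∑ y, LinearMap.proj y : (Y → ℂ) →ₗ[ℂ] ℂ)) where
  toFun g := (LinearMap.funLeft ℂ ℂ (fun y : Y => g⁻¹ • y)).restrict (fun f hf => by
    rw [LinearMap.mem_ker] at hf ⊢
    simp only [LinearMap.sum_apply, LinearMap.proj_apply, LinearMap.funLeft_apply] at hf ⊢
    have : ∑ y, f (g⁻¹ • y) = ∑ y, f y := Equiv.sum_comp (MulAction.toPerm g⁻¹) f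
    rwa [this])
  map_one' := by
    refine LinearMap.ext fun f => Subtype.ext (funext fun y => ?_)
    change (f : Y → ℂ) ((1 : G)⁻¹ • y) = _
    simp
  map_mul' a b := by
    refine LinearMap.ext fun f => Subtype.ext (funext fun y => ?_)
    change (f : Y → ℂ) ((a * b)⁻¹ • y) = (f : Y → ℂ) (b⁻¹ • a⁻¹ • y)
    rw [mul_inv_rev, mul_smul]

theorem standardRep_apply (g : G) (f) (y : Y) :
    (standardRep G Y g f : Y → ℂ) y = (f : Y → ℂ) (g⁻¹ • y) := rfl

/-- The trace is computed on the whole function space, for the operator that permutes coordinates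
and subtracts the mean. It maps into the sum-zero space and restricts there to the action, and its
matrix trace is the number of fixed points minus one. -/
theorem standardRep_character [Nonempty Y] [DecidableEq Y] (g : G) :
    (standardRep G Y).character g = (Finset.univ.filter fun y : Y => g • y = y).card - 1 := by
  set V := LinearMap.ker (∑ y, LinearMap.proj y : (Y → ℂ) →ₗ[ℂ] ℂ) with hV
  let M : Matrix Y Y ℂ := Matrix.of fun i j =>
    (if g⁻¹ • i = j then 1 else 0) - (Fintype.card Y : ℂ)⁻¹
  have hcard : (Fintype.card Y : ℂ) ≠ 0 := by simp
  have hM : ∀ f i, Matrix.toLin' M f i = f (g⁻¹ • i) - (Fintype.card Y : ℂ)⁻¹ * ∑ j, f j := by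
    intro f i
    rw [Matrix.toLin'_apply]
    simp [Matrix.mulVec, dotProduct, M, sub_mul, Finset.sum_sub_distrib, Finset.mul_sum]
  have hmem : ∀ f, Matrix.toLin' M f ∈ V := by
    intro f
    rw [hV, LinearMap.mem_ker]
    simp only [LinearMap.sum_apply, LinearMap.proj_apply, hM, Finset.sum_sub_distrib,
      Finset.sum_const, Finset.card_univ, nsmul_eq_mul]
    have : ∑ y, f (g⁻¹ • y) = ∑ y, f y := Equiv.sum_comp (MulAction.toPerm g⁻¹) f
    rw [this, mul_inv_cancel_left₀ hcard, sub_self]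
  have h1 := LinearMap.trace_restrict_eq_of_forall_mem V (Matrix.toLin' M) hmem
  have h2 : standardRep G Y g = (Matrix.toLin' M).restrict (p := V) (fun x _ => hmem x) := by
    refine LinearMap.ext fun f => Subtype.ext (funext fun y => ?_)
    rw [standardRep_apply]
    change _ = Matrix.toLin' M (f : Y → ℂ) y
    have hf := f.2
    rw [LinearMap.mem_ker] at hf
    simp only [LinearMap.sum_apply, LinearMap.proj_apply] at hf
    rw [hM, hf]; simp
  change LinearMap.trace ℂ V (standardRep G Y g) = _
  rw [h2, h1, Matrix.trace_toLin'_eq]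
  simp only [Matrix.trace, Matrix.diag, M, Matrix.of_apply, Finset.sum_sub_distrib,
    Finset.sum_const, Finset.card_univ, nsmul_eq_mul, mul_inv_cancel₀ hcard]
  rw [Finset.sum_boole]
  congr 3
  ext y
  simp only [Finset.mem_filter, Finset.mem_univ, true_and]
  rw [inv_smul_eq_iff]
  exact eq_comm

/-- The sum-zero part of a doubly transitive permutation representation is irreducible. -/
theorem standardRep_isIrreducible [Finite G] [Nontrivial Y]
    (h : ∀ a b c d : Y, a ≠ b → c ≠ d → ∃ g : G, g • a = c ∧ g • b = d) :
    (standardRep G Y).IsIrreducible := by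
  classical
  have := Fintype.ofFinite G
  set V := LinearMap.ker (∑ y, LinearMap.proj y : (Y → ℂ) →ₗ[ℂ] ℂ) with hV
  have hsum : ∀ f : V, ∑ y, (f : Y → ℂ) y = 0 := by
    intro f
    have := LinearMap.mem_ker.1 f.2
    simpa only [LinearMap.sum_apply, LinearMap.proj_apply] using this
  obtain ⟨a₀, b₀, hab⟩ := exists_pair_ne Y
  have hmemV : ∀ a b : Y, Pi.single a (1 : ℂ) - Pi.single b 1 ∈ V := by
    intro a b; rw [hV, LinearMap.mem_ker]; simp
  have : Nontrivial V := ⟨⟨⟨_, hmemV a₀ b₀⟩, 0, fun e => by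
    have := congrFun (congrArg Subtype.val e) a₀
    simp [hab] at this⟩⟩
  refine isIrreducible_of_forall fun W hW hne => ?_
  obtain ⟨f, hf, hf0⟩ := W.exists_mem_ne_zero_of_ne_bot hne
  obtain ⟨a, ha⟩ : ∃ a, (f : Y → ℂ) a ≠ 0 := by
    by_contra! hcon
    exact hf0 (Subtype.ext (funext hcon))
  -- average over the stabilizer of `a`
  let S : Finset G := Finset.univ.filter fun g => g • a = a
  let F : V := ∑ g ∈ S, standardRep G Y g f
  have hF : F ∈ W := W.sum_mem fun g _ => hW g f hf
  have hFv : ∀ y, (F : Y → ℂ) y = ∑ g ∈ S, (f : Y → ℂ) (g⁻¹ • y) := by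
    intro y
    simp only [F, AddSubmonoidClass.coe_finsetSum, Finset.sum_apply]
    rfl
  have hFa : (F : Y → ℂ) a = S.card * (f : Y → ℂ) a := by
    rw [hFv, Finset.sum_congr rfl (g := fun _ => (f : Y → ℂ) a), Finset.sum_const, nsmul_eq_mul]
    intro g hg
    have : g • a = a := by simpa [S] using hg
    rw [inv_smul_eq_iff.2 this.symm]
  -- The stabilizer of `a` is transitive on the other points; multiplying the summation index by an
  -- element that fixes `a` and moves `c` to `b` matches the two sums.
  have hFb : ∀ b c, b ≠ a → c ≠ a → (F : Y → ℂ) b = (F : Y → ℂ) c := by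
    intro b c hb hc
    obtain ⟨k, hk1, hk2⟩ := h a c a b hc.symm hb.symm
    rw [hFv, hFv]
    refine Finset.sum_bij' (fun g _ => k⁻¹ * g) (fun g _ => k * g) ?_ ?_ ?_ ?_ ?_
    · intro g hg
      have : g • a = a := by simpa [S] using hg
      simp [S, mul_smul, this, inv_smul_eq_iff, hk1]
    · intro g hg
      have : g • a = a := by simpa [S] using hg
      simp [S, mul_smul, this, hk1]
    · intro g _; simp
    · intro g _; simp
    · intro g _
      rw [mul_inv_rev, inv_inv, mul_smul, hk2]
  have hSpos : (S.card : ℂ) ≠ 0 := by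
    have : (1 : G) ∈ S := by simp [S]
    exact_mod_cast (Finset.card_pos.2 ⟨1, this⟩).ne'
  have hFa0 : (F : Y → ℂ) a ≠ 0 := by rw [hFa]; exact mul_ne_zero hSpos ha
  obtain ⟨b, hb⟩ := exists_ne a
  have hdiff : (F : Y → ℂ) a - (F : Y → ℂ) b ≠ 0 := by
    intro h0
    have h1 := hsum F
    rw [Finset.sum_congr rfl (g := fun _ => (F : Y → ℂ) a)] at h1
    · simp [hFa0] at h1
    · intro y _
      by_cases hy : y = a
      · rw [hy]
      · rw [hFb y b hy hb, sub_eq_zero.1 h0]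
  -- `F` takes one value at `a` and another one everywhere else, so a difference of two translates
  -- is a nonzero multiple of a difference of two basis vectors. These span the sum-zero space.
  have hpair : ∀ a' b' : Y, (⟨_, hmemV a' b'⟩ : V) ∈ W := by
    intro a' b'
    by_cases hab' : a' = b'
    · subst hab'
      convert W.zero_mem
      simp
    obtain ⟨g₁, hg₁, -⟩ := h a b a' b' hb.symm hab'
    obtain ⟨g₂, hg₂, -⟩ := h a b b' a' hb.symm (Ne.symm hab')
    have h1 := W.smul_mem (((F : Y → ℂ) a - (F : Y → ℂ) b)⁻¹)
      (W.sub_mem (hW g₁ F hF) (hW g₂ F hF))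
    convert h1 using 1
    refine Subtype.ext (funext fun y => ?_)
    have hval : ∀ (g : G) (c : Y), g • a = c → ∀ y,
        (F : Y → ℂ) (g⁻¹ • y) = if y = c then (F : Y → ℂ) a else (F : Y → ℂ) b := by
      intro g c hg y
      split_ifs with hy
      · rw [hy, ← hg, inv_smul_smul]
      · refine hFb _ _ (fun e => hy ?_) hb
        rw [← hg, ← e, smul_inv_smul]
    change _ = ((F : Y → ℂ) a - (F : Y → ℂ) b)⁻¹ *
      ((F : Y → ℂ) (g₁⁻¹ • y) - (F : Y → ℂ) (g₂⁻¹ • y))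
    rw [hval g₁ a' hg₁, hval g₂ b' hg₂]
    by_cases h1 : y = a'
    · subst h1
      simp [hab', hdiff]
    · by_cases h2 : y = b'
      · subst h2
        simp only [Pi.sub_apply, Pi.single_eq_same, if_neg h1, if_true,
          Pi.single_eq_of_ne h1]
        rw [← neg_sub ((F : Y → ℂ) a), mul_neg, inv_mul_cancel₀ hdiff, zero_sub]
      · simp [h1, h2]
  rw [eq_top_iff]
  intro f' _
  have : f' = ∑ y, (f' : Y → ℂ) y • (⟨_, hmemV y a⟩ : V) := by
    refine Subtype.ext (funext fun y => ?_)
    simp only [AddSubmonoidClass.coe_finsetSum, Finset.sum_apply, SetLike.val_smul, Pi.smul_apply,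
      Pi.sub_apply, smul_eq_mul, mul_sub, Finset.sum_sub_distrib]
    rw [← Finset.sum_mul, hsum f', zero_mul, sub_zero]
    simp [Pi.single_apply]
  rw [this]
  exact W.sum_mem fun y _ => W.smul_mem _ (hpair _ _)

end Standard

/-! ### Arithmetic of `μ(k)/φ(k)`. -/

open ArithmeticFunction in
theorem Nat.dvd_thirty_of_moebius_ne_zero {k : ℕ} (h : moebius k ≠ 0) (hk : k.totient ≤ 4) :
    k ∣ 30 := by
  have hsq := moebius_ne_zero_iff_squarefree.1 h
  rw [← Nat.prod_primeFactors_of_squarefree hsq]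
  have : k.primeFactors ⊆ {2, 3, 5} := by
    intro p hp
    have hpp := Nat.prime_of_mem_primeFactors hp
    have h1 := Nat.totient_dvd_of_dvd (Nat.dvd_of_mem_primeFactors hp)
    rw [Nat.totient_prime hpp] at h1
    have h2 := Nat.le_of_dvd (Nat.totient_pos.2 (Nat.pos_of_ne_zero hsq.ne_zero)) h1
    have : p ≤ 5 := by lia
    interval_cases p <;> simp_all (config := {decide := true})
  exact (Finset.prod_dvd_prod_of_subset _ _ (fun p : ℕ => p) this).trans (by decide)

theorem totient_arith_aux {a b : ℕ} (ha : 0 < a) (h : a * 2 = a * b) : b = 2 :=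
  (Nat.eq_of_mul_eq_mul_left ha h).symm

/-- The equation reads `(a - 2)(b - 2) = 4`. Its other positive solutions contain a `3`, which is
never a value of the totient function. -/
theorem totient_arith_aux₂ {a b : ℕ} (ha : 0 < a) (hb : 0 < b) (ha3 : a ≠ 3) (hb3 : b ≠ 3)
    (h : 2 * (a + b) = a * b) : a = 4 ∧ b = 4 := by
  have h1 : 4 ≤ a := by
    by_contra hlt
    have : a = 1 ∨ a = 2 := by lia
    rcases this with rfl | rfl <;> lia
  have h2 : 4 ≤ b := by
    by_contra hlt
    have : b = 1 ∨ b = 2 := by lia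
    rcases this with rfl | rfl <;> lia
  obtain ⟨p, rfl⟩ := Nat.exists_eq_add_of_le h1
  obtain ⟨q, rfl⟩ := Nat.exists_eq_add_of_le h2
  have : (4 + p) * (4 + q) = 16 + 4 * p + 4 * q + p * q := by ring
  lia

theorem totient_arith_aux₃ {a b : ℕ} (ha : 0 < a) (h : 2 * b = a * b + 2 * a) :
    a = 1 ∧ b = 2 := by
  have : a = 1 := by
    by_contra hne
    have h2 : 2 ≤ a := by lia
    have := Nat.mul_le_mul_right b h2
    lia
  subst this; exact ⟨rfl, by lia⟩

open ArithmeticFunction in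
-- Here `k` and `l` will be the orders of `x y` and `x y⁻¹` for `x`, `y` of order three. The
-- solutions correspond to `y = x⁻¹`, to `y = x`, to one of the products having order six, and to
-- both having order ten. After clearing denominators the Möbius signs bound both relevant totients
-- by four.
theorem moebius_div_totient_add {k l : ℕ} (hk : k ≠ 0) (hl : l ≠ 0)
    (h : (moebius k : ℝ) / k.totient + (moebius l : ℝ) / l.totient = 1 / 2) :
    (k = 1 ∧ l = 3) ∨ (k = 3 ∧ l = 1) ∨ (k = 6 ∧ (moebius l : ℝ) / l.totient = 0) ∨
    ((moebius k : ℝ) / k.totient = 0 ∧ l = 6) ∨ (k = 10 ∧ l = 10) := by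
  have hcl : ∀ {m : ℕ}, moebius m ≠ 0 → m.totient ≤ 4 → m = 1 ∨ m = 2 ∨ m = 3 ∨ m = 5 ∨ m = 6 ∨
      m = 10 ∨ m = 15 ∨ m = 30 := by
    intro m h1 h2
    have h3 := Nat.dvd_thirty_of_moebius_ne_zero h1 h2
    have h4 := Nat.le_of_dvd (by norm_num) h3
    interval_cases m <;> simp_all (config := {decide := true})
  have m1 : moebius 1 = 1 := moebius_apply_one
  have m2 : moebius 2 = -1 := moebius_apply_prime Nat.prime_two
  have m3 : moebius 3 = -1 := moebius_apply_prime Nat.prime_three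
  have m5 : moebius 5 = -1 := moebius_apply_prime Nat.prime_five
  have m6 : moebius 6 = 1 := by
    rw [show 6 = 2 * 3 by rfl, isMultiplicative_moebius.map_mul_of_coprime (by decide), m2, m3]; rfl
  have m10 : moebius 10 = 1 := by
    rw [show 10 = 2 * 5 by rfl, isMultiplicative_moebius.map_mul_of_coprime (by decide), m2, m5]; rfl
  have t15 : Nat.totient 15 = 8 := by decide
  have t30 : Nat.totient 30 = 8 := by decide
  have t1 : Nat.totient 1 = 1 := by decide
  have t2 : Nat.totient 2 = 1 := by decide
  have t3 : Nat.totient 3 = 2 := by decide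
  have t5 : Nat.totient 5 = 4 := by decide
  have t6 : Nat.totient 6 = 2 := by decide
  have t10 : Nat.totient 10 = 4 := by decide
  have hcl1 : ∀ {m : ℕ}, moebius m = 1 → m.totient ≤ 4 → (m = 1 ∧ m.totient = 1) ∨
      (m = 6 ∧ m.totient = 2) ∨ (m = 10 ∧ m.totient = 4) := by
    intro m h1 h2
    rcases hcl (by rw [h1]; decide) h2 with rfl | rfl | rfl | rfl | rfl | rfl | rfl | rfl <;> simp_all
  have hcl2 : ∀ {m : ℕ}, moebius m = -1 → m.totient ≤ 4 → (m = 2 ∧ m.totient = 1) ∨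
      (m = 3 ∧ m.totient = 2) ∨ (m = 5 ∧ m.totient = 4) := by
    intro m h1 h2
    rcases hcl (by rw [h1]; decide) h2 with rfl | rfl | rfl | rfl | rfl | rfl | rfl | rfl <;> simp_all
  have n3 : ∀ {m : ℕ}, m.totient ≠ 3 := by
    intro m hm
    rcases le_or_gt m 2 with h | h
    · interval_cases m <;> simp_all
    · have := Nat.totient_even h
      rw [hm] at this
      exact absurd this (by decide)
  have ha : 0 < k.totient := Nat.totient_pos.2 (Nat.pos_of_ne_zero hk)
  have hb : 0 < l.totient := Nat.totient_pos.2 (Nat.pos_of_ne_zero hl)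
  have ha' : (0 : ℝ) < k.totient := by exact_mod_cast ha
  have hb' : (0 : ℝ) < l.totient := by exact_mod_cast hb
  have h' : 2 * (moebius k * (l.totient : ℤ) + moebius l * k.totient) = k.totient * l.totient := by
    rw [div_add_div _ _ ha'.ne' hb'.ne', div_eq_div_iff (by positivity) (by norm_num)] at h
    have h2 : (2 * (moebius k * (l.totient : ℤ) + moebius l * k.totient) : ℝ)
      = k.totient * l.totient := by push_cast; linarith
    exact_mod_cast h2
  have hkn : k.totient ≠ 3 := n3
  have hln : l.totient ≠ 3 := n3
  rcases moebius_eq_or k with e | e | e <;> rcases moebius_eq_or l with e' | e' | e' <;>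
    rw [e, e'] at h'
  · simp only [zero_mul, add_zero, mul_zero] at h'
    have := mul_pos ha hb
    lia
  · have : l.totient = 2 := totient_arith_aux ha (by lia)
    rcases hcl1 e' (by lia) with ⟨h1, h2⟩ | ⟨h1, h2⟩ | ⟨h1, h2⟩
    · lia
    · exact Or.inr (Or.inr (Or.inr (Or.inl ⟨by simp [e], h1⟩)))
    · lia
  · exact absurd h' (by have := mul_pos ha hb; lia)
  · have : k.totient = 2 := totient_arith_aux hb (by lia)
    rcases hcl1 e (by lia) with ⟨h1, h2⟩ | ⟨h1, h2⟩ | ⟨h1, h2⟩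
    · lia
    · exact Or.inr (Or.inr (Or.inl ⟨h1, by simp [e']⟩))
    · lia
  · obtain ⟨h3, h4⟩ := totient_arith_aux₂ ha hb hkn hln (by lia)
    rcases hcl1 e (by lia) with ⟨h1, h2⟩ | ⟨h1, h2⟩ | ⟨h1, h2⟩ <;>
    rcases hcl1 e' (by lia) with ⟨h1', h2'⟩ | ⟨h1', h2'⟩ | ⟨h1', h2'⟩ <;> lia
  · obtain ⟨h3, h4⟩ := totient_arith_aux₃ (b := l.totient) ha (by lia)
    rcases hcl1 e (by lia) with ⟨h1, h2⟩ | ⟨h1, h2⟩ | ⟨h1, h2⟩ <;>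
    rcases hcl2 e' (by lia) with ⟨h1', h2'⟩ | ⟨h1', h2'⟩ | ⟨h1', h2'⟩ <;> lia
  · exact absurd h' (by have := mul_pos ha hb; lia)
  · obtain ⟨h3, h4⟩ := totient_arith_aux₃ (b := k.totient) hb (by lia)
    rcases hcl2 e (by lia) with ⟨h1, h2⟩ | ⟨h1, h2⟩ | ⟨h1, h2⟩ <;>
    rcases hcl1 e' (by lia) with ⟨h1', h2'⟩ | ⟨h1', h2'⟩ | ⟨h1', h2'⟩ <;> lia
  · exact absurd h' (by have := mul_pos ha hb; lia)

/-! ### Elements of order three as skew-symmetric matrices. -/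

section Geometry
open Matrix
variable {n : Type*} [Fintype n]

/-- The normalized trace. -/
noncomputable def ntr {n : Type*} [Fintype n] : Matrix n n ℝ →ₗ[ℝ] ℝ := (Fintype.card n : ℝ)⁻¹ • Matrix.traceLinearMap n ℝ ℝ

theorem ntr_apply {n : Type*} [Fintype n] (M : Matrix n n ℝ) : ntr M = (Fintype.card n : ℝ)⁻¹ * M.trace := rfl

theorem ntr_mul_comm (M N : Matrix n n ℝ) : ntr (M * N) = ntr (N * M) := by
  rw [ntr_apply, ntr_apply, Matrix.trace_mul_comm]

theorem ntr_one [DecidableEq n] [Nonempty n] : ntr (1 : Matrix n n ℝ) = 1 := by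
  rw [ntr_apply, Matrix.trace_one, inv_mul_cancel₀]; simp

theorem ntr_transpose (M : Matrix n n ℝ) : ntr Mᵀ = ntr M := by
  rw [ntr_apply, ntr_apply, Matrix.trace_transpose]

theorem ntr_transpose_mul_self_nonneg (M : Matrix n n ℝ) : 0 ≤ ntr (Mᵀ * M) := by
  rw [ntr_apply, Matrix.trace]
  refine mul_nonneg (by positivity) (Finset.sum_nonneg fun i _ => ?_)
  rw [Matrix.diag_apply, Matrix.mul_apply]
  exact Finset.sum_nonneg fun j _ => mul_self_nonneg _

theorem eq_zero_of_ntr_transpose_mul_self {M : Matrix n n ℝ} (h : ntr (Mᵀ * M) = 0) : M = 0 := by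
  rcases isEmpty_or_nonempty n with hn | hn
  · ext i; exact hn.elim i
  · rw [ntr_apply, mul_eq_zero, or_iff_right (by simp)] at h
    exact Matrix.trace_conjTranspose_mul_self_eq_zero_iff.1 (by simpa using h)

variable [DecidableEq n]

theorem ofNat_mul_eq_smul (k : ℕ) [k.AtLeastTwo] (M : Matrix n n ℝ) :
    (OfNat.ofNat k : Matrix n n ℝ) * M = (OfNat.ofNat k : ℝ) • M := by
  rw [← Nat.cast_ofNat, ← Nat.cast_ofNat (R := ℝ), ← nsmul_eq_mul, Nat.cast_smul_eq_nsmul]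

theorem ntr_ofNat_mul (k : ℕ) [k.AtLeastTwo] (M : Matrix n n ℝ) :
    ntr (OfNat.ofNat k * M) = OfNat.ofNat k * ntr M := by
  rw [ofNat_mul_eq_smul, map_smul, smul_eq_mul]

theorem ntr_ofNat [Nonempty n] (k : ℕ) [k.AtLeastTwo] :
    ntr (OfNat.ofNat k : Matrix n n ℝ) = OfNat.ofNat k := by
  rw [← mul_one (OfNat.ofNat k : Matrix n n ℝ), ntr_ofNat_mul, ntr_one, mul_one]

/-- A real orthogonal representation on which every nontrivial element acts without fixed points;
this is expressed through its traces, which are then determined by the orders of the elements. -/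
structure IsFixedPointFreeRep {L n : Type*} [Group L] [Fintype n] [DecidableEq n]
    (ρ : L →* Matrix n n ℝ) : Prop where
  nonempty : Nonempty n
  transpose_apply : ∀ g, (ρ g)ᵀ = ρ g⁻¹
  ntr_apply : ∀ g, ntr (ρ g) =
    (ArithmeticFunction.moebius (orderOf g) : ℝ) / Nat.totient (orderOf g)

/-- Up to the factor `k`, `M` is an orthogonal projection, so its trace measures its size. Applied
to the sum over a cyclic group of prime order, whose traces cancel, this produces the cyclotomic
relation for the generator. -/
theorem eq_zero_of_isSymm_of_ntr {M : Matrix n n ℝ} (hs : Mᵀ = M) (k : ℕ) [k.AtLeastTwo]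
    (hk : M * M = OfNat.ofNat k * M) (h : ntr M = 0) : M = 0 := by
  refine eq_zero_of_ntr_transpose_mul_self ?_
  rw [hs, hk, ntr_ofNat_mul, h, mul_zero]

theorem mul_self_mul_self_of_orderOf_three {L : Type*} [Group L] {x : L} (hx : orderOf x = 3) :
    x * x * x = 1 := by
  have := pow_orderOf_eq_one x
  rwa [hx, pow_succ, pow_two] at this

namespace IsFixedPointFreeRep

variable {L : Type*} [Group L] {ρ : L →* Matrix n n ℝ}

theorem ntr_of_orderOf (h : IsFixedPointFreeRep ρ) {g : L} {k : ℕ} (hg : orderOf g = k) :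
    ntr (ρ g) = (ArithmeticFunction.moebius k : ℝ) / Nat.totient k := by
  rw [h.ntr_apply, hg]

theorem ntr_of_prime (h : IsFixedPointFreeRep ρ) {g : L} {p : ℕ} (hp : p.Prime)
    (hg : orderOf g = p) : ntr (ρ g) = - ((p : ℝ) - 1)⁻¹ := by
  rw [h.ntr_of_orderOf hg, ArithmeticFunction.moebius_apply_prime hp, Nat.totient_prime hp,
    Nat.cast_pred hp.pos]
  simp [neg_div]

theorem apply_of_orderOf_two (h : IsFixedPointFreeRep ρ) {z : L} (hz : orderOf z = 2) :
    ρ z = -1 := by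
  have := h.nonempty
  have h1 : ρ z * ρ z = 1 := by
    rw [← map_mul, ← pow_two, ← hz, pow_orderOf_eq_one, map_one]
  have h2 : z⁻¹ = z := inv_eq_of_mul_eq_one_left (by rw [← pow_two, ← hz, pow_orderOf_eq_one])
  refine eq_neg_of_add_eq_zero_left (eq_zero_of_isSymm_of_ntr ?_ 2 ?_ ?_)
  · rw [transpose_add, transpose_one, h.transpose_apply, h2]
  · linear_combination (norm := noncomm_ring) h1
  · rw [map_add, ntr_one, h.ntr_of_prime Nat.prime_two hz]; norm_num

theorem sq_of_orderOf_three (h : IsFixedPointFreeRep ρ) {x : L} (hx : orderOf x = 3) :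
    ρ x * ρ x = -ρ x - 1 := by
  have := h.nonempty
  have h1 : ρ x * ρ x * ρ x = 1 := by
    rw [← map_mul, ← map_mul, mul_self_mul_self_of_orderOf_three hx, map_one]
  have h2 : x⁻¹ = x * x :=
    inv_eq_of_mul_eq_one_left (mul_self_mul_self_of_orderOf_three hx)
  have h3 : (x * x)⁻¹ = x := by rw [← h2, inv_inv]
  have h4 : orderOf (x * x) = 3 := by rw [← h2, orderOf_inv, hx]
  have h0 : ρ x * ρ x + ρ x + 1 = 0 := by
    refine eq_zero_of_isSymm_of_ntr ?_ 3 ?_ ?_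
    · rw [transpose_add, transpose_add, transpose_one, ← map_mul, h.transpose_apply,
        h.transpose_apply, h3, h2]
      abel
    · linear_combination (norm := (noncomm_ring; all_goals norm_num)) (ρ x + 2) * h1
    · rw [map_add, map_add, ntr_one, ← map_mul, h.ntr_of_prime Nat.prime_three hx,
        h.ntr_of_prime Nat.prime_three h4]
      norm_num
  linear_combination (norm := noncomm_ring) h0

theorem apply_inv_of_orderOf_three (h : IsFixedPointFreeRep ρ) {x : L} (hx : orderOf x = 3) :
    ρ x⁻¹ = -ρ x - 1 := by
  rw [← h.sq_of_orderOf_three hx, ← map_mul, inv_eq_of_mul_eq_one_left (mul_self_mul_self_of_orderOf_three hx)]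

/-- The eigenvalues are primitive sixth roots of unity, the roots of `X² - X + 1`; the relation is
extracted from `g³ = -1` and the quadratic equation of `g²`. -/
theorem apply_add_apply_inv_of_orderOf_six (h : IsFixedPointFreeRep ρ) {g : L}
    (hg : orderOf g = 6) : ρ g + ρ g⁻¹ = 1 := by
  have h2 : orderOf (g ^ 3) = 2 := by
    rw [orderOf_pow' g (by norm_num), hg]; norm_num
  have h3 : orderOf (g ^ 2) = 3 := by
    rw [orderOf_pow' g (by norm_num), hg]; norm_num
  have e3 : ρ g * ρ g * ρ g = -1 := by
    rw [← h.apply_of_orderOf_two h2, map_pow]; noncomm_ring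
  have e2 := h.sq_of_orderOf_three h3
  rw [map_pow] at e2
  have h1 : g⁻¹ = g ^ 2 * g ^ 3 := by
    refine inv_eq_of_mul_eq_one_left ?_
    rw [← pow_add, ← pow_succ, show 2 + 3 + 1 = orderOf g by rw [hg], pow_orderOf_eq_one]
  rw [h1, map_mul, h.apply_of_orderOf_two h2, map_pow]
  linear_combination (norm := noncomm_ring) ρ g * e3 - e2

/-- For a primitive tenth root of unity `ζ` the sum `ζ + ζ⁻¹` is `(1 ± √5)/2`, so `1 - 2(ζ + ζ⁻¹)`
is a square root of five. -/
theorem sq_of_orderOf_ten (h : IsFixedPointFreeRep ρ) {g : L} (hg : orderOf g = 10) :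
    (1 - 2 * (ρ g + ρ g⁻¹)) * (1 - 2 * (ρ g + ρ g⁻¹)) = 5 := by
  have := h.nonempty
  have h2 : orderOf (g ^ 5) = 2 := by
    rw [orderOf_pow' g (by norm_num), hg]; norm_num
  have h5 : ∀ k : ℕ, k ∈ Finset.Icc 1 4 → orderOf ((g ^ 2) ^ k) = 5 := by
    intro k hk
    rw [← pow_mul, orderOf_pow' g (by simp at hk; lia), hg]
    simp at hk; obtain ⟨_, _⟩ := hk
    interval_cases k <;> norm_num
  -- Everything is expressed through `y = g²` of order five: since `g⁵` acts as `-1`, one has `g =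
  -- -y³` and `g⁻¹ = -y²` in the representation.
  obtain ⟨y, hy⟩ : ∃ y, y = g ^ 2 := ⟨_, rfl⟩
  have hy5 : y ^ 5 = 1 := by
    rw [hy, ← pow_mul, show 2 * 5 = orderOf g by rw [hg], pow_orderOf_eq_one]
  have e5 : ρ y * ρ y * ρ y * ρ y * ρ y = 1 := by
    rw [← map_one ρ, ← hy5, map_pow]; noncomm_ring
  have hgy : ρ g = - (ρ y * ρ y * ρ y) := by
    have : g = y ^ 3 * (g ^ 5)⁻¹ := by rw [hy]; group
    rw [this, map_mul, h.apply_of_orderOf_two (z := (g ^ 5)⁻¹) (by rw [orderOf_inv, h2]), map_pow]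
    noncomm_ring
  have hgy' : ρ g⁻¹ = - (ρ y * ρ y) := by
    have : g⁻¹ = y ^ 2 * (g ^ 5)⁻¹ := by rw [hy]; group
    rw [this, map_mul, h.apply_of_orderOf_two (z := (g ^ 5)⁻¹) (by rw [orderOf_inv, h2]), map_pow]
    noncomm_ring
  rw [← hy] at h5
  have inv : ∀ a b, a + b = 5 → (y ^ a)⁻¹ = y ^ b := by
    intro a b hab
    refine inv_eq_of_mul_eq_one_left ?_
    rw [← pow_add, add_comm, hab, hy5]
  have h0 : ρ y ^ 4 + ρ y ^ 3 + ρ y ^ 2 + ρ y ^ 1 + 1 = 0 := by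
    refine eq_zero_of_isSymm_of_ntr ?_ 5 ?_ ?_
    · simp only [transpose_add, transpose_one, ← map_pow, h.transpose_apply]
      rw [inv 4 1 rfl, inv 3 2 rfl, inv 2 3 rfl, inv 1 4 rfl]
      abel
    · linear_combination (norm := (noncomm_ring; all_goals norm_num))
        (ρ y * ρ y * ρ y + 2 * (ρ y * ρ y) + 3 * ρ y + 4) * e5
    · simp only [map_add, ntr_one, ← map_pow]
      rw [h.ntr_of_prime Nat.prime_five (h5 1 (by decide)),
        h.ntr_of_prime Nat.prime_five (h5 2 (by decide)),
        h.ntr_of_prime Nat.prime_five (h5 3 (by decide)),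
        h.ntr_of_prime Nat.prime_five (h5 4 (by decide))]
      norm_num
  rw [hgy, hgy']
  linear_combination (norm := (noncomm_ring; all_goals norm_num))
        4 * (ρ y + 2) * e5 + 4 * h0

/-- The skew matrix `ρ x - ρ x⁻¹ = 2 ρ x + 1` attached to an element `x` of order three. -/
def skew (ρ : L →* Matrix n n ℝ) (x : L) : Matrix n n ℝ := 2 * ρ x + 1

theorem skew_mul_self (h : IsFixedPointFreeRep ρ) {x : L} (hx : orderOf x = 3) :
    skew ρ x * skew ρ x = -3 := by
  have := h.sq_of_orderOf_three hx
  rw [skew]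
  linear_combination (norm := (noncomm_ring; all_goals norm_num)) 4 * this

theorem skew_inv (h : IsFixedPointFreeRep ρ) {x : L} (hx : orderOf x = 3) :
    skew ρ x⁻¹ = - skew ρ x := by
  rw [skew, skew, h.apply_inv_of_orderOf_three hx]; noncomm_ring

theorem transpose_skew (h : IsFixedPointFreeRep ρ) {x : L} (hx : orderOf x = 3) :
    (skew ρ x)ᵀ = - skew ρ x := by
  rw [← h.skew_inv hx, skew, skew, transpose_add, transpose_one, transpose_mul, h.transpose_apply]
  congr 1
  have : ((2 : Matrix n n ℝ))ᵀ = 2 := by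
    rw [← one_add_one_eq_two, transpose_add, transpose_one]
  rw [this]; noncomm_ring

/-- Because `x⁻¹` and `y⁻¹` are linear in `x` and `y`, the anticommutator depends on the product `x
y` alone, and so is controlled by its order. -/
theorem skew_mul_add (h : IsFixedPointFreeRep ρ) {x y : L} (hx : orderOf x = 3)
    (hy : orderOf y = 3) : skew ρ x * skew ρ y + skew ρ y * skew ρ x =
      -2 * (1 - 2 * (ρ (x * y) + ρ (x * y)⁻¹)) := by
  rw [_root_.mul_inv_rev, map_mul, map_mul, h.apply_inv_of_orderOf_three hx,
    h.apply_inv_of_orderOf_three hy, skew, skew]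
  rw [← sub_eq_zero]
  noncomm_ring; norm_num

theorem skew_conj (g x : L) : skew ρ (g * x * g⁻¹) = ρ g * skew ρ x * ρ g⁻¹ := by
  have : ρ g * ρ g⁻¹ = 1 := by rw [← map_mul, mul_inv_cancel, map_one]
  rw [skew, skew, map_mul, map_mul]
  linear_combination (norm := noncomm_ring) -this

/-- The Gram matrix of the skew matrices has entries `-3, 3, 1, -1, 0` only. The orders of `x y` and
`x y⁻¹` satisfy the equation solved by `moebius_div_totient_add`, and each solution determines the
anticommutator or its square. -/
theorem skew_cases [Finite L] (h : IsFixedPointFreeRep ρ) {x y : L} (hx : orderOf x = 3) (hy : orderOf y = 3) :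
    (y = x ∧ ntr (skew ρ x * skew ρ y) = -3) ∨ (y = x⁻¹ ∧ ntr (skew ρ x * skew ρ y) = 3) ∨
    (ntr (skew ρ x * skew ρ y) = 1 ∧ skew ρ x * skew ρ y + skew ρ y * skew ρ x = 2) ∨
    (ntr (skew ρ x * skew ρ y) = -1 ∧ skew ρ x * skew ρ y + skew ρ y * skew ρ x = -2) ∨
    (ntr (skew ρ x * skew ρ y) = 0 ∧ (skew ρ x * skew ρ y + skew ρ y * skew ρ x) *
      (skew ρ x * skew ρ y + skew ρ y * skew ρ x) = 20) := by
  have := h.nonempty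
  have htr : ∀ M N : Matrix n n ℝ, ntr (M * N) = ntr (M * N + N * M) / 2 := by
    intro M N; rw [map_add, ntr_mul_comm N M]; ring
  have hsix : ∀ {x y : L}, orderOf x = 3 → orderOf y = 3 → orderOf (x * y) = 6 → 
      skew ρ x * skew ρ y + skew ρ y * skew ρ x = 2 := by
    intro x y hx hy hxy
    rw [h.skew_mul_add hx hy, h.apply_add_apply_inv_of_orderOf_six hxy]; noncomm_ring
  have n2 : ntr (2 : Matrix n n ℝ) = 2 := ntr_ofNat 2
  have n3 : ntr (3 : Matrix n n ℝ) = 3 := ntr_ofNat 3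
  -- `ρ y + ρ y⁻¹ = -1`, so the two products add up to `-ρ x`, whose normalized trace is `1/2`.
  have hsum : ntr (ρ (x * y)) + ntr (ρ (x * y⁻¹)) = 1 / 2 := by
    have : ρ (x * y) + ρ (x * y⁻¹) = - ρ x := by
      rw [map_mul, map_mul, h.apply_inv_of_orderOf_three hy]; noncomm_ring
    rw [← map_add, this, map_neg, h.ntr_of_prime Nat.prime_three hx]; norm_num
  rw [h.ntr_apply, h.ntr_apply] at hsum
  rcases moebius_div_totient_add (orderOf_pos _).ne' (orderOf_pos _).ne' hsum with
    ⟨h1, h2⟩ | ⟨h1, h2⟩ | ⟨h1, h2⟩ | ⟨h1, h2⟩ | ⟨h1, h2⟩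
  · have : y = x⁻¹ := eq_inv_of_mul_eq_one_right (orderOf_eq_one_iff.1 h1)
    refine Or.inr (Or.inl ⟨this, ?_⟩)
    rw [this, h.skew_inv hx, mul_neg, h.skew_mul_self hx, neg_neg, n3]
  · have : y = x := (mul_inv_eq_one.1 (orderOf_eq_one_iff.1 h2)).symm
    refine Or.inl ⟨this, ?_⟩
    rw [this, h.skew_mul_self hx, map_neg, n3]
  · have h3 := hsix hx hy h1
    refine Or.inr (Or.inr (Or.inl ⟨?_, h3⟩))
    rw [htr, h3, n2]; norm_num
  · have h3 := hsix hx (by rw [orderOf_inv, hy]) h2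
    rw [h.skew_inv hy] at h3
    have h4 : skew ρ x * skew ρ y + skew ρ y * skew ρ x = -2 := by
      rw [← h3]; noncomm_ring
    refine Or.inr (Or.inr (Or.inr (Or.inl ⟨?_, h4⟩)))
    rw [htr, h4, map_neg, n2]; norm_num
  · have h3 := h.sq_of_orderOf_ten h1
    have t10 : ntr (ρ (x * y)) = 1 / 4 := by
      rw [h.ntr_of_orderOf h1, show 10 = 2 * 5 by rfl,
        ArithmeticFunction.isMultiplicative_moebius.map_mul_of_coprime (by decide),
        ArithmeticFunction.moebius_apply_prime Nat.prime_two,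
        ArithmeticFunction.moebius_apply_prime Nat.prime_five,
        show Nat.totient (2 * 5) = 4 by decide]
      norm_num
    have t10' : ntr (ρ (x * y)⁻¹) = 1 / 4 := by
      rw [← h.transpose_apply, ntr_transpose, t10]
    refine Or.inr (Or.inr (Or.inr (Or.inr ⟨?_, ?_⟩)))
    · rw [htr, h.skew_mul_add hx hy, neg_mul, map_neg, ntr_ofNat_mul, map_sub, ntr_ofNat_mul,
        map_add, t10, t10', ntr_one]
      norm_num
    · rw [h.skew_mul_add hx hy]
      linear_combination (norm := (noncomm_ring; all_goals norm_num)) 4 * h3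

end IsFixedPointFreeRep
end Geometry

/-! ### Quaternion pairs and the lines they carry. -/

section
open Matrix

/-- Allows a rewriting rule for two letters to fire inside a right-associated word. With a rule and
its companion, words in the generators of the algebras below reach a normal form, and the identities
become linear. -/
theorem mul_mul_eq_of_mul_eq {A : Type*} [Semigroup A] {a b c : A} (h : a * b = c) (t : A) :
    a * (b * t) = c * t := by rw [← mul_assoc, h]

/-- A pair of anticommuting square roots of `-1`. -/
structure IsQuaternionPair {A : Type*} [Ring A] (I J : A) : Prop where
  left_sq : I * I = -1
  right_sq : J * J = -1
  mul_comm : J * I = -(I * J)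

set_option linter.unusedSimpArgs false in
/-- A quaternion pair attached to two elements of order three whose product has order six. -/
theorem quaternion_of_cubic {A : Type*} [Ring A] {X Y : A} (hX : X * X = -X - 1)
    (hY : Y * Y = -Y - 1) (hYX : Y * X = -(X * Y) - X - Y) :
    IsQuaternionPair (X + Y + 1) (X * Y + X) ∧
    (X + Y + 1) * (X * Y + X) = -Y - X * Y ∧ Y * (-X - 1) = X * Y + X ∧
    (-X - 1) * Y * X = X * Y - 1 ∧ X * Y * (-X - 1) = - (X * Y) - X - Y - 1 := by
  have hX' := mul_mul_eq_of_mul_eq hX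
  have hY' := mul_mul_eq_of_mul_eq hY
  have hYX' := mul_mul_eq_of_mul_eq hYX
  refine ⟨⟨?_, ?_, ?_⟩, ?_, ?_, ?_, ?_⟩ <;>
  simp only [mul_add, add_mul, mul_sub, sub_mul, mul_neg, neg_mul, neg_neg, mul_assoc, mul_one,
    one_mul, hX, hX', hY, hY', hYX, hYX', neg_add, neg_sub]  <;> abel

variable {n : Type*} [Fintype n] [DecidableEq n]

/-- Four times the component of `M` that commutes with a quaternion pair. -/
def quatAverage {A : Type*} [Ring A] (I J M : A) : A :=
  M - I * M * I - J * M * J - I * J * M * (I * J)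

set_option linter.unusedSimpArgs false in
-- Since `I`, `J` and `I * J` have square `-1`, the four summands are the conjugates of `M` by `1`,
-- `I`, `J`, `I * J`; conjugation by `I` or `J` permutes them.
theorem quatAverage_commute {A : Type*} [Ring A] {I J : A} (h : IsQuaternionPair I J) (M : A) :
    I * quatAverage I J M = quatAverage I J M * I ∧
    J * quatAverage I J M = quatAverage I J M * J := by
  have hI := h.left_sq
  have hJ := h.right_sq
  have hJI := h.mul_comm
  have hI' := mul_mul_eq_of_mul_eq hI
  have hJ' := mul_mul_eq_of_mul_eq hJ
  have hJI' := mul_mul_eq_of_mul_eq hJI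
  rw [quatAverage]
  constructor <;>
  simp only [mul_add, add_mul, mul_sub, sub_mul, mul_neg, neg_mul, neg_neg, mul_assoc, mul_one,
    one_mul, hI, hI', hJ, hJ', hJI, hJI', neg_add, neg_sub] <;> abel

set_option linter.unusedSimpArgs false in
/-- If the average vanishes, the anticommutators of `M` commute with the quaternion pair, and `M`
is recovered from them. -/
theorem anticommutator_commute {A : Type*} [Ring A] {I J M : A} (h : IsQuaternionPair I J)
    (h0 : quatAverage I J M = 0) :
    (Commute I (M * I + I * M) ∧ Commute J (M * I + I * M)) ∧
    (Commute I (M * J + J * M) ∧ Commute J (M * J + J * M)) ∧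
    (Commute I (M * (I * J) + I * J * M) ∧ Commute J (M * (I * J) + I * J * M)) ∧
    -(2 * M) = (M * I + I * M) * I + (M * J + J * M) * J + (M * (I * J) + I * J * M) * (I * J) := by
  have hI := h.left_sq
  have hJ := h.right_sq
  have hJI := h.mul_comm
  have hI' := mul_mul_eq_of_mul_eq hI
  have hJ' := mul_mul_eq_of_mul_eq hJ
  have hJI' := mul_mul_eq_of_mul_eq hJI
  have e1 : quatAverage I J M * I = 0 := by rw [h0, zero_mul]
  have e2 : quatAverage I J M * J = 0 := by rw [h0, zero_mul]
  have e3 : quatAverage I J M * (I * J) = 0 := by rw [h0, zero_mul]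
  simp only [Commute, SemiconjBy]
  refine ⟨⟨?_, ?_⟩, ⟨?_, ?_⟩, ⟨?_, ?_⟩, ?_⟩
  · linear_combination (norm := skip)  0 * e1
    simp only [mul_add, add_mul, mul_sub, sub_mul, mul_neg, neg_mul, neg_neg, mul_assoc, mul_one,
    one_mul, hI, hI', hJ, hJ', hJI, hJI', neg_add, neg_sub, zero_mul, mul_zero]
    abel
  · linear_combination (norm := skip) - e3
    simp only [quatAverage, mul_add, add_mul, mul_sub, sub_mul, mul_neg, neg_mul, neg_neg,
      mul_assoc, mul_one, one_mul, hI, hI', hJ, hJ', hJI, hJI', neg_add, neg_sub, zero_mul,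
      mul_zero]
    abel
  · linear_combination (norm := skip)  e3
    simp only [quatAverage, mul_add, add_mul, mul_sub, sub_mul, mul_neg, neg_mul, neg_neg,
      mul_assoc, mul_one, one_mul, hI, hI', hJ, hJ', hJI, hJI', neg_add, neg_sub, zero_mul,
      mul_zero]
    abel
  · linear_combination (norm := skip) 0 * e1
    simp only [mul_add, add_mul, mul_sub, sub_mul, mul_neg, neg_mul, neg_neg, mul_assoc, mul_one,
    one_mul, hI, hI', hJ, hJ', hJI, hJI', neg_add, neg_sub, zero_mul, mul_zero]
    abel
  · linear_combination (norm := skip) - e2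
    simp only [quatAverage, mul_add, add_mul, mul_sub, sub_mul, mul_neg, neg_mul, neg_neg,
      mul_assoc, mul_one, one_mul, hI, hI', hJ, hJ', hJI, hJI', neg_add, neg_sub, zero_mul,
      mul_zero]
    abel
  · linear_combination (norm := skip) e1
    simp only [quatAverage, mul_add, add_mul, mul_sub, sub_mul, mul_neg, neg_mul, neg_neg,
      mul_assoc, mul_one, one_mul, hI, hI', hJ, hJ', hJI, hJI', neg_add, neg_sub, zero_mul,
      mul_zero]
    abel
  · linear_combination (norm := skip) h0
    simp only [quatAverage, mul_add, add_mul, mul_sub, sub_mul, mul_neg, neg_mul, neg_neg,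
      mul_assoc, mul_one, one_mul, hI, hI', hJ, hJ', hJI, hJI', neg_add, neg_sub, zero_mul,
      mul_zero, two_mul]
    abel

/-- The average `N` commutes with the pair, so each conjugate of `M` has the same trace against `N`
as `M` itself: the trace of `N²` is four times that of `N M`, which is then expanded. -/
theorem ntr_quatAverage_sq {I J M : Matrix n n ℝ} (h : IsQuaternionPair I J) (hM : M * M = -3)
    [Nonempty n] :
    ntr (quatAverage I J M * quatAverage I J M) = -4 * (3 + ntr (M * I * M * I + M * J * M * J
      + M * (I * J) * M * (I * J))) := by
  obtain ⟨hcI, hcJ⟩ := quatAverage_commute h M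
  have hcK : I * J * quatAverage I J M = quatAverage I J M * (I * J) := by
    rw [mul_assoc, hcJ, ← mul_assoc, hcI, mul_assoc]
  have hK : I * J * (I * J) = -1 := by
    have := h.right_sq
    rw [mul_assoc, ← mul_assoc J I J, h.mul_comm, neg_mul, mul_neg, mul_assoc, ← mul_assoc I I,
      h.left_sq, this, mul_neg, mul_one, neg_neg]
  set N := quatAverage I J M with hN
  have key : ∀ U : Matrix n n ℝ, U * U = -1 → U * N = N * U → ntr (N * (U * M * U)) = - ntr (N * M) := by
    intro U hU hc
    have : N * (U * M * U) = U * (N * M * U) := by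
      rw [← mul_assoc, ← mul_assoc, ← hc]; simp only [mul_assoc]
    rw [this, ntr_mul_comm, mul_assoc, hU]; simp
  have h1 : ntr (N * N) = 4 * ntr (N * M) := by
    conv_lhs => rw [hN]; arg 2; arg 2; rw [quatAverage]
    rw [← hN, mul_sub, mul_sub, mul_sub, map_sub, map_sub, map_sub, key I h.left_sq hcI,
      key J h.right_sq hcJ, key _ hK hcK]
    ring
  have key2 : ∀ U : Matrix n n ℝ, ntr (M * (U * M * U)) = ntr (M * U * M * U) := by
    intro U; simp only [mul_assoc]
  rw [h1, ntr_mul_comm, hN, quatAverage, mul_sub, mul_sub, mul_sub, map_sub, map_sub, map_sub, key2,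
    key2, key2, hM, map_neg, map_add, map_add]
  rw [ntr_ofNat 3]
  ring

theorem ntr_anticommutator_sq {M U : Matrix n n ℝ} (hM : M * M = -3) (hU : U * U = -3) [Nonempty n] :
    ntr ((M * U + U * M) * (M * U + U * M)) = 2 * ntr (M * U * M * U) + 18 := by
  have h1 : (M * U + U * M) * (M * U + U * M) =
      M * U * M * U + U * (M * U * M) - 3 * (M * M) - 3 * (U * U) := by
    linear_combination (norm := noncomm_ring) M * hU * M + U * hM * U
  rw [h1, hM, hU, map_sub, map_sub, map_add, ntr_mul_comm U, ntr_ofNat_mul, map_neg, ntr_ofNat 3]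
  ring

/-- The four sign patterns are the vertices of a regular tetrahedron, so mixed terms cancel in the
sum. When `M` is skew the trace of the squared average is nonpositive, and the identity becomes a
Bessel inequality for `M` against the four vertices. -/
theorem sum_ntr_anticommutator_sq {I J M : Matrix n n ℝ} (h : IsQuaternionPair I J)
    (hM : M * M = -3) [Nonempty n] {e₀ e₁ e₂ e₃ : Matrix n n ℝ} (h₀ : e₀ = I + J + I * J)
    (h₁ : e₁ = I - J - I * J) (h₂ : e₂ = -I + J - I * J) (h₃ : e₃ = -I - J + I * J)
    (s₀ : e₀ * e₀ = -3) (s₁ : e₁ * e₁ = -3) (s₂ : e₂ * e₂ = -3) (s₃ : e₃ * e₃ = -3) :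
    ntr ((M * e₀ + e₀ * M) * (M * e₀ + e₀ * M)) + ntr ((M * e₁ + e₁ * M) * (M * e₁ + e₁ * M)) +
    ntr ((M * e₂ + e₂ * M) * (M * e₂ + e₂ * M)) + ntr ((M * e₃ + e₃ * M) * (M * e₃ + e₃ * M)) =
    48 - 2 * ntr (quatAverage I J M * quatAverage I J M) := by
  rw [ntr_anticommutator_sq hM s₀, ntr_anticommutator_sq hM s₁, ntr_anticommutator_sq hM s₂,
    ntr_anticommutator_sq hM s₃, ntr_quatAverage_sq h hM]
  have : M * e₀ * M * e₀ + M * e₁ * M * e₁ + M * e₂ * M * e₂ + M * e₃ * M * e₃ =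
      4 * (M * I * M * I + M * J * M * J + M * (I * J) * M * (I * J)) := by
    rw [h₀, h₁, h₂, h₃]; noncomm_ring
  have h2 := congrArg ntr this
  rw [ntr_ofNat_mul, map_add, map_add, map_add] at h2
  linarith

theorem transpose_quatAverage {I J M : Matrix n n ℝ} (h : IsQuaternionPair I J) (hI : Iᵀ = -I)
    (hJ : Jᵀ = -J) (hM : Mᵀ = -M) : (quatAverage I J M)ᵀ = - quatAverage I J M := by
  have hJI := h.mul_comm
  simp only [quatAverage, transpose_sub, transpose_mul, hI, hJ, hM, neg_mul, mul_neg, neg_neg, hJI,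
    mul_assoc]
  abel

namespace IsFixedPointFreeRep
variable {L : Type*} [Group L] {ρ : L →* Matrix n n ℝ}

/-- Two elements of order three whose product has order six. -/
structure Adj (ρ : L →* Matrix n n ℝ) (x y : L) : Prop where
  left : orderOf x = 3
  right : orderOf y = 3
  ntr_eq : ntr (skew ρ x * skew ρ y) = 1

theorem orderOf_conj {x : L} (g : L) : orderOf (g * x * g⁻¹) = orderOf x :=
  orderOf_injective (MulAut.conj g).toMonoidHom (MulAut.conj g).injective x

theorem orderOf_conj' {x : L} (g : L) : orderOf (g⁻¹ * x * g) = orderOf x := by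
  simpa using orderOf_conj (x := x) g⁻¹

theorem Adj.symm {x y : L} (h : Adj ρ x y) : Adj ρ y x :=
  ⟨h.right, h.left, by rw [ntr_mul_comm, h.ntr_eq]⟩

theorem Adj.conj {x y : L} (h : Adj ρ x y) (g : L) : Adj ρ (g * x * g⁻¹) (g * y * g⁻¹) := by
  refine ⟨?_, ?_, ?_⟩
  · rw [orderOf_conj, h.left]
  · rw [orderOf_conj, h.right]
  · rw [skew_conj, skew_conj, ← h.ntr_eq]
    have h1 : ρ g⁻¹ * ρ g = 1 := by rw [← map_mul, inv_mul_cancel, map_one]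
    have : ρ g * skew ρ x * ρ g⁻¹ * (ρ g * skew ρ y * ρ g⁻¹) = ρ g * (skew ρ x * skew ρ y * ρ g⁻¹) := by
      simp only [mul_assoc, mul_mul_eq_of_mul_eq h1, one_mul]
    rw [this, ntr_mul_comm, mul_assoc, h1, mul_one]

theorem Adj.inv (hρ : IsFixedPointFreeRep ρ) {x y : L} (h : Adj ρ x y) : Adj ρ x⁻¹ y⁻¹ :=
  ⟨by rw [orderOf_inv, h.left], by rw [orderOf_inv, h.right], by
    rw [hρ.skew_inv h.left, hρ.skew_inv h.right, neg_mul_neg, h.ntr_eq]⟩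

theorem Adj.anticommutator [Finite L] (hρ : IsFixedPointFreeRep ρ) {x y : L} (h : Adj ρ x y) :
    skew ρ x * skew ρ y + skew ρ y * skew ρ x = 2 := by
  have := h.ntr_eq
  rcases hρ.skew_cases h.left h.right with h1 | h1 | h1 | h1 | h1
  · rw [h1.2] at this; norm_num at this
  · rw [h1.2] at this; norm_num at this
  · exact h1.2
  · rw [h1.1] at this; norm_num at this
  · rw [h1.1] at this; norm_num at this

/-- Two adjacent elements satisfy the relations of the binary tetrahedral group, whose quaternion
subgroup supplies the pair. In coordinates `I`, `J`, `I * J` the skew matrices of the line are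
`(1,1,1)`, `(1,-1,-1)`, `(-1,1,-1)`, `(-1,-1,1)`. -/
theorem Adj.exists_quaternionPair [Finite L] (hρ : IsFixedPointFreeRep ρ) {x y : L}
    (h : Adj ρ x y) : ∃ I J, IsQuaternionPair I J ∧ Iᵀ = -I ∧ Jᵀ = -J ∧ J = ρ (y * x⁻¹) ∧
      skew ρ x = I + J + I * J ∧ skew ρ y = I - J - I * J ∧
      skew ρ (x⁻¹ * y * x) = -I + J - I * J ∧ skew ρ (x * y * x⁻¹) = -I - J + I * J := by
  have hX := hρ.sq_of_orderOf_three h.left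
  have hY := hρ.sq_of_orderOf_three h.right
  have hx := hρ.apply_inv_of_orderOf_three h.left
  have hy := hρ.apply_inv_of_orderOf_three h.right
  have hYX : ρ y * ρ x = -(ρ x * ρ y) - ρ x - ρ y := by
    have h1 := h.anticommutator hρ
    rw [skew, skew] at h1
    have h2 : (4 : ℝ) • (ρ y * ρ x - (-(ρ x * ρ y) - ρ x - ρ y)) = 0 := by
      rw [← ofNat_mul_eq_smul 4]
      linear_combination (norm := (noncomm_ring; all_goals norm_num)) h1
    rw [smul_eq_zero, or_iff_right (by norm_num), sub_eq_zero] at h2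
    exact h2
  obtain ⟨h1, h2, h3, h4, h5⟩ := quaternion_of_cubic hX hY hYX
  have hJ : ρ x * ρ y + ρ x = ρ (y * x⁻¹) := by rw [map_mul, hx, h3]
  refine ⟨ρ x + ρ y + 1, ρ x * ρ y + ρ x, h1, ?_, ?_, hJ, ?_, ?_, ?_, ?_⟩
  · rw [transpose_add, transpose_add, transpose_one, hρ.transpose_apply, hρ.transpose_apply, hx, hy]
    abel
  · rw [hJ, hρ.transpose_apply, _root_.mul_inv_rev, inv_inv, map_mul, hy, ← hJ]
    noncomm_ring
  · rw [h2, skew]; noncomm_ring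
  · rw [h2, skew]; noncomm_ring
  · rw [h2, skew, map_mul, map_mul, hx, h4]; noncomm_ring
  · rw [h2, skew, map_mul, map_mul, hx, h5]; noncomm_ring

/-- The four elements of the line through two adjacent elements. -/
def line (x y : L) : Set L := {x, y, x⁻¹ * y * x, x * y * x⁻¹}

/-- One formula for all cases: anticommutators `2` and `-2` have square `4 = 20 - 16`, and trace
zero goes with square `20`. -/
theorem skew_anticommutator_cases [Finite L] (hρ : IsFixedPointFreeRep ρ) {x y : L}
    (hx : orderOf x = 3) (hy : orderOf y = 3) (h1 : y ≠ x) (h2 : y ≠ x⁻¹) :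
    (ntr (skew ρ x * skew ρ y) = 1 ∨ ntr (skew ρ x * skew ρ y) = -1 ∨
      ntr (skew ρ x * skew ρ y) = 0) ∧
    ntr ((skew ρ x * skew ρ y + skew ρ y * skew ρ x) *
      (skew ρ x * skew ρ y + skew ρ y * skew ρ x)) = 20 - 16 * ntr (skew ρ x * skew ρ y) ^ 2 := by
  have := hρ.nonempty
  have n20 : ntr (20 : Matrix n n ℝ) = 20 := ntr_ofNat 20
  have n4 : ntr (2 * 2 : Matrix n n ℝ) = 4 := by
    rw [ntr_ofNat_mul, ntr_ofNat 2]; norm_num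
  rcases hρ.skew_cases hx hy with h | h | h | h | h
  · exact absurd h.1 h1
  · exact absurd h.1 h2
  · rw [h.2, h.1, n4]; norm_num
  · rw [h.2, h.1, neg_mul_neg, n4]; norm_num
  · rw [h.2, h.1, n20]; norm_num

/-- The Bessel inequality bounds the sum of the squares of the four Gram values by two, with
equality exactly when the average vanishes. The values lie in `{0, 1, -1}` and add up to zero, so
the sum of squares is even: it is `0` or `2`. -/
theorem Adj.line_values [Finite L] (hρ : IsFixedPointFreeRep ρ) {x y u : L} (h : Adj ρ x y)
    (hu : orderOf u = 3) (h1 : u ∉ line x y) (h2 : u⁻¹ ∉ line x y) {I J : Matrix n n ℝ}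
    (hIJ : IsQuaternionPair I J) (hI : Iᵀ = -I) (hJ : Jᵀ = -J) (e₀ : skew ρ x = I + J + I * J)
    (e₁ : skew ρ y = I - J - I * J) (e₂ : skew ρ (x⁻¹ * y * x) = -I + J - I * J)
    (e₃ : skew ρ (x * y * x⁻¹) = -I - J + I * J) :
    ((ntr (skew ρ u * skew ρ x)) ^ 2 + (ntr (skew ρ u * skew ρ y)) ^ 2 +
      (ntr (skew ρ u * skew ρ (x⁻¹ * y * x))) ^ 2 + (ntr (skew ρ u * skew ρ (x * y * x⁻¹))) ^ 2 = 0 ∨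
    ((ntr (skew ρ u * skew ρ x)) ^ 2 + (ntr (skew ρ u * skew ρ y)) ^ 2 +
      (ntr (skew ρ u * skew ρ (x⁻¹ * y * x))) ^ 2 + (ntr (skew ρ u * skew ρ (x * y * x⁻¹))) ^ 2 = 2 ∧
      quatAverage I J (skew ρ u) = 0)) ∧
    (∀ s ∈ line x y, ntr (skew ρ u * skew ρ s) = 1 ∨ ntr (skew ρ u * skew ρ s) = -1 ∨
      ntr (skew ρ u * skew ρ s) = 0) ∧
    ntr (skew ρ u * skew ρ x) + ntr (skew ρ u * skew ρ y) +
      ntr (skew ρ u * skew ρ (x⁻¹ * y * x)) + ntr (skew ρ u * skew ρ (x * y * x⁻¹)) = 0 := by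
  have := hρ.nonempty
  have o₂ : orderOf (x⁻¹ * y * x) = 3 := by rw [orderOf_conj', h.right]
  have o₃ : orderOf (x * y * x⁻¹) = 3 := by rw [orderOf_conj, h.right]
  have ol : ∀ s ∈ line x y, orderOf s = 3 := by
    rintro s (rfl | rfl | rfl | rfl)
    exacts [h.left, h.right, o₂, o₃]
  have hne : ∀ s ∈ line x y, s ≠ u ∧ s ≠ u⁻¹ := by
    intro s hs
    exact ⟨fun e => h1 (e ▸ hs), fun e => h2 (e ▸ hs)⟩
  have hc : ∀ s ∈ line x y, _ := fun s hs =>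
    hρ.skew_anticommutator_cases hu (ol s hs) (hne s hs).1 (hne s hs).2
  have m₀ : x ∈ line x y := by simp [line]
  have m₁ : y ∈ line x y := by simp [line]
  have m₂ : x⁻¹ * y * x ∈ line x y := by simp [line]
  have m₃ : x * y * x⁻¹ ∈ line x y := by simp [line]
  have hq := sum_ntr_anticommutator_sq hIJ (hρ.skew_mul_self hu) e₀ e₁ e₂ e₃
    (hρ.skew_mul_self h.left) (hρ.skew_mul_self h.right) (hρ.skew_mul_self o₂)
    (hρ.skew_mul_self o₃)
  rw [(hc _ m₀).2, (hc _ m₁).2, (hc _ m₂).2, (hc _ m₃).2] at hq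
  have hT := transpose_quatAverage hIJ hI hJ (hρ.transpose_skew hu)
  have hpos := ntr_transpose_mul_self_nonneg (quatAverage I J (skew ρ u))
  rw [hT, neg_mul, map_neg] at hpos
  have hsum : ntr (skew ρ u * skew ρ x) + ntr (skew ρ u * skew ρ y) +
      ntr (skew ρ u * skew ρ (x⁻¹ * y * x)) + ntr (skew ρ u * skew ρ (x * y * x⁻¹)) = 0 := by
    rw [← map_add, ← map_add, ← map_add, ← mul_add, ← mul_add, ← mul_add, e₀, e₁, e₂, e₃]
    have : I + J + I * J + (I - J - I * J) + (-I + J - I * J) + (-I - J + I * J) = 0 := by abel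
    rw [this, mul_zero, map_zero]
  refine ⟨?_, fun s hs => (hc s hs).1, hsum⟩
  have c₀ := (hc _ m₀).1
  have c₁ := (hc _ m₁).1
  have c₂ := (hc _ m₂).1
  have c₃ := (hc _ m₃).1
  have hzero : ntr (quatAverage I J (skew ρ u) * quatAverage I J (skew ρ u)) = 0 →
      quatAverage I J (skew ρ u) = 0 := by
    intro h0
    refine eq_zero_of_ntr_transpose_mul_self ?_
    rw [hT, neg_mul, map_neg, h0, neg_zero]
  generalize ntr (skew ρ u * skew ρ x) = t₀ at *
  generalize ntr (skew ρ u * skew ρ y) = t₁ at *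
  generalize ntr (skew ρ u * skew ρ (x⁻¹ * y * x)) = t₂ at *
  generalize ntr (skew ρ u * skew ρ (x * y * x⁻¹)) = t₃ at *
  generalize ntr (quatAverage I J (skew ρ u) * quatAverage I J (skew ρ u)) = N at *
  have hle : t₀ ^ 2 + t₁ ^ 2 + t₂ ^ 2 + t₃ ^ 2 ≤ 2 := by linarith
  have hN : t₀ ^ 2 + t₁ ^ 2 + t₂ ^ 2 + t₃ ^ 2 = 2 → N = 0 := fun h => by linarith
  clear hq hpos hT hc hne
  have : t₀ ^ 2 + t₁ ^ 2 + t₂ ^ 2 + t₃ ^ 2 = 0 ∨ t₀ ^ 2 + t₁ ^ 2 + t₂ ^ 2 + t₃ ^ 2 = 2 := by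
    rcases c₀ with rfl | rfl | rfl <;> rcases c₁ with rfl | rfl | rfl <;>
    rcases c₂ with rfl | rfl | rfl <;> rcases c₃ with rfl | rfl | rfl <;>
    first | (exfalso; linarith) | (left; norm_num; done) | (right; norm_num)
  exact this.imp_right fun h => ⟨h, hzero (hN h)⟩

end IsFixedPointFreeRep
end

/-! ### The bound on lines through a point, and common neighbours. -/

section
open Matrix
variable {n : Type*} [Fintype n] [DecidableEq n]

set_option linter.unusedSimpArgs false in
-- Elements of the form produced by `Adj.exists_root_five`: their anticommutator, and that of one
-- with the conjugate of the other by `J`, are written through `d` and `d'`, which commute with the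
-- pair.
theorem quaternion_products {A : Type*} [Ring A] {I J d d' m m' : A} (h : IsQuaternionPair I J)
    (hId : Commute I d) (hJd : Commute J d) (hId' : Commute I d') (hJd' : Commute J d')
    (hm : m = -((1 + d) * J + (1 - d) * (I * J)))
    (hm' : m' = -((1 + d') * J + (1 - d') * (I * J))) :
    m * m' + m' * m = -(4 • (1 : A)) - 2 • (d * d' + d' * d) ∧
    m * (-(J * m' * J)) + (-(J * m' * J)) * m =
      -(4 • (d + d')) + 2 • ((d * d' - d' * d) * I) := by
  have hI := h.left_sq
  have hJ := h.right_sq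
  have hJI := h.mul_comm
  have hI' := mul_mul_eq_of_mul_eq hI
  have hJ' := mul_mul_eq_of_mul_eq hJ
  have hJI' := mul_mul_eq_of_mul_eq hJI
  have e1 := hId.eq
  have e2 := hJd.eq
  have e3 := hId'.eq
  have e4 := hJd'.eq
  have e1' := mul_mul_eq_of_mul_eq e1
  have e2' := mul_mul_eq_of_mul_eq e2
  have e3' := mul_mul_eq_of_mul_eq e3
  have e4' := mul_mul_eq_of_mul_eq e4
  subst hm hm'
  constructor <;>
  simp only [mul_add, add_mul, mul_sub, sub_mul, mul_neg, neg_mul, neg_neg, mul_assoc, mul_one,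
    one_mul, hI, hI', hJ, hJ', hJI, hJI', e1, e2, e3, e4, e1', e2', e3', e4', neg_add,
    neg_sub] <;> abel

/-- Conjugation by `J` fixes `X` and negates `I`, while the trace is invariant. -/
theorem ntr_mul_eq_zero {I J X : Matrix n n ℝ} (h : IsQuaternionPair I J) (hX : Commute J X) :
    ntr (X * I) = 0 := by
  have h1 : J * (X * I) * J = X * I := by
    have := h.mul_comm
    rw [← mul_assoc, hX.eq, mul_assoc X, this, mul_neg, neg_mul, mul_assoc, mul_assoc, h.right_sq]
    simp
  have h2 := ntr_mul_comm (J * (X * I)) J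
  rw [h1, ← mul_assoc, h.right_sq, neg_mul, one_mul, map_neg] at h2
  linarith

/-- The trace identity behind the bound on the number of lines through a point. -/
theorem ntr_sq_identity {I J d d' W : Matrix n n ℝ} [Nonempty n] (h : IsQuaternionPair I J)
    (hId : Commute I d) (hJd : Commute J d) (hId' : Commute I d') (hJd' : Commute J d')
    (hd : d * d = 5) (hd' : d' * d' = 5)
    (hW : 2 * W = -(2 * (d + d')) + (d * d' - d' * d) * I) :
    ntr (W * W) = 1 / 4 * (140 + 4 * ntr (d * d' + d' * d) -
      ntr ((d * d' + d' * d) * (d * d' + d' * d))) := by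
  set C := d * d' - d' * d with hC
  set P := d * d' + d' * d with hP
  have hIC : Commute I C := (hId.mul_right hId').sub_right (hId'.mul_right hId)
  have hJC : Commute J C := (hJd.mul_right hJd').sub_right (hJd'.mul_right hJd)
  have hz : ntr ((d + d') * C * I) = 0 :=
    ntr_mul_eq_zero h ((hJd.add_right hJd').mul_right hJC)
  have hz' : ntr (C * I * (d + d')) = 0 := by
    rw [ntr_mul_comm, ← mul_assoc, hz]
  have e1 : (2 * W) * (2 * W) = 4 * ((d + d') * (d + d')) - 2 * ((d + d') * C * I) -
      2 * (C * I * (d + d')) + C * (I * C) * I := by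
    rw [hW]; noncomm_ring
  have e2 : (d + d') * (d + d') = 10 + P := by
    rw [hP]
    linear_combination (norm := (noncomm_ring; all_goals norm_num)) hd + hd'
  have e3 : C * (I * C) * I = - (C * C) := by
    rw [hIC.eq, ← mul_assoc, mul_assoc, h.left_sq, mul_neg, mul_one]
  have e4 : ntr (C * C) = ntr (P * P) - 100 := by
    have : C * C = P * P - 2 * (d * (d' * d') * d) - 2 * (d' * (d * d) * d') := by
      rw [hC, hP]; noncomm_ring
    rw [this, hd, hd', map_sub, map_sub, ntr_ofNat_mul, ntr_ofNat_mul, ntr_mul_comm _ d,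
      ← mul_assoc d, ntr_mul_comm _ d', ← mul_assoc d', hd, hd']
    have : ntr (5 * 5 : Matrix n n ℝ) = 25 := by rw [ntr_ofNat_mul, ntr_ofNat 5]; norm_num
    rw [this]; ring
  have e5 : (2 * W) * (2 * W) = 4 * (W * W) := by noncomm_ring
  have := congrArg ntr (e5.symm.trans e1)
  rw [e2, e3, map_add, map_sub, map_sub, ntr_ofNat_mul, ntr_ofNat_mul, ntr_ofNat_mul, ntr_ofNat_mul,
    hz, hz', map_neg, e4, map_add, ntr_ofNat 10] at this
  linarith

set_option linter.unusedSimpArgs false in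
-- With `a`, `b` the skew matrices of `x`, `u`, the long product is sixteen times the skew matrix of
-- a conjugate of an inverse of `x`. The anticommutator `Z = ab + ba` commutes with `a` and `b`
-- because their squares are scalar, so everything reduces to `1`, `a`, `b`, `ab` with coefficients
-- in `Z`.
theorem conj_products {A : Type*} [Ring A] {a b : A} (ha : a * a = -3) (hb : b * b = -3)
    (hZ : (a * b + b * a) * (a * b + b * a) = 20) :
    (a - 1) * ((b - 1) * a * (-b - 1)) * (a + 1) * a =
      -(4 • 1) + 2 • ((a * b + b * a) * (a * b)) - 20 • a - 6 • ((a * b + b * a) * b) +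
        2 • ((a * b + b * a) * a) - 6 • (a * b + b * a) + 12 • b + 12 • (a * b) ∧
    (a - 1) * ((b - 1) * a * (-b - 1)) * (a + 1) * b =
      36 • 1 - 2 • ((a * b + b * a) * (a * b)) - 12 • a - 2 • ((a * b + b * a) * b) +
        6 • ((a * b + b * a) * a) + 6 • (a * b + b * a) + 20 • b - 12 • (a * b) := by
  have ha' : a * a = -(3 • 1) := by rw [ha]; simp
  have hb' : b * b = -(3 • 1) := by rw [hb]; simp
  have hZ' : (a * b + b * a) * (a * b + b * a) = 20 • 1 := by rw [hZ]; simp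
  obtain ⟨Z, hZd⟩ : ∃ Z, Z = a * b + b * a := ⟨_, rfl⟩
  rw [← hZd] at hZ' ⊢
  have hba : b * a = Z - a * b := by rw [hZd]; abel
  have hZa : a * Z = Z * a := by
    rw [hZd]; simp only [mul_add, add_mul, mul_assoc, ha']
    rw [← mul_assoc a a, ha']
    simp only [neg_mul, mul_neg, smul_mul_assoc, mul_smul_comm, one_mul, mul_one]; abel
  have hZb : b * Z = Z * b := by
    rw [hZd]; simp only [mul_add, add_mul, mul_assoc, hb']
    rw [← mul_assoc b b, hb']
    simp only [neg_mul, mul_neg, smul_mul_assoc, mul_smul_comm, one_mul, mul_one]; abel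
  clear hZd ha hb hZ
  have ha'' := mul_mul_eq_of_mul_eq ha'
  have hb'' := mul_mul_eq_of_mul_eq hb'
  have hba' := mul_mul_eq_of_mul_eq hba
  have hZa' := mul_mul_eq_of_mul_eq hZa
  have hZb' := mul_mul_eq_of_mul_eq hZb
  have hZZ := mul_mul_eq_of_mul_eq hZ'
  constructor <;>
  simp only [mul_add, add_mul, mul_sub, sub_mul, mul_neg, neg_mul, neg_neg, mul_assoc, mul_one,
    one_mul, ha', hb', hba, hZa, hZb, hZ', ha'', hb'', hba', hZa', hZb', hZZ, neg_add, neg_sub,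
    smul_mul_assoc, mul_smul_comm, smul_neg, smul_smul] <;> abel

namespace IsFixedPointFreeRep
variable {L : Type*} [Group L] {ρ : L →* Matrix n n ℝ}

theorem anticommutator_of_ntr_neg_one [Finite L] (hρ : IsFixedPointFreeRep ρ) {x y : L}
    (hx : orderOf x = 3) (hy : orderOf y = 3) (h : ntr (skew ρ x * skew ρ y) = -1) :
    skew ρ x * skew ρ y + skew ρ y * skew ρ x = -2 := by
  rcases hρ.skew_cases hx hy with h' | h' | h' | h' | h' <;>
  first
  | exact h'.2
  | (rw [h'.1] at h; norm_num at h; done)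
  | (rw [h'.2] at h; norm_num at h)

theorem anticommutator_sq_of_ntr_zero [Finite L] (hρ : IsFixedPointFreeRep ρ) {x y : L}
    (hx : orderOf x = 3) (hy : orderOf y = 3) (h : ntr (skew ρ x * skew ρ y) = 0) :
    (skew ρ x * skew ρ y + skew ρ y * skew ρ x) *
      (skew ρ x * skew ρ y + skew ρ y * skew ρ x) = 20 := by
  rcases hρ.skew_cases hx hy with h' | h' | h' | h' | h' <;>
  first
  | exact h'.2
  | (rw [h'.1] at h; norm_num at h; done)
  | (rw [h'.2] at h; norm_num at h)

/-- The values `1` at `x` and `-1` at `y` already exhaust the sum of squares, so the average of `u`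
vanishes and `u` is recovered from its anticommutators with `I`, `J`, `I * J`. These are `0`, `1 +
d`, `1 - d`, where `d` is half the anticommutator with the third point of the line; orthogonality to
that point gives `d² = 20/4`. -/
theorem Adj.exists_root_five [Finite L] (hρ : IsFixedPointFreeRep ρ) {x y u : L} (h : Adj ρ x y)
    (hxu : Adj ρ x u) (h1 : u ∉ line x y) (h2 : u⁻¹ ∉ line x y)
    (huy : ntr (skew ρ u * skew ρ y) = -1) {I J : Matrix n n ℝ}
    (hIJ : IsQuaternionPair I J) (hI : Iᵀ = -I) (hJ : Jᵀ = -J) (e₀ : skew ρ x = I + J + I * J)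
    (e₁ : skew ρ y = I - J - I * J) (e₂ : skew ρ (x⁻¹ * y * x) = -I + J - I * J)
    (e₃ : skew ρ (x * y * x⁻¹) = -I - J + I * J) :
    ∃ d, Commute I d ∧ Commute J d ∧ d * d = 5 ∧ ntr d = 0 ∧
      2 * skew ρ u = -((1 + d) * J + (1 - d) * (I * J)) := by
  have hv := h.line_values hρ hxu.right h1 h2 hIJ hI hJ e₀ e₁ e₂ e₃
  rw [huy, hxu.symm.ntr_eq] at hv
  obtain ⟨hv1, -, -⟩ := hv
  rcases hv1 with hv1 | ⟨hv1, hN⟩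
  · nlinarith [sq_nonneg (ntr (skew ρ u * skew ρ (x⁻¹ * y * x))),
      sq_nonneg (ntr (skew ρ u * skew ρ (x * y * x⁻¹)))]
  have t2 : ntr (skew ρ u * skew ρ (x⁻¹ * y * x)) = 0 := by
    nlinarith [sq_nonneg (ntr (skew ρ u * skew ρ (x⁻¹ * y * x))),
      sq_nonneg (ntr (skew ρ u * skew ρ (x * y * x⁻¹)))]
  obtain ⟨⟨a1, a2⟩, ⟨b1, b2⟩, ⟨c1, c2⟩, hM⟩ := anticommutator_commute hIJ hN
  have o₂ : orderOf (x⁻¹ * y * x) = 3 := by rw [orderOf_conj', h.right]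
  have ac0 := hxu.symm.anticommutator hρ
  have ac1 : skew ρ u * skew ρ y + skew ρ y * skew ρ u = -2 :=
    hρ.anticommutator_of_ntr_neg_one hxu.right h.right huy
  have ac2 : (skew ρ u * skew ρ (x⁻¹ * y * x) + skew ρ (x⁻¹ * y * x) * skew ρ u) *
      (skew ρ u * skew ρ (x⁻¹ * y * x) + skew ρ (x⁻¹ * y * x) * skew ρ u) = 20 :=
    hρ.anticommutator_sq_of_ntr_zero hxu.right o₂ t2
  have t2' : ntr (skew ρ u * skew ρ (x⁻¹ * y * x) + skew ρ (x⁻¹ * y * x) * skew ρ u) = 0 := by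
    rw [map_add, ntr_mul_comm _ (skew ρ u), t2, add_zero]
  rw [e₂] at ac2 t2'
  rw [e₁] at ac1
  rw [e₀] at ac0
  set M := skew ρ u with hMdef
  set D := M * (-I + J - I * J) + (-I + J - I * J) * M with hD
  have hDe : D = -(M * I + I * M) + (M * J + J * M) - (M * (I * J) + I * J * M) := by
    rw [hD]; noncomm_ring
  have hdD : 2 * ((1 / 2 : ℝ) • D) = D := by
    rw [ofNat_mul_eq_smul 2, smul_smul]; norm_num
  refine ⟨(1 / 2 : ℝ) • D, ?_, ?_, ?_, ?_, ?_⟩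
  · refine Commute.smul_right ?_ _
    rw [hDe]; exact (a1.neg_right.add_right b1).sub_right c1
  · refine Commute.smul_right ?_ _
    rw [hDe]; exact (a2.neg_right.add_right b2).sub_right c2
  · rw [smul_mul_smul_comm, ac2]
    have : (20 : Matrix n n ℝ) = (4 : ℝ) • 5 := by rw [← ofNat_mul_eq_smul 4]; norm_num
    rw [this, smul_smul]; norm_num
  · rw [map_smul, t2', smul_zero]
  · generalize (1 / 2 : ℝ) • D = d at *
    have hinj : ∀ N : Matrix n n ℝ, 2 * N = 0 → N = 0 := by
      intro N hN
      rw [ofNat_mul_eq_smul 2, smul_eq_zero, or_iff_right (by norm_num)] at hN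
      exact hN
    have hI0 : M * I + I * M = 0 := by
      refine hinj _ ?_
      linear_combination (norm := noncomm_ring) ac0 + ac1
    have hJ1 : M * J + J * M = 1 + d := by
      rw [← sub_eq_zero]
      refine hinj _ ?_
      linear_combination (norm := (noncomm_ring; all_goals norm_num)) ac0 - hdD - hD
    have hK1 : M * (I * J) + I * J * M = 1 - d := by
      rw [← sub_eq_zero]
      refine hinj _ ?_
      linear_combination (norm := (noncomm_ring; all_goals norm_num)) ac0 + hdD + hD - 2 * hI0
    rw [hI0, hJ1, hK1] at hM
    rw [← neg_eq_iff_eq_neg, hM, zero_mul, zero_add]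

/-- Three pairwise distinct lines through a point cannot exist. -/
theorem Adj.false_of_three [Finite L] (hρ : IsFixedPointFreeRep ρ) {x y u v : L} (h : Adj ρ x y)
    (hxu : Adj ρ x u) (hxv : Adj ρ x v) (hu1 : u ∉ line x y) (hu2 : u⁻¹ ∉ line x y)
    (hv1 : v ∉ line x y) (hv2 : v⁻¹ ∉ line x y) (huy : ntr (skew ρ u * skew ρ y) = -1)
    (hvy : ntr (skew ρ v * skew ρ y) = -1)
    (huv : ntr (skew ρ u * skew ρ v) = -1 ∨ ntr (skew ρ u * skew ρ v) = 0) : False := by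
  have := hρ.nonempty
  obtain ⟨I, J, hIJ, hI, hJ, hJρ, e₀, e₁, e₂, e₃⟩ := h.exists_quaternionPair hρ
  obtain ⟨d, hId, hJd, hd, td, hu⟩ :=
    h.exists_root_five hρ hxu hu1 hu2 huy hIJ hI hJ e₀ e₁ e₂ e₃
  obtain ⟨d', hId', hJd', hd', td', hv⟩ :=
    h.exists_root_five hρ hxv hv1 hv2 hvy hIJ hI hJ e₀ e₁ e₂ e₃
  obtain ⟨p1, p2⟩ := quaternion_products hIJ hId hJd hId' hJd' hu hv
  have hinj : ∀ N N' : Matrix n n ℝ, 2 * N = 2 * N' → N = N' := by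
    intro N N' hN
    rw [ofNat_mul_eq_smul 2, ofNat_mul_eq_smul 2] at hN
    exact smul_right_injective _ (two_ne_zero' ℝ) hN
  have n2 : ntr (2 : Matrix n n ℝ) = 2 := ntr_ofNat 2
  have n20 : ntr (20 : Matrix n n ℝ) = 20 := ntr_ofNat 20
  have m2 : ∀ N : Matrix n n ℝ, ntr (2 * N) = 2 * ntr N := ntr_ofNat_mul 2
  have m4 : ∀ N : Matrix n n ℝ, ntr (4 * N) = 4 * ntr N := ntr_ofNat_mul 4
  have hJinv : ρ (y * x⁻¹)⁻¹ = -J := by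
    rw [← hρ.transpose_apply, ← hJρ, hJ]
  -- Conjugation by `y x⁻¹`, whose image is `J`, gives an element orthogonal to `u`. Its
  -- anticommutator with `u` must then have square `20`, while `ntr_sq_identity` computes the trace
  -- of that square from the anticommutator of `u` and `v`.
  let v' := y * x⁻¹ * v * (y * x⁻¹)⁻¹
  have ov' : orderOf v' = 3 := by rw [orderOf_conj, hxv.right]
  have hv' : skew ρ v' = -(J * skew ρ v * J) := by
    rw [skew_conj, hJinv, ← hJρ, mul_neg]
  set M := skew ρ u with hM
  set M' := skew ρ v with hM'
  have hW : 2 * (M * skew ρ v' + skew ρ v' * M) = -(2 * (d + d')) + (d * d' - d' * d) * I := by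
    refine hinj _ _ ?_
    rw [hv']
    simp only [nsmul_eq_mul, Nat.cast_ofNat] at p2
    linear_combination (norm := noncomm_ring) p2
  have hid := ntr_sq_identity hIJ hId hJd hId' hJd' hd hd' hW
  have hP : d * d' + d' * d = -2 - 2 * (M * M' + M' * M) := by
    refine hinj _ _ ?_
    simp only [nsmul_eq_mul, Nat.cast_ofNat] at p1
    linear_combination (norm := (noncomm_ring; all_goals norm_num)) p1
  have hC : ntr ((d * d' - d' * d) * I) = 0 :=
    ntr_mul_eq_zero hIJ ((hJd.mul_right hJd').sub_right (hJd'.mul_right hJd))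
  have t0 : ntr (M * skew ρ v') = 0 := by
    have h1 := congrArg ntr hW
    rw [ntr_ofNat_mul, map_add, map_add, hC, ntr_mul_comm _ M, map_neg, ntr_ofNat_mul, map_add, td,
      td'] at h1
    linarith
  have hWW : (M * skew ρ v' + skew ρ v' * M) * (M * skew ρ v' + skew ρ v' * M) = 20 :=
    hρ.anticommutator_sq_of_ntr_zero hxu.right ov' t0
  rw [hWW, n20, hP] at hid
  have expand : ∀ Z : Matrix n n ℝ, (-2 - 2 * Z) * (-2 - 2 * Z) = 2 * 2 + 4 * (2 * Z) + 4 * (Z * Z) := by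
    intro Z; noncomm_ring
  rw [expand] at hid
  simp only [map_sub, map_add, map_neg, m2, m4, n2] at hid
  rw [← map_add] at hid
  -- The trace identity gives `36` when the Gram value of `u` and `v` is `-1`, and `12` when it is
  -- `0`, instead of the required `20`.
  rcases huv with huv | huv
  · have hZ : M * M' + M' * M = -2 :=
      hρ.anticommutator_of_ntr_neg_one hxu.right hxv.right huv
    rw [hZ, neg_mul_neg, ntr_ofNat_mul, map_neg, n2] at hid
    norm_num at hid
  · have hZ : (M * M' + M' * M) * (M * M' + M' * M) = 20 :=
      hρ.anticommutator_sq_of_ntr_zero hxu.right hxv.right huv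
    rw [hZ, n20, map_add, ntr_mul_comm M' M, huv] at hid
    norm_num at hid

/-- Elements of order three that are not adjacent up to inversion have a common neighbour. -/
theorem exists_common_adj [Finite L] (hρ : IsFixedPointFreeRep ρ) {x u : L} (hx : orderOf x = 3)
    (hu : orderOf u = 3) (hxu : ntr (skew ρ x * skew ρ u) = 0) :
    ∃ v, Adj ρ v x ∧ Adj ρ v u := by
  have := hρ.nonempty
  have hZ : (skew ρ x * skew ρ u + skew ρ u * skew ρ x) *
      (skew ρ x * skew ρ u + skew ρ u * skew ρ x) = 20 :=
    hρ.anticommutator_sq_of_ntr_zero hx hu hxu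
  have haa := hρ.skew_mul_self hx
  have hbb := hρ.skew_mul_self hu
  have ta : ntr (skew ρ x) = 0 := by
    rw [skew, map_add, ntr_ofNat_mul, ntr_one, hρ.ntr_of_prime Nat.prime_three hx]; norm_num
  have tb : ntr (skew ρ u) = 0 := by
    rw [skew, map_add, ntr_ofNat_mul, ntr_one, hρ.ntr_of_prime Nat.prime_three hu]; norm_num
  have hw : 4 * skew ρ (u * x * u⁻¹) = (skew ρ u - 1) * skew ρ x * (-skew ρ u - 1) := by
    rw [skew_conj, hρ.apply_inv_of_orderOf_three hu]
    simp only [skew]; noncomm_ring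
  have hv : 4 * skew ρ (x * (u * x * u⁻¹)⁻¹ * x⁻¹) =
      (skew ρ x - 1) * skew ρ (u * x * u⁻¹) * (skew ρ x + 1) := by
    rw [skew_conj, hρ.apply_inv_of_orderOf_three hx, hρ.skew_inv (by rw [orderOf_conj, hx])]
    generalize skew ρ (u * x * u⁻¹) = w
    simp only [skew]; noncomm_ring
  have ov : orderOf (x * (u * x * u⁻¹)⁻¹ * x⁻¹) = 3 := by
    rw [orderOf_conj, orderOf_inv, orderOf_conj, hx]
  -- The common neighbour is the conjugate by `x` of the inverse of `u x u⁻¹`. By `conj_products`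
  -- its Gram values with `x` and `u` are both `16/16 = 1`.
  refine ⟨_, ⟨ov, hx, ?_⟩, ⟨ov, hu, ?_⟩⟩
  all_goals
    clear ov
    generalize skew ρ (x * (u * x * u⁻¹)⁻¹ * x⁻¹) = e at *
    generalize skew ρ (u * x * u⁻¹) = w at *
    generalize skew ρ x = a at *
    generalize skew ρ u = b at *
    obtain ⟨h1, h2⟩ := conj_products haa hbb hZ
    have he : 16 * e = (a - 1) * ((b - 1) * a * (-b - 1)) * (a + 1) := by
      rw [← hw]
      linear_combination (norm := noncomm_ring) 4 * hv
    have tZ : ntr (a * b + b * a) = 0 := by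
      rw [map_add, ntr_mul_comm b, hxu, add_zero]
    have n3 : ∀ N : Matrix n n ℝ, ntr (N * -3) = -3 * ntr N := fun N => by
      rw [mul_neg, map_neg, ntr_mul_comm, ntr_ofNat_mul]; ring
    have tZa : ntr ((a * b + b * a) * a) = 0 := by
      rw [add_mul, map_add, mul_assoc b, haa, ntr_mul_comm (a * b) a, ← mul_assoc, haa,
        ntr_mul_comm, n3, tb]; ring
    have tZb : ntr ((a * b + b * a) * b) = 0 := by
      rw [add_mul, map_add, mul_assoc a, hbb, ntr_mul_comm (b * a) b, ← mul_assoc, hbb,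
        ntr_mul_comm _ a, n3, ta]; ring
    have t9 : ntr (b * a * (a * b)) = 9 := by
      rw [mul_assoc, ← mul_assoc a, haa, ntr_mul_comm, mul_assoc, hbb, neg_mul_neg, ntr_ofNat_mul,
        ntr_ofNat 3]; norm_num
    have t9' : ntr (a * b * (b * a)) = 9 := by rw [ntr_mul_comm, t9]
    have tab : ntr (b * a * (b * a)) = ntr (a * b * (a * b)) := by
      rw [mul_assoc, ntr_mul_comm]; simp only [mul_assoc]
    have t1 : ntr (a * b * (a * b)) = 1 := by
      have := congrArg ntr hZ
      rw [mul_add, add_mul, add_mul, map_add, map_add, map_add, t9, t9', tab, ntr_ofNat 20] at this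
      linarith
    have tZab : ntr ((a * b + b * a) * (a * b)) = 10 := by
      rw [add_mul, map_add, t1, t9]; norm_num
    rw [← he] at h1 h2
    have h1' := congrArg ntr h1
    have h2' := congrArg ntr h2
    rw [mul_assoc, ntr_ofNat_mul 16] at h1' h2'
    simp only [map_add, map_sub, map_neg, map_nsmul, ntr_one] at h1' h2'
    simp only [← map_add] at h1' h2'
    rw [tZ, tZa, tZb, tZab, ta, tb, hxu] at h1' h2'
    simp only [nsmul_eq_mul] at h1' h2'
    norm_num at h1' h2'
    linarith

end IsFixedPointFreeRep
end

/-! ### Incidence properties of lines. -/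

section
open Matrix
variable {n : Type*} [Fintype n] [DecidableEq n]
-- Two values equal to `1` use up the sum of squares, so the other two vanish and the sum would be
-- two.
theorem eq_of_sum_eq_zero_of_sum_sq_eq_two {α : Type*} (f : α → ℝ) {a b c d : α}
    (h : f a + f b + f c + f d = 0) (h2 : f a ^ 2 + f b ^ 2 + f c ^ 2 + f d ^ 2 = 2) {s t : α}
    (hs : s ∈ ({a, b, c, d} : Set α)) (ht : t ∈ ({a, b, c, d} : Set α)) (hs1 : f s = 1)
    (ht1 : f t = 1) : s = t := by
  have key : ∀ p q r s : ℝ, p + q + r + s = 0 → p ^ 2 + q ^ 2 + r ^ 2 + s ^ 2 = 2 → p = 1 →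
      q = 1 → False := by
    rintro p q r s h h2 rfl rfl
    nlinarith [sq_nonneg (r - s)]
  have k1 := key (f a) (f b) (f c) (f d) h h2
  have k2 := key (f a) (f c) (f b) (f d) (by linarith) (by linarith)
  have k3 := key (f a) (f d) (f b) (f c) (by linarith) (by linarith)
  have k4 := key (f b) (f c) (f a) (f d) (by linarith) (by linarith)
  have k5 := key (f b) (f d) (f a) (f c) (by linarith) (by linarith)
  have k6 := key (f c) (f d) (f a) (f b) (by linarith) (by linarith)
  rcases hs with rfl | rfl | rfl | rfl <;> rcases ht with rfl | rfl | rfl | rfl <;>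
    first | rfl | tauto

namespace IsFixedPointFreeRep
variable {L : Type*} [Group L] {ρ : L →* Matrix n n ℝ} {x y u v s t : L}

theorem ntr_skew_self (hρ : IsFixedPointFreeRep ρ) (hx : orderOf x = 3) :
    ntr (skew ρ x * skew ρ x) = -3 := by
  have := hρ.nonempty
  rw [hρ.skew_mul_self hx, map_neg, ntr_ofNat 3]

theorem ntr_skew_inv (hρ : IsFixedPointFreeRep ρ) (hy : orderOf y = 3) :
    ntr (skew ρ x * skew ρ y⁻¹) = - ntr (skew ρ x * skew ρ y) := by
  rw [hρ.skew_inv hy, mul_neg, map_neg]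

theorem ntr_skew_conj (g : L) : ntr (skew ρ (g * x * g⁻¹) * skew ρ (g * y * g⁻¹)) =
    ntr (skew ρ x * skew ρ y) := by
  rw [skew_conj, skew_conj]
  have h1 : ρ g⁻¹ * ρ g = 1 := by rw [← map_mul, inv_mul_cancel, map_one]
  have : ρ g * skew ρ x * ρ g⁻¹ * (ρ g * skew ρ y * ρ g⁻¹) =
      ρ g * (skew ρ x * skew ρ y * ρ g⁻¹) := by
    simp only [mul_assoc, mul_mul_eq_of_mul_eq h1, one_mul]
  rw [this, ntr_mul_comm, mul_assoc, h1, mul_one]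

theorem Adj.ne (hρ : IsFixedPointFreeRep ρ) (h : Adj ρ x y) : x ≠ y := by
  rintro rfl
  have := h.ntr_eq
  rw [hρ.ntr_skew_self h.left] at this
  norm_num at this

theorem Adj.ne_inv (hρ : IsFixedPointFreeRep ρ) (h : Adj ρ x y) : x ≠ y⁻¹ := by
  rintro rfl
  have h1 := h.ntr_eq
  rw [hρ.skew_inv h.right, neg_mul, map_neg, hρ.ntr_skew_self h.right] at h1
  norm_num at h1

theorem Adj.not_adj_inv (hρ : IsFixedPointFreeRep ρ) (h : Adj ρ x y) : ¬ Adj ρ x y⁻¹ := by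
  intro h1
  have := h1.ntr_eq
  rw [hρ.ntr_skew_inv h.right, h.ntr_eq] at this
  norm_num at this

theorem adj_inv_iff (hρ : IsFixedPointFreeRep ρ) : Adj ρ x⁻¹ y⁻¹ ↔ Adj ρ x y :=
  ⟨fun h => by simpa using h.inv hρ, fun h => h.inv hρ⟩

theorem adj_inv_left_iff (hρ : IsFixedPointFreeRep ρ) : Adj ρ x⁻¹ y ↔ Adj ρ x y⁻¹ := by
  rw [← hρ.adj_inv_iff, inv_inv]

theorem Adj.sum_skew [Finite L] (hρ : IsFixedPointFreeRep ρ) (h : Adj ρ x y) :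
    skew ρ x + skew ρ y + skew ρ (x⁻¹ * y * x) + skew ρ (x * y * x⁻¹) = 0 := by
  obtain ⟨I, J, -, -, -, -, e₀, e₁, e₂, e₃⟩ := h.exists_quaternionPair hρ
  rw [e₀, e₁, e₂, e₃]; abel

theorem pow_conj_three (hx : orderOf x = 3) : x * (x * y * x⁻¹) * x⁻¹ = x⁻¹ * y * x := by
  have h1 : x⁻¹ = x * x := inv_eq_of_mul_eq_one_left (mul_self_mul_self_of_orderOf_three hx)
  have h2 : x = x⁻¹ * x⁻¹ := by
    rw [← _root_.inv_inj, _root_.mul_inv_rev, inv_inv, ← h1]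
  calc x * (x * y * x⁻¹) * x⁻¹ = (x * x) * y * (x⁻¹ * x⁻¹) := by group
    _ = _ := by rw [← h1, ← h2]

theorem Adj.conj_self (h : Adj ρ x y) : Adj ρ x (x * y * x⁻¹) := by
  simpa using h.conj x

theorem Adj.conj_self' (h : Adj ρ x y) : Adj ρ x (x⁻¹ * y * x) := by
  simpa using h.conj x⁻¹

/-- The four skew matrices of a line add up to zero. Pairing with `y` gives `1 - 3 + 2 t = 0`, the
two unknown values being equal by conjugation with `x`. -/
theorem Adj.adj_conj [Finite L] (hρ : IsFixedPointFreeRep ρ) (h : Adj ρ x y) :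
    Adj ρ y (x * y * x⁻¹) := by
  refine ⟨h.right, by rw [orderOf_conj, h.right], ?_⟩
  have h1 := congrArg (fun M => ntr (skew ρ y * M)) (h.sum_skew hρ)
  simp only [mul_add, map_add, mul_zero, map_zero] at h1
  have h2 := ntr_skew_conj (ρ := ρ) (x := y) (y := x⁻¹ * y * x) x
  have h3 : x * (x⁻¹ * y * x) * x⁻¹ = y := by group
  rw [h3, ntr_mul_comm] at h2
  rw [h.symm.ntr_eq, hρ.ntr_skew_self h.right, ← h2] at h1
  linarith

theorem Adj.of_mem_line_of_ne [Finite L] (hρ : IsFixedPointFreeRep ρ) (h : Adj ρ x y)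
    (hs : s ∈ line x y) (ht : t ∈ line x y) (hst : s ≠ t) : Adj ρ s t := by
  have h13 := h.adj_conj hρ
  have h21 : Adj ρ (x⁻¹ * y * x) y := by
    have := h13.conj x⁻¹
    simpa [mul_assoc] using this
  have h32 : Adj ρ (x * y * x⁻¹) (x⁻¹ * y * x) := by
    have := h13.conj x
    rwa [pow_conj_three h.left] at this
  have h02 := h.conj_self'
  have h03 := h.conj_self
  rcases hs with rfl | rfl | rfl | rfl <;> rcases ht with rfl | rfl | rfl | rfl <;>
  first
  | exact absurd rfl hst
  | assumption
  | (apply Adj.symm; assumption)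

theorem mem_line_left : x ∈ line x y := Or.inl rfl

theorem mem_line_right : y ∈ line x y := Or.inr (Or.inl rfl)

theorem Adj.orderOf_of_mem_line (h : Adj ρ x y) (hs : s ∈ line x y) : orderOf s = 3 := by
  rcases hs with rfl | rfl | rfl | rfl
  · exact h.left
  · exact h.right
  · rw [orderOf_conj', h.right]
  · rw [orderOf_conj, h.right]

theorem Adj.inv_notMem_line [Finite L] (hρ : IsFixedPointFreeRep ρ) (h : Adj ρ x y)
    (hs : s ∈ line x y) (hu : Adj ρ u s) : u⁻¹ ∉ line x y := by
  intro hm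
  by_cases he : u⁻¹ = s
  · exact hu.ne_inv hρ (by rw [← he, inv_inv])
  · exact (h.of_mem_line_of_ne hρ hm hs he).not_adj_inv hρ ((hρ.adj_inv_iff).2 hu)

/-- The four Gram values add up to zero and their squares to `0` or `2`. Either `u` is orthogonal to
the line, or exactly one value is `1` and one is `-1`. -/
theorem Adj.line_dichotomy [Finite L] (hρ : IsFixedPointFreeRep ρ) (h : Adj ρ x y)
    (hu : orderOf u = 3) (h1 : u ∉ line x y) (h2 : u⁻¹ ∉ line x y) :
    (∀ s ∈ line x y, ntr (skew ρ u * skew ρ s) = 0) ∨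
    ((∃ s ∈ line x y, Adj ρ u s) ∧ (∃ s ∈ line x y, Adj ρ u s⁻¹) ∧
      ∀ s ∈ line x y, ∀ t ∈ line x y, Adj ρ u s → Adj ρ u t → s = t) := by
  obtain ⟨I, J, hIJ, hI, hJ, -, e₀, e₁, e₂, e₃⟩ := h.exists_quaternionPair hρ
  obtain ⟨hv, hc, hs⟩ := h.line_values hρ hu h1 h2 hIJ hI hJ e₀ e₁ e₂ e₃
  have ho : ∀ s ∈ line x y, orderOf s = 3 := fun s hs => h.orderOf_of_mem_line hs
  have m₂ : x⁻¹ * y * x ∈ line x y := by simp [line]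
  have m₃ : x * y * x⁻¹ ∈ line x y := by simp [line]
  have c₀ := hc _ mem_line_left
  have c₁ := hc _ mem_line_right
  have c₂ := hc _ m₂
  have c₃ := hc _ m₃
  have q₀ := sq_nonneg (ntr (skew ρ u * skew ρ x))
  have q₁ := sq_nonneg (ntr (skew ρ u * skew ρ y))
  have q₂ := sq_nonneg (ntr (skew ρ u * skew ρ (x⁻¹ * y * x)))
  have q₃ := sq_nonneg (ntr (skew ρ u * skew ρ (x * y * x⁻¹)))
  rcases hv with hv | ⟨hv, -⟩
  · left
    rintro s (rfl | rfl | rfl | rfl) <;> refine pow_eq_zero_iff (two_ne_zero) |>.1 ?_ <;> linarith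
  · right
    refine ⟨?_, ?_, ?_⟩
    · by_contra! hcon
      have hle : ∀ s ∈ line x y, ntr (skew ρ u * skew ρ s) ≤ 0 := by
        intro s hs
        rcases hc s hs with h | h | h
        · exact absurd ⟨hu, ho s hs, h⟩ (hcon s hs)
        · rw [h]; norm_num
        · rw [h]
      have a₀ := hle _ mem_line_left
      have a₁ := hle _ mem_line_right
      have a₂ := hle _ m₂
      have a₃ := hle _ m₃
      rw [show ntr (skew ρ u * skew ρ x) = 0 by linarith,
        show ntr (skew ρ u * skew ρ y) = 0 by linarith,
        show ntr (skew ρ u * skew ρ (x⁻¹ * y * x)) = 0 by linarith,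
        show ntr (skew ρ u * skew ρ (x * y * x⁻¹)) = 0 by linarith] at hv
      norm_num at hv
    · by_contra! hcon
      have hle : ∀ s ∈ line x y, 0 ≤ ntr (skew ρ u * skew ρ s) := by
        intro s hs
        rcases hc s hs with h | h | h
        · rw [h]; norm_num
        · refine absurd ⟨hu, by rw [orderOf_inv, ho s hs], ?_⟩ (hcon s hs)
          rw [hρ.ntr_skew_inv (ho s hs), h, neg_neg]
        · rw [h]
      have a₀ := hle _ mem_line_left
      have a₁ := hle _ mem_line_right
      have a₂ := hle _ m₂
      have a₃ := hle _ m₃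
      rw [show ntr (skew ρ u * skew ρ x) = 0 by linarith,
        show ntr (skew ρ u * skew ρ y) = 0 by linarith,
        show ntr (skew ρ u * skew ρ (x⁻¹ * y * x)) = 0 by linarith,
        show ntr (skew ρ u * skew ρ (x * y * x⁻¹)) = 0 by linarith] at hv
      norm_num at hv
    · intro s hs' t ht hs1 ht1
      exact eq_of_sum_eq_zero_of_sum_sq_eq_two (fun s => ntr (skew ρ u * skew ρ s)) hs hv hs' ht
        hs1.ntr_eq ht1.ntr_eq

/-- A line is a maximal clique: a common neighbour of two of its points outside the line would
contradict the uniqueness in `Adj.line_dichotomy`. So any two points determine the line. -/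
theorem Adj.mem_line_iff [Finite L] (hρ : IsFixedPointFreeRep ρ) (h : Adj ρ x y) :
    s ∈ line x y ↔ s = x ∨ s = y ∨ (Adj ρ s x ∧ Adj ρ s y) := by
  constructor
  · intro hs
    by_cases h1 : s = x
    · exact Or.inl h1
    by_cases h2 : s = y
    · exact Or.inr (Or.inl h2)
    exact Or.inr (Or.inr ⟨h.of_mem_line_of_ne hρ hs mem_line_left h1,
      h.of_mem_line_of_ne hρ hs mem_line_right h2⟩)
  · rintro (rfl | rfl | ⟨h1, h2⟩)
    · exact mem_line_left
    · exact mem_line_right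
    · by_contra hs
      rcases h.line_dichotomy hρ h1.left hs (h.inv_notMem_line hρ mem_line_left h1) with h3 | h3
      · have := h3 x mem_line_left
        rw [h1.ntr_eq] at this
        norm_num at this
      · exact h.ne hρ (h3.2.2 x mem_line_left y mem_line_right h1 h2)

theorem Adj.line_eq [Finite L] (hρ : IsFixedPointFreeRep ρ) (h : Adj ρ x y)
    (hs : s ∈ line x y) (ht : t ∈ line x y) (hst : s ≠ t) : line s t = line x y := by
  have key : ∀ {x y s t : L}, Adj ρ x y → s ∈ line x y → t ∈ line x y → s ≠ t →
      line x y ⊆ line s t := by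
    intro x y s t h hs ht hst z hz
    rw [(h.of_mem_line_of_ne hρ hs ht hst).mem_line_iff hρ]
    by_cases h1 : z = s
    · exact Or.inl h1
    by_cases h2 : z = t
    · exact Or.inr (Or.inl h2)
    exact Or.inr (Or.inr ⟨h.of_mem_line_of_ne hρ hz hs h1, h.of_mem_line_of_ne hρ hz ht h2⟩)
  have h1 := key h hs ht hst
  exact (key (h.of_mem_line_of_ne hρ hs ht hst) (h1 mem_line_left) (h1 mem_line_right)
    (h.ne hρ)).antisymm h1

theorem conj_mem_line_conj (g : L) (hs : s ∈ line x y) :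
    g * s * g⁻¹ ∈ line (g * x * g⁻¹) (g * y * g⁻¹) := by
  rcases hs with rfl | rfl | rfl | rfl
  · exact Or.inl rfl
  · exact Or.inr (Or.inl rfl)
  · exact Or.inr (Or.inr (Or.inl (by group)))
  · exact Or.inr (Or.inr (Or.inr (by simp only [Set.mem_singleton_iff]; group)))

theorem Adj.conj_mem_line [Finite L] (hρ : IsFixedPointFreeRep ρ) (h : Adj ρ x y)
    (hs : s ∈ line x y) : x * s * x⁻¹ ∈ line x y := by
  have h1 := conj_mem_line_conj x hs
  rwa [mul_inv_cancel_right, h.line_eq hρ mem_line_left _ (h.conj_self.ne hρ)] at h1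
  exact Or.inr (Or.inr (Or.inr rfl))

end IsFixedPointFreeRep
end

/-! ### Points on two lines, and double lines. -/

section
open Matrix
variable {n : Type*} [Fintype n] [DecidableEq n]
namespace IsFixedPointFreeRep
variable {L : Type*} [Group L] [Finite L] {ρ : L →* Matrix n n ℝ} {x y u v s t p q : L}

theorem Adj.conj_mem_line_iff (hρ : IsFixedPointFreeRep ρ) (h : Adj ρ x y) :
    x * s * x⁻¹ ∈ line x y ↔ s ∈ line x y := by
  refine ⟨fun hs => ?_, h.conj_mem_line hρ⟩
  have h1 := h.conj_mem_line hρ (h.conj_mem_line hρ hs)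
  have h2 : x * (x * (x * s * x⁻¹) * x⁻¹) * x⁻¹ = s := by
    rw [pow_conj_three h.left]; group
  rwa [h2] at h1

theorem inv_ne_self_of_orderOf_three {L : Type*} [Group L] {x : L} (hx : orderOf x = 3) : x⁻¹ ≠ x := by
  intro e
  have h1 : x ^ 2 = 1 := by rw [pow_two]; nth_rewrite 1 [← e]; exact inv_mul_cancel x
  have h2 := orderOf_dvd_of_pow_eq_one h1
  rw [hx] at h2
  exact absurd h2 (by norm_num)

theorem ntr_cases (hρ : IsFixedPointFreeRep ρ) (hx : orderOf x = 3) (hy : orderOf y = 3) :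
    y = x ∨ y = x⁻¹ ∨ Adj ρ x y ∨ Adj ρ x y⁻¹ ∨ ntr (skew ρ x * skew ρ y) = 0 := by
  rcases hρ.skew_cases hx hy with h | h | h | h | h
  · exact Or.inl h.1
  · exact Or.inr (Or.inl h.1)
  · exact Or.inr (Or.inr (Or.inl ⟨hx, hy, h.1⟩))
  · refine Or.inr (Or.inr (Or.inr (Or.inl ⟨hx, by rw [orderOf_inv, hy], ?_⟩)))
    rw [hρ.ntr_skew_inv hy, h.1, neg_neg]
  · exact Or.inr (Or.inr (Or.inr (Or.inr h.1)))

/-- A point lies on at most two lines. -/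
theorem Adj.mem_line_or_mem_line (hρ : IsFixedPointFreeRep ρ) (h : Adj ρ x y) (hxu : Adj ρ x u)
    (hu : u ∉ line x y) (hxv : Adj ρ x v) : v ∈ line x y ∨ v ∈ line x u := by
  by_contra! hv
  obtain ⟨hv1, hv2⟩ := hv
  -- A neighbour of `x` off the line has value `1` at `x`, hence value `-1` at some other point of
  -- the line. Rotating by `x` lets two such neighbours be matched with the same point.
  have match_of : ∀ {w}, Adj ρ x w → w ∉ line x y → ∃ s ∈ line x y, s ≠ x ∧ Adj ρ w s⁻¹ := by
    intro w hw hwl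
    rcases h.line_dichotomy hρ hw.right hwl (h.inv_notMem_line hρ mem_line_left hw.symm) with h1 | h1
    · have := h1 x mem_line_left
      rw [hw.symm.ntr_eq] at this
      norm_num at this
    · obtain ⟨s, hs, hsw⟩ := h1.2.1
      refine ⟨s, hs, ?_, hsw⟩
      rintro rfl
      exact hw.symm.not_adj_inv hρ hsw
  obtain ⟨s, hs, hsx, hus⟩ := match_of hxu hu
  obtain ⟨s', hs', hsx', hvs'⟩ := match_of hxv hv1
  have hl : line x s = line x y := h.line_eq hρ mem_line_left hs hsx.symm
  have hxs : Adj ρ x s := h.of_mem_line_of_ne hρ mem_line_left hs hsx.symm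
  rw [← hl] at hs' hu hv1
  -- move `v` around `x` so that it is matched with `s`
  obtain ⟨w, hw1, hw2, hxw, hws⟩ : ∃ w, w ∉ line x s ∧ w ∉ line x u ∧ Adj ρ x w ∧ Adj ρ w s⁻¹ := by
    rcases hs' with rfl | rfl | rfl | rfl
    · exact absurd rfl hsx'
    · exact ⟨v, hv1, hv2, hxv, hvs'⟩
    · refine ⟨x * v * x⁻¹, by rwa [hxs.conj_mem_line_iff hρ], by rwa [hxu.conj_mem_line_iff hρ],
        hxv.conj_self, ?_⟩
      have := hvs'.conj x
      convert this using 1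
      group
    · refine ⟨x⁻¹ * v * x, fun hm => hv1 ?_, fun hm => hv2 ?_, hxv.conj_self', ?_⟩
      · have := hxs.conj_mem_line hρ hm
        convert this using 1; group
      · have := hxu.conj_mem_line hρ hm
        convert this using 1; group
      · have := hvs'.conj x⁻¹
        convert this using 1 <;> group
  have neg : ∀ {w}, Adj ρ w s⁻¹ → ntr (skew ρ w * skew ρ s) = -1 := by
    intro w hw
    have := hw.ntr_eq
    rw [hρ.ntr_skew_inv hxs.right] at this
    linarith
  refine hxs.false_of_three hρ hxu hxw hu (hxs.inv_notMem_line hρ mem_line_left hxu.symm) hw1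
    (hxs.inv_notMem_line hρ mem_line_left hxw.symm) (neg hus) (neg hws) ?_
  rcases hxu.line_dichotomy hρ hxw.right hw2 (hxu.inv_notMem_line hρ mem_line_left hxw.symm)
    with h1 | ⟨-, -, h1⟩
  · have := h1 x mem_line_left
    rw [hxw.symm.ntr_eq] at this
    norm_num at this
  · have hnot : ¬ Adj ρ w u := fun h2 =>
      hxu.ne hρ (h1 x mem_line_left u mem_line_right hxw.symm h2)
    rcases hρ.ntr_cases hxw.right hxu.right with rfl | h2 | h2 | h2 | h2
    · exact absurd mem_line_right hw2
    · refine absurd ?_ (hxu.inv_notMem_line hρ mem_line_left hxw.symm)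
      rw [← h2]; exact mem_line_right
    · exact absurd h2 hnot
    · left
      have := h2.ntr_eq
      rw [hρ.ntr_skew_inv hxu.right, ntr_mul_comm] at this
      linarith
    · right; rw [ntr_mul_comm, h2]

/-- If `u` were orthogonal to the line, a common neighbour `v` of `u` and `x` would be adjacent to
`x`, to the inverse of some point `s` of the line, and to `u`. Since `v` lies on at most two lines,
`u` would be on a line with `x` or with `s⁻¹`, hence equal to one of them or adjacent to it. -/
theorem Adj.exists_adj_of_notMem_line (hρ : IsFixedPointFreeRep ρ) (h : Adj ρ x y)
    (hu : orderOf u = 3) (h1 : u ∉ line x y) (h2 : u⁻¹ ∉ line x y) :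
    (∃ s ∈ line x y, Adj ρ u s) ∧ ∃ s ∈ line x y, Adj ρ u s⁻¹ := by
  rcases h.line_dichotomy hρ hu h1 h2 with h3 | ⟨h3, h4, -⟩
  swap
  · exact ⟨h3, h4⟩
  exfalso
  have notadj : ∀ s ∈ line x y, ¬ Adj ρ u s ∧ ¬ Adj ρ u s⁻¹ := by
    refine fun s hs => ⟨fun h4 => ?_, fun h4 => ?_⟩
    · have := h3 s hs
      rw [h4.ntr_eq] at this; norm_num at this
    · have := h4.ntr_eq
      rw [hρ.ntr_skew_inv (h.orderOf_of_mem_line hs), h3 s hs] at this; norm_num at this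
  obtain ⟨v, hvu, hvx⟩ := hρ.exists_common_adj hu h.left (h3 x mem_line_left)
  have hv1 : v ∉ line x y := fun hv => (notadj v hv).1 hvu.symm
  have hv2 := h.inv_notMem_line hρ mem_line_left hvx
  rcases h.line_dichotomy hρ hvx.left hv1 hv2 with h4 | ⟨-, ⟨s, hs, hvs⟩, -⟩
  · have := h4 x mem_line_left
    rw [hvx.ntr_eq] at this; norm_num at this
  have hs1 : s⁻¹ ∉ line v x := by
    intro hm
    rw [hvx.mem_line_iff hρ] at hm
    rcases hm with e | e | ⟨-, e⟩
    · exact hvs.ne hρ e.symm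
    · have hsx : s = x⁻¹ := by rw [← e, inv_inv]
      have hm : x⁻¹ ∈ line x y := hsx ▸ hs
      exact (h.of_mem_line_of_ne hρ hm mem_line_left
        (inv_ne_self_of_orderOf_three h.left)).ne_inv hρ rfl
    · by_cases hsx : s = x
      · subst hsx; exact e.symm.ne_inv hρ (inv_inv s).symm
      · exact (h.of_mem_line_of_ne hρ hs mem_line_left hsx).not_adj_inv hρ
          ((hρ.adj_inv_left_iff).1 e)
  rcases hvx.mem_line_or_mem_line hρ hvs hs1 hvu with h5 | h5
  · rw [hvx.mem_line_iff hρ] at h5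
    rcases h5 with e | e | ⟨-, e⟩
    · exact hvu.ne hρ e.symm
    · exact h1 (e ▸ mem_line_left)
    · exact (notadj x mem_line_left).1 e
  · rw [hvs.mem_line_iff hρ] at h5
    rcases h5 with e | e | ⟨-, e⟩
    · exact hvu.ne hρ e.symm
    · exact h2 (by rwa [e, inv_inv])
    · exact (notadj s hs).2 e

/-- A line together with the inverses of its elements. -/
def doubleLine (x y : L) : Set L := {s | s ∈ line x y ∨ s⁻¹ ∈ line x y}

/-- The double lines of a representation. -/
def doubleLines (ρ : L →* Matrix n n ℝ) : Set (Set L) :=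
  {B | ∃ x y, Adj ρ x y ∧ B = doubleLine x y}

theorem inv_mem_doubleLine {L : Type*} [Group L] {x y s : L} :
    s⁻¹ ∈ doubleLine x y ↔ s ∈ doubleLine x y := by
  simp only [doubleLine, Set.mem_ofPred_eq, inv_inv]; tauto

theorem Adj.inv_mem_line_inv (hρ : IsFixedPointFreeRep ρ) (h : Adj ρ x y) :
    s⁻¹ ∈ line x⁻¹ y⁻¹ ↔ s ∈ line x y := by
  rw [(h.inv hρ).mem_line_iff hρ, h.mem_line_iff hρ, hρ.adj_inv_iff, hρ.adj_inv_iff, _root_.inv_inj,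
    _root_.inv_inj]

theorem Adj.doubleLine_inv (hρ : IsFixedPointFreeRep ρ) (h : Adj ρ x y) :
    doubleLine x⁻¹ y⁻¹ = doubleLine x y := by
  ext s
  simp only [doubleLine, Set.mem_ofPred_eq]
  have h1 := h.inv_mem_line_inv hρ (s := s)
  have h2 := h.inv_mem_line_inv hρ (s := s⁻¹)
  rw [inv_inv] at h2
  tauto

theorem Adj.doubleLine_eq (hρ : IsFixedPointFreeRep ρ) (h : Adj ρ x y)
    (hs : s ∈ line x y) (ht : t ∈ line x y) (hst : s ≠ t) : doubleLine s t = doubleLine x y := by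
  rw [doubleLine, doubleLine, h.line_eq hρ hs ht hst]

theorem Adj.orderOf_of_mem_doubleLine {L : Type*} [Group L] {ρ : L →* Matrix n n ℝ} {x y s : L}
    (h : Adj ρ x y) (hs : s ∈ doubleLine x y) :
    orderOf s = 3 := by
  rcases hs with hs | hs
  · exact h.orderOf_of_mem_line hs
  · rw [← orderOf_inv]; exact h.orderOf_of_mem_line hs

variable {B B' B₁ B₂ : Set L}

theorem orderOf_of_mem_doubleLines {L : Type*} [Group L] {ρ : L →* Matrix n n ℝ} {s : L}
    {B : Set L} (hB : B ∈ doubleLines ρ) (hs : s ∈ B) : orderOf s = 3 := by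
  obtain ⟨x, y, h, rfl⟩ := hB
  exact h.orderOf_of_mem_doubleLine hs

theorem inv_mem_of_mem_doubleLines {L : Type*} [Group L] {ρ : L →* Matrix n n ℝ} {s : L}
    {B : Set L} (hB : B ∈ doubleLines ρ) : s⁻¹ ∈ B ↔ s ∈ B := by
  obtain ⟨x, y, h, rfl⟩ := hB
  exact inv_mem_doubleLine

theorem exists_eq_doubleLine (hρ : IsFixedPointFreeRep ρ) (hB : B ∈ doubleLines ρ) (hp : p ∈ B) :
    ∃ y, Adj ρ p y ∧ B = doubleLine p y := by
  have key : ∀ {x y p : L}, Adj ρ x y → p ∈ line x y → ∃ z, Adj ρ p z ∧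
      doubleLine x y = doubleLine p z := by
    intro x y p h hp
    by_cases hpx : p = x
    · exact ⟨y, hpx ▸ h, by rw [hpx]⟩
    · exact ⟨x, h.of_mem_line_of_ne hρ hp mem_line_left hpx,
        (h.doubleLine_eq hρ hp mem_line_left hpx).symm⟩
  obtain ⟨x, y, h, rfl⟩ := hB
  rcases hp with hp | hp
  · exact key h hp
  · obtain ⟨z, hz, e⟩ := key (h.inv hρ) ((h.inv_mem_line_inv hρ).2 hp)
    rw [inv_inv] at hz e
    exact ⟨z, hz, by rw [← e, h.doubleLine_inv hρ]⟩

theorem mem_doubleLine_left {L : Type*} [Group L] {x y : L} : x ∈ doubleLine x y :=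
  Or.inl mem_line_left

theorem mem_doubleLine_right {L : Type*} [Group L] {x y : L} : y ∈ doubleLine x y :=
  Or.inl mem_line_right

theorem eq_doubleLine_of_mem (hρ : IsFixedPointFreeRep ρ) (hB : B ∈ doubleLines ρ) (hp : p ∈ B)
    (hq : q ∈ B) (h1 : q ≠ p) (h2 : q ≠ p⁻¹) :
    (Adj ρ p q ∧ B = doubleLine p q) ∨ (Adj ρ p q⁻¹ ∧ B = doubleLine p q⁻¹) := by
  obtain ⟨y, h, rfl⟩ := hρ.exists_eq_doubleLine hB hp
  rcases hq with hq | hq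
  · exact Or.inl ⟨h.of_mem_line_of_ne hρ mem_line_left hq h1.symm,
      (h.doubleLine_eq hρ mem_line_left hq h1.symm).symm⟩
  · have h3 : p ≠ q⁻¹ := fun e => h2 (by rw [e, inv_inv])
    exact Or.inr ⟨h.of_mem_line_of_ne hρ mem_line_left hq h3,
      (h.doubleLine_eq hρ mem_line_left hq h3).symm⟩

theorem doubleLines_eq_of_mem (hρ : IsFixedPointFreeRep ρ) (hB : B ∈ doubleLines ρ)
    (hB' : B' ∈ doubleLines ρ) (hp : p ∈ B) (hq : q ∈ B) (hp' : p ∈ B') (hq' : q ∈ B')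
    (h1 : q ≠ p) (h2 : q ≠ p⁻¹) : B = B' := by
  rcases hρ.eq_doubleLine_of_mem hB hp hq h1 h2 with ⟨h, rfl⟩ | ⟨h, rfl⟩ <;>
  rcases hρ.eq_doubleLine_of_mem hB' hp' hq' h1 h2 with ⟨h', rfl⟩ | ⟨h', rfl⟩
  · rfl
  · exact absurd h' (h.not_adj_inv hρ)
  · exact absurd h (h'.not_adj_inv hρ)
  · rfl

theorem eq_or_eq_of_mem_doubleLines (hρ : IsFixedPointFreeRep ρ) (hB : B ∈ doubleLines ρ)
    (hB₁ : B₁ ∈ doubleLines ρ) (hB₂ : B₂ ∈ doubleLines ρ) (hp : p ∈ B) (hp₁ : p ∈ B₁)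
    (hp₂ : p ∈ B₂) (hne : B₁ ≠ B₂) : B = B₁ ∨ B = B₂ := by
  obtain ⟨v, hv, rfl⟩ := hρ.exists_eq_doubleLine hB hp
  obtain ⟨y, hy, rfl⟩ := hρ.exists_eq_doubleLine hB₁ hp₁
  obtain ⟨u, hu, rfl⟩ := hρ.exists_eq_doubleLine hB₂ hp₂
  have h1 : u ∉ line p y := fun h =>
    hne (hy.doubleLine_eq hρ mem_line_left h (hu.ne hρ)).symm
  rcases hy.mem_line_or_mem_line hρ hu h1 hv with h | h
  · exact Or.inl (hy.doubleLine_eq hρ mem_line_left h (hv.ne hρ))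
  · exact Or.inr (hu.doubleLine_eq hρ mem_line_left h (hv.ne hρ))

/-- The points where `u` has Gram value `1` and `-1` span two double lines with `u`. Were these
equal, they would share two independent points with `B`, and `u` would lie on `B`. -/
theorem exists_doubleLines_of_notMem (hρ : IsFixedPointFreeRep ρ) (hB : B ∈ doubleLines ρ)
    (hu : orderOf u = 3) (h : u ∉ B) : ∃ s ∈ B, ∃ t ∈ B, Adj ρ u s ∧ Adj ρ u t ∧
      doubleLine u s ≠ doubleLine u t := by
  have hB0 := hB
  obtain ⟨x, y, hxy, rfl⟩ := hB
  obtain ⟨⟨s, hs, hus⟩, ⟨t, ht, hut⟩⟩ := hxy.exists_adj_of_notMem_line hρ hu (fun h1 => h (Or.inl h1))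
    (fun h1 => h (Or.inr h1))
  refine ⟨s, Or.inl hs, t⁻¹, inv_mem_doubleLine.2 (Or.inl ht), hus, hut, fun e => h ?_⟩
  have h1 : t⁻¹ ≠ s := by
    intro e'
    have : t ≠ s := fun e2 => inv_ne_self_of_orderOf_three hus.right (by rw [← e2, e', e2])
    exact (hxy.of_mem_line_of_ne hρ ht hs this).ne_inv hρ (by rw [← e', inv_inv])
  have h2 : t⁻¹ ≠ s⁻¹ := by
    intro e'
    rw [e'] at hut
    exact hus.not_adj_inv hρ hut
  rw [hρ.doubleLines_eq_of_mem hB0 ⟨u, s, hus, rfl⟩ (Or.inl hs)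
    (inv_mem_doubleLine.2 (Or.inl ht)) mem_doubleLine_right
    (by rw [e]; exact mem_doubleLine_right) h1 h2]
  exact mem_doubleLine_left

/-- A point `u` of `B'` off `B` is joined to `B` by two double lines. There is no third double line
through `u`, so `B'` is one of the two. -/
theorem doubleLines_inter_nonempty (hρ : IsFixedPointFreeRep ρ) (hB : B ∈ doubleLines ρ)
    (hB' : B' ∈ doubleLines ρ) (hne : B ≠ B') : ∃ p ∈ B, p ∈ B' := by
  obtain ⟨u, huB', huB⟩ : ∃ u ∈ B', u ∉ B := by
    by_contra! hcon
    obtain ⟨x, y, h, rfl⟩ := hB'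
    exact hne (hρ.doubleLines_eq_of_mem hB ⟨x, y, h, rfl⟩ (hcon x mem_doubleLine_left)
      (hcon y mem_doubleLine_right) mem_doubleLine_left mem_doubleLine_right (h.ne hρ).symm
      (fun e => h.ne_inv hρ (by rw [e, inv_inv])))
  obtain ⟨s, hs, t, ht, hus, hut, hst⟩ :=
    hρ.exists_doubleLines_of_notMem hB (orderOf_of_mem_doubleLines hB' huB') huB
  rcases hρ.eq_or_eq_of_mem_doubleLines hB' ⟨u, s, hus, rfl⟩ ⟨u, t, hut, rfl⟩ huB'
    mem_doubleLine_left mem_doubleLine_left hst with rfl | rfl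
  · exact ⟨s, hs, mem_doubleLine_right⟩
  · exact ⟨t, ht, mem_doubleLine_right⟩

/-- Two elements of order three that normalize each other's subgroup generate the same subgroup. -/
theorem conj_ne (hρ : IsFixedPointFreeRep ρ) (hp : orderOf p = 3) (hq : orderOf q = 3)
    (h1 : q ≠ p) (h2 : q ≠ p⁻¹) : p * q * p⁻¹ ≠ q ∧ p * q * p⁻¹ ≠ q⁻¹ := by
  have := hρ.nonempty
  have hcomm : p * q * p⁻¹ ≠ q := by
    intro hc
    have hpq : p * q = q * p := by rw [← mul_inv_eq_iff_eq_mul, hc]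
    have hm : skew ρ q * skew ρ p = skew ρ p * skew ρ q := by
      have : ρ p * ρ q = ρ q * ρ p := by rw [← map_mul, hpq, map_mul]
      rw [skew, skew]
      linear_combination (norm := noncomm_ring) -4 * this
    have hval := (hρ.skew_anticommutator_cases hp hq h1 h2).2
    -- For commuting elements the anticommutator is `2 S T` with `S² = T² = -3`, so its square is
    -- `36`, above the maximum `20`.
    have h36 : (skew ρ p * skew ρ q + skew ρ q * skew ρ p) *
        (skew ρ p * skew ρ q + skew ρ q * skew ρ p) = 4 * (3 * 3) := by
      rw [hm]
      have e : (skew ρ p * skew ρ q + skew ρ p * skew ρ q) *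
        (skew ρ p * skew ρ q + skew ρ p * skew ρ q) =
          4 * (skew ρ p * (skew ρ q * skew ρ p) * skew ρ q) := by noncomm_ring
      rw [e, hm, ← mul_assoc (skew ρ p) (skew ρ p), hρ.skew_mul_self hp, mul_assoc,
        hρ.skew_mul_self hq, neg_mul_neg]
    rw [h36, ntr_ofNat_mul, ntr_ofNat_mul, ntr_ofNat 3] at hval
    nlinarith [sq_nonneg (ntr (skew ρ p * skew ρ q))]
  -- If `p` inverted `q`, then `p² = p⁻¹` would centralize it.
  refine ⟨hcomm, fun hc => hcomm ?_⟩
  have h3 : p * (p * q * p⁻¹) * p⁻¹ = q := by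
    rw [hc]
    have := congrArg (·⁻¹) hc
    simpa [mul_assoc] using this
  rw [pow_conj_three hp] at h3
  calc p * q * p⁻¹ = p * (p⁻¹ * q * p) * p⁻¹ := by rw [h3]
    _ = q := by group

end IsFixedPointFreeRep
end

/-! ### Permutation actions with all three-cycles in the image. -/

section ThreeCycles

open Equiv.Perm

/-- If the elements of order three of `L` act on `Y` with every three-element set as support, then
every three-cycle is the image of an element of order three. -/
theorem exists_orderOf_three_apply_eq {L Y : Type*} [Group L] [Fintype Y] [DecidableEq Y]
    (φ : L →* Equiv.Perm Y)
    (H : ∀ a b c, a ≠ b → a ≠ c → b ≠ c →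
      ∃ x, orderOf x = 3 ∧ ∀ y, φ x y ≠ y ↔ y = a ∨ y = b ∨ y = c)
    {τ : Equiv.Perm Y} (hτ : τ.IsThreeCycle) : ∃ x, orderOf x = 3 ∧ φ x = τ := by
  have threeCycle : ∀ {x a b c}, a ≠ b → a ≠ c → b ≠ c →
      (∀ y, φ x y ≠ y ↔ y = a ∨ y = b ∨ y = c) → (φ x).IsThreeCycle := by
    intro x a b c hab hac hbc h
    rw [← card_support_eq_three_iff]
    have : (φ x).support = {a, b, c} := by
      ext y; simp [mem_support, h y]
    rw [this, Finset.card_eq_three]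
    exact ⟨a, b, c, hab, hac, hbc, rfl⟩
  have cube : ∀ {σ : Equiv.Perm Y}, σ.IsThreeCycle → ∀ a, σ (σ (σ a)) = a := by
    intro σ h a
    have := pow_orderOf_eq_one σ
    rw [h.orderOf] at this
    exact DFunLike.congr_fun this a
  obtain ⟨a, ha⟩ : τ.support.Nonempty := by
    rw [← Finset.card_pos, hτ.card_support]; norm_num
  have hnd := (hτ.nodup_iff_mem_support (a := a)).2 ha
  simp only [List.nodup_cons, List.mem_cons, List.not_mem_nil, or_false, not_or] at hnd
  obtain ⟨⟨hab, hac⟩, hbc, -⟩ := hnd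
  have hform := (hτ.eq_swap_mul_swap_iff_mem_support).2 ha
  obtain ⟨x, hx, hs⟩ := H a (τ a) (τ (τ a)) hab hac hbc
  have h3 := threeCycle hab hac hbc hs
  have hax : φ x a ≠ a := (hs a).2 (Or.inl rfl)
  have hform' := (h3.eq_swap_mul_swap_iff_mem_support).2 (mem_support.2 hax)
  have hxa : φ x (φ x a) ≠ φ x a := fun h => hax ((φ x).injective h)
  have hxa2 : φ x (φ x a) ≠ a := by
    intro h
    have := cube h3 a
    rw [h] at this
    exact hax this
  have m1 := (hs (φ x a)).1 hxa
  have m2 := (hs (φ x (φ x a))).1 (fun h => hxa ((φ x).injective h))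
  rcases m1 with h | h | h
  · exact absurd h hax
  · refine ⟨x, hx, ?_⟩
    have h2 : φ x (φ x a) = τ (τ a) := by
      rcases m2 with h' | h' | h'
      · exact absurd h' hxa2
      · exact absurd (h'.trans h.symm) hxa
      · exact h'
    rw [hform', hform, h, ← h, h2]
    simp [h]
  -- Here `φ x` runs through the same three points in the opposite direction, so `x⁻¹` is the
  -- element sought.
  · have h2 : φ x (φ x a) = τ a := by
      rcases m2 with h' | h' | h'
      · exact absurd h' hxa2
      · exact h'
      · exact absurd (h'.trans h.symm) hxa
    have e1 := ((hτ.inv).eq_swap_mul_swap_iff_mem_support (a := a)).2 (by rwa [support_inv])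
    have e2 : τ⁻¹ a = τ (τ a) := by rw [inv_eq_iff_eq, cube hτ]
    have e3 : τ⁻¹ (τ⁻¹ a) = τ a := by rw [e2]; simp
    rw [e3, e2] at e1
    rw [h2, h, ← e1] at hform'
    exact ⟨x⁻¹, by rw [orderOf_inv, hx], by rw [map_inv, hform', inv_inv]⟩

/-- The permutation action by conjugation on an invariant family of subsets. -/
def conjPerm {L : Type*} [Group L] (F : Set (Set L))
    (hF : ∀ g, ∀ B ∈ F, {s | g⁻¹ * s * g ∈ B} ∈ F) : L →* Equiv.Perm F :=
  MonoidHom.toHomPerm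
    { toFun := fun g B => ⟨{s | g⁻¹ * s * g ∈ B.1}, hF g B.1 B.2⟩
      map_one' := by
        funext B
        apply Subtype.ext
        ext s
        change 1⁻¹ * s * 1 ∈ B.1 ↔ s ∈ B.1
        simp
      map_mul' := by
        intro g h; funext B
        apply Subtype.ext
        ext s
        change (g * h)⁻¹ * s * (g * h) ∈ B.1 ↔ h⁻¹ * (g⁻¹ * s * g) * h ∈ B.1
        rw [mul_inv_rev]; simp only [mul_assoc] }

theorem mem_conjPerm {L : Type*} [Group L] {F : Set (Set L)}
    {hF : ∀ g, ∀ B ∈ F, {s | g⁻¹ * s * g ∈ B} ∈ F} {g s : L} {B : F} :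
    s ∈ (conjPerm F hF g B).1 ↔ g⁻¹ * s * g ∈ B.1 := Iff.rfl

theorem conj_mem_conjPerm {L : Type*} [Group L] {F : Set (Set L)}
    {hF : ∀ g, ∀ B ∈ F, {s | g⁻¹ * s * g ∈ B} ∈ F} {g s : L} {B : F} :
    g * s * g⁻¹ ∈ (conjPerm F hF g B).1 ↔ s ∈ B.1 := by
  rw [mem_conjPerm]; simp [mul_assoc]

theorem exists_hom_perm_fin {L Y : Type*} [Group L] [Finite Y] (φ : L →* Equiv.Perm Y)
    (H : ∀ a b c, a ≠ b → a ≠ c → b ≠ c →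
      ∃ x, orderOf x = 3 ∧ ∀ y, φ x y ≠ y ↔ y = a ∨ y = b ∨ y = c) :
    ∃ φ' : L →* Equiv.Perm (Fin (Nat.card Y)), φ'.ker = φ.ker ∧
      ∀ τ : Equiv.Perm (Fin (Nat.card Y)), τ.IsThreeCycle → ∃ x, orderOf x = 3 ∧ φ' x = τ := by
  let e := Finite.equivFin Y
  refine ⟨e.permCongrHom.toMonoidHom.comp φ, ?_, fun τ hτ => exists_orderOf_three_apply_eq _ ?_ hτ⟩
  · ext g; simp [MonoidHom.mem_ker]
  · intro a b c hab hac hbc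
    obtain ⟨x, hx, h⟩ := H (e.symm a) (e.symm b) (e.symm c) (e.symm.injective.ne hab)
      (e.symm.injective.ne hac) (e.symm.injective.ne hbc)
    refine ⟨x, hx, fun y => ?_⟩
    have h1 := h (e.symm y)
    simp only [e.symm.injective.eq_iff] at h1
    rw [← h1]
    simp [Equiv.permCongrHom, Equiv.permCongr_apply, Equiv.eq_symm_apply]

end ThreeCycles

/-! ### The actions on four subgroups or five double lines. -/

section
open Matrix
variable {n : Type*} [Fintype n] [DecidableEq n]
namespace IsFixedPointFreeRep
variable {L : Type*} [Group L] [Finite L] {ρ : L →* Matrix n n ℝ} {x y u v s t p q : L}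

theorem exists_adj (hρ : IsFixedPointFreeRep ρ) (hx : orderOf x = 3) (hy : orderOf y = 3)
    (h1 : y ≠ x) (h2 : y ≠ x⁻¹) : ∃ x y, Adj ρ x y := by
  rcases hρ.ntr_cases hx hy with h | h | h | h | h
  · exact absurd h h1
  · exact absurd h h2
  · exact ⟨_, _, h⟩
  · exact ⟨_, _, h⟩
  · obtain ⟨v, hv, -⟩ := hρ.exists_common_adj hx hy h
    exact ⟨_, _, hv⟩

theorem Adj.card_line (hρ : IsFixedPointFreeRep ρ) (h : Adj ρ x y) : (line x y).ncard = 4 := by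
  have h1 := h.ne hρ
  have h2 := h.conj_self.ne hρ
  have h3 := h.conj_self'.ne hρ
  have h4 : y ≠ x * y * x⁻¹ := fun e => (hρ.conj_ne h.left h.right h1.symm
    (fun e => h.ne_inv hρ (by rw [e, inv_inv]))).1 e.symm
  have h5 : y ≠ x⁻¹ * y * x := by
    intro e; apply h4; nth_rewrite 2 [e]; group
  have h6 : x⁻¹ * y * x ≠ x * y * x⁻¹ := by
    intro e; apply h5
    have := pow_conj_three h.left (y := y)
    rw [← e] at this
    rw [← this]; group
  rw [line, Set.ncard_insert_of_notMem, Set.ncard_insert_of_notMem, Set.ncard_insert_of_notMem,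
    Set.ncard_singleton]
  all_goals simp [*]

/-- All elements of order three lie on one double line, so there are four subgroups of order three,
permuted by conjugation. By `conj_ne` an element of order three normalizes its own subgroup only,
and moves the other three. -/
theorem exists_hom_perm_four (hρ : IsFixedPointFreeRep ρ) (h : Adj ρ x y)
    (hall : ∀ u, orderOf u = 3 → u ∈ doubleLine x y) :
    ∃ φ : L →* Equiv.Perm (Fin 4),
      ∀ τ : Equiv.Perm (Fin 4), τ.IsThreeCycle → ∃ x, orderOf x = 3 ∧ φ x = τ := by
  classical
  have pair_inv : ∀ p : L, ({p⁻¹, p⁻¹⁻¹} : Set L) = {p, p⁻¹} := fun p => by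
    rw [inv_inv, Set.pair_comm]
  let F : Set (Set L) := {B | ∃ p : L, orderOf p = 3 ∧ B = {p, p⁻¹}}
  have hF : ∀ g : L, ∀ B ∈ F, {s | g⁻¹ * s * g ∈ B} ∈ F := by
    rintro g _ ⟨p, hp, rfl⟩
    refine ⟨g * p * g⁻¹, by rw [orderOf_conj, hp], ?_⟩
    ext s
    have e1 : ∀ r, g⁻¹ * s * g = r ↔ s = g * r * g⁻¹ := fun r =>
      ⟨fun e => by rw [← e]; group, fun e => by rw [e]; group⟩
    change _ ∨ _ ↔ _ ∨ _
    rw [Set.mem_singleton_iff, Set.mem_singleton_iff, e1, e1]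
    simp [mul_assoc]
  have hcard : Nat.card F = 4 := by
    have : F = (fun s : L => ({s, s⁻¹} : Set L)) '' line x y := by
      ext B
      constructor
      · rintro ⟨p, hp, rfl⟩
        rcases hall p hp with h1 | h1
        · exact ⟨p, h1, rfl⟩
        · exact ⟨p⁻¹, h1, pair_inv p⟩
      · rintro ⟨s, hs, rfl⟩
        exact ⟨s, h.orderOf_of_mem_line hs, rfl⟩
    rw [Nat.card_coe_set_eq, this, Set.InjOn.ncard_image, h.card_line hρ]
    intro s hs t ht e
    by_contra hst
    have hs' : s ∈ ({t, t⁻¹} : Set L) := by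
      rw [← show ({s, s⁻¹} : Set L) = {t, t⁻¹} from e]; exact Or.inl rfl
    rcases hs' with e' | e'
    · exact hst e'
    · exact (h.of_mem_line_of_ne hρ hs ht hst).ne_inv hρ e'
  rw [← hcard]
  suffices H : _ from (exists_hom_perm_fin (conjPerm F hF) H).imp fun φ hφ => hφ.2
  intro a b c hab hac hbc
  obtain ⟨⟨_, p, hp, rfl⟩, hd⟩ : ∃ d : F, ∀ y, y ≠ d ↔ y = a ∨ y = b ∨ y = c := by
    have := Fintype.ofFinite F
    have h3 : ({a, b, c} : Finset F).card = 3 := Finset.card_eq_three.2 ⟨a, b, c, hab, hac, hbc, rfl⟩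
    have h1 : ({a, b, c} : Finset F)ᶜ.card = 1 := by
      rw [Finset.card_compl, h3, ← Nat.card_eq_fintype_card, hcard]
    obtain ⟨d, hd⟩ := Finset.card_eq_one.1 h1
    refine ⟨d, fun y => ?_⟩
    have : y ∉ ({a, b, c} : Finset F)ᶜ ↔ y ∉ ({d} : Finset F) := by rw [hd]
    rw [Finset.mem_compl, not_not] at this
    simpa using this.symm
  refine ⟨p, hp, fun y => ?_⟩
  rw [← hd y, not_iff_not]
  obtain ⟨_, q, hq, rfl⟩ := y
  constructor
  · intro e
    have hm := (conj_mem_conjPerm (hF := hF) (g := p) (s := q)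
      (B := ⟨{q, q⁻¹}, q, hq, rfl⟩)).2 (Or.inl rfl)
    rw [e] at hm
    apply Subtype.ext
    change ({q, q⁻¹} : Set L) = {p, p⁻¹}
    by_cases h1 : q = p
    · rw [h1]
    by_cases h2 : q = p⁻¹
    · rw [h2, pair_inv]
    rcases hm with hm | hm
    · exact absurd hm (hρ.conj_ne hp hq h1 h2).1
    · exact absurd hm (hρ.conj_ne hp hq h1 h2).2
  · rintro e
    rw [e]
    apply Subtype.ext
    ext s
    rw [mem_conjPerm]
    have e1 : p⁻¹ * s * p = p ↔ s = p := by
      constructor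
      · intro e; rw [mul_eq_right, inv_mul_eq_one] at e; exact e.symm
      · rintro rfl; group
    have e2 : p⁻¹ * s * p = p⁻¹ ↔ s = p⁻¹ := by
      rw [mul_assoc, mul_eq_left, mul_eq_one_iff_eq_inv]
    simp [e1, e2]

/-- Conjugation maps double lines to double lines. -/
theorem conj_doubleLines {L : Type*} [Group L] {ρ : L →* Matrix n n ℝ} (g : L) {B : Set L} (hB : B ∈ doubleLines ρ) :
    {s | g⁻¹ * s * g ∈ B} ∈ doubleLines ρ := by
  obtain ⟨x, y, h, rfl⟩ := hB
  refine ⟨_, _, h.conj g, ?_⟩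
  have key : ∀ s, g⁻¹ * s * g ∈ line x y ↔ s ∈ line (g * x * g⁻¹) (g * y * g⁻¹) := by
    intro s
    constructor
    · intro h1
      have := conj_mem_line_conj g h1
      convert this using 1; group
    · intro h1
      have := conj_mem_line_conj g⁻¹ h1
      convert this using 1 <;> group
  ext s
  have e : (g⁻¹ * s * g)⁻¹ = g⁻¹ * s⁻¹ * g := by group
  simp only [doubleLine, Set.mem_ofPred_eq, e, key]

/-- There are exactly five double lines: a given one, and one further through each of its four
points. Two of them meet in a subgroup of order three, whose generator fixes just these two and so
permutes the other three. An element acting trivially normalizes every subgroup of order three,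
since each is the intersection of two double lines; in fact it centralizes it. -/
theorem exists_hom_perm_five (hρ : IsFixedPointFreeRep ρ) (h : Adj ρ x y)
    (hu : orderOf u = 3) (hu' : u ∉ doubleLine x y) :
    ∃ φ : L →* Equiv.Perm (Fin 5),
      (∀ τ : Equiv.Perm (Fin 5), τ.IsThreeCycle → ∃ x, orderOf x = 3 ∧ φ x = τ) ∧
      ∀ g, φ g = 1 → ∀ s, orderOf s = 3 → g * s * g⁻¹ = s := by
  classical
  have hB₀ : doubleLine x y ∈ doubleLines ρ := ⟨x, y, h, rfl⟩
  have two : ∀ p, orderOf p = 3 → ∃ B₁ ∈ doubleLines ρ, ∃ B₂ ∈ doubleLines ρ,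
      p ∈ B₁ ∧ p ∈ B₂ ∧ B₁ ≠ B₂ := by
    intro p hp
    by_cases hall : ∀ B ∈ doubleLines ρ, p ∈ B
    · obtain ⟨s, -, t, -, hs, ht, hst⟩ := hρ.exists_doubleLines_of_notMem hB₀ hu hu'
      exact ⟨_, ⟨u, s, hs, rfl⟩, _, ⟨u, t, ht, rfl⟩, hall _ ⟨u, s, hs, rfl⟩, hall _ ⟨u, t, ht, rfl⟩,
        hst⟩
    · push Not at hall
      obtain ⟨B, hB, hpB⟩ := hall
      obtain ⟨s, -, t, -, hs, ht, hst⟩ := hρ.exists_doubleLines_of_notMem hB hp hpB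
      exact ⟨_, ⟨p, s, hs, rfl⟩, _, ⟨p, t, ht, rfl⟩, mem_doubleLine_left, mem_doubleLine_left, hst⟩
  have other : ∀ s : line x y, ∃ B : doubleLines ρ, s.1 ∈ B.1 ∧ B.1 ≠ doubleLine x y := by
    rintro ⟨s, hs⟩
    obtain ⟨B₁, hB₁, B₂, hB₂, hs₁, hs₂, hne⟩ := two s (h.orderOf_of_mem_line hs)
    by_cases e : B₁ = doubleLine x y
    · exact ⟨⟨B₂, hB₂⟩, hs₂, fun e' => hne (e.trans e'.symm)⟩
    · exact ⟨⟨B₁, hB₁⟩, hs₁, e⟩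
  choose f hf hf' using other
  -- `none` stands for the chosen double line and `some s` for the other one through the point `s`.
  -- Surjectivity holds because every double line meets the chosen one.
  have hbij : Function.Bijective
      (fun o : Option (line x y) => o.elim (⟨doubleLine x y, hB₀⟩ : doubleLines ρ) f) := by
    constructor
    · rintro (_ | ⟨s, hs⟩) (_ | ⟨t, ht⟩) e
      · rfl
      · exact absurd (congrArg Subtype.val e).symm (hf' ⟨t, ht⟩)
      · exact absurd (congrArg Subtype.val e) (hf' ⟨s, hs⟩)
      · by_contra hne
        have hst : t ≠ s := fun e => hne (by subst e; rfl)
        have e' : f ⟨s, hs⟩ = f ⟨t, ht⟩ := e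
        refine hf' ⟨s, hs⟩ (hρ.doubleLines_eq_of_mem (f ⟨s, hs⟩).2 hB₀ (hf ⟨s, hs⟩)
          (e' ▸ hf ⟨t, ht⟩) (Or.inl hs) (Or.inl ht) hst
          (h.of_mem_line_of_ne hρ ht hs hst |>.ne_inv hρ))
    · rintro ⟨B, hB⟩
      by_cases e : B = doubleLine x y
      · exact ⟨none, Subtype.ext e.symm⟩
      obtain ⟨p, hpB, hp⟩ := hρ.doubleLines_inter_nonempty hB hB₀ e
      obtain ⟨p, hpB, hp⟩ : ∃ p ∈ B, p ∈ line x y := by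
        rcases hp with hp | hp
        · exact ⟨p, hpB, hp⟩
        · exact ⟨p⁻¹, (inv_mem_of_mem_doubleLines hB).2 hpB, hp⟩
      refine ⟨some ⟨p, hp⟩, Subtype.ext ?_⟩
      rcases hρ.eq_or_eq_of_mem_doubleLines (f ⟨p, hp⟩).2 hB hB₀ (hf ⟨p, hp⟩) hpB (Or.inl hp) e
        with e' | e'
      · exact e'
      · exact absurd e' (hf' ⟨p, hp⟩)
  have hcard : Nat.card (doubleLines ρ) = 5 := by
    rw [← Nat.card_congr (Equiv.ofBijective _ hbij), Finite.card_option, Nat.card_coe_set_eq,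
      h.card_line hρ]
  have hF : ∀ g, ∀ B ∈ doubleLines ρ, {s | g⁻¹ * s * g ∈ B} ∈ doubleLines ρ :=
    fun g B hB => conj_doubleLines g hB
  have fixes : ∀ (p : L) (d : doubleLines ρ), p ∈ d.1 → conjPerm _ hF p d = d := by
    intro p d hp
    apply Subtype.ext
    obtain ⟨w, hw, e⟩ := hρ.exists_eq_doubleLine d.2 hp
    have hwd : w ∈ d.1 := by rw [e]; exact mem_doubleLine_right
    have hpw : p * w * p⁻¹ ∈ d.1 := by
      rw [e]; exact Or.inl (hw.conj_mem_line hρ mem_line_right)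
    refine hρ.doubleLines_eq_of_mem (conjPerm _ hF p d).2 d.2 (p := p) (q := p * w * p⁻¹) ?_
      (conj_mem_conjPerm.2 hwd) hp hpw (hw.conj_self.ne hρ).symm ?_
    · rw [mem_conjPerm]; simpa using hp
    · exact hw.conj_self.symm.ne_inv hρ
  suffices H : _ by
    have hlift := exists_hom_perm_fin (conjPerm _ hF) H
    rw [hcard] at hlift
    obtain ⟨φ, hker, hφ⟩ := hlift
    refine ⟨φ, hφ, fun g hg => ?_⟩
    rw [← MonoidHom.mem_ker, hker, MonoidHom.mem_ker] at hg
    have hcases : ∀ s, orderOf s = 3 → g * s * g⁻¹ = s ∨ g * s * g⁻¹ = s⁻¹ := by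
      intro s hs
      by_contra! hcon
      obtain ⟨B₁, hB₁, B₂, hB₂, hs₁, hs₂, hne⟩ := two s hs
      have hmem : ∀ B : doubleLines ρ, s ∈ B.1 → g * s * g⁻¹ ∈ B.1 := by
        intro B hsB
        have := (conj_mem_conjPerm (hF := hF) (g := g)).2 hsB
        rwa [hg] at this
      exact hne (hρ.doubleLines_eq_of_mem hB₁ hB₂ hs₁ (hmem ⟨B₁, hB₁⟩ hs₁) hs₂ (hmem ⟨B₂, hB₂⟩ hs₂)
        hcon.1 hcon.2)
    intro s hs
    -- If `g` inverts `s`, it inverts each neighbour `w`, because inverting one of two adjacent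
    -- elements and fixing the other destroys adjacency. But then `g` maps `s w s⁻¹` to the inverse
    -- of `s⁻¹ w s`, which is neither it nor its inverse.
    refine (hcases s hs).resolve_right fun hs' => ?_
    obtain ⟨B, hB, -, -, hsB, -⟩ := two s hs
    obtain ⟨w, hw, -⟩ := hρ.exists_eq_doubleLine hB hsB
    have hw' : g * w * g⁻¹ = w⁻¹ := by
      refine (hcases w hw.right).resolve_left fun hw' => ?_
      have := hw.conj g
      rw [hs', hw', hρ.adj_inv_left_iff] at this
      exact hw.not_adj_inv hρ this
    have hconj : g * (s * w * s⁻¹) * g⁻¹ = (s⁻¹ * w * s)⁻¹ := by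
      calc g * (s * w * s⁻¹) * g⁻¹ = (g * s * g⁻¹) * (g * w * g⁻¹) * (g * s * g⁻¹)⁻¹ := by group
        _ = _ := by rw [hs', hw']; group
    have hadj : Adj ρ (s⁻¹ * w * s) (s * w * s⁻¹) := by
      have := ((hw.adj_conj hρ).conj s).symm
      rwa [pow_conj_three hs] at this
    rcases hcases (s * w * s⁻¹) (by rw [orderOf_conj, hw.right]) with e | e
    · rw [hconj] at e
      exact hadj.symm.ne_inv hρ e.symm
    · rw [hconj, _root_.inv_inj] at e
      exact hadj.ne hρ e
  intro a b c hab hac hbc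
  obtain ⟨d, e, hde, hcompl⟩ : ∃ d e : doubleLines ρ, d ≠ e ∧
      ∀ y, (y ≠ d ∧ y ≠ e) ↔ y = a ∨ y = b ∨ y = c := by
    have := Fintype.ofFinite (doubleLines ρ)
    have h3 : ({a, b, c} : Finset (doubleLines ρ)).card = 3 :=
      Finset.card_eq_three.2 ⟨a, b, c, hab, hac, hbc, rfl⟩
    have h1 : ({a, b, c} : Finset (doubleLines ρ))ᶜ.card = 2 := by
      rw [Finset.card_compl, h3, ← Nat.card_eq_fintype_card, hcard]
    obtain ⟨d, e, hde, hd⟩ := Finset.card_eq_two.1 h1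
    refine ⟨d, e, hde, fun y => ?_⟩
    have : y ∉ ({a, b, c} : Finset (doubleLines ρ))ᶜ ↔ y ∉ ({d, e} : Finset _) := by rw [hd]
    rw [Finset.mem_compl, not_not] at this
    simpa using this.symm
  have hde' : d.1 ≠ e.1 := fun h => hde (Subtype.ext h)
  -- The two double lines outside `{a, b, c}` meet in `p`. A third one fixed by `p` would contain,
  -- besides a point of `d`, its conjugate by `p`, hence two independent points of `d`.
  obtain ⟨p, hpd, hpe⟩ := hρ.doubleLines_inter_nonempty d.2 e.2 hde'
  have hp := orderOf_of_mem_doubleLines d.2 hpd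
  refine ⟨p, hp, fun y => ?_⟩
  rw [← hcompl y]
  constructor
  · refine fun hy => ⟨?_, ?_⟩
    · rintro rfl; exact hy (fixes _ _ hpd)
    · rintro rfl; exact hy (fixes _ _ hpe)
  · rintro ⟨hyd, hye⟩ hfix
    have hpy : p ∉ y.1 := by
      intro hpy
      rcases hρ.eq_or_eq_of_mem_doubleLines y.2 d.2 e.2 hpy hpd hpe hde' with e' | e'
      · exact hyd (Subtype.ext e')
      · exact hye (Subtype.ext e')
    obtain ⟨q, hqy, hqd⟩ := hρ.doubleLines_inter_nonempty y.2 d.2 (fun e => hyd (Subtype.ext e))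
    have h1 : q ≠ p := fun e => hpy (e ▸ hqy)
    have h2 : q ≠ p⁻¹ := fun e => hpy ((inv_mem_of_mem_doubleLines y.2).1 (e ▸ hqy))
    have h3 := hρ.conj_ne hp (orderOf_of_mem_doubleLines y.2 hqy) h1 h2
    have h4 := (conj_mem_conjPerm (hF := hF) (g := p)).2 hqy
    have h5 := (conj_mem_conjPerm (hF := hF) (g := p)).2 hqd
    rw [hfix] at h4
    rw [fixes _ _ hpd] at h5
    exact hyd (Subtype.ext (hρ.doubleLines_eq_of_mem y.2 d.2 hqy h4 hqd h5 h3.1 h3.2))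

end IsFixedPointFreeRep
end

/-! ### Representations that annihilate sums over subgroups of prime order. -/

/-- `σ` annihilates the sum of the elements of every subgroup of prime order. -/
def KillsPrimeSums {L A : Type*} [Group L] [Ring A] (σ : L →* A) : Prop :=
  ∀ (g : L) (p : ℕ), p.Prime → orderOf g = p → ∑ i ∈ Finset.range p, σ g ^ i = 0

namespace KillsPrimeSums

variable {L A : Type*} [Group L] [Ring A] {σ : L →* A}

theorem comp (h : KillsPrimeSums σ) {M : Type*} [Group M] {f : M →* L}
    (hf : Function.Injective f) : KillsPrimeSums (σ.comp f) := fun g p hp hg =>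
  h (f g) p hp (by rw [orderOf_injective f hf, hg])

theorem apply_of_orderOf_two (h : KillsPrimeSums σ) {z : L} (hz : orderOf z = 2) : σ z = -1 := by
  have := h z 2 Nat.prime_two hz
  simp only [Finset.sum_range_succ, Finset.range_zero, Finset.sum_empty, pow_zero, pow_one,
    zero_add] at this
  exact (neg_eq_of_add_eq_zero_right this).symm

theorem sq_of_orderOf_three (h : KillsPrimeSums σ) {x : L} (hx : orderOf x = 3) :
    σ x * σ x = -σ x - 1 := by
  have := h x 3 Nat.prime_three hx
  simp only [Finset.sum_range_succ, Finset.range_zero, Finset.sum_empty, pow_zero, pow_one,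
    zero_add, pow_two] at this
  rw [← sub_eq_zero, ← this]; abel

theorem apply_inv_of_orderOf_three (h : KillsPrimeSums σ) {x : L} (hx : orderOf x = 3) :
    σ x⁻¹ = -σ x - 1 := by
  rw [← h.sq_of_orderOf_three hx, ← map_mul,
    inv_eq_of_mul_eq_one_left (mul_self_mul_self_of_orderOf_three hx)]

theorem eq_one_of_apply_eq_one [CharZero A] [Finite L] (h : KillsPrimeSums σ) {g : L}
    (hg : σ g = 1) : g = 1 := by
  by_contra hne
  have h1 : orderOf g ≠ 1 := by rwa [Ne, orderOf_eq_one_iff]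
  obtain ⟨p, hp, hd⟩ := Nat.exists_prime_and_dvd h1
  have h2 : orderOf (g ^ (orderOf g / p)) = p := orderOf_pow_orderOf_div (orderOf_pos g).ne' hd
  have := h _ p hp h2
  simp only [map_pow, hg, one_pow, Finset.sum_const, Finset.card_range, nsmul_eq_mul,
    mul_one, Nat.cast_eq_zero] at this
  exact hp.ne_zero this

theorem injective [CharZero A] [Finite L] (h : KillsPrimeSums σ) : Function.Injective σ :=
  (injective_iff_map_eq_one σ).2 fun _ hg => h.eq_one_of_apply_eq_one hg

theorem eq_of_orderOf_two [CharZero A] [Finite L] (h : KillsPrimeSums σ) {z w : L}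
    (hz : orderOf z = 2) (hw : orderOf w = 2) : w = z :=
  h.injective (by rw [h.apply_of_orderOf_two hz, h.apply_of_orderOf_two hw])

theorem commute_of_orderOf_two [CharZero A] [Finite L] (h : KillsPrimeSums σ) {z : L}
    (hz : orderOf z = 2) (g : L) : g * z = z * g :=
  h.injective (by rw [map_mul, map_mul, h.apply_of_orderOf_two hz]; simp)

/-- A subgroup of order four without elements of order four would contain three involutions, but the
only possible involution is the one acting as `-1`. -/
theorem exists_orderOf_four [CharZero A] [Finite L] (h : KillsPrimeSums σ)
    (h4 : 4 ∣ Nat.card L) : ∃ j : L, orderOf j = 4 := by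
  have := Fact.mk Nat.prime_two
  obtain ⟨H, hH⟩ := Sylow.exists_subgroup_card_pow_prime (G := L) 2 (n := 2) h4
  by_contra! hcon
  have hord : ∀ g ∈ H, orderOf g = 1 ∨ orderOf g = 2 := by
    intro g hg
    have h1 := H.orderOf_dvd_natCard hg
    rw [hH] at h1
    obtain ⟨k, hk, e⟩ := (Nat.dvd_prime_pow Nat.prime_two).1 h1
    interval_cases k
    · exact Or.inl e
    · exact Or.inr e
    · exact absurd e (hcon g)
  have hone : (1 : ℕ) < Nat.card H := by rw [hH]; norm_num
  have := Finite.one_lt_card_iff_nontrivial.1 hone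
  obtain ⟨⟨z, hzH⟩, hz1⟩ := exists_ne (1 : H)
  have hz : orderOf z = 2 := (hord z hzH).resolve_left fun e => hz1 (by
    rw [orderOf_eq_one_iff] at e; exact Subtype.ext e)
  have hsub : (H : Set L) ⊆ {1, z} := by
    intro g hg
    rcases hord g hg with e | e
    · exact Or.inl (orderOf_eq_one_iff.1 e)
    · exact Or.inr (h.eq_of_orderOf_two hz e)
  have h1 := Set.ncard_le_ncard hsub
  have h2 := Set.ncard_insert_le (1 : L) {z}
  rw [Set.ncard_singleton] at h2
  have h3 : (H : Set L).ncard = 4 := by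
    rw [← Nat.card_coe_set_eq]; exact hH
  lia

end KillsPrimeSums

/-- The sum `M` over a subgroup of order `p` satisfies `Mᵀ M = p M`, and its normalized trace is `1
- (p - 1)/(p - 1) = 0`. -/
theorem IsFixedPointFreeRep.killsPrimeSums {L n : Type*} [Group L] [Fintype n] [DecidableEq n]
    {ρ : L →* Matrix n n ℝ} (h : IsFixedPointFreeRep ρ) : KillsPrimeSums ρ := by
  intro g p hp hg
  have := h.nonempty
  set M := ∑ i ∈ Finset.range p, ρ g ^ i with hM
  have hpow : ρ g ^ p = 1 := by rw [← map_pow, ← hg, pow_orderOf_eq_one, map_one]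
  have hgM : ρ g * M = M := by
    have := mul_geom_sum (ρ g) p
    rw [hpow, sub_self, sub_mul, one_mul, sub_eq_zero] at this
    exact this
  have hiM : ρ g⁻¹ * M = M := by
    nth_rewrite 1 [← hgM]
    rw [← mul_assoc, ← map_mul, inv_mul_cancel, map_one, one_mul]
  have hT : Matrix.transpose M * M = (p : ℝ) • M := by
    rw [hM, Matrix.transpose_sum, Finset.sum_mul, ← hM]
    have : ∀ i ∈ Finset.range p, Matrix.transpose (ρ g ^ i) * M = M := by
      intro i hi
      clear hi
      rw [Matrix.transpose_pow, h.transpose_apply]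
      induction i with
      | zero => simp
      | succ i ih => rw [pow_succ, mul_assoc, hiM, ih]
    rw [Finset.sum_congr rfl this]
    simp [Nat.cast_smul_eq_nsmul]
  apply eq_zero_of_ntr_transpose_mul_self
  rw [hT, map_smul, hM, map_sum, ← Nat.succ_pred_eq_of_pos hp.pos, Finset.sum_range_succ']
  have : ∀ i ∈ Finset.range (p.pred), ntr (ρ g ^ (i + 1)) = - ((p : ℝ) - 1)⁻¹ := by
    intro i hi
    rw [← map_pow]
    refine h.ntr_of_prime hp ?_
    rw [Nat.Coprime.orderOf_pow, hg]
    rw [hg]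
    refine ((Nat.Prime.coprime_iff_not_dvd hp).2 fun hd => ?_)
    have h1 := Nat.le_of_dvd (Nat.succ_pos i) hd
    have h2 := Finset.mem_range.1 hi
    have h3 := Nat.succ_pred_eq_of_pos hp.pos
    lia
  rw [Finset.sum_congr rfl this]
  have hp1 : ((p : ℝ) - 1) ≠ 0 := by
    have : (1 : ℝ) < p := by exact_mod_cast hp.one_lt
    linarith
  have hpred : ((p.pred : ℕ) : ℝ) = (p : ℝ) - 1 := by
    rw [Nat.pred_eq_sub_one, Nat.cast_pred hp.pos]
  rw [Finset.sum_const, Finset.card_range, nsmul_eq_mul, hpred, pow_zero, ntr_one, mul_neg,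
    mul_inv_cancel₀ hp1, neg_add_cancel, smul_zero]

namespace Representation

/-- Every nonzero finite-dimensional representation contains an irreducible one. -/
theorem exists_irreducible_submodule {G V : Type*} [Group G] [AddCommGroup V] [Module ℂ V]
    [FiniteDimensional ℂ V] [Nontrivial V] (τ : Representation ℂ G V) :
    ∃ (W : Submodule ℂ V) (σ : Representation ℂ G W), σ.IsIrreducible ∧
      ∀ g w, (σ g w : V) = τ g w := by
  obtain ⟨W, ⟨hW, hne⟩, hmin⟩ := WellFounded.has_min
    (IsWellFounded.wf : WellFounded ((· < ·) : Submodule ℂ V → Submodule ℂ V → Prop))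
    {W : Submodule ℂ V | (∀ g, ∀ v ∈ W, τ g v ∈ W) ∧ W ≠ ⊥}
    ⟨⊤, fun _ _ _ => Submodule.mem_top, top_ne_bot⟩
  let σ : Representation ℂ G W :=
    { toFun g := (τ g).restrict (hW g)
      map_one' := by ext w; simp
      map_mul' a b := by ext w; simp }
  have hσ : ∀ g w, (σ g w : V) = τ g w := fun _ _ => rfl
  have : Nontrivial W := Submodule.nontrivial_iff_ne_bot.2 hne
  refine ⟨W, σ, isIrreducible_of_forall fun U hU hU0 => ?_, hσ⟩
  have h1 : U.map W.subtype ≤ W := Submodule.map_subtype_le W U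
  have h2 : U.map W.subtype = W := by
    by_contra hlt
    refine hmin (U.map W.subtype) ⟨?_, ?_⟩ (lt_of_le_of_ne h1 hlt)
    · rintro g _ ⟨u, hu, rfl⟩
      exact ⟨σ g u, hU g u hu, rfl⟩
    · intro e
      refine hU0 ((Submodule.eq_bot_iff _).2 fun u hu => Subtype.ext ?_)
      have : (u : V) ∈ U.map W.subtype := ⟨u, hu, rfl⟩
      rwa [e, Submodule.mem_bot] at this
  rw [eq_top_iff]
  intro w _
  have : (w : V) ∈ U.map W.subtype := by rw [h2]; exact w.2
  obtain ⟨u, hu, e⟩ := this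
  rwa [← Subtype.ext e]

end Representation

/-- A fixed point free representation of `L` yields irreducible complex representations of the
groups embedded in `L` that annihilate the sums over subgroups of prime order. -/
theorem IsFixedPointFreeRep.exists_isIrreducible {L M n : Type*} [Group L] [Group M] [Fintype n]
    [DecidableEq n] {ρ : L →* Matrix n n ℝ} (h : IsFixedPointFreeRep ρ) {f : M →* L}
    (hf : Function.Injective f) :
    ∃ (W : Submodule ℂ (n → ℂ)) (σ : Representation ℂ M W), σ.IsIrreducible ∧
      KillsPrimeSums (A := Module.End ℂ W) σ := by
  have := h.nonempty
  let Φ : Matrix n n ℝ →+* Module.End ℂ (n → ℂ) :=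
    (Matrix.toLinAlgEquiv' : Matrix n n ℂ ≃ₐ[ℂ] _).toRingEquiv.toRingHom.comp
      (algebraMap ℝ ℂ).mapMatrix
  let τ : Representation ℂ M (n → ℂ) := (Φ.toMonoidHom.comp ρ).comp f
  obtain ⟨W, σ, hσ, hW⟩ := Representation.exists_irreducible_submodule τ
  refine ⟨W, σ, hσ, fun g p hp hg => ?_⟩
  have hk := h.killsPrimeSums (f g) p hp (by rw [orderOf_injective f hf, hg])
  have h1 := congrArg Φ hk
  rw [map_sum, map_zero] at h1
  refine LinearMap.ext fun w => Subtype.ext ?_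
  have h2 := LinearMap.congr_fun h1 (w : n → ℂ)
  rw [LinearMap.sum_apply] at h2 ⊢
  rw [AddSubmonoidClass.coe_finsetSum]
  refine Eq.trans (Finset.sum_congr rfl fun i _ => ?_) h2
  rw [← map_pow, hW, map_pow (f := τ), map_pow]
  rfl

/-! ### Rational character values, and the case of four points. -/

/-- Nonlinear irreducible characters of the same degree agree where one of them is rational. -/
def RationalValuesAgree (L : Type*) [Group L] : Prop :=
  ∀ χ ψ : L → ℂ, IsIrrChar χ → IsIrrChar ψ → χ 1 ≠ 1 → χ 1 = ψ 1 →
    ∀ (g : L) (r : ℚ), χ g = r → ψ g = r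

/-- A twist by a linear character preserves degree and irreducibility, so `χ` and its twist agree at
`g`, and the nonzero value can be cancelled. -/
theorem RationalValuesAgree.apply_eq_one {L : Type*} [Group L] (h : RationalValuesAgree L)
    {χ : L → ℂ} (hχ : IsIrrChar χ) (h1 : χ 1 ≠ 1) (l : L →* ℂˣ) {g : L} {r : ℚ} (hr : r ≠ 0)
    (hg : χ g = r) : l g = 1 := by
  have := h χ _ hχ (hχ.twist l) h1 (by simp) g r hg
  rw [hg] at this
  have hr' : (r : ℂ) ≠ 0 := by exact_mod_cast hr
  exact Units.ext (mul_right_cancel₀ hr' (by rw [this]; simp))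

theorem exists_hom_apply_ne_one_of_notMem_commutator {L : Type*} [Group L] [Finite L] {x : L}
    (hx : x ∉ commutator L) : ∃ l : L →* ℂˣ, l x ≠ 1 := by
  have hx' : (Abelianization.of x : Abelianization L) ≠ 1 := by
    rwa [Ne, ← MonoidHom.mem_ker, Abelianization.ker_of]
  have : NeZero (Monoid.exponent (Abelianization L)) :=
    ⟨Monoid.exponent_ne_zero_of_finite⟩
  obtain ⟨l, hl⟩ := CommGroup.exists_apply_ne_one_of_hasEnoughRootsOfUnity
    (Abelianization L) ℂ hx'
  exact ⟨l.comp Abelianization.of, hl⟩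

/-- The alternating group of degree `k` is `(k - 2)`-transitive, hence doubly transitive for `k ≥
4`. -/
theorem IsIrrChar.standard {L : Type*} [Group L] [Finite L] {k : ℕ} (hk : 4 ≤ k)
    (φ : L →* Equiv.Perm (Fin k)) (hφ : alternatingGroup (Fin k) ≤ φ.range) :
    IsIrrChar (fun g => ((Finset.univ.filter fun y : Fin k => φ g y = y).card : ℂ) - 1) := by
  let _ : MulAction L (Fin k) := MulAction.compHom (Fin k) φ
  have hsmul : ∀ (g : L) (y : Fin k), g • y = φ g y := fun _ _ => rfl
  have : Nontrivial (Fin k) := Fin.nontrivial_iff_two_le.2 (by lia)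
  have h2 : MulAction.IsMultiplyPretransitive (alternatingGroup (Fin k)) (Fin k) 2 := by
    have := alternatingGroup.isMultiplyPretransitive (Fin k)
    refine MulAction.isMultiplyPretransitive_of_le (n := Nat.card (Fin k) - 2) ?_ ?_ <;>
      rw [Nat.card_fin] <;> lia
  rw [MulAction.is_two_pretransitive_iff] at h2
  have hirr : (standardRep L (Fin k)).IsIrreducible := by
    refine standardRep_isIrreducible fun a b c d hab hcd => ?_
    obtain ⟨τ, h⟩ := h2 hab hcd
    obtain ⟨g, hg⟩ := hφ τ.2
    exact ⟨g, by rw [hsmul, hg]; exact h.1, by rw [hsmul, hg]; exact h.2⟩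
  convert IsIrrChar.of_rep hirr using 1
  ext g
  have : Nonempty (Fin k) := inferInstance
  rw [standardRep_character]
  rfl

/-- The action cannot involve odd permutations. -/
theorem RationalValuesAgree.mem_alternatingGroup {L : Type*} [Group L] [Finite L]
    (h : RationalValuesAgree L) {k : ℕ} (hk : 4 ≤ k)
    (φ : L →* Equiv.Perm (Fin k)) (hφ : alternatingGroup (Fin k) ≤ φ.range) (g : L) :
    φ g ∈ alternatingGroup (Fin k) := by
  by_contra hg
  have hsign : Equiv.Perm.sign (φ g) = -1 := by
    rw [Equiv.Perm.mem_alternatingGroup] at hg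
    exact (Int.units_eq_one_or _).resolve_left hg
  let a : Fin k := ⟨0, by lia⟩
  let b : Fin k := ⟨1, by lia⟩
  have hab : a ≠ b := by simp [a, b]
  -- With one odd permutation the image is the full symmetric group. A transposition has value `k -
  -- 3`, a nonzero rational since `k ≥ 4`, while its sign is `-1`.
  obtain ⟨t, ht⟩ : ∃ t, φ t = Equiv.swap a b := by
    have : Equiv.swap a b * (φ g)⁻¹ ∈ alternatingGroup (Fin k) := by
      rw [Equiv.Perm.mem_alternatingGroup, map_mul, map_inv, hsign, Equiv.Perm.sign_swap hab]
      simp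
    obtain ⟨t, ht⟩ := hφ this
    exact ⟨t * g, by rw [map_mul, ht]; simp⟩
  have hfix : (Finset.univ.filter fun y : Fin k => φ t y = y).card = k - 2 := by
    have h1 := Finset.card_compl (φ t).support
    rw [ht, Equiv.Perm.card_support_swap hab, Fintype.card_fin] at h1
    rw [← h1, ht]
    congr 1
    ext y
    simp [Equiv.Perm.mem_support]
  have hone : (Finset.univ.filter fun y : Fin k => φ 1 y = y).card = k := by simp
  have hirr := IsIrrChar.standard hk φ hφ
  let l : L →* ℂˣ := (Units.map (Int.castRingHom ℂ).toMonoidHom).comp (Equiv.Perm.sign.comp φ)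
  have hl : l t = 1 := by
    refine h.apply_eq_one hirr ?_ l (g := t) (r := (k : ℚ) - 3) ?_ ?_
    · rw [hone]
      have : (4 : ℝ) ≤ k := by exact_mod_cast hk
      intro e
      have : (k : ℂ) = 2 := by linear_combination e
      have : k = 2 := by exact_mod_cast this
      lia
    · have : (4 : ℚ) ≤ k := by exact_mod_cast hk
      linarith
    · rw [hfix, Nat.cast_sub (by lia)]; push_cast; ring
  have hl' : (l t : ℂ) = -1 := by
    change ((Equiv.Perm.sign (φ t) : ℤ) : ℂ) = -1
    rw [ht, Equiv.Perm.sign_swap hab]; simp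
  rw [hl] at hl'
  norm_num at hl'

theorem alternatingGroup_le_range {L : Type*} [Group L] {k : ℕ} {φ : L →* Equiv.Perm (Fin k)}
    (hφ : ∀ τ : Equiv.Perm (Fin k), τ.IsThreeCycle → ∃ x, orderOf x = 3 ∧ φ x = τ) :
    alternatingGroup (Fin k) ≤ φ.range := by
  rw [← Equiv.Perm.closure_three_cycles_eq_alternating, Subgroup.closure_le]
  intro τ hτ
  obtain ⟨x, -, hx⟩ := hφ τ hτ
  exact ⟨x, hx⟩

/-- The geometry with four points contradicts `RationalValuesAgree`. -/
theorem RationalValuesAgree.false_of_perm_four {L : Type*} [Group L] [Finite L]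
    (h : RationalValuesAgree L) (φ : L →* Equiv.Perm (Fin 4))
    (hφ : ∀ τ : Equiv.Perm (Fin 4), τ.IsThreeCycle → ∃ x, orderOf x = 3 ∧ φ x = τ)
    (hχ : ∀ x, orderOf x = 3 → ∃ (χ : L → ℂ) (r : ℚ), IsIrrChar χ ∧ χ 1 ≠ 1 ∧ r ≠ 0 ∧ χ x = r) :
    False := by
  have halt := h.mem_alternatingGroup le_rfl φ (alternatingGroup_le_range hφ)
  have h3 : (Equiv.swap (0 : Fin 4) 1 * Equiv.swap 0 2).IsThreeCycle :=
    Equiv.Perm.isThreeCycle_swap_mul_swap_same (by decide) (by decide) (by decide)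
  obtain ⟨x, hx, hφx⟩ := hφ _ h3
  let φ' : L →* alternatingGroup (Fin 4) := φ.codRestrict _ halt
  -- Otherwise a three-cycle would lie in the commutator subgroup of the alternating group of degree
  -- four, a Klein four-group.
  have hx' : x ∉ commutator L := by
    intro hmem
    have h1 : φ' x ∈ commutator (alternatingGroup (Fin 4)) := by
      have := Subgroup.mem_map_of_mem φ' hmem
      rw [commutator_def, Subgroup.map_commutator] at this
      exact Subgroup.commutator_mono le_top le_top this
    rw [← alternatingGroup.kleinFour_eq_commutator (Nat.card_fin 4)] at h1
    have h2 := Monoid.pow_exponent_eq_one (⟨φ' x, h1⟩ : alternatingGroup.kleinFour (Fin 4))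
    rw [alternatingGroup.exponent_kleinFour_of_card_eq_four (Nat.card_fin 4)] at h2
    have h4 : φ x ^ 2 = 1 := 
      congrArg (fun y : alternatingGroup.kleinFour (Fin 4) => ((y.1 : _) : Equiv.Perm (Fin 4))) h2
    have h5 := orderOf_dvd_of_pow_eq_one h4
    rw [hφx, h3.orderOf] at h5
    norm_num at h5
  obtain ⟨l, hl⟩ := exists_hom_apply_ne_one_of_notMem_commutator hx'
  obtain ⟨χ, r, hirr, h1, hr, hχr⟩ := hχ x hx
  exact hl (h.apply_eq_one hirr h1 l hr hχr)

/-- For `g = x y` the anticommutator relation says `ρ g + ρ g⁻¹ = 1`, hence `ρ g² = ρ g - 1` and `ρ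
g³ = -1`. -/
theorem IsFixedPointFreeRep.Adj.orderOf_mul {L n : Type*} [Group L] [Finite L] [Fintype n]
    [DecidableEq n] {ρ : L →* Matrix n n ℝ} (hρ : IsFixedPointFreeRep ρ) {x y : L}
    (h : Adj ρ x y) : orderOf ((x * y) ^ 3) = 2 ∧ orderOf ((x * y) ^ 2) = 3 := by
  have := hρ.nonempty
  have hk := hρ.killsPrimeSums
  have : CharZero (Matrix n n ℝ) := algebraRat.charZero _
  have h1 := h.anticommutator hρ
  rw [hρ.skew_mul_add h.left h.right] at h1
  have h2 : ρ (x * y) * ρ (x * y)⁻¹ = 1 := by rw [← map_mul, mul_inv_cancel, map_one]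
  generalize x * y = g at h1 h2 ⊢
  have h3 : ρ g + ρ g⁻¹ = 1 := by
    have : (4 : ℝ) • (ρ g + ρ g⁻¹ - 1) = 0 := by
      rw [ofNat_smul_eq_nsmul]
      linear_combination (norm := (noncomm_ring; all_goals norm_num)) h1
    exact sub_eq_zero.1 ((smul_eq_zero.1 this).resolve_left (by norm_num))
  have h4 : ρ g * ρ g = ρ g - 1 := by
    linear_combination (norm := noncomm_ring) ρ g * h3 - h2
  have h5 : ρ (g ^ 3) = -1 := by
    rw [map_pow, pow_succ, pow_two, h4, sub_mul, h4, one_mul]; abel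
  have h6 : g ^ 6 = 1 := hk.injective (by
    rw [show g ^ 6 = g ^ 3 * g ^ 3 by group, map_mul, h5, map_one]; simp)
  constructor
  · refine orderOf_eq_prime (by rw [← pow_mul, h6]) fun e => ?_
    rw [e, map_one] at h5
    have := congrArg ntr h5
    rw [map_neg, ntr_one] at this
    norm_num at this
  · refine orderOf_eq_prime (p := 3) (by rw [← pow_mul, h6]) fun e => ?_
    have h7 := congrArg ρ e
    rw [map_pow, pow_two, h4, map_one] at h7
    have h8 : ρ g = 2 := by rw [sub_eq_iff_eq_add] at h7; rw [h7]; norm_num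
    rw [h8] at h4
    have := congrArg ntr h4
    have n2 := ntr_ofNat (n := n) 2
    rw [ntr_ofNat_mul 2, map_sub, n2, ntr_one] at this
    norm_num at this

/-- The trace of an element of order three in the binary tetrahedral configuration. -/
theorem KillsPrimeSums.two_mul_trace {L A : Type*} [Group L] [Ring A] [Module ℂ A] {σ : L →* A}
    (hk : KillsPrimeSums σ) (T : A →ₗ[ℂ] ℂ) (hT : ∀ a b, T (a * b) = T (b * a)) {x y : L}
    (hx : orderOf x = 3) (hy : orderOf y = 3) (h2 : orderOf ((x * y) ^ 3) = 2)
    (h3 : orderOf ((x * y) ^ 2) = 3) : 2 * T (σ x) = - T 1 := by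
  have hX := hk.sq_of_orderOf_three hx
  have hY := hk.sq_of_orderOf_three hy
  have hxi := hk.apply_inv_of_orderOf_three hx
  have hyi := hk.apply_inv_of_orderOf_three hy
  have hg3 := hk.apply_of_orderOf_two h2
  have hg2 := hk.sq_of_orderOf_three h3
  have hrel : σ (x * y) + σ (x * y)⁻¹ = 1 := by
    generalize x * y = g at hg3 hg2
    have e1 : σ (g ^ 2) * σ (g ^ 2) = - σ g := by
      rw [← map_mul, show g ^ 2 * g ^ 2 = g ^ 3 * g by group, map_mul, hg3, neg_one_mul]
    have e2 : σ (g ^ 2) = - σ g⁻¹ := by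
      rw [show g ^ 2 = g ^ 3 * g⁻¹ by group, map_mul, hg3, neg_one_mul]
    rw [e1, e2, neg_neg] at hg2
    linear_combination (norm := noncomm_ring) -hg2
  rw [mul_inv_rev, map_mul, map_mul, hxi, hyi] at hrel
  generalize σ x = X at *
  generalize σ y = Y at *
  have e0 : X * Y + Y * X + X + Y = 0 := by linear_combination (norm := noncomm_ring) hrel
  -- Multiplying the relation by `X` and by `Y` gives, after taking traces, three linear equations
  -- for the traces of `X`, `Y` and `X Y`.
  have e1 : X * Y * X + X * Y = 1 + X + Y + X * Y := by
    linear_combination (norm := noncomm_ring) X * e0 - hX * Y - hX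
  have e2 : Y * X * Y + Y * X = 1 + X + Y + Y * X := by
    linear_combination (norm := noncomm_ring) Y * e0 - hY * X - hY
  have t0 := congrArg T e0
  have t1 := congrArg T e1
  have t2 := congrArg T e2
  have t3 : T (X * Y * X) = - T (X * Y) - T Y := by
    rw [hT, ← mul_assoc, hX, sub_mul, neg_mul, one_mul, map_sub, map_neg]
  have t4 : T (Y * X * Y) = - T (X * Y) - T X := by
    rw [hT, ← mul_assoc, hY, sub_mul, neg_mul, one_mul, map_sub, map_neg, hT Y X]
  simp only [map_add, map_zero, hT Y X, t3, t4] at t0 t1 t2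
  linear_combination -1 / 2 * t0 + 1 / 2 * t1 - 3 / 2 * t2

open IsFixedPointFreeRep in
-- An irreducible constituent of the complexified representation has value minus half its degree at
-- `x`, a nonzero rational. It is nonlinear because it is faithful and `x`, `y` do not commute.
theorem IsFixedPointFreeRep.Adj.exists_isIrrChar {L n : Type*} [Group L] [Finite L] [Fintype n]
    [DecidableEq n] {ρ : L →* Matrix n n ℝ} (hρ : IsFixedPointFreeRep ρ) {x y : L}
    (h : Adj ρ x y) :
    ∃ (χ : L → ℂ) (r : ℚ), IsIrrChar χ ∧ χ 1 ≠ 1 ∧ r ≠ 0 ∧ χ x = r := by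
  obtain ⟨W, σ, hσ, hk⟩ := hρ.exists_isIrreducible (f := MonoidHom.id L) Function.injective_id
  have := hσ.nontrivial_space
  obtain ⟨h2, h3⟩ := h.orderOf_mul hρ
  have htr := hk.two_mul_trace (LinearMap.trace ℂ W) (LinearMap.trace_mul_comm ℂ) h.left h.right h2 h3
  have hdeg : σ.character 1 = Module.finrank ℂ W := by simp
  rw [LinearMap.trace_one] at htr
  have hpos : 0 < Module.finrank ℂ W := Module.finrank_pos
  refine ⟨σ.character, -(Module.finrank ℂ W : ℚ) / 2, IsIrrChar.of_rep hσ, ?_, ?_, ?_⟩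
  · rw [hdeg]
    intro e
    have e1 : Module.finrank ℂ W = 1 := by exact_mod_cast e
    have hcomm := Representation.commute_of_finrank_eq_one (ρ := σ) e1 x y
    have : CharZero (Module.End ℂ W) := algebraRat.charZero _
    have hxy := hk.injective hcomm
    refine (hρ.conj_ne h.left h.right (h.ne hρ).symm
      (fun e => h.ne_inv hρ (by rw [e, inv_inv]))).1 ?_
    rw [hxy]; group
  · have : (Module.finrank ℂ W : ℚ) ≠ 0 := by exact_mod_cast hpos.ne'
    simpa using this
  · change LinearMap.trace ℂ W (σ x) = _
    push_cast
    linear_combination 1 / 2 * htr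

/-! ### The symmetric cube of a two-dimensional representation. -/

section SymCube
open Matrix

/-- The third symmetric power of a two-dimensional matrix, in the basis of monomials. -/
def symCube : Matrix (Fin 2) (Fin 2) ℂ →* Matrix (Fin 4) (Fin 4) ℂ where
  toFun M := !![M 0 0 ^ 3, M 0 0 ^ 2 * M 0 1, M 0 0 * M 0 1 ^ 2, M 0 1 ^ 3;
    3 * M 0 0 ^ 2 * M 1 0, M 0 0 ^ 2 * M 1 1 + 2 * M 0 0 * M 0 1 * M 1 0,
      2 * M 0 0 * M 0 1 * M 1 1 + M 1 0 * M 0 1 ^ 2, 3 * M 0 1 ^ 2 * M 1 1;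
    3 * M 0 0 * M 1 0 ^ 2, 2 * M 0 0 * M 1 0 * M 1 1 + M 0 1 * M 1 0 ^ 2,
      M 0 0 * M 1 1 ^ 2 + 2 * M 0 1 * M 1 0 * M 1 1, 3 * M 0 1 * M 1 1 ^ 2;
    M 1 0 ^ 3, M 1 0 ^ 2 * M 1 1, M 1 0 * M 1 1 ^ 2, M 1 1 ^ 3]
  map_one' := by
    ext i j
    fin_cases i <;> fin_cases j <;> simp
  map_mul' M N := by
    ext i j
    fin_cases i <;> fin_cases j <;>
      simp [Matrix.mul_apply, Fin.sum_univ_succ] <;> ring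

theorem symCube_diagonal (a b : ℂ) :
    symCube !![a, 0; 0, b] = diagonal ![a ^ 3, a ^ 2 * b, a * b ^ 2, b ^ 3] := by
  ext i j
  fin_cases i <;> fin_cases j <;> simp [symCube]

theorem symCube_neg_one : symCube (-1) = -1 := by
  ext i j
  fin_cases i <;> fin_cases j <;> simp [symCube] <;> norm_num

/-- A subspace stable under the symmetric cubes of a diagonal matrix with distinct weights and of
a matrix whose relevant entries do not vanish is trivial or everything. -/
theorem symCube_irreducible {a b c d ζ : ℂ} (ha : a ≠ 0) (hb : b ≠ 0) (hc : c ≠ 0) (hζ : ζ ≠ 0)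
    (h4 : ζ ^ 4 ≠ 1) (h6 : ζ ^ 6 ≠ 1) (S : Submodule ℂ (Fin 4 → ℂ))
    (hS1 : ∀ f ∈ S, symCube !![ζ, 0; 0, ζ⁻¹] *ᵥ f ∈ S)
    (hS2 : ∀ f ∈ S, symCube !![a, b; c, d] *ᵥ f ∈ S) (hne : S ≠ ⊥) : S = ⊤ := by
  let w : Fin 4 → ℂ := ![ζ ^ 3, ζ ^ 2 * ζ⁻¹, ζ * ζ⁻¹ ^ 2, ζ⁻¹ ^ 3]
  have h2 : ζ ^ 2 ≠ 1 := fun h => h4 (by rw [show 4 = 2 * 2 from rfl, pow_mul, h, one_pow])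
  have hw : ∀ i j, i ≠ j → w i ≠ w j := by
    have e : ∀ i j : Fin 4, w i = w j → ζ ^ 3 * w i = ζ ^ 3 * w j := fun i j h => by rw [h]
    have w0 : ζ ^ 3 * w 0 = ζ ^ 6 := by simp [w]; ring
    have w1 : ζ ^ 3 * w 1 = ζ ^ 4 := by simp [w]; field_simp
    have w2 : ζ ^ 3 * w 2 = ζ ^ 2 := by simp [w]; field_simp
    have w3 : ζ ^ 3 * w 3 = 1 := by simp [w]; field_simp
    have h62 : ζ ^ 6 ≠ ζ ^ 2 := fun h => h4 (mul_left_cancel₀ (pow_ne_zero 2 hζ) (by rw [← pow_add, mul_one, h]))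
    have h64 : ζ ^ 6 ≠ ζ ^ 4 := fun h => h2 (mul_left_cancel₀ (pow_ne_zero 4 hζ) (by rw [← pow_add, mul_one, h]))
    have h42 : ζ ^ 4 ≠ ζ ^ 2 := fun h => h2 (mul_left_cancel₀ (pow_ne_zero 2 hζ) (by rw [← pow_add, mul_one, h]))
    have hcyc : ∀ i j : Fin 4, i < j → w i ≠ w j := by
      intro i j hij h
      have h' := e i j h
      fin_cases i <;> fin_cases j <;>
        simp [w0, w1, w2, w3, h62, h64, h42, h2, h4, h6] at h' hij
    intro i j hij
    rcases lt_or_gt_of_ne hij with h | h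
    · exact hcyc i j h
    · exact (hcyc j i h).symm
  have hd : ∀ _ : Unit, ∀ f ∈ S, w * f ∈ S := by
    intro _ f hf
    have := hS1 f hf
    rw [symCube_diagonal] at this
    convert this using 1
    ext i
    rw [mulVec_diagonal]; rfl
  have hsingle : ∀ {f : Fin 4 → ℂ}, f ∈ S → ∀ {i}, f i ≠ 0 → Pi.single i 1 ∈ S :=
    fun hf _ hi => Representation.single_mem_of_separating S (fun _ : Unit => w) hd
      (fun i j hij => ⟨(), hw i j hij⟩) hf hi
  obtain ⟨f, hf, hf0⟩ := S.exists_mem_ne_zero_of_ne_bot hne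
  obtain ⟨i, hi⟩ := Function.ne_iff.1 hf0
  -- The row of index `0` of the second matrix is `a³, a²b, ab², b³`, so every basis vector leads to
  -- the one of index `0`; the column `a³, 3a²c, 3ac², c³` leads from there to all of them.
  have h0 : Pi.single 0 1 ∈ S := by
    refine hsingle (hS2 _ (hsingle hf hi)) ?_
    rw [mulVec_single_one]
    fin_cases i <;> simp [symCube, ha, hb]
  rw [eq_top_iff]
  intro f _
  have hall : ∀ j, Pi.single j 1 ∈ S := by
    intro j
    refine hsingle (hS2 _ h0) ?_
    rw [mulVec_single_one]
    fin_cases j <;> simp [symCube, ha, hc]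
  have : f = ∑ j, f j • (Pi.single j 1 : Fin 4 → ℂ) := by
    ext j; simp [Finset.sum_apply, Pi.single_apply]
  rw [this]
  exact S.sum_mem fun j _ => S.smul_mem _ (hall j)

end SymCube

/-! ### Two-dimensional models, transfer, and the case of five double lines. -/

theorem forall_of_closure_eq_top {D : Type*} [Group D] [Finite D] {k : Set D}
    (hk : Subgroup.closure k = ⊤) {p : D → Prop} (one : p 1) (mul : ∀ a b, p a → p b → p (a * b))
    (mem : ∀ a ∈ k, p a) (d : D) : p d := by
  have hd : d ∈ Subgroup.closure k := hk ▸ Subgroup.mem_top d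
  induction hd using Subgroup.closure_induction with
  | mem a ha => exact mem a ha
  | one => exact one
  | mul a b _ _ ha hb => exact mul a b ha hb
  | inv a _ ha =>
    -- In a finite group the inverse is a nonnegative power, so closure under products suffices.
    rw [inv_eq_of_mul_eq_one_left (a := a ^ (orderOf a - 1)) (by
      rw [pow_sub_one_mul (orderOf_pos a).ne', pow_orderOf_eq_one])]
    generalize orderOf a - 1 = n
    induction n with
    | zero => rw [pow_zero]; exact one
    | succ n ih => rw [pow_succ]; exact mul _ _ ih ha

/-- A unipotent element of finite order is trivial in characteristic zero: `(1 + M)ⁿ = 1 + n M`. -/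
theorem eq_zero_of_one_add_pow_eq_one {A : Type*} [Ring A] [Module ℂ A] {M : A} (hM : M * M = 0)
    {n : ℕ} (hn : n ≠ 0) (h : (1 + M) ^ n = 1) : M = 0 := by
  have key : ∀ n : ℕ, (1 + M) ^ n = 1 + n • M := by
    intro n
    induction n with
    | zero => simp
    | succ n ih =>
      rw [pow_succ, ih, add_mul, one_mul, mul_add, smul_mul_assoc, smul_mul_assoc, hM, mul_one,
        add_nsmul, one_nsmul]
      simp only [smul_zero, add_zero]
      abel
  rw [key, add_eq_left, ← Nat.cast_smul_eq_nsmul ℂ, smul_eq_zero] at h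
  exact h.resolve_left (by exact_mod_cast hn)

theorem charZero_end (W : Type*) [AddCommGroup W] [Module ℂ W] [Nontrivial W] :
    CharZero (Module.End ℂ W) :=
  charZero_of_injective_algebraMap (FaithfulSMul.algebraMap_injective ℂ (Module.End ℂ W))

/-- A group generated by two elements of order three with a fixed point free irreducible
representation embeds into the matrices of size two, in an explicit form. -/
theorem exists_matrix_hom_of_isIrreducible {D W : Type*} [Group D] [Finite D] [AddCommGroup W]
    [Module ℂ W] [FiniteDimensional ℂ W] {σ : Representation ℂ D W} (hσ : σ.IsIrreducible)
    (hk : KillsPrimeSums (A := Module.End ℂ W) σ) {x u : D} (hx : orderOf x = 3)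
    (hu : orderOf u = 3) (hgen : Subgroup.closure {x, u} = ⊤) (h4 : (x * u) ^ 4 ≠ 1)
    (h6 : (x * u) ^ 6 ≠ 1) :
    ∃ (Ψ : D →* Matrix (Fin 2) (Fin 2) ℂ) (ζ k : ℂ), Function.Injective Ψ ∧ KillsPrimeSums Ψ ∧
      ζ ≠ 0 ∧ k * (ζ + 1) = ζ ∧ Ψ (x * u) = !![ζ, 0; 0, ζ⁻¹] ∧
      Ψ x = !![-k, -(k ^ 2 - k + 1); 1, k - 1] := by
  have := hσ.nontrivial_space
  have hchar := charZero_end W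
  have hinj := hk.injective
  -- pointwise forms of the relations
  have hmul : ∀ (a b : D) (w : W), σ (a * b) w = σ a (σ b w) := fun a b w => by
    rw [map_mul]; rfl
  have hxi : ∀ w, σ x⁻¹ w = - σ x w - w := fun w =>
    LinearMap.congr_fun (hk.apply_inv_of_orderOf_three hx) w
  have hui : ∀ w, σ u⁻¹ w = - σ u w - w := fun w =>
    LinearMap.congr_fun (hk.apply_inv_of_orderOf_three hu) w
  have hxx : ∀ w, σ x (σ x w) = - σ x w - w := fun w =>
    LinearMap.congr_fun (hk.sq_of_orderOf_three hx) w
  have huu : ∀ w, σ u (σ u w) = - σ u w - w := fun w =>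
    LinearMap.congr_fun (hk.sq_of_orderOf_three hu) w
  have hgi : ∀ w, σ (x * u)⁻¹ w = σ u (σ x w) + σ u w + σ x w + w := by
    intro w
    rw [mul_inv_rev, hmul, hxi, hui, map_sub, map_neg]; abel
  -- For `g = x u` the quadratic relations of `x` and `u` make `g + g⁻¹` commute with both
  -- generators; Schur's lemma makes it scalar.
  obtain ⟨t, ht⟩ : ∃ t : ℂ, ∀ w, (σ (x * u) + σ (x * u)⁻¹) w = t • w := by
    refine hσ.exists_eq_smul _ fun d => ?_
    refine forall_of_closure_eq_top hgen (p := fun d => ∀ v, (σ (x * u) + σ (x * u)⁻¹) (σ d v) =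
      σ d ((σ (x * u) + σ (x * u)⁻¹) v)) (by simp) ?_ ?_ d
    · intro a b ha hb v
      rw [hmul, ha, hb, hmul]
    · rintro a (rfl | rfl) v
      · simp only [LinearMap.add_apply, hgi, hmul, hxx, map_add, map_sub, map_neg]; abel
      · simp only [LinearMap.add_apply, hgi, hmul, huu, map_add, map_sub, map_neg]; abel
  have ht' : ∀ w, σ (x * u)⁻¹ w = t • w - σ (x * u) w := fun w => by
    rw [← ht w, LinearMap.add_apply]; abel
  obtain ⟨ζ, hζ⟩ := Module.End.exists_eigenvalue (σ (x * u))
  obtain ⟨v, hv⟩ := hζ.exists_hasEigenvector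
  have hv0 : v ≠ 0 := hv.2
  have hgv : σ (x * u) v = ζ • v := hv.apply_eq_smul
  have hζ0 : ζ ≠ 0 := by
    rintro rfl
    rw [zero_smul] at hgv
    have : σ ((x * u)⁻¹ * (x * u)) v = 0 := by rw [hmul, hgv, map_zero]
    rw [inv_mul_cancel, map_one] at this
    exact hv0 this
  have hgiv : σ (x * u)⁻¹ v = ζ⁻¹ • v := by
    have : σ (x * u)⁻¹ (σ (x * u) v) = v := by rw [← hmul, inv_mul_cancel, map_one]; rfl
    rw [hgv, map_smul] at this
    nth_rewrite 2 [← this]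
    rw [smul_smul, inv_mul_cancel₀ hζ0, one_smul]
  have htζ : t = ζ + ζ⁻¹ := by
    have := ht v
    rw [LinearMap.add_apply, hgv, hgiv, ← add_smul] at this
    exact (smul_left_injective ℂ hv0 this).symm
  -- If `ζ² = 1`, then `ζ g - 1` has square zero, so finite order forces `ζ g = 1` and `(x u)² = 1`.
  have hζ2 : ζ ^ 2 ≠ 1 := by
    intro h
    let g : Module.End ℂ W := σ (x * u)
    have hgg : g * g = (2 * ζ) • g - 1 := by
      have e : ζ⁻¹ = ζ := by field_simp; exact h.symm
      ext y
      have h1 := ht' (σ (x * u) y)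
      rw [← hmul, inv_mul_cancel, map_one, htζ, e, ← two_mul] at h1
      change σ (x * u) (σ (x * u) y) = (2 * ζ) • σ (x * u) y - y
      have h2 : y = (2 * ζ) • σ (x * u) y - σ (x * u) (σ (x * u) y) := h1
      rw [eq_sub_iff_add_eq] at h2 ⊢
      rw [add_comm]; exact h2
    have hM : (ζ • g - 1) * (ζ • g - 1) = 0 := by
      rw [mul_sub, sub_mul, sub_mul, smul_mul_smul_comm, hgg, ← pow_two, h, one_smul, mul_one,
        one_mul, mul_one, mul_smul, two_smul]
      abel
    have hpow : (1 + (ζ • g - 1)) ^ (2 * orderOf (x * u)) = 1 := by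
      rw [add_sub_cancel, smul_pow, pow_mul, h, one_pow, one_smul, mul_comm 2, pow_mul,
        show g ^ orderOf (x * u) = σ ((x * u) ^ orderOf (x * u)) from (map_pow σ _ _).symm,
        pow_orderOf_eq_one, map_one]
      exact one_pow 2
    have h0 := eq_zero_of_one_add_pow_eq_one hM
      (mul_ne_zero two_ne_zero (orderOf_pos (x * u)).ne') hpow
    have hg2 : σ ((x * u) ^ 2) = σ 1 := by
      have h1 : ζ • g = 1 := sub_eq_zero.1 h0
      have h2 : (ζ • g) ^ 2 = 1 := by rw [h1, one_pow]
      rw [smul_pow, h, one_smul] at h2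
      rw [map_pow, map_one]; exact h2
    refine h4 ?_
    rw [show 4 = 2 * 2 from rfl, pow_mul, hinj hg2, one_pow]
  set w := σ x v with hw
  have huv : σ u v = -(ζ • w) - ζ • v := by
    have : σ u v = σ x⁻¹ (σ (x * u) v) := by rw [← hmul, inv_mul_cancel_left]
    rw [this, hgv, map_smul, hxi, smul_sub, smul_neg]
  have hxw : σ x w = -w - v := hxx v
  have hgiw : σ (x * u)⁻¹ w = ζ • w + (ζ - 1) • v := by
    rw [hgi, hxw, map_sub, map_neg, huv]
    rw [sub_smul, one_smul]; abel
  have hgw : σ (x * u) w = ζ⁻¹ • w - (ζ - 1) • v := by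
    have := ht' w
    rw [hgiw, htζ, add_smul] at this
    rw [← sub_eq_zero] at this ⊢
    rw [← this]; abel
  have huw : σ u w = (ζ - 1) • w + (ζ - 1 + ζ⁻¹) • v := by
    have : σ u w = σ x⁻¹ (σ (x * u) w) := by
      rw [← hmul x⁻¹ (x * u) w, inv_mul_cancel_left]
    rw [this, hgw, hxi, map_sub, map_smul, map_smul, hxw, ← hw]
    module
  have htop : ∀ S : Submodule ℂ W, v ∈ S → (∀ s ∈ S, σ x s ∈ S) → (∀ s ∈ S, σ u s ∈ S) → S = ⊤ := by
    intro S hvS hxS huS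
    refine hσ.eq_top_of_invariant S (fun d => ?_) ((Submodule.ne_bot_iff S).2 ⟨v, hvS, hv0⟩)
    refine forall_of_closure_eq_top hgen (p := fun d => ∀ s ∈ S, σ d s ∈ S) (by simp) ?_ ?_ d
    · intro a b ha hb s hs
      rw [hmul]; exact ha _ (hb s hs)
    · rintro a (rfl | rfl)
      exacts [hxS, huS]
  -- If `x v` were a multiple of `v`, the whole space would be a line, `x` and `u` would commute,
  -- and `(x u)⁶ = 1`.
  have hw_ne : ∀ s : ℂ, w ≠ s • v := by
    intro s hs
    have hS := htop (Submodule.span ℂ {v}) (Submodule.mem_span_singleton_self v) ?_ ?_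
    · have h1 : Module.finrank ℂ W = 1 := finrank_eq_one_iff'.2 ⟨v, hv0, fun y =>
        Submodule.mem_span_singleton.1 (hS ▸ Submodule.mem_top)⟩
      have hcomm : Commute x u := hinj (Representation.commute_of_finrank_eq_one (ρ := σ) h1 x u)
      refine h6 ?_
      rw [hcomm.mul_pow, show 6 = 3 * 2 from rfl, pow_mul, pow_mul, ← hx, pow_orderOf_eq_one, hx,
        ← hu, pow_orderOf_eq_one]
      simp
    · intro y hy
      obtain ⟨c, rfl⟩ := Submodule.mem_span_singleton.1 hy
      rw [map_smul, ← hw, hs]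
      exact Submodule.smul_mem _ _ (Submodule.smul_mem _ _ (Submodule.mem_span_singleton_self v))
    · intro y hy
      obtain ⟨c, rfl⟩ := Submodule.mem_span_singleton.1 hy
      rw [map_smul, huv, hs]
      refine Submodule.mem_span_singleton.2 ⟨c * (-(ζ * s) - ζ), ?_⟩
      module
  have hζ1 : ζ + 1 ≠ 0 := by
    intro h
    exact hζ2 (by linear_combination (ζ - 1) * h)
  -- With this `k` the vector `w + k v` is an eigenvector of `x u` for `ζ⁻¹`, so the basis `v`, `w +
  -- k v` diagonalizes `x u`.
  obtain ⟨k, hkζ⟩ : ∃ k : ℂ, k * (ζ + 1) = ζ := ⟨ζ / (ζ + 1), div_mul_cancel₀ _ hζ1⟩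
  have hli : LinearIndependent ℂ ![v, w + k • v] := by
    rw [LinearIndependent.pair_iff]
    intro a c hac
    have hc : c = 0 := by
      by_contra hc
      refine hw_ne (-(a * c⁻¹) - k) ?_
      have : c⁻¹ • (a • v + c • (w + k • v)) = 0 := by rw [hac, smul_zero]
      rw [smul_add, smul_smul c⁻¹ c, inv_mul_cancel₀ hc] at this
      rw [← sub_eq_zero, ← this]
      module
    rw [hc, zero_smul, add_zero] at hac
    exact ⟨(smul_eq_zero.1 hac).resolve_right hv0, hc⟩
  have hsp : ⊤ ≤ Submodule.span ℂ (Set.range ![v, w + k • v]) := by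
    have hvS : v ∈ Submodule.span ℂ (Set.range ![v, w + k • v]) :=
      Submodule.subset_span ⟨0, rfl⟩
    have hwS : w ∈ Submodule.span ℂ (Set.range ![v, w + k • v]) := by
      have : w + k • v ∈ Submodule.span ℂ (Set.range ![v, w + k • v]) :=
        Submodule.subset_span ⟨1, rfl⟩
      have := Submodule.sub_mem _ this (Submodule.smul_mem _ k hvS)
      rwa [add_sub_cancel_right] at this
    have hlin : ∀ d : D, σ d v ∈ Submodule.span ℂ (Set.range ![v, w + k • v]) →
        σ d w ∈ Submodule.span ℂ (Set.range ![v, w + k • v]) →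
        ∀ s ∈ Submodule.span ℂ (Set.range ![v, w + k • v]),
          σ d s ∈ Submodule.span ℂ (Set.range ![v, w + k • v]) := by
      intro d h1 h2 s hs
      induction hs using Submodule.span_induction with
      | mem y hy =>
        obtain ⟨i, rfl⟩ := hy
        fin_cases i
        · exact h1
        · change σ d (w + k • v) ∈ _
          rw [map_add, map_smul]
          exact Submodule.add_mem _ h2 (Submodule.smul_mem _ _ h1)
      | zero => rw [map_zero]; exact Submodule.zero_mem _
      | add a b _ _ ha hb => rw [map_add]; exact Submodule.add_mem _ ha hb
      | smul c a _ ha => rw [map_smul]; exact Submodule.smul_mem _ _ ha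
    refine (htop _ hvS (hlin x hwS ?_) (hlin u ?_ ?_)).ge
    · rw [hxw]
      exact Submodule.sub_mem _ (Submodule.neg_mem _ hwS) hvS
    · rw [huv]
      exact Submodule.sub_mem _ (Submodule.neg_mem _ (Submodule.smul_mem _ _ hwS))
        (Submodule.smul_mem _ _ hvS)
    · rw [huw]
      exact Submodule.add_mem _ (Submodule.smul_mem _ _ hwS) (Submodule.smul_mem _ _ hvS)
  let b : Module.Basis (Fin 2) ℂ W := Module.Basis.mk hli hsp
  have hb0 : b 0 = v := by simp [b]
  have hb1 : b 1 = w + k • v := by simp [b]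
  let e := LinearMap.toMatrixAlgEquiv b
  let Ψ : D →* Matrix (Fin 2) (Fin 2) ℂ := (e : Module.End ℂ W →* _).comp σ
  have hΨ : ∀ d M, σ d v = M 0 0 • v + M 1 0 • (w + k • v) →
      σ d (w + k • v) = M 0 1 • v + M 1 1 • (w + k • v) → Ψ d = M := by
    intro d M h1 h2
    change LinearMap.toMatrixAlgEquiv b (σ d) = M
    rw [← LinearMap.toMatrixAlgEquiv_toLinAlgEquiv b M]
    congr 1
    refine b.ext fun j => ?_
    rw [Matrix.toLinAlgEquiv_self, Fin.sum_univ_two]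
    fin_cases j
    · simpa [hb0, hb1] using h1
    · simpa [hb0, hb1] using h2
  have hkk : k * (ζ - ζ⁻¹) = ζ - 1 := by
    have : k * (ζ - ζ⁻¹) * ζ = (ζ - 1) * ζ := by
      have e : ζ⁻¹ * ζ = 1 := inv_mul_cancel₀ hζ0
      linear_combination (ζ - 1) * hkζ - k * e
    exact mul_right_cancel₀ hζ0 this
  refine ⟨Ψ, ζ, k, e.injective.comp hinj, fun g p hp hg => ?_, hζ0, hkζ, hΨ _ _ ?_ ?_, hΨ _ _ ?_ ?_⟩
  · have := congrArg e (hk g p hp hg)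
    rw [map_sum, map_zero] at this
    rw [← this]
    exact Finset.sum_congr rfl fun i _ => (map_pow e _ _).symm
  · rw [hgv]; simp
  · rw [map_add, map_smul, hgw, hgv]
    have : ζ⁻¹ • w - (ζ - 1) • v + k • ζ • v - ζ⁻¹ • (w + k • v) =
        (k * (ζ - ζ⁻¹) - (ζ - 1)) • v := by module
    rw [hkk, sub_self, zero_smul, sub_eq_zero] at this
    simpa using this
  · simp [← hw]
  · rw [map_add, map_smul, hxw, ← hw]
    simp only [Matrix.of_apply, Matrix.cons_val', Matrix.cons_val_zero, Matrix.cons_val_one,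
      Matrix.cons_val_fin_one]
    module

/-- Burnside's transfer: on `P` it is the power map to the index of `P`, which is prime to `p`, so
it does not kill `x`. -/
theorem exists_hom_apply_ne_one_of_sylow {L : Type*} [Group L] [Finite L] {p : ℕ} [Fact p.Prime]
    (P : Sylow p L)
    (hP : Subgroup.normalizer (P : Set L) ≤ Subgroup.centralizer (P : Set L)) {x : L}
    (hx : x ∈ P) (hx1 : x ≠ 1) : ∃ l : L →* ℂˣ, l x ≠ 1 := by
  let τ := MonoidHom.transferSylow P hP
  have hcomm : commutator P = ⊥ := by
    rw [eq_bot_iff, commutator_def, Subgroup.commutator_le]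
    rintro ⟨a, ha⟩ - ⟨b, hb⟩ -
    rw [Subgroup.mem_bot, commutatorElement_eq_one_iff_commute]
    exact Subtype.ext ((Subgroup.mem_centralizer_iff.1 (hP (Subgroup.le_normalizer hb)) a ha))
  have hτ : τ x ∉ commutator P := by
    rw [hcomm, Subgroup.mem_bot, MonoidHom.transferSylow_eq_pow P hP x hx]
    intro h
    have h1 : x ^ (P : Subgroup L).index = 1 := congrArg Subtype.val h
    obtain ⟨k, hk⟩ := P.isPGroup'.exists_orderOf_eq_pow ⟨x, hx⟩
    rw [Subgroup.orderOf_mk] at hk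
    have h2 : (orderOf x).Coprime (P : Subgroup L).index := by
      rw [hk]
      exact Nat.Coprime.pow_left _ ((Nat.Prime.coprime_iff_not_dvd Fact.out).2 P.not_dvd_index)
    exact hx1 (orderOf_eq_one_iff.1 (Nat.eq_one_of_dvd_coprimes h2 dvd_rfl
      (orderOf_dvd_of_pow_eq_one h1)))
  obtain ⟨l, hl⟩ := exists_hom_apply_ne_one_of_notMem_commutator hτ
  exact ⟨l.comp τ, hl⟩

/-- The two three-cycles make the group transitive of prime degree, hence primitive, and Jordan's
theorem on three-cycles applies. -/
theorem alternatingGroup_five_le {H : Subgroup (Equiv.Perm (Fin 5))}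
    (h1 : Equiv.swap 0 1 * Equiv.swap 1 2 ∈ H) (h2 : Equiv.swap 2 3 * Equiv.swap 3 4 ∈ H) :
    alternatingGroup (Fin 5) ≤ H := by
  have h3 : (Equiv.swap (0 : Fin 5) 1 * Equiv.swap 1 2).IsThreeCycle := by
    rw [Equiv.swap_comm 0 1]
    exact Equiv.Perm.isThreeCycle_swap_mul_swap_same (by decide) (by decide) (by decide)
  have htrans : MulAction.IsPretransitive H (Fin 5) := by
    rw [MulAction.isPretransitive_iff_base (0 : Fin 5)]
    intro y
    set p : Equiv.Perm (Fin 5) := Equiv.swap 0 1 * Equiv.swap 1 2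
    set q : Equiv.Perm (Fin 5) := Equiv.swap 2 3 * Equiv.swap 3 4
    have hp2 := mul_mem h1 h1
    have hqp := mul_mem h2 hp2
    fin_cases y
    · exact ⟨1, by simp⟩
    · exact ⟨⟨p, h1⟩, (by decide : p 0 = 1)⟩
    · exact ⟨⟨p * p, hp2⟩, (by decide : (p * p) 0 = 2)⟩
    · exact ⟨⟨q * (p * p), hqp⟩, (by decide : (q * (p * p)) 0 = 3)⟩
    · exact ⟨⟨q * (q * (p * p)), mul_mem h2 hqp⟩, (by decide : (q * (q * (p * p))) 0 = 4)⟩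
  exact Equiv.Perm.alternatingGroup_le_of_isPreprimitive_of_isThreeCycle_mem
    (MulAction.IsPreprimitive.of_prime_card (by rw [Nat.card_fin]; norm_num)) h3 h1

/-- A homomorphism on a product of two commuting subgroups can be defined on the factors. -/
theorem exists_hom_of_commuting_subgroups {L M : Type*} [Group L] [Group M] {D C : Subgroup L}
    (hDC : ∀ d ∈ D, ∀ c ∈ C, d * c = c * d) (htop : ∀ l, ∃ d ∈ D, ∃ c ∈ C, d * c = l)
    (α : D →* M) (β : C →* M) (hαβ : ∀ d c, α d * β c = β c * α d)
    (hag : ∀ l (hd : l ∈ D) (hc : l ∈ C), α ⟨l, hd⟩ = β ⟨l, hc⟩) :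
    ∃ R : L →* M, (∀ d : D, R d = α d) ∧ ∀ c : C, R c = β c := by
  let f : D × C →* L := D.subtype.noncommCoprod C.subtype fun d c => hDC d d.2 c c.2
  let g : D × C →* M := α.noncommCoprod β hαβ
  have hf : Function.Surjective f := fun l => by
    obtain ⟨d, hd, c, hc, e⟩ := htop l
    exact ⟨(⟨d, hd⟩, ⟨c, hc⟩), e⟩
  have hker : f.ker ≤ g.ker := by
    rintro ⟨⟨d, hd⟩, ⟨c, hc⟩⟩ h
    have h1 : d * c = 1 := h
    have h2 : d = c⁻¹ := eq_inv_of_mul_eq_one_left h1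
    subst h2
    change α _ * β _ = 1
    rw [hag c⁻¹ hd (inv_mem hc), ← map_mul]
    convert map_one β
    exact Subtype.ext (inv_mul_cancel c)
  let R := MonoidHom.liftOfRightInverse f _ (Function.rightInverse_surjInv hf) ⟨g, hker⟩
  have hR : ∀ y, R (f y) = g y := fun y =>
    MonoidHom.liftOfRightInverse_comp_apply f _ (Function.rightInverse_surjInv hf) ⟨g, hker⟩ y
  refine ⟨R, fun d => ?_, fun c => ?_⟩
  · have h1 : f (d, 1) = d := mul_one _
    have h2 : g (d, 1) = α d := by
      change α d * β 1 = α d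
      rw [map_one, mul_one]
    rw [← h1, hR, h2]
  · have h1 : f (1, c) = c := one_mul _
    have h2 : g (1, c) = β c := by
      change α 1 * β c = β c
      rw [map_one, one_mul]
    rw [← h1, hR, h2]

open Matrix in
/-- The geometry with five points contradicts `RationalValuesAgree`. -/
theorem RationalValuesAgree.false_of_perm_five {L n : Type*} [Group L] [Finite L] [Fintype n]
    [DecidableEq n] {ρ : L →* Matrix n n ℝ} (hρ : IsFixedPointFreeRep ρ)
    (h : RationalValuesAgree L) (φ : L →* Equiv.Perm (Fin 5))
    (hφ : ∀ τ : Equiv.Perm (Fin 5), τ.IsThreeCycle → ∃ x, orderOf x = 3 ∧ φ x = τ)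
    (hker : ∀ g, φ g = 1 → ∀ s, orderOf s = 3 → g * s * g⁻¹ = s) : False := by
  have := hρ.nonempty
  have : CharZero (Matrix n n ℝ) := algebraRat.charZero _
  have : CharZero (Matrix (Fin 2) (Fin 2) ℂ) := algebraRat.charZero _
  have hkL := hρ.killsPrimeSums
  have hrange := alternatingGroup_le_range hφ
  have halt := h.mem_alternatingGroup (by norm_num) φ hrange
  obtain ⟨x, hx, hφx⟩ := hφ (Equiv.swap 0 1 * Equiv.swap 1 2) (by
    rw [Equiv.swap_comm 0 1]
    exact Equiv.Perm.isThreeCycle_swap_mul_swap_same (by decide) (by decide) (by decide))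
  obtain ⟨u, hu, hφu⟩ := hφ (Equiv.swap 2 3 * Equiv.swap 3 4) (by
    rw [Equiv.swap_comm 2 3]
    exact Equiv.Perm.isThreeCycle_swap_mul_swap_same (by decide) (by decide) (by decide))
  -- The images of `x` and `u` are three-cycles sharing one point, so `x u` maps to a five-cycle.
  have h4 : (x * u) ^ 4 ≠ 1 := fun e => by
    have := congrArg φ e
    rw [map_pow, map_mul, hφx, hφu, map_one] at this
    exact absurd this (by decide)
  have h6 : (x * u) ^ 6 ≠ 1 := fun e => by
    have := congrArg φ e
    rw [map_pow, map_mul, hφx, hφu, map_one] at this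
    exact absurd this (by decide)
  let D : Subgroup L := Subgroup.closure {x, u}
  have hxD : x ∈ D := Subgroup.subset_closure (Or.inl rfl)
  have huD : u ∈ D := Subgroup.subset_closure (Or.inr rfl)
  have hDmap : alternatingGroup (Fin 5) ≤ D.map φ :=
    alternatingGroup_five_le ⟨x, hxD, hφx⟩ ⟨u, huD, hφu⟩
  have hgen : Subgroup.closure ({⟨x, hxD⟩, ⟨u, huD⟩} : Set D) = ⊤ := by
    rw [← Subgroup.closure_closure_coe_preimage (k := {x, u})]
    congr 1
    ext d
    simp [Subtype.ext_iff]
  obtain ⟨W, σ, hσ, hk⟩ := hρ.exists_isIrreducible (f := D.subtype) D.subtype_injective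
  obtain ⟨Ψ, ζ, k, hΨ, hkΨ, hζ, hkζ, hΨg, hΨx⟩ := exists_matrix_hom_of_isIrreducible hσ hk
    (x := ⟨x, hxD⟩) (u := ⟨u, huD⟩) (by rw [Subgroup.orderOf_mk, hx])
    (by rw [Subgroup.orderOf_mk, hu]) hgen
    (fun e => h4 (congrArg Subtype.val e)) (fun e => h6 (congrArg Subtype.val e))
  have hζpow : ∀ m : ℕ, (x * u) ^ m ≠ 1 → ζ ^ m ≠ 1 := by
    intro m hm e
    have h1 : Ψ ((⟨x, hxD⟩ * ⟨u, huD⟩) ^ m) = Ψ 1 := by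
      rw [map_pow, hΨg, map_one, show !![ζ, 0; 0, ζ⁻¹] = diagonal ![ζ, ζ⁻¹] by
        ext i j; fin_cases i <;> fin_cases j <;> rfl, diagonal_pow]
      ext i j
      fin_cases i <;> fin_cases j <;> simp [e]
    exact hm (congrArg Subtype.val (hΨ h1))
  have hζ4 := hζpow 4 h4
  have hζ6 := hζpow 6 h6
  have hζ2 : ζ ^ 2 ≠ 1 := fun e => hζ4 (by rw [show 4 = 2 * 2 from rfl, pow_mul, e, one_pow])
  have hk0 : -k ≠ 0 := by
    intro e
    rw [neg_eq_zero] at e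
    rw [e, zero_mul] at hkζ
    exact hζ hkζ.symm
  -- Vanishing would mean `ζ² + ζ + 1 = 0`, contrary to `ζ⁶ ≠ 1`. Such nonzero entries are what the
  -- irreducibility of the symmetric cube needs.
  have hkk : -(k ^ 2 - k + 1) ≠ 0 := by
    intro e
    have e1 : ζ ^ 2 + ζ + 1 = 0 := by
      linear_combination -(ζ + 1) ^ 2 * e - (k * (ζ + 1) + ζ - (ζ + 1)) * hkζ
    exact hζ6 (by linear_combination (ζ ^ 4 - ζ ^ 3 + ζ - 1) * e1)
  have hdet : ∀ d, (Ψ d).det = 1 := by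
    have hdx : (Ψ ⟨x, hxD⟩).det = 1 := by
      rw [hΨx, det_fin_two_of]; ring
    refine forall_of_closure_eq_top hgen (by simp) (fun a b ha hb => ?_) ?_
    · rw [map_mul, det_mul, ha, hb, one_mul]
    · rintro a (rfl | rfl)
      · exact hdx
      · have := congrArg det hΨg
        rw [map_mul, det_mul, hdx, one_mul, det_fin_two_of, mul_inv_cancel₀ hζ] at this
        simpa using this
  -- The kernel centralizes `D`, and `L = D C`. An element of the intersection acts as a scalar of
  -- determinant one in dimension two, so its square is trivial.
  let C : Subgroup L := φ.ker
  have hDC : ∀ d ∈ D, ∀ c ∈ C, d * c = c * d := by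
    intro d hd c hc
    have hle : D ≤ Subgroup.centralizer {c} := by
      rw [Subgroup.closure_le]
      rintro s (rfl | rfl) <;> rw [SetLike.mem_coe, Subgroup.mem_centralizer_singleton_iff]
      · have := hker c hc s hx
        rw [mul_inv_eq_iff_eq_mul] at this; exact this.symm
      · have := hker c hc s hu
        rw [mul_inv_eq_iff_eq_mul] at this; exact this.symm
    exact Subgroup.mem_centralizer_singleton_iff.1 (hle hd)
  have hint : ∀ c (hc : c ∈ D), c ∈ C → c ^ 2 = 1 := by
    intro c hc hcC
    have hcom : ∀ d : D, Ψ ⟨c, hc⟩ * Ψ d = Ψ d * Ψ ⟨c, hc⟩ := fun d => by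
      rw [← map_mul, ← map_mul]
      congr 1
      exact Subtype.ext (hDC d d.2 c hcC).symm
    have c1 := hcom (⟨x, hxD⟩ * ⟨u, huD⟩)
    have c2 := hcom ⟨x, hxD⟩
    have hd := hdet ⟨c, hc⟩
    rw [hΨg] at c1
    rw [hΨx] at c2
    have hM : Ψ ⟨c, hc⟩ * Ψ ⟨c, hc⟩ = 1 := by
      generalize Ψ ⟨c, hc⟩ = M at c1 c2 hd
      have hzz : ζ - ζ⁻¹ ≠ 0 := by
        intro e
        refine hζ2 ?_
        have : ζ⁻¹ * ζ = 1 := inv_mul_cancel₀ hζ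
        linear_combination ζ * e + this
      have e01 : M 0 1 = 0 := by
        have := congrFun (congrFun c1 0) 1
        simp [Matrix.mul_apply, Fin.sum_univ_two] at this
        exact (mul_eq_zero.1 (show (ζ - ζ⁻¹) * M 0 1 = 0 by linear_combination -this)).resolve_left hzz
      have e10 : M 1 0 = 0 := by
        have := congrFun (congrFun c1 1) 0
        simp [Matrix.mul_apply, Fin.sum_univ_two] at this
        exact (mul_eq_zero.1 (show (ζ - ζ⁻¹) * M 1 0 = 0 by linear_combination this)).resolve_left hzz
      have e11 : M 1 1 = M 0 0 := by
        have := congrFun (congrFun c2 1) 0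
        simp [Matrix.mul_apply, Fin.sum_univ_two, e10] at this
        exact this
      rw [det_fin_two, e01, e10, e11] at hd
      ext i j
      fin_cases i <;> fin_cases j <;> simp [Matrix.mul_apply, Fin.sum_univ_two, e01, e10, e11] <;>
        linear_combination hd
    rw [← map_mul, ← map_one Ψ] at hM
    rw [pow_two]
    exact congrArg Subtype.val (hΨ hM)
  have hcard : 4 ∣ Nat.card D := by
    have h1 : Nat.card (alternatingGroup (Fin 5)) = 60 := by
      rw [nat_card_alternatingGroup, Nat.card_fin]; rfl
    have h2 := Subgroup.card_dvd_of_le hDmap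
    rw [h1] at h2
    exact (Dvd.intro _ (by norm_num : 4 * 15 = 60)).trans (h2.trans (Subgroup.card_map_dvd D φ))
  obtain ⟨⟨j, hjD⟩, hj⟩ := hkΨ.exists_orderOf_four hcard
  rw [Subgroup.orderOf_mk] at hj
  have hj4 : j ^ 4 = 1 := hj ▸ pow_orderOf_eq_one j
  have hz : orderOf (j ^ 2) = 2 := by
    rw [orderOf_pow' j (by norm_num), hj]; rfl
  have hzD : j ^ 2 ∈ D := pow_mem hjD 2
  -- The involution is central in `L`, so its image is central in the alternating group of degree
  -- five.
  have hφz : φ (j ^ 2) = 1 := by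
    have h1 : (⟨φ (j ^ 2), halt _⟩ : alternatingGroup (Fin 5)) ∈
        Subgroup.center (alternatingGroup (Fin 5)) := by
      rw [Subgroup.mem_center_iff]
      rintro ⟨τ, hτ⟩
      obtain ⟨g, rfl⟩ := hrange hτ
      apply Subtype.ext
      change φ g * φ (j ^ 2) = φ (j ^ 2) * φ g
      rw [← map_mul, hkL.commute_of_orderOf_two hz, map_mul]
    rw [alternatingGroup.center_eq_bot (by rw [Nat.card_fin]; norm_num), Subgroup.mem_bot] at h1
    exact congrArg Subtype.val h1
  have hzC : j ^ 2 ∈ C := hφz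
  have hinv : ∀ {c : L}, c ^ 2 = 1 → c = 1 ∨ c = j ^ 2 := by
    intro c hc
    by_cases hc1 : c = 1
    · exact Or.inl hc1
    · exact Or.inr (hkL.eq_of_orderOf_two hz (orderOf_eq_prime hc hc1))
  -- An element `c` of order four in `C` has the same square as `j`, so `(j c)² = 1` and `j c` lies
  -- in `D`. Then `c` lies in `D ∩ C`, where squares are trivial.
  have hC4 : ¬ 4 ∣ Nat.card C := by
    intro h4C
    obtain ⟨⟨c, hcC⟩, hc⟩ := (hkL.comp C.subtype_injective).exists_orderOf_four h4C
    rw [Subgroup.orderOf_mk] at hc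
    have hc2 : orderOf (c ^ 2) = 2 := by
      rw [orderOf_pow' c (by norm_num), hc]; rfl
    have e1 : c ^ 2 = j ^ 2 := hkL.eq_of_orderOf_two hz hc2
    have e2 : (j * c) ^ 2 = 1 := by
      rw [(show Commute j c from hDC j hjD c hcC).mul_pow, e1, ← pow_add]
      exact hj4
    have hcD : c ∈ D := by
      have hjc : j * c ∈ D := by
        rcases hinv e2 with e | e
        · rw [e]; exact one_mem D
        · rw [e]; exact hzD
      have := mul_mem (inv_mem hjD) hjc
      rwa [inv_mul_cancel_left] at this
    have e3 := orderOf_dvd_of_pow_eq_one (hint c hcD hcC)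
    rw [hc] at e3
    norm_num at e3
  -- The involution generates a Sylow `2`-subgroup of `C` and is central, so Burnside's transfer
  -- provides a linear character of `C` that takes the value `-1` on it.
  obtain ⟨l, hl⟩ : ∃ l : C →* ℂˣ, l ⟨j ^ 2, hzC⟩ ≠ 1 := by
    have : Fact (Nat.Prime 2) := ⟨Nat.prime_two⟩
    have hzo : orderOf (⟨j ^ 2, hzC⟩ : C) = 2 := by rw [Subgroup.orderOf_mk, hz]
    have hzcard : Nat.card (Subgroup.zpowers (⟨j ^ 2, hzC⟩ : C)) = 2 ^ (Nat.card C).factorization 2 := by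
      rw [Nat.card_zpowers, hzo]
      have h2C : 2 ∣ Nat.card C := hzo ▸ orderOf_dvd_natCard _
      have h1 : (Nat.card C).factorization 2 = 1 := by
        have h1 : 1 ≤ (Nat.card C).factorization 2 :=
          (Nat.prime_two.dvd_iff_one_le_factorization Nat.card_pos.ne').1 h2C
        have h2 : ¬ 2 ≤ (Nat.card C).factorization 2 := fun h2 =>
          hC4 ((Nat.prime_two.pow_dvd_iff_le_factorization Nat.card_pos.ne').2 h2)
        lia
      rw [h1, pow_one]
    let P := Sylow.ofCard _ hzcard
    refine exists_hom_apply_ne_one_of_sylow P ?_ (x := ⟨j ^ 2, hzC⟩)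
      (Subgroup.mem_zpowers _) (fun e => ?_)
    · intro g _
      rw [Subgroup.mem_centralizer_iff]
      rintro a ⟨m, rfl⟩
      have hcom : Commute (⟨j ^ 2, hzC⟩ : C) g :=
        Subtype.ext (hkL.commute_of_orderOf_two hz g.1).symm
      exact hcom.zpow_left m
    · rw [e, orderOf_one] at hzo; norm_num at hzo
  have hlz : (l ⟨j ^ 2, hzC⟩ : ℂ) = -1 := by
    have h1 : l ⟨j ^ 2, hzC⟩ ^ 2 = 1 := by
      rw [← map_pow, ← map_one l]
      congr 1
      apply Subtype.ext
      change (j ^ 2) ^ 2 = 1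
      rw [← pow_mul]
      exact hj4
    have h2 : (l ⟨j ^ 2, hzC⟩ : ℂ) ^ 2 = 1 := by
      rw [← Units.val_pow_eq_pow_val, h1, Units.val_one]
    exact (mul_self_eq_one_iff.1 ((pow_two _).symm.trans h2)).resolve_left fun e => hl (Units.ext e)
  -- The symmetric cube on `D` and the scalars `l` on `C` both send the involution to `-1`, so they
  -- glue to a representation of `L` of degree four.
  let α : D →* (Matrix (Fin 4) (Fin 4) ℂ)ˣ := MonoidHom.toHomUnits (symCube.comp Ψ)
  let β : C →* (Matrix (Fin 4) (Fin 4) ℂ)ˣ :=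
    (Units.map (algebraMap ℂ (Matrix (Fin 4) (Fin 4) ℂ)).toMonoidHom).comp l
  have hα : ∀ d, (α d : Matrix (Fin 4) (Fin 4) ℂ) = symCube (Ψ d) := fun _ => rfl
  have hβ : ∀ c, (β c : Matrix (Fin 4) (Fin 4) ℂ) = algebraMap ℂ _ (l c : ℂ) := fun _ => rfl
  have hαz : (α ⟨j ^ 2, hzD⟩ : Matrix (Fin 4) (Fin 4) ℂ) = -1 := by
    rw [hα, hkΨ.apply_of_orderOf_two (by rw [Subgroup.orderOf_mk, hz]), symCube_neg_one]
  obtain ⟨R, hRD, -⟩ := exists_hom_of_commuting_subgroups hDC (fun g => by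
      obtain ⟨d, hd, e⟩ := hDmap (halt g)
      refine ⟨d, hd, d⁻¹ * g, ?_, by group⟩
      rw [MonoidHom.mem_ker, map_mul, map_inv, e, inv_mul_cancel]) α β
    (fun d c => Units.ext (by
      rw [Units.val_mul, Units.val_mul, hβ]
      exact (Algebra.commutes _ _).symm))
    (fun g hd hc => by
      rcases hinv (hint g hd hc) with rfl | rfl
      · exact (map_one α).trans (map_one β).symm
      · refine Units.ext ?_
        rw [hαz, hβ, hlz, map_neg, map_one])
  let τ : Representation ℂ L (Fin 4 → ℂ) :=
    ((Matrix.toLinAlgEquiv' : Matrix (Fin 4) (Fin 4) ℂ ≃ₐ[ℂ] _) : _ →* _).comp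
      ((Units.coeHom _).comp R)
  have hτ : ∀ g f, τ g f = (R g : Matrix (Fin 4) (Fin 4) ℂ) *ᵥ f := fun g f =>
    Matrix.toLinAlgEquiv'_apply _ _
  have hirr : τ.IsIrreducible := by
    refine Representation.isIrreducible_of_forall fun S hS hne => ?_
    refine symCube_irreducible (d := k - 1) hk0 hkk one_ne_zero hζ hζ4 hζ6 S (fun f hf => ?_)
      (fun f hf => ?_) hne
    · have := hS (x * u) f hf
      rw [hτ] at this
      have e := hRD (⟨x, hxD⟩ * ⟨u, huD⟩)
      rw [Subgroup.coe_mul] at e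
      rwa [e, hα, hΨg] at this
    · have := hS x f hf
      rw [hτ] at this
      have e := hRD ⟨x, hxD⟩
      rwa [e, hα, hΨx] at this
  have hone : τ.character 1 = 4 := by simp
  have hchz : τ.character (j ^ 2) = -4 := by
    have e1 : τ (j ^ 2) = -1 := by
      refine LinearMap.ext fun f => ?_
      rw [hτ, hRD ⟨j ^ 2, hzD⟩, hαz, neg_mulVec, one_mulVec]
      rfl
    change LinearMap.trace ℂ _ (τ (j ^ 2)) = -4
    rw [e1, map_neg, LinearMap.trace_one]
    simp
  -- The sum-zero permutation character also has degree four, but it is `4` at the involution, which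
  -- acts trivially, while the glued character is `-4`.
  have hfinal := h _ _ (IsIrrChar.standard (by norm_num) φ hrange) (IsIrrChar.of_rep hirr)
    (by norm_num) (by rw [hone]; norm_num) (j ^ 2) 4 (by rw [hφz]; norm_num)
  rw [hchz] at hfinal
  norm_num at hfinal

/-- Under `RationalValuesAgree` there is at most one subgroup of order three. -/
theorem RationalValuesAgree.eq_or_eq_inv_of_orderOf_three {L n : Type*} [Group L] [Finite L]
    [Fintype n] [DecidableEq n] {ρ : L →* Matrix n n ℝ} (hρ : IsFixedPointFreeRep ρ)
    (h : RationalValuesAgree L) {x y : L} (hx : orderOf x = 3) (hy : orderOf y = 3) :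
    y = x ∨ y = x⁻¹ := by
  by_contra! hcon
  obtain ⟨a, b, hab⟩ := hρ.exists_adj hx hy hcon.1 hcon.2
  by_cases hall : ∀ u, orderOf u = 3 → u ∈ IsFixedPointFreeRep.doubleLine a b
  · obtain ⟨φ, hφ⟩ := hρ.exists_hom_perm_four hab hall
    refine h.false_of_perm_four φ hφ fun p hp => ?_
    obtain ⟨w, hw, -⟩ := hρ.exists_eq_doubleLine ⟨a, b, hab, rfl⟩ (hall p hp)
    exact hw.exists_isIrrChar hρ
  · push Not at hall
    obtain ⟨u, hu, hu'⟩ := hall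
    obtain ⟨φ, hφ, hker⟩ := hρ.exists_hom_perm_five hab hu hu'
    exact h.false_of_perm_five hρ φ hφ hker

/-! ### Lifting idempotents modulo powers of `q`. -/

section Divisibility

variable {A : Type*} [Ring A]

theorem natCast_pow_dvd_mul_left {q m : ℕ} {y : A} (h : (q : A) ^ m ∣ y) (a : A) :
    (q : A) ^ m ∣ a * y := by
  obtain ⟨c, rfl⟩ := h
  refine ⟨a * c, ?_⟩
  rw [← mul_assoc, ← mul_assoc, ((Nat.cast_commute q a).pow_left m).eq]

theorem natCast_pow_dvd_of_coprime {q m p : ℕ} (hpq : p.Coprime q) {y : A}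
    (h : (q : A) ^ m ∣ (p : A) * y) : (q : A) ^ m ∣ y := by
  have h1 := Nat.gcd_eq_gcd_ab p (q ^ m)
  rw [(hpq.pow_right m).gcd_eq_one] at h1
  have h2 : y = (p.gcdA (q ^ m) : A) * ((p : A) * y) + (q : A) ^ m * ((p.gcdB (q ^ m) : A) * y) := by
    have := congrArg (fun z : ℤ => (z : A) * y) h1
    push_cast at this
    rw [one_mul] at this
    nth_rewrite 1 [this]
    rw [add_mul, (Nat.cast_commute p _).eq, mul_assoc, mul_assoc]
  rw [h2]
  exact dvd_add (natCast_pow_dvd_mul_left h _) (dvd_mul_right _ _)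

/-- Idempotents modulo `q` lift to idempotents modulo powers of `q`. -/
theorem exists_idempotent_lift {q : ℕ} {e₀ : A} (h : (q : A) ∣ e₀ * e₀ - e₀) (m : ℕ) :
    ∃ e : A, (q : A) ^ (m + 1) ∣ e * e - e ∧ (q : A) ∣ e - e₀ := by
  induction m with
  | zero => exact ⟨e₀, by simpa using h, by simp⟩
  | succ m ih =>
    obtain ⟨e, he, he0⟩ := ih
    -- The Newton step for idempotents: the new error is a multiple of the square of `e² - e`.
    refine ⟨3 * (e * e) - 2 * (e * e * e), ?_, ?_⟩
    · have : (3 * (e * e) - 2 * (e * e * e)) * (3 * (e * e) - 2 * (e * e * e)) -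
          (3 * (e * e) - 2 * (e * e * e)) = (e * e - e) * ((e * e - e) * (4 * (e * e) - 4 * e - 3)) := by
        noncomm_ring
      rw [this]
      obtain ⟨c, hc⟩ := he
      have h2 : (q : A) ∣ (e * e - e) * (4 * (e * e) - 4 * e - 3) :=
        (dvd_trans (dvd_pow_self _ (by lia)) ⟨c, hc⟩).mul_right _
      obtain ⟨d, hd⟩ := h2
      rw [hd, hc, pow_succ]
      refine ⟨c * d, ?_⟩
      rw [mul_assoc, ← mul_assoc c, ← (Nat.cast_commute q c).eq]
      simp only [mul_assoc]
    · have : 3 * (e * e) - 2 * (e * e * e) - e₀ = (e * e - e) * (1 - 2 * e) + (e - e₀) := by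
        noncomm_ring
      rw [this]
      exact dvd_add ((dvd_trans (dvd_pow_self _ (by lia)) he).mul_right _) he0

/-- If `t` is a multiple of an idempotent by a number prime to `q` and `t A e` vanishes modulo `q`,
then it vanishes modulo every power of `q` modulo which `e` is idempotent. -/
theorem natCast_pow_dvd_mul_mul {q p m : ℕ} (hpq : p.Coprime q) {t e : A}
    (ht : t * t = (p : A) * t) (he : (q : A) ^ m ∣ e * e - e) (h : ∀ a, (q : A) ∣ t * a * e) (a : A) :
    (q : A) ^ m ∣ t * a * e := by
  have key : ∀ i ≤ m, ∀ a, (q : A) ^ i ∣ t * a * e := by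
    intro i
    induction i with
    | zero => intro _ a; simp
    | succ i ih =>
      intro hi a
      apply natCast_pow_dvd_of_coprime hpq
      obtain ⟨y, hy⟩ := h a
      -- Writing `t a e = q y` and `t a e = t a e² - t a (e² - e)`, multiplication by `t` gains a
      -- factor `q` in the first term by induction, and the second is divisible by assumption.
      have h1 : (p : A) * (t * a * e) = t * ((q : A) * (y * e)) - t * (t * a * (e * e - e)) := by
        have : t * a * (e * e - e) = t * a * e * e - t * a * e := by noncomm_ring
        rw [this, hy, mul_sub, mul_assoc (q : A), sub_sub_cancel, ← hy, ← mul_assoc, ← mul_assoc, ← mul_assoc, ← mul_assoc, ht]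
      rw [h1]
      refine dvd_sub ?_ ?_
      · obtain ⟨c, hc⟩ := ih (by lia) y
        refine ⟨c, ?_⟩
        rw [← mul_assoc, ← (Nat.cast_commute q t).eq, mul_assoc, ← mul_assoc t, hc, ← mul_assoc,
          ← pow_succ']
      · exact natCast_pow_dvd_mul_left (natCast_pow_dvd_mul_left ((pow_dvd_pow _ hi).trans he) _) _
  exact key m le_rfl a

end Divisibility

/-! ### From characteristic `q` to the integral group ring. -/

section GroupAlgebra
open MonoidAlgebra

theorem coeff_nsmul_apply {L : Type*} (n : ℕ) (y : MonoidAlgebra ℤ L) (g : L) :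
    (n • y).coeff g = n • y.coeff g := by
  induction n with
  | zero => simp
  | succ n ih => rw [succ_nsmul, coeff_add, Finsupp.add_apply, ih, succ_nsmul]

variable {L : Type*} [Group L]

theorem natCast_dvd_iff_map_eq_zero {q : ℕ} {y : MonoidAlgebra ℤ L} :
    (q : MonoidAlgebra ℤ L) ∣ y ↔ mapRingHom L (Int.castRingHom (ZMod q)) y = 0 := by
  constructor
  · rintro ⟨c, rfl⟩
    rw [map_mul, map_natCast]
    have : ((q : ℕ) : MonoidAlgebra (ZMod q) L) = 0 := by
      rw [← map_natCast (algebraMap (ZMod q) (MonoidAlgebra (ZMod q) L)), ZMod.natCast_self, map_zero]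
    rw [this, zero_mul]
  · intro h
    have h1 : ∀ g, (q : ℤ) ∣ y.coeff g := by
      intro g
      rw [← ZMod.intCast_zmod_eq_zero_iff_dvd]
      have := congrArg (fun z => coeff z g) h
      simpa [mapRingHom] using this
    refine ⟨ofCoeff (y.coeff.mapRange (fun z => z / q) (by simp)), ?_⟩
    rw [← nsmul_eq_mul]
    ext g
    rw [coeff_nsmul_apply]
    rw [nsmul_eq_mul]
    exact (Int.mul_ediv_cancel' (h1 g)).symm

/-- A fixed point free module in characteristic `q` yields an idempotent in the group algebra that
is annihilated by the sums over subgroups of prime order. -/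
theorem exists_idempotent_of_killsPrimeSums [Finite L] {q : ℕ} [Fact q.Prime] {V : Type*}
    [AddCommGroup V] [Module (ZMod q) V] [Nontrivial V] {τ : Representation (ZMod q) L V}
    (hτ : KillsPrimeSums (A := Module.End (ZMod q) V) τ) (hq : ¬ q ∣ Nat.card L) :
    ∃ ε : MonoidAlgebra (ZMod q) L, ε ≠ 0 ∧ ε * ε = ε ∧ ∀ (g : L) (p : ℕ), p.Prime → orderOf g = p →
      ∀ a, (∑ i ∈ Finset.range p, of (ZMod q) L g ^ i) * a * ε = 0 := by
  have : NeZero (Nat.card L : ZMod q) := ⟨by rwa [Ne, ZMod.natCast_eq_zero_iff]⟩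
  obtain ⟨v, hv⟩ := exists_ne (0 : V)
  let Φ := τ.asAlgebraHom
  -- The annihilator of a nonzero vector is a proper left ideal. By Maschke it has a complement, and
  -- the component of `1` there is the idempotent. A prime sum times anything times `ε` lies in the
  -- complement, and in `J` as prime sums act by zero; so it vanishes.
  let J : Submodule (MonoidAlgebra (ZMod q) L) (MonoidAlgebra (ZMod q) L) :=
    { carrier := {a | Φ a v = 0}
      add_mem' := fun {a b} ha hb => by
        change Φ (a + b) v = 0
        rw [map_add, LinearMap.add_apply, show Φ a v = 0 from ha, show Φ b v = 0 from hb, add_zero]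
      zero_mem' := by change Φ 0 v = 0; rw [map_zero]; rfl
      smul_mem' := fun c a ha => by
        change Φ (c * a) v = 0
        rw [map_mul, Module.End.mul_apply, show Φ a v = 0 from ha, map_zero] }
  obtain ⟨J', hJ'⟩ := exists_isCompl J
  obtain ⟨j, hj, ε, hε, hsum⟩ := Submodule.mem_sup.1
    (hJ'.sup_eq_top ▸ Submodule.mem_top : (1 : MonoidAlgebra (ZMod q) L) ∈ J ⊔ J')
  have hzero : ∀ a, a ∈ J → a ∈ J' → a = 0 := fun a h1 h2 =>
    (Submodule.mem_bot _).1 (hJ'.inf_eq_bot ▸ Submodule.mem_inf.2 ⟨h1, h2⟩)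
  refine ⟨ε, ?_, ?_, ?_⟩
  · rintro rfl
    rw [add_zero] at hsum
    rw [hsum] at hj
    have : Φ 1 v = 0 := hj
    rw [map_one] at this
    exact hv this
  · have h1 : ε * j = ε - ε * ε := by
      rw [eq_sub_iff_add_eq, ← mul_add, hsum, mul_one]
    have h2 : ε * j = 0 := hzero _ (J.smul_mem ε hj) (by
      rw [h1]; exact J'.sub_mem hε (J'.smul_mem ε hε))
    rw [h2] at h1
    exact (sub_eq_zero.1 h1.symm).symm
  · intro g p hp hg a
    refine hzero _ ?_ (J'.smul_mem _ hε)
    change Φ _ v = 0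
    rw [map_mul, map_mul, map_sum]
    have := hτ g p hp hg
    have h2 : ∑ i ∈ Finset.range p, Φ (of (ZMod q) L g ^ i) = 0 := by
      rw [← this]
      refine Finset.sum_congr rfl fun i _ => ?_
      rw [map_pow]
      congr 1
      exact τ.asAlgebraHom_of g
    rw [h2, zero_mul, zero_mul]
    rfl

/-- The elements of the integral group ring that, up to a nonzero factor, lie in the two-sided ideal
generated by the sums over subgroups of prime order. -/
noncomputable def primeSumIdeal (L : Type*) [Group L] :
    Submodule (MonoidAlgebra ℤ L) (MonoidAlgebra ℤ L) where
  carrier := {y | ∃ N : ℕ, N ≠ 0 ∧ (N : MonoidAlgebra ℤ L) * y ∈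
    Submodule.span (MonoidAlgebra ℤ L) {y : MonoidAlgebra ℤ L | ∃ (g : L) (p : ℕ), p.Prime ∧
      orderOf g = p ∧ ∃ a, y = (∑ i ∈ Finset.range p, of ℤ L g ^ i) * a}}
  add_mem' := by
    rintro a b ⟨M, hM, ha⟩ ⟨N, hN, hb⟩
    refine ⟨M * N, mul_ne_zero hM hN, ?_⟩
    have : ((M * N : ℕ) : MonoidAlgebra ℤ L) * (a + b) =
        (N : MonoidAlgebra ℤ L) • ((M : MonoidAlgebra ℤ L) * a) +
          (M : MonoidAlgebra ℤ L) • ((N : MonoidAlgebra ℤ L) * b) := by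
      push_cast
      rw [smul_eq_mul, smul_eq_mul, mul_add, mul_assoc, mul_assoc, ← mul_assoc (N : MonoidAlgebra ℤ L) M,
        (Nat.cast_commute N (M : MonoidAlgebra ℤ L)).eq, mul_assoc]
    rw [this]
    exact Submodule.add_mem _ (Submodule.smul_mem _ _ ha) (Submodule.smul_mem _ _ hb)
  zero_mem' := ⟨1, one_ne_zero, by rw [mul_zero]; exact Submodule.zero_mem _⟩
  smul_mem' := by
    rintro c a ⟨M, hM, ha⟩
    refine ⟨M, hM, ?_⟩
    have : (M : MonoidAlgebra ℤ L) * (c • a) = c • ((M : MonoidAlgebra ℤ L) * a) := by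
      rw [smul_eq_mul, smul_eq_mul, ← mul_assoc, (Nat.cast_commute M c).eq, mul_assoc]
    rw [this]
    exact Submodule.smul_mem _ _ ha

theorem primeSum_mul_self {A : Type*} [Ring A] {x : A} {p : ℕ} (hx : x ^ p = 1) :
    (∑ i ∈ Finset.range p, x ^ i) * (∑ i ∈ Finset.range p, x ^ i) =
      (p : A) * ∑ i ∈ Finset.range p, x ^ i := by
  have h1 : x * (∑ i ∈ Finset.range p, x ^ i) = ∑ i ∈ Finset.range p, x ^ i := by
    have := mul_geom_sum x p
    rw [hx, sub_self, sub_mul, one_mul, sub_eq_zero] at this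
    exact this
  have h2 : ∀ i : ℕ, x ^ i * (∑ i ∈ Finset.range p, x ^ i) = ∑ i ∈ Finset.range p, x ^ i := by
    intro i
    induction i with
    | zero => rw [pow_zero, one_mul]
    | succ i ih => rw [pow_succ, mul_assoc, h1, ih]
  nth_rewrite 1 [Finset.sum_mul]
  rw [Finset.sum_congr rfl fun i _ => h2 i, Finset.sum_const, Finset.card_range, nsmul_eq_mul]

/-- If an integer `N` were a combination of prime sums, then `N e` would vanish modulo `q^(m+1)` for
a lift `e` of the idempotent modulo that power. As `e` has a coefficient prime to `q`, every power
of `q` would divide `N`. -/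
theorem one_notMem_primeSumIdeal [Finite L] {q : ℕ} [Fact q.Prime] (hq : ¬ q ∣ Nat.card L)
    {ε : MonoidAlgebra (ZMod q) L} (hε0 : ε ≠ 0) (hε : ε * ε = ε)
    (hkill : ∀ (g : L) (p : ℕ), p.Prime → orderOf g = p →
      ∀ a, (∑ i ∈ Finset.range p, of (ZMod q) L g ^ i) * a * ε = 0) :
    (1 : MonoidAlgebra ℤ L) ∉ primeSumIdeal L := by
  rintro ⟨N, hN, hmem⟩
  rw [mul_one] at hmem
  have hqp : q.Prime := Fact.out
  obtain ⟨e₀, rfl⟩ : ∃ e₀, mapRingHom L (Int.castRingHom (ZMod q)) e₀ = ε :=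
    MonoidAlgebra.map_surjective _ (fun z => ZMod.intCast_surjective z) ε
  have h0 : (q : MonoidAlgebra ℤ L) ∣ e₀ * e₀ - e₀ := by
    rw [natCast_dvd_iff_map_eq_zero, map_sub, map_mul, hε, sub_self]
  -- a coefficient of `e₀` prime to `q`
  obtain ⟨g, hg⟩ : ∃ g, ¬ (q : ℤ) ∣ e₀.coeff g := by
    by_contra! hcon
    refine hε0 ?_
    ext g
    have := (ZMod.intCast_zmod_eq_zero_iff_dvd (e₀.coeff g) q).2 (hcon g)
    simpa [mapRingHom] using this
  have key : ∀ m : ℕ, q ^ (m + 1) ∣ N := by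
    intro m
    obtain ⟨e, he, hee⟩ := exists_idempotent_lift h0 m
    have h1 : (q : MonoidAlgebra ℤ L) ^ (m + 1) ∣ (N : MonoidAlgebra ℤ L) * e := by
      generalize (N : MonoidAlgebra ℤ L) = y at hmem
      induction hmem using Submodule.span_induction with
      | mem y hy =>
        obtain ⟨x, p, hp, hx, a, rfl⟩ := hy
        refine natCast_pow_dvd_mul_mul ?_ (primeSum_mul_self ?_) he (fun b => ?_) a
        · refine (Nat.coprime_primes hp hqp).2 ?_
          rintro rfl
          exact hq (hx ▸ orderOf_dvd_natCard x)
        · rw [← map_pow, ← hx, pow_orderOf_eq_one, map_one]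
        · have h3 : (q : MonoidAlgebra ℤ L) ∣ (∑ i ∈ Finset.range p, of ℤ L x ^ i) * b * e₀ := by
            rw [natCast_dvd_iff_map_eq_zero, map_mul, map_mul, map_sum, ← hkill x p hp hx
              (mapRingHom L (Int.castRingHom (ZMod q)) b)]
            congr 2
            refine Finset.sum_congr rfl fun i _ => ?_
            rw [map_pow]
            simp [of_apply]
          have h4 := natCast_pow_dvd_mul_left (m := 1) (by simpa using hee)
            ((∑ i ∈ Finset.range p, of ℤ L x ^ i) * b)
          rw [pow_one] at h4
          have h5 := dvd_add h4 h3
          rwa [← mul_add, sub_add_cancel] at h5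
      | zero => rw [zero_mul]; exact dvd_zero _
      | add a b _ _ ha hb => rw [add_mul]; exact dvd_add ha hb
      | smul c a _ ha => rw [smul_eq_mul, mul_assoc]; exact natCast_pow_dvd_mul_left ha c
    obtain ⟨c, hc⟩ := h1
    have h2 := congrArg (fun z => coeff z g) hc
    simp only [← Nat.cast_pow, ← nsmul_eq_mul, coeff_nsmul_apply] at h2
    simp only [nsmul_eq_mul] at h2
    have h3 : ¬ (q : ℤ) ∣ e.coeff g := by
      intro h4
      obtain ⟨c', hc'⟩ := hee
      have h5 := congrArg (fun z => coeff z g) hc'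
      simp only [← nsmul_eq_mul, coeff_nsmul_apply, coeff_sub, Finsupp.sub_apply] at h5
      rw [nsmul_eq_mul] at h5
      refine hg ?_
      have h6 : e₀.coeff g = e.coeff g - q * c'.coeff g := by rw [← h5]; ring
      rw [h6]
      exact dvd_sub h4 (dvd_mul_right _ _)
    have h4 : IsCoprime ((q ^ (m + 1) : ℕ) : ℤ) (e.coeff g) := by
      rw [Nat.cast_pow]
      exact ((Nat.prime_iff_prime_int.1 hqp).coprime_iff_not_dvd.2 h3).pow_left
    exact Int.natCast_dvd_natCast.1 (h4.dvd_of_dvd_mul_right ⟨_, h2⟩)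
  have := Nat.le_of_dvd (Nat.pos_of_ne_zero hN) (key N)
  have h2 : N < q ^ N := Nat.lt_pow_self hqp.one_lt
  have h3 : q ^ N ≤ q ^ (N + 1) := Nat.pow_le_pow_right hqp.pos (Nat.le_succ N)
  omega

end GroupAlgebra

/-! ### Traces of fixed point free integral representations. -/

/-- A class function on a finite group that is constant on generators of cyclic subgroups and whose
sums over nontrivial cyclic subgroups vanish is given by the Möbius function. -/
theorem eq_moebius_div_totient {L : Type*} [Group L] [Finite L] {T : L → ℝ} (h1 : T 1 = 1)
    (hpow : ∀ (g : L) (a : ℕ), (orderOf g).Coprime a → T (g ^ a) = T g)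
    (hsum : ∀ g : L, g ≠ 1 → ∑ i ∈ Finset.range (orderOf g), T (g ^ i) = 0) (g : L) :
    T g = (ArithmeticFunction.moebius (orderOf g) : ℝ) / Nat.totient (orderOf g) := by
  induction hk : orderOf g using Nat.strong_induction_on generalizing g with
  | _ k ih =>
  subst hk
  by_cases hg : g = 1
  · simp [hg, h1]
  set k := orderOf g with hk
  have hk0 : 0 < k := orderOf_pos g
  have hφ : (Nat.totient k : ℝ) ≠ 0 := by exact_mod_cast (Nat.totient_pos.2 hk0).ne'
  -- Powers of `g` are grouped by the gcd of the exponent with the order. Induction handles every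
  -- group except the generators, whose unknown common value is kept in the correction at `d = 1`;
  -- the Möbius values themselves sum to zero.
  have hfib : ∀ d ∈ k.divisors, ∑ i ∈ Finset.range k with k.gcd i = d, T (g ^ i) =
      (ArithmeticFunction.moebius (k / d) : ℝ) + if d = 1 then Nat.totient k * T g -
        (ArithmeticFunction.moebius k : ℝ) else 0 := by
    intro d hd
    have hdk := Nat.dvd_of_mem_divisors hd
    have hcard := Nat.totient_div_of_dvd hdk
    split_ifs with h
    · subst h
      rw [Finset.sum_congr rfl fun i hi => hpow g i (Finset.mem_filter.1 hi).2, Finset.sum_const,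
        ← hcard, Nat.div_one, nsmul_eq_mul]
      ring
    · have hd0 : 0 < d := Nat.pos_of_mem_divisors hd
      have hlt : k / d < k := Nat.div_lt_self hk0 (by omega)
      have hpos : 0 < k / d := Nat.div_pos (Nat.le_of_dvd hk0 hdk) hd0
      have hφ' : (Nat.totient (k / d) : ℝ) ≠ 0 := by exact_mod_cast (Nat.totient_pos.2 hpos).ne'
      rw [Finset.sum_congr rfl fun i hi => ih (k / d) hlt (g ^ i) (by
        rw [orderOf_pow, ← hk, (Finset.mem_filter.1 hi).2]), Finset.sum_const, ← hcard,
        nsmul_eq_mul, mul_div_cancel₀ _ hφ', add_zero]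
  have htot := hsum g hg
  rw [← Finset.sum_fiberwise_of_maps_to (g := fun i => k.gcd i) (t := k.divisors)
    (fun i _ => Nat.mem_divisors.2 ⟨Nat.gcd_dvd_left k i, hk0.ne'⟩), Finset.sum_congr rfl hfib,
    Finset.sum_add_distrib, Finset.sum_ite_eq' , if_pos (Nat.one_mem_divisors.2 hk0.ne')] at htot
  have hmu : ∑ d ∈ k.divisors, (ArithmeticFunction.moebius (k / d) : ℝ) = 0 := by
    rw [Nat.sum_div_divisors k (fun d => (ArithmeticFunction.moebius d : ℝ))]
    have h2 := ArithmeticFunction.coe_mul_zeta_apply (f := ArithmeticFunction.moebius) (x := k)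
    rw [ArithmeticFunction.moebius_mul_coe_zeta, ArithmeticFunction.one_apply_ne
      (by rwa [hk, Ne, orderOf_eq_one_iff])] at h2
    exact_mod_cast h2.symm
  rw [hmu, zero_add, sub_eq_zero] at htot
  rw [eq_div_iff hφ, mul_comm, htot]

/-- The full sum absorbs powers of `g`, so multiplying it by a prime sum, which is zero, gives `p`
times itself. -/
theorem KillsPrimeSums.sum_pow_eq_zero {L A : Type*} [Group L] [Finite L] [Ring A]
    [IsAddTorsionFree A] {σ : L →* A} (h : KillsPrimeSums σ) {g : L} (hg : g ≠ 1) :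
    ∑ i ∈ Finset.range (orderOf g), σ g ^ i = 0 := by
  obtain ⟨p, hp, hd⟩ := Nat.exists_prime_and_dvd (n := orderOf g) (by rwa [Ne, orderOf_eq_one_iff])
  have h2 := h _ p hp (orderOf_pow_orderOf_div (orderOf_pos g).ne' hd)
  set S := ∑ i ∈ Finset.range (orderOf g), σ g ^ i
  have h1 : σ g * S = S := by
    have := mul_geom_sum (σ g) (orderOf g)
    rw [← map_pow, pow_orderOf_eq_one, map_one, sub_self, sub_mul, one_mul, sub_eq_zero] at this
    exact this
  have h3 : ∀ i : ℕ, σ g ^ i * S = S := by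
    intro i
    induction i with
    | zero => rw [pow_zero, one_mul]
    | succ i ih => rw [pow_succ, mul_assoc, h1, ih]
  have h4 := congrArg (· * S) h2
  simp only [Finset.sum_mul, map_pow, ← pow_mul, h3, Finset.sum_const, Finset.card_range,
    zero_mul] at h4
  exact (smul_eq_zero_iff_right hp.ne_zero).1 h4

/-- By Dirichlet the exponent may be replaced by a prime `r` congruent to `a` and exceeding the
difference of the two integer traces. Modulo `r` the trace of an `r`-th power is the `r`-th power of
the trace, which is the trace. -/
theorem trace_apply_pow_of_coprime {L ι : Type*} [Group L] [Finite L] [Fintype ι] [DecidableEq ι]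
    (R : L →* Matrix ι ι ℤ) (g : L) {a : ℕ}
    (ha : (orderOf g).Coprime a) : (R (g ^ a)).trace = (R g).trace := by
  have : NeZero (orderOf g) := ⟨(orderOf_pos g).ne'⟩
  obtain ⟨r, hr, hrp, hra⟩ := Nat.forall_exists_prime_gt_and_eq_mod
    ((ZMod.isUnit_iff_coprime a (orderOf g)).2 ha.symm)
    ((R (g ^ a)).trace - (R g).trace).natAbs
  have := Fact.mk hrp
  have h1 : g ^ a = g ^ r := by
    rw [pow_eq_pow_iff_modEq]
    exact ((ZMod.natCast_eq_natCast_iff _ _ _).1 hra).symm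
  have h2 := ZMod.trace_pow_card ((R g).map (Int.castRingHom (ZMod r)))
  have h3 : (((R (g ^ r)).trace : ℤ) : ZMod r) = ((R g).trace : ℤ) := by
    have e : ∀ M : Matrix ι ι ℤ, ((M.trace : ℤ) : ZMod r) =
        (M.map (Int.castRingHom (ZMod r))).trace := by
      intro M
      simp [Matrix.trace]
    rw [e, map_pow, e, Matrix.map_pow, h2]
    rw [← e]
    exact ZMod.pow_card _
  rw [h1] at hr ⊢
  have h4 := (ZMod.intCast_eq_intCast_iff_dvd_sub _ _ _).1 h3.symm
  exact sub_eq_zero.1 (Int.eq_zero_of_abs_lt_dvd h4 (by rw [Int.abs_eq_natAbs]; exact_mod_cast hr))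

/-! ### Integral and orthogonal models. -/

section IntegralRep
open MonoidAlgebra

/-- The ideal is saturated, so the quotient of the integral group ring is torsion-free and hence a
lattice. It is nonzero because `1` is not in the ideal, and prime sums act on it by zero. -/
theorem exists_int_rep {L : Type*} [Group L] [Finite L]
    (h1 : (1 : MonoidAlgebra ℤ L) ∉ primeSumIdeal L) :
    ∃ (m : ℕ) (R : L →* Matrix (Fin m) (Fin m) ℤ), m ≠ 0 ∧ KillsPrimeSums R := by
  let V := MonoidAlgebra ℤ L ⧸ primeSumIdeal L
  have hfin : Module.Finite ℤ V := Module.Finite.trans (MonoidAlgebra ℤ L) V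
  have htf : Module.IsTorsionFree ℤ V := by
    refine Module.IsTorsionFree.mk fun n hn v w hvw => ?_
    have hn0 : n ≠ 0 := hn.ne_zero
    obtain ⟨v, rfl⟩ := Submodule.Quotient.mk_surjective _ v
    obtain ⟨w, rfl⟩ := Submodule.Quotient.mk_surjective _ w
    rw [Submodule.Quotient.eq]
    have h2 : n • (v - w) ∈ primeSumIdeal L := by
      rw [← Submodule.Quotient.mk_eq_zero]
      have : n • (Submodule.Quotient.mk v : V) = n • (Submodule.Quotient.mk w : V) := hvw
      rw [smul_sub, Submodule.Quotient.mk_sub]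
      exact sub_eq_zero.2 this
    obtain ⟨N, hN, hmem⟩ := h2
    refine ⟨N * n.natAbs, mul_ne_zero hN (Int.natAbs_ne_zero.2 hn0), ?_⟩
    have h3 : ((N * n.natAbs : ℕ) : MonoidAlgebra ℤ L) * (v - w) =
        (n.sign : MonoidAlgebra ℤ L) • ((N : MonoidAlgebra ℤ L) * (n • (v - w))) := by
      have h4 : ((n.natAbs : ℕ) : MonoidAlgebra ℤ L) = (n.sign : MonoidAlgebra ℤ L) * n := by
        rw [← Int.cast_mul, Int.sign_mul_self_eq_abs, Int.abs_eq_natAbs, Int.cast_natCast]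
      rw [Nat.cast_mul, h4, smul_eq_mul, zsmul_eq_mul, ← mul_assoc, ← mul_assoc, ← mul_assoc,
        (Nat.cast_commute N (n.sign : MonoidAlgebra ℤ L)).eq]
    rw [h3]
    exact Submodule.smul_mem _ _ hmem
  obtain ⟨m, b⟩ := Module.basisOfFiniteTypeTorsionFree' (R := ℤ) (M := V)
  obtain ⟨Ψ, hΨ⟩ : ∃ Ψ : MonoidAlgebra ℤ L →+* Matrix (Fin m) (Fin m) ℤ,
      ∀ a, (∀ v : V, a • v = 0) → Ψ a = 0 :=
    ⟨((LinearMap.toMatrixAlgEquiv b).toAlgHom.comp (Algebra.lsmul ℤ ℤ V)).toRingHom, fun a ha => by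
      change LinearMap.toMatrixAlgEquiv b (Algebra.lsmul ℤ ℤ V a) = 0
      rw [show Algebra.lsmul ℤ ℤ V a = 0 from LinearMap.ext ha, map_zero]⟩
  refine ⟨m, Ψ.toMonoidHom.comp (of ℤ L), ?_, ?_⟩
  · rintro rfl
    have : Subsingleton V := b.repr.toEquiv.subsingleton
    exact h1 ((Submodule.Quotient.mk_eq_zero _).1 (Subsingleton.elim (α := V) _ 0))
  · intro g p hp hg
    have h2 : ∑ i ∈ Finset.range p, Ψ (of ℤ L g) ^ i =
        Ψ (∑ i ∈ Finset.range p, of ℤ L g ^ i) := by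
      rw [map_sum]; simp only [map_pow]
    refine h2.trans (hΨ _ fun v => ?_)
    obtain ⟨v, rfl⟩ := Submodule.Quotient.mk_surjective _ v
    rw [← Submodule.Quotient.mk_smul, Submodule.Quotient.mk_eq_zero]
    exact ⟨1, one_ne_zero, by
      rw [Nat.cast_one, one_mul]; exact Submodule.subset_span ⟨g, p, hp, hg, v, rfl⟩⟩

end IntegralRep

open scoped MatrixOrder Matrix.Norms.L2Operator in
theorem exists_transpose_mul_self_eq {m : ℕ} {B : Matrix (Fin m) (Fin m) ℝ} (hB : B.PosSemidef) :
    ∃ S : Matrix (Fin m) (Fin m) ℝ, B = S.transpose * S := by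
  obtain ⟨S, hS⟩ := CStarAlgebra.nonneg_iff_eq_star_mul_self.mp hB.nonneg
  exact ⟨S, by rw [hS, Matrix.star_eq_conjTranspose, Matrix.conjTranspose_eq_transpose_of_trivial]⟩

open Matrix in
-- Averaging gives an invariant positive definite form `Sᵀ S`, and conjugation by `S` makes the
-- action orthogonal without changing traces. These come from integer matrices, hence are constant
-- on generators of cyclic subgroups, and vanishing prime sums determine them.
theorem exists_isFixedPointFreeRep_of_int {L : Type*} [Group L] [Finite L] {m : ℕ}
    {R : L →* Matrix (Fin m) (Fin m) ℤ} (hm : m ≠ 0) (hR : KillsPrimeSums R) :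
    ∃ ρ : L →* Matrix (Fin m) (Fin m) ℝ, IsFixedPointFreeRep ρ := by
  have := Fintype.ofFinite L
  have hne : Nonempty (Fin m) := ⟨⟨0, Nat.pos_of_ne_zero hm⟩⟩
  let R' : L →* Matrix (Fin m) (Fin m) ℝ :=
    ((Int.castRingHom ℝ).mapMatrix : Matrix (Fin m) (Fin m) ℤ →+* _).toMonoidHom.comp R
  have hR' : ∀ g, R' g = (R g).map (Int.castRingHom ℝ) := fun _ => rfl
  let B := ∑ g, (R' g)ᵀ * R' g
  have hpsd : B.PosSemidef := by
    refine Matrix.posSemidef_sum _ fun g _ => ?_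
    have := Matrix.posSemidef_conjTranspose_mul_self (R' g)
    rwa [Matrix.conjTranspose_eq_transpose_of_trivial] at this
  obtain ⟨S, hS⟩ := exists_transpose_mul_self_eq hpsd
  have hinv : ∀ g, (R' g)ᵀ * B * R' g = B := by
    intro g
    simp only [B, Finset.mul_sum, Finset.sum_mul]
    refine Fintype.sum_equiv (Equiv.mulRight g) _ _ fun h => ?_
    rw [Equiv.coe_mulRight, map_mul, transpose_mul]
    simp only [Matrix.mul_assoc]
  have hSinj : ∀ v, S *ᵥ v = 0 → v = 0 := by
    intro v hv
    have h1 : v ⬝ᵥ (B *ᵥ v) = 0 := by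
      rw [hS, ← mulVec_mulVec, hv, mulVec_zero, dotProduct_zero]
    have h2 : ∑ g, (R' g *ᵥ v) ⬝ᵥ (R' g *ᵥ v) = 0 := by
      rw [← h1, Matrix.sum_mulVec, dotProduct_sum]
      refine Finset.sum_congr rfl fun g _ => ?_
      rw [← mulVec_mulVec, dotProduct_mulVec v, vecMul_transpose]
    have h3 := (Finset.sum_eq_zero_iff_of_nonneg fun g _ =>
      Finset.sum_nonneg fun i _ => mul_self_nonneg _).1 h2 1 (Finset.mem_univ _)
    rw [map_one, one_mulVec] at h3
    exact dotProduct_self_eq_zero.1 h3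
  have hSu : IsUnit S := by
    rw [← Matrix.mulVec_injective_iff_isUnit]
    intro v w hvw
    exact sub_eq_zero.1 (hSinj _ (by rw [mulVec_sub]; exact sub_eq_zero.2 hvw))
  obtain ⟨T, hST, hTS⟩ := isUnit_iff_exists.1 hSu
  let ρ : L →* Matrix (Fin m) (Fin m) ℝ :=
    { toFun := fun g => S * R' g * T
      map_one' := by rw [map_one, Matrix.mul_one, hST]
      map_mul' := fun g h => by
        rw [map_mul, show S * R' g * T * (S * R' h * T) = S * R' g * (T * S) * R' h * T by
          simp only [Matrix.mul_assoc], hTS, Matrix.mul_one]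
        simp only [Matrix.mul_assoc] }
  have htr : ∀ g, ntr (ρ g) = (Fintype.card (Fin m) : ℝ)⁻¹ * ((R g).trace : ℤ) := by
    intro g
    rw [ntr_apply]
    congr 1
    change (S * R' g * T).trace = _
    rw [Matrix.trace_mul_comm, ← Matrix.mul_assoc, hTS, Matrix.one_mul, hR']
    simp [Matrix.trace]
  refine ⟨ρ, hne, fun g => ?_, eq_moebius_div_totient (T := fun g => ntr (ρ g)) ?_ ?_ ?_⟩
  · have h1 : (R' g)ᵀ * Sᵀ * S = Sᵀ * S * R' g⁻¹ := by
      rw [← hS, ← mul_one ((R' g)ᵀ * Sᵀ * S), ← map_one R', ← mul_inv_cancel g, map_mul,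
        Matrix.mul_assoc (R' g)ᵀ, ← hS, ← Matrix.mul_assoc, hinv g]
    have h2 : Tᵀ * Sᵀ = 1 := by rw [← transpose_mul, hST, transpose_one]
    change (S * R' g * T)ᵀ = S * R' g⁻¹ * T
    rw [transpose_mul, transpose_mul, ← Matrix.mul_one (Tᵀ * _), ← hST,
      show Tᵀ * ((R' g)ᵀ * Sᵀ) * (S * T) = Tᵀ * ((R' g)ᵀ * Sᵀ * S) * T by
        simp only [Matrix.mul_assoc], h1,
      show Tᵀ * (Sᵀ * S * R' g⁻¹) * T = (Tᵀ * Sᵀ) * (S * R' g⁻¹ * T) by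
        simp only [Matrix.mul_assoc], h2, Matrix.one_mul]
  · simp only [map_one, ntr_one]
  · intro g a ha
    simp only [htr, trace_apply_pow_of_coprime R g ha]
  · intro g hg
    simp only [htr]
    rw [← Finset.mul_sum, ← Int.cast_sum, ← Matrix.trace_sum]
    simp only [map_pow]
    have : IsAddTorsionFree (Matrix (Fin m) (Fin m) ℤ) :=
      inferInstanceAs (IsAddTorsionFree (Fin m → Fin m → ℤ))
    rw [hR.sum_pow_eq_zero hg]
    simp

/-- A finite group acting fixed point freely in coprime characteristic has an orthogonal
representation with the same property. -/
theorem exists_isFixedPointFreeRep {L : Type*} [Group L] [Finite L] {q : ℕ} [Fact q.Prime]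
    {V : Type*} [AddCommGroup V] [Module (ZMod q) V] [Nontrivial V]
    {τ : Representation (ZMod q) L V} (hτ : KillsPrimeSums (A := Module.End (ZMod q) V) τ)
    (hq : ¬ q ∣ Nat.card L) :
    ∃ (m : ℕ) (ρ : L →* Matrix (Fin m) (Fin m) ℝ), IsFixedPointFreeRep ρ := by
  obtain ⟨ε, hε0, hε, hkill⟩ := exists_idempotent_of_killsPrimeSums hτ hq
  obtain ⟨m, R, hm, hR⟩ := exists_int_rep (one_notMem_primeSumIdeal hq hε0 hε hkill)
  exact ⟨m, exists_isFixedPointFreeRep_of_int hm hR⟩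

/-! ### Subgroups of order `p²` and `p r`. -/

namespace KillsPrimeSums

variable {L A : Type*} [Group L] [Ring A] [CharZero A] {σ : L →* A}

/-- If `x` were not a power of `y`, the prime sums of all `x yⁱ` vanish. Adding them over `i`, the
identity contributes `p`, while the terms with exponent `j ≠ 0` contain the prime sum of `yʲ`; so
`p` would be zero. -/
theorem mem_zpowers_of_commute (h : KillsPrimeSums σ) {p : ℕ} (hp : p.Prime) {x y : L}
    (hx : orderOf x = p) (hy : orderOf y = p) (hxy : Commute x y) : x ∈ Subgroup.zpowers y := by
  by_contra hne
  have h1 : ∀ i : ℕ, ∑ j ∈ Finset.range p, σ (x * y ^ i) ^ j = 0 := by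
    intro i
    refine h _ p hp ?_
    have := Fact.mk hp
    refine orderOf_eq_prime ?_ ?_
    · rw [(hxy.pow_right i).mul_pow, ← hx, pow_orderOf_eq_one, hx, ← pow_mul, mul_comm i, pow_mul,
        ← hy, pow_orderOf_eq_one, one_pow, one_mul]
    · intro h2
      exact hne ⟨-(i : ℤ), by
        rw [eq_inv_of_mul_eq_one_left h2]; simp⟩
  have h2 : ∑ i ∈ Finset.range p, ∑ j ∈ Finset.range p, σ (x * y ^ i) ^ j = 0 :=
    Finset.sum_eq_zero fun i _ => h1 i
  rw [Finset.sum_comm, ← Finset.sum_erase_add _ _ (Finset.mem_range.2 hp.pos),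
    Finset.sum_eq_zero (s := (Finset.range p).erase 0), zero_add] at h2
  · simp only [pow_zero, Finset.sum_const, Finset.card_range, nsmul_eq_mul, mul_one,
      Nat.cast_eq_zero] at h2
    exact hp.ne_zero h2
  · intro j hj
    rw [Finset.mem_erase, Finset.mem_range] at hj
    have h3 := h (y ^ j) p hp (by
      rw [← hy]
      refine Nat.Coprime.orderOf_pow ?_
      rw [hy]
      exact Nat.coprime_of_lt_prime hj.1 hj.2 hp)
    have h4 : ∀ i ∈ Finset.range p, σ (x * y ^ i) ^ j = σ (x ^ j) * σ (y ^ j) ^ i := by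
      intro i _
      rw [← map_pow, (hxy.pow_right i).mul_pow, map_mul, ← map_pow, ← pow_mul, ← pow_mul,
        mul_comm i]
    rw [Finset.sum_congr rfl h4, ← Finset.mul_sum, h3, mul_zero]

/-- In a group with a fixed point free representation, an element of prime order that normalizes a
subgroup of prime order centralizes it. -/
theorem commute_of_orderOf_prime (h : KillsPrimeSums σ) {p r : ℕ} (hp : p.Prime) (hr : r.Prime)
    {x y : L} (hx : orderOf x = p) (hy : orderOf y = r)
    (hxy : x * y * x⁻¹ ∈ Subgroup.zpowers y) : Commute x y := by
  by_contra hne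
  have hrF := Fact.mk hr
  have hconj : ∀ j : ℕ, x ^ j * y * (x ^ j)⁻¹ ∈ Subgroup.zpowers y := by
    intro j
    induction j with
    | zero => simp
    | succ j ih =>
      obtain ⟨m, hm : y ^ m = _⟩ := ih
      obtain ⟨c, hc : y ^ c = _⟩ := hxy
      refine ⟨c * m, ?_⟩
      change y ^ (c * m) = _
      rw [zpow_mul, hc, conj_zpow, hm, pow_succ']
      group
  -- The prime sums of the conjugates of `x` by powers of `y` are added. As `yⁱ xʲ y⁻ⁱ = wⁱ xʲ` with
  -- `w` a power of `y` of order `r`, the terms with `j ≠ 0` cancel and `r = 0` is left.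
  have h1 : ∀ i : ℕ, ∑ j ∈ Finset.range p, σ (y ^ i * x * (y ^ i)⁻¹) ^ j = 0 := fun i =>
    h _ p hp (by rw [← hx]; exact IsFixedPointFreeRep.orderOf_conj _)
  have h2 : ∑ i ∈ Finset.range r, ∑ j ∈ Finset.range p, σ (y ^ i * x * (y ^ i)⁻¹) ^ j = 0 :=
    Finset.sum_eq_zero fun i _ => h1 i
  rw [Finset.sum_comm, ← Finset.sum_erase_add _ _ (Finset.mem_range.2 hp.pos),
    Finset.sum_eq_zero (s := (Finset.range p).erase 0), zero_add] at h2
  · simp only [pow_zero, Finset.sum_const, Finset.card_range, nsmul_eq_mul, mul_one,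
      Nat.cast_eq_zero] at h2
    exact hr.ne_zero h2
  · intro j hj
    rw [Finset.mem_erase, Finset.mem_range] at hj
    obtain ⟨m, hm : y ^ m = _⟩ := hconj j
    set w := y * (y ^ m)⁻¹ with hw
    have hcomm : Commute y (y ^ m) := (Commute.refl y).zpow_right m
    have hw1 : w ≠ 1 := by
      intro hw1
      have h3 : Commute (x ^ j) y := by
        rw [hw, mul_inv_eq_one, hm, eq_mul_inv_iff_mul_eq] at hw1
        exact hw1.symm
      have hcop : (orderOf x).Coprime j := by
        rw [hx]; exact Nat.coprime_of_lt_prime hj.1 hj.2 hp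
      obtain ⟨d, hd⟩ := exists_pow_eq_self_of_coprime hcop.symm
      exact hne (hd ▸ h3.pow_left d)
    have hwr : orderOf w = r := by
      refine orderOf_eq_prime ?_ hw1
      rw [hw, hcomm.inv_right.mul_pow, inv_pow, ← zpow_natCast (y ^ m), zpow_comm, zpow_natCast,
        ← hy, pow_orderOf_eq_one]
      simp
    have h4 : ∀ i ∈ Finset.range r, σ (y ^ i * x * (y ^ i)⁻¹) ^ j = σ w ^ i * σ (x ^ j) := by
      intro i _
      rw [← map_pow, conj_pow, ← map_pow, ← map_mul]
      congr 1
      rw [hw, hcomm.inv_right.mul_pow, hm, inv_pow, conj_pow]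
      group
    rw [Finset.sum_congr rfl h4, ← Finset.sum_mul, h w r hr hwr, zero_mul]

end KillsPrimeSums

/-! ### Finite `p`-groups in which commuting elements of order `p` are dependent. -/

section PGroups

variable {P : Type*} [Group P] {p : ℕ}

/-- A nontrivial normal subgroup of a finite `p`-group meets the center. -/
theorem IsPGroup.exists_mem_center [Finite P] [Fact p.Prime] (hP : IsPGroup p P) {N : Subgroup P}
    [N.Normal] (hN : N ≠ ⊥) : ∃ x ∈ N, x ≠ 1 ∧ ∀ g, g * x = x * g := by
  have hP' : IsPGroup p (ConjAct P) := hP.of_equiv ConjAct.toConjAct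
  have hdvd : p ∣ Nat.card N :=
    ((hP.to_subgroup N).card_eq_or_dvd).resolve_left fun h => hN (Subgroup.card_eq_one.1 h)
  obtain ⟨x, hx, hne⟩ := hP'.exists_fixed_point_of_prime_dvd_card_of_fixed_point N hdvd
    (a := 1) (fun g => by simp)
  refine ⟨x, x.2, fun h => hne (Subtype.ext h.symm), fun g => ?_⟩
  have h : g * (x : P) * g⁻¹ = x := congrArg Subtype.val (hx (ConjAct.toConjAct g))
  exact mul_inv_eq_iff_eq_mul.1 h

theorem IsPGroup.exists_central_mod [Finite P] [Fact p.Prime] (hP : IsPGroup p P)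
    {A C : Subgroup P} [A.Normal] [C.Normal] (hAC : ¬ C ≤ A) :
    ∃ x ∈ C, x ∉ A ∧ x ^ p ∈ A ∧ ∀ g, g * x * g⁻¹ * x⁻¹ ∈ A := by
  have : (C.map (QuotientGroup.mk' A)).Normal :=
    Subgroup.Normal.map inferInstance _ (QuotientGroup.mk'_surjective A)
  obtain ⟨y, hy, hy1, hyc⟩ := (hP.to_quotient A).exists_mem_center
    (N := C.map (QuotientGroup.mk' A)) (by
      rwa [Ne, Subgroup.map_eq_bot_iff, QuotientGroup.ker_mk'])
  obtain ⟨x, hx, rfl⟩ := hy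
  have hex : ∃ n : ℕ, x ^ p ^ n ∈ A := (hP x).imp fun n hn => by rw [hn]; exact A.one_mem
  classical
  have hn := Nat.find_spec hex
  have hn0 : Nat.find hex ≠ 0 := by
    intro h0
    rw [h0, pow_zero, pow_one] at hn
    exact hy1 ((QuotientGroup.eq_one_iff x).2 hn)
  obtain ⟨m, hm⟩ := Nat.exists_eq_succ_of_ne_zero hn0
  refine ⟨x ^ p ^ m, C.pow_mem hx _, Nat.find_min hex (by omega), ?_, fun g => ?_⟩
  · rw [← pow_mul, ← pow_succ, ← Nat.succ_eq_add_one, ← hm]; exact hn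
  · rw [← QuotientGroup.eq_one_iff]
    have h1 := hyc (QuotientGroup.mk' A g)
    have h2 : Commute (QuotientGroup.mk' A g) (QuotientGroup.mk' A x) := h1
    have h3 := h2.pow_right (p ^ m)
    have h4 : (QuotientGroup.mk' A) (g * x ^ p ^ m * g⁻¹ * (x ^ p ^ m)⁻¹) = 1 := by
      simp only [map_mul, map_inv, map_pow]
      rw [h3.eq]
      group
    exact h4

theorem exists_dvd_mul_add {p : ℕ} (hp : p.Prime) {v t : ℤ} (hv : ¬ (p : ℤ) ∣ v)
    (ht : (p : ℤ) ∣ t) (k : ℕ) : ∃ s : ℤ, (p : ℤ) ^ k ∣ s * (p * v) + t := by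
  obtain ⟨w, rfl⟩ := ht
  obtain ⟨α, β, h⟩ := ((Nat.prime_iff_prime_int.1 hp).coprime_iff_not_dvd.2 hv).symm.pow_right
    (n := k)
  exact ⟨-w * α, ⟨p * w * β, by linear_combination (-p * w) * h⟩⟩

/-- The hypothesis of the following lemmas: commuting elements of order `p` generate the same
subgroup. -/
def UniqueCommutingOrder (P : Type*) [Group P] (p : ℕ) : Prop :=
  ∀ x y : P, orderOf x = p → orderOf y = p → Commute x y → x ∈ Subgroup.zpowers y

theorem zpowers_le_of_not_dvd {a x : P} [Fact p.Prime] {k : ℕ} (ha : orderOf a = p ^ k) {t : ℤ}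
    (ht : ¬ (p : ℤ) ∣ t) (hx : x ^ p = a ^ t) : a ∈ Subgroup.zpowers x := by
  obtain ⟨α, β, h⟩ := ((Nat.prime_iff_prime_int.1 (Fact.out : p.Prime)).coprime_iff_not_dvd.2
    ht).symm.pow_right (n := k)
  refine ⟨p * α, ?_⟩
  change x ^ (p * α) = a
  rw [zpow_mul, zpow_natCast, hx, ← zpow_mul]
  have : (t * α : ℤ) = 1 - β * (orderOf a : ℤ) := by rw [ha]; push_cast; linear_combination h
  rw [this, zpow_sub, mul_comm β, zpow_mul, zpow_natCast, pow_orderOf_eq_one]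
  simp

/-- A maximal normal cyclic subgroup `⟨a⟩` is self-centralizing. Otherwise some `x` centralizes it,
is central modulo it, and has `x^p = a^t`. If `a` is a power of `x`, then `⟨x⟩` is a larger normal
cyclic subgroup; if not, `p ∣ t` and `x a^(-t/p)` has order `p`, commutes with `a`, and so falls
into `⟨a⟩`. -/
theorem UniqueCommutingOrder.exists_zpowers [Finite P] [Fact p.Prime] (hP : IsPGroup p P)
    (h : UniqueCommutingOrder P p) :
    ∃ a : P, (Subgroup.zpowers a).Normal ∧ ∀ x, Commute x a → x ∈ Subgroup.zpowers a := by
  obtain ⟨A, hA⟩ := (Set.toFinite {A : Subgroup P | A.Normal ∧ ∃ a, Subgroup.zpowers a = A}).exists_maximal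
    ⟨⊥, inferInstance, 1, Subgroup.zpowers_one_eq_bot⟩
  obtain ⟨⟨hn, a, rfl⟩, hmax⟩ := hA
  refine ⟨a, hn, fun y hy => ?_⟩
  by_contra hyA
  have hC : (Subgroup.centralizer (Subgroup.zpowers a : Set P)).Normal := inferInstance
  have hCA : ¬ Subgroup.centralizer (Subgroup.zpowers a : Set P) ≤ Subgroup.zpowers a := fun hle =>
    hyA (hle (by
      rw [Subgroup.mem_centralizer_iff]
      rintro _ ⟨n, rfl⟩
      exact (hy.symm.zpow_left n).eq))
  obtain ⟨x, hx, hxA, ⟨t, ht : a ^ t = x ^ p⟩, hcomm⟩ := hP.exists_central_mod hCA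
  have hxa : Commute x a :=
    ((Subgroup.mem_centralizer_iff.1 hx) a (Subgroup.mem_zpowers a)).symm
  obtain ⟨k, hk⟩ := (IsPGroup.iff_orderOf.1 hP) a
  by_cases hax : a ∈ Subgroup.zpowers x
  · have hle : Subgroup.zpowers a ≤ Subgroup.zpowers x := by rwa [Subgroup.zpowers_le]
    have hnx : (Subgroup.zpowers x).Normal := by
      refine ⟨?_⟩
      rintro _ ⟨n, rfl⟩ g
      change g * x ^ n * g⁻¹ ∈ _
      rw [← conj_zpow]
      refine Subgroup.zpow_mem _ ?_ n
      have := mul_mem (hle (hcomm g)) (Subgroup.mem_zpowers x)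
      rwa [inv_mul_cancel_right] at this
    exact hxA (hmax ⟨hnx, x, rfl⟩ hle (Subgroup.mem_zpowers x))
  · have hpt : (p : ℤ) ∣ t := by
      by_contra hpt
      exact hax (zpowers_le_of_not_dvd hk hpt ht.symm)
    obtain ⟨w, rfl⟩ := hpt
    have hk0 : k ≠ 0 := by
      rintro rfl
      rw [pow_zero, orderOf_eq_one_iff] at hk
      exact hax (hk ▸ Subgroup.one_mem _)
    have hu : orderOf (a ^ (orderOf a / p)) = p :=
      orderOf_pow_orderOf_div (orderOf_pos a).ne' (hk ▸ dvd_pow_self p hk0)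
    have hy : orderOf (x * (a ^ w)⁻¹) = p := by
      refine orderOf_eq_prime ?_ fun h1 => hxA ?_
      · rw [(hxa.zpow_right w).inv_right.mul_pow, ← ht, inv_pow, ← zpow_natCast (a ^ w), ← zpow_mul,
          mul_comm w, mul_inv_cancel]
      · rw [mul_inv_eq_one.1 h1]; exact ⟨w, rfl⟩
    obtain ⟨j, hj : _ ^ j = _⟩ := h _ _ hy hu (((hxa.mul_left
      ((Commute.refl a).zpow_left w).inv_left)).pow_right _)
    refine hxA ?_
    rw [eq_mul_inv_iff_mul_eq] at hj
    rw [← hj]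
    exact mul_mem (Subgroup.zpow_mem _ (Subgroup.pow_mem _ (Subgroup.mem_zpowers a) _) _)
      (Subgroup.zpow_mem _ (Subgroup.mem_zpowers a) _)

theorem mul_pow_of_conj {a b : P} {c : ℤ} (h : b * a * b⁻¹ = a ^ c) (s : ℤ) (j : ℕ) :
    (a ^ s * b) ^ j = a ^ (s * ∑ i ∈ Finset.range j, c ^ i) * b ^ j := by
  have h1 : ∀ j : ℕ, b ^ j * a = a ^ (c ^ j) * b ^ j := by
    intro j
    induction j with
    | zero => simp
    | succ j ih =>
      have h2 : b * a ^ (c ^ j) = a ^ (c ^ (j + 1)) * b := by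
        rw [pow_succ', zpow_mul, ← h, conj_zpow]; group
      rw [pow_succ', mul_assoc, ih, ← mul_assoc, h2, mul_assoc, ← pow_succ']
  induction j with
  | zero => simp
  | succ j ih =>
    have h2 : b ^ j * a ^ s = a ^ (c ^ j * s) * b ^ j := by
      have := conj_zpow (a := b ^ j) (b := a) (i := s)
      rw [h1 j, mul_inv_cancel_right, ← zpow_mul] at this
      rw [this]; group
    rw [pow_succ, ih, ← mul_assoc, mul_assoc _ (b ^ j), h2, ← mul_assoc, ← zpow_add, mul_assoc,
      ← pow_succ, Finset.sum_range_succ]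
    congr 2
    ring

/-- Adjusting `b` by a power of `a` to an element of order `p`. -/
theorem UniqueCommutingOrder.false_of_sum [Fact p.Prime] (h : UniqueCommutingOrder P p) {a b : P}
    {k : ℕ} (ha : orderOf a = p ^ k) (hk : k ≠ 0) (hb : b ∉ Subgroup.zpowers a) {t c v : ℤ}
    (hbp : b ^ p = a ^ t) (ht : (p : ℤ) ∣ t) (hc : b * a * b⁻¹ = a ^ c) (hc1 : (p : ℤ) ∣ c - 1)
    (hsum : ∑ i ∈ Finset.range p, c ^ i = p * v) (hv : ¬ (p : ℤ) ∣ v) : False := by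
  -- With this `s` the exponent of `a` in `(a^s b)^p` is divisible by the order of `a`. The
  -- congruence `c ≡ 1` makes `b` commute with the elements of order `p` in `⟨a⟩`, so the new
  -- element falls under the hypothesis.
  obtain ⟨s, hs⟩ := exists_dvd_mul_add Fact.out hv ht k
  have hy : orderOf (a ^ s * b) = p := by
    refine orderOf_eq_prime ?_ fun h1 => hb ?_
    · rw [mul_pow_of_conj hc, hsum, hbp, ← zpow_add, ← orderOf_dvd_iff_zpow_eq_one, ha]
      exact_mod_cast hs
    · rw [eq_inv_of_mul_eq_one_right h1]
      exact Subgroup.inv_mem _ ⟨s, rfl⟩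
  have hpos : 0 < orderOf a := by rw [ha]; exact pow_pos (Fact.out : p.Prime).pos k
  have hdvd : p ∣ orderOf a := ha ▸ dvd_pow_self p hk
  have hu : orderOf (a ^ (orderOf a / p)) = p := orderOf_pow_orderOf_div hpos.ne' hdvd
  set u := a ^ (orderOf a / p) with hu'
  have hbu : b * u * b⁻¹ = u := by
    rw [hu', ← conj_pow, hc, ← zpow_natCast, zpow_comm, zpow_natCast, ← hu',
      ← mul_inv_eq_one, ← zpow_sub_one, ← orderOf_dvd_iff_zpow_eq_one, hu]
    exact hc1
  have hcomm : Commute (a ^ s * b) u :=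
    Commute.mul_left (((Commute.refl a).zpow_left s).pow_right _) (mul_inv_eq_iff_eq_mul.1 hbu)
  obtain ⟨j, hj : u ^ j = _⟩ := h _ _ hy hu hcomm
  refine hb ?_
  rw [← inv_mul_eq_iff_eq_mul] at hj
  rw [← hj]
  exact mul_mem (inv_mem ⟨s, rfl⟩)
    (Subgroup.zpow_mem _ (Subgroup.pow_mem _ (Subgroup.mem_zpowers a) _) _)

/-- With `c = 1 + p m` the sum is `p + p m · p(p-1)/2` modulo `p²`, and for odd `p` the second term
is divisible by `p²`. -/
theorem exists_sum_pow_eq {p : ℕ} (hp : p.Prime) (h2 : p ≠ 2) {c : ℤ} (hc : (p : ℤ) ∣ c - 1) :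
    ∃ v : ℤ, ∑ i ∈ Finset.range p, c ^ i = p * v ∧ ¬ (p : ℤ) ∣ v := by
  obtain ⟨m, hm⟩ := hc
  obtain ⟨r, hr⟩ := hp.odd_of_ne_two h2
  have h1 : ∀ i : ℕ, ∃ w : ℤ, c ^ i = 1 + i * (p * m) + p ^ 2 * w := by
    intro i
    induction i with
    | zero => exact ⟨0, by simp⟩
    | succ i ih =>
      obtain ⟨w, hw⟩ := ih
      refine ⟨i * m ^ 2 + w * c, ?_⟩
      rw [pow_succ, hw, show c = 1 + p * m by linarith]
      push_cast
      ring
  choose w hw using h1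
  have h3 : (∑ i ∈ Finset.range p, (i : ℤ)) = p * r := by
    have := Finset.sum_range_id p
    rw [show p * (p - 1) / 2 = p * r by
      rw [show p - 1 = r * 2 by omega, ← mul_assoc, Nat.mul_div_cancel _ two_pos]] at this
    have h4 := congrArg (Nat.cast : ℕ → ℤ) this
    rwa [Nat.cast_sum, Nat.cast_mul] at h4
  refine ⟨1 + p * (r * m + ∑ i ∈ Finset.range p, w i), ?_, ?_⟩
  · rw [Finset.sum_congr rfl fun i _ => hw i, Finset.sum_add_distrib, Finset.sum_add_distrib,
      ← Finset.sum_mul, h3, ← Finset.mul_sum]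
    simp only [Finset.sum_const, Finset.card_range, nsmul_eq_mul, mul_one]
    ring
  · intro hd
    have h4 := (Int.dvd_add_left (dvd_mul_right (p : ℤ) _)).1 hd
    exact hp.one_lt.ne' (Int.natCast_dvd_natCast.1 (by exact_mod_cast h4) |> Nat.dvd_one.1)

/-- Data of an element acting on a self-centralizing normal cyclic subgroup of a `p`-group. -/
theorem exists_conj_data [Fact p.Prime] {a b : P} {k : ℕ} (hk : orderOf a = p ^ k)
    (hn : (Subgroup.zpowers a).Normal) (hself : ∀ x, Commute x a → x ∈ Subgroup.zpowers a)
    (hb : b ∉ Subgroup.zpowers a) (hbp : b ^ p ∈ Subgroup.zpowers a) :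
    k ≠ 0 ∧ ∃ t c : ℤ, b ^ p = a ^ t ∧ (p : ℤ) ∣ t ∧ b * a * b⁻¹ = a ^ c ∧
      (p : ℤ) ^ k ∣ c ^ p - 1 ∧ (p : ℤ) ∣ c - 1 := by
  have hk0 : k ≠ 0 := by
    rintro rfl
    rw [pow_zero, orderOf_eq_one_iff] at hk
    exact hb (hself b (hk ▸ Commute.one_right b))
  obtain ⟨t, ht : a ^ t = _⟩ := hbp
  obtain ⟨c, hc : a ^ c = _⟩ := hn.conj_mem a (Subgroup.mem_zpowers a) b
  have hpt : (p : ℤ) ∣ t := by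
    by_contra hpt
    obtain ⟨j, hj : b ^ j = a⟩ := zpowers_le_of_not_dvd hk hpt ht.symm
    exact hb (hself b (hj ▸ (Commute.refl b).zpow_right j))
  have hcp : (p : ℤ) ^ k ∣ c ^ p - 1 := by
    have h1 : ∀ j : ℕ, b ^ j * a * (b ^ j)⁻¹ = a ^ (c ^ j) := by
      intro j
      induction j with
      | zero => simp
      | succ j ih =>
        rw [pow_succ c, mul_comm, zpow_mul, hc, conj_zpow, ← ih, pow_succ']
        group
    have h2 := h1 p
    rw [← ht, ((Commute.refl a).zpow_left t).eq, mul_inv_cancel_right] at h2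
    have h3 : a ^ (c ^ p - 1) = 1 := by rw [zpow_sub_one, ← h2, mul_inv_cancel]
    rw [← orderOf_dvd_iff_zpow_eq_one, hk] at h3
    exact_mod_cast h3
  refine ⟨hk0, t, c, ht.symm, hpt, hc.symm, hcp, ?_⟩
  have h4 : (p : ℤ) ∣ c ^ p - 1 := (dvd_pow_self _ hk0).trans hcp
  rw [← ZMod.intCast_zmod_eq_zero_iff_dvd] at h4 ⊢
  push_cast at h4 ⊢
  rwa [ZMod.pow_card] at h4

theorem UniqueCommutingOrder.isCyclic [Finite P] [Fact p.Prime] (hP : IsPGroup p P)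
    (h : UniqueCommutingOrder P p) (h2 : p ≠ 2) : IsCyclic P := by
  obtain ⟨a, hn, hself⟩ := h.exists_zpowers hP
  by_cases htop : (⊤ : Subgroup P) ≤ Subgroup.zpowers a
  · exact ⟨a, fun x => htop (Subgroup.mem_top x)⟩
  obtain ⟨b, -, hb, hbp, -⟩ := hP.exists_central_mod htop
  obtain ⟨k, hk⟩ := (IsPGroup.iff_orderOf.1 hP) a
  obtain ⟨hk0, t, c, ht, hpt, hc, -, hc1⟩ := exists_conj_data hk hn hself hb hbp
  obtain ⟨v, hv, hv'⟩ := exists_sum_pow_eq Fact.out h2 hc1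
  exact (h.false_of_sum hk hk0 hb ht hpt hc hc1 hv hv').elim

/-- Let `b` act by the odd exponent `c`. If `c ≡ 1` modulo `4`, `b` could be corrected to a second
involution, so `c - 1` is twice an odd number. This makes `b²` the involution and `c ≡ -1` modulo
half the order of `a`. If `c` were not `-1` modulo the order, `a b` would have square one. -/
theorem conj_eq_inv_of_unique_involution [Finite P]
    (h : ∀ x y : P, orderOf x = 2 → orderOf y = 2 → x = y) {a b : P} {k : ℕ}
    (hk : orderOf a = 2 ^ k) (hn : (Subgroup.zpowers a).Normal)
    (hself : ∀ x, Commute x a → x ∈ Subgroup.zpowers a) (hb : b ∉ Subgroup.zpowers a)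
    (hbp : b ^ 2 ∈ Subgroup.zpowers a) :
    2 ≤ k ∧ b * a * b⁻¹ = a⁻¹ ∧ b * b = a ^ (orderOf a / 2) := by
  have h2F := Fact.mk Nat.prime_two
  obtain ⟨hk0, t, c, ht, hpt, hc, hcp, hc1⟩ := exists_conj_data hk hn hself hb hbp
  have hu : orderOf (a ^ (orderOf a / 2)) = 2 :=
    orderOf_pow_orderOf_div (orderOf_pos a).ne' (hk ▸ dvd_pow_self 2 hk0)
  have hinv : ∀ y, y ∉ Subgroup.zpowers a → y ^ 2 ≠ 1 := by
    intro y hy hy2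
    refine hy ?_
    rw [h y _ (orderOf_eq_prime hy2 fun h1 => hy (h1 ▸ Subgroup.one_mem _)) hu]
    exact Subgroup.pow_mem _ (Subgroup.mem_zpowers a) _
  have hU : UniqueCommutingOrder P 2 := fun x y hx hy _ => h x y hx hy ▸ Subgroup.mem_zpowers x
  have hodd : c % 2 = 1 := by push_cast at hc1; omega
  have h3 : c % 4 = 3 := by
    by_contra h3
    exact hU.false_of_sum hk hk0 hb ht hpt hc hc1 (v := (1 + c) / 2)
      (by simp [Finset.sum_range_succ]; omega) (by push_cast; omega)
  obtain ⟨k, rfl⟩ := Nat.exists_eq_succ_of_ne_zero hk0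
  obtain ⟨e, he⟩ : ∃ e, c - 1 = 2 * (2 * e + 1) := ⟨(c - 3) / 4, by omega⟩
  have hcop : IsCoprime ((2 : ℤ) ^ k) (2 * e + 1) :=
    IsCoprime.pow_left ⟨-e, 1, by ring⟩
  have hhalf : ∀ w : ℤ, (2 : ℤ) ^ (k + 1) ∣ w * (c - 1) → (2 : ℤ) ^ k ∣ w := by
    intro w hw
    rw [he, pow_succ', show w * (2 * (2 * e + 1)) = 2 * (w * (2 * e + 1)) by ring] at hw
    exact hcop.dvd_of_dvd_mul_right ((mul_dvd_mul_iff_left two_ne_zero).1 hw)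
  have hord : orderOf a / 2 = 2 ^ k := by
    rw [hk, pow_succ, Nat.mul_div_cancel _ two_pos]
  have hval : ∀ w : ℤ, (2 : ℤ) ^ k ∣ w → a ^ w = 1 ∨ a ^ w = a ^ (orderOf a / 2) := by
    rintro _ ⟨w, rfl⟩
    have h4 : a ^ ((2 : ℤ) ^ k * w) = (a ^ (orderOf a / 2)) ^ w := by
      rw [hord, zpow_mul]; congr 1; exact_mod_cast zpow_natCast a (2 ^ k)
    rw [h4]
    have h5 : (a ^ (orderOf a / 2)) ^ (2 : ℤ) = 1 := by
      exact_mod_cast hu ▸ pow_orderOf_eq_one _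
    rcases Int.even_or_odd' w with ⟨j, rfl | rfl⟩
    · left; rw [zpow_mul, h5, one_zpow]
    · right; rw [zpow_add, zpow_mul, h5, one_zpow, one_mul, zpow_one]
  have hb2 : b ^ 2 = a ^ (orderOf a / 2) := by
    refine ((hval t (hhalf t ?_)).resolve_left ?_) ▸ ht
    · have h6 : b * a ^ t * b⁻¹ = a ^ (c * t) := by rw [← conj_zpow, hc, zpow_mul]
      rw [← ht, ← pow_succ', pow_succ, mul_inv_cancel_right, ht] at h6
      have h7 : a ^ (t * (c - 1)) = 1 := by
        rw [mul_sub, mul_one, zpow_sub, mul_comm t c, ← h6, mul_inv_cancel]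
      rw [← orderOf_dvd_iff_zpow_eq_one, hk] at h7
      exact_mod_cast h7
    · rw [← ht]; exact hinv b hb
  refine ⟨?_, ?_, by rw [← pow_two, hb2]⟩
  · by_contra hlt
    have hk0 : k = 0 := by omega
    subst hk0
    refine hb (hself b ?_)
    have h8 : a ^ c = a := by
      rw [← mul_inv_eq_one, ← zpow_sub_one, ← orderOf_dvd_iff_zpow_eq_one, hk]
      push_cast; omega
    rw [h8] at hc
    exact mul_inv_eq_iff_eq_mul.1 hc
  · have h9 := hval (c + 1) (hhalf _ (by
      rw [show (c + 1) * (c - 1) = c ^ 2 - 1 by ring]; exact_mod_cast hcp))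
    rcases h9 with h9 | h9
    · rw [hc, eq_inv_iff_mul_eq_one, ← zpow_add_one, h9]
    · refine (hinv (a ^ (1 : ℤ) * b) ?_ ?_).elim
      · intro hmem
        exact hb ((Subgroup.mul_mem_cancel_left _
          (Subgroup.zpow_mem _ (Subgroup.mem_zpowers a) 1)).1 hmem)
      · rw [mul_pow_of_conj hc, hb2]
        simp only [Finset.sum_range_succ, Finset.range_zero, Finset.sum_empty, pow_zero, pow_one,
          zero_add, one_mul]
        rw [add_comm 1 c, h9, ← pow_two]
        have := pow_orderOf_eq_one (a ^ (orderOf a / 2))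
        rwa [hu] at this

/-- A finite `2`-group with at most one involution is cyclic or generalized quaternion. -/
theorem isCyclic_or_quaternion_of_unique_involution [Finite P] (hP : IsPGroup 2 P)
    (h : ∀ x y : P, orderOf x = 2 → orderOf y = 2 → x = y) :
    IsCyclic P ∨ ∃ a : P, 4 ∣ orderOf a ∧ Subgroup.zpowers a ≠ ⊤ ∧
      (∀ x, Commute x a → x ∈ Subgroup.zpowers a) ∧
      ∀ g ∉ Subgroup.zpowers a, g * a * g⁻¹ = a⁻¹ ∧ g * g = a ^ (orderOf a / 2) := by
  have h2F := Fact.mk Nat.prime_two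
  have hU : UniqueCommutingOrder P 2 := fun x y hx hy _ => h x y hx hy ▸ Subgroup.mem_zpowers x
  obtain ⟨a, hn, hself⟩ := hU.exists_zpowers hP
  by_cases htop : Subgroup.zpowers a = ⊤
  · exact Or.inl ⟨a, fun x => htop.ge (Subgroup.mem_top x)⟩
  obtain ⟨k, hk⟩ := (IsPGroup.iff_orderOf.1 hP) a
  have hcase := fun {b : P} => conj_eq_inv_of_unique_involution h (b := b) hk hn hself
  obtain ⟨b, -, hb, hbp, -⟩ := hP.exists_central_mod (C := ⊤) (fun hle => htop (top_le_iff.1 hle))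
  obtain ⟨hk2, -⟩ := hcase hb hbp
  have h4 : 4 ∣ orderOf a := hk ▸ (pow_dvd_pow 2 hk2 : 2 ^ 2 ∣ 2 ^ k)
  refine Or.inr ⟨a, h4, htop, hself, fun g hg => ?_⟩
  suffices hsq : g ^ 2 ∈ Subgroup.zpowers a from (hcase hg hsq).2
  by_contra hsq
  have hex : ∃ n : ℕ, g ^ 2 ^ n ∈ Subgroup.zpowers a :=
    (hP g).imp fun n hn => by rw [hn]; exact Subgroup.one_mem _
  classical
  have hspec := Nat.find_spec hex
  obtain ⟨m, hm⟩ : ∃ m, Nat.find hex = m + 2 := by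
    refine ⟨Nat.find hex - 2, ?_⟩
    have h0 : Nat.find hex ≠ 0 := fun h0 => hg (by rwa [h0, pow_zero, pow_one] at hspec)
    have h1 : Nat.find hex ≠ 1 := fun h1 => hsq (by rwa [h1, pow_one] at hspec)
    omega
  have hm1 : g ^ 2 ^ (m + 1) ∉ Subgroup.zpowers a := Nat.find_min hex (by omega)
  obtain ⟨-, hconj, -⟩ := hcase hm1 (by rw [← pow_mul, ← pow_succ]; exact hm ▸ hspec)
  -- The previous power of `g` acts on `a` by an exponent `e` with `e² ≡ -1` modulo a multiple of
  -- `4`, which is impossible.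
  obtain ⟨e, he : a ^ e = _⟩ := hn.conj_mem a (Subgroup.mem_zpowers a) (g ^ 2 ^ m)
  have h5 : a ^ (e * e) = a⁻¹ := by
    rw [zpow_mul, he, conj_zpow, he, ← hconj, pow_succ, pow_mul, pow_two]
    group
  have h6 : a ^ (e * e + 1) = 1 := by rw [zpow_add_one, h5, inv_mul_cancel]
  rw [← orderOf_dvd_iff_zpow_eq_one] at h6
  have h7 : (4 : ℤ) ∣ e * e + 1 := dvd_trans (by exact_mod_cast h4) h6
  rcases Int.even_or_odd' e with ⟨j, rfl | rfl⟩
  · have : (2 * j * (2 * j) + 1) % 4 = 1 := by ring_nf; omega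
    omega
  · have : ((2 * j + 1) * (2 * j + 1) + 1) % 4 = 2 := by ring_nf; omega
    omega

end PGroups

/-! ### Central elements of prime order, cyclic Sylow subgroups, and elements of `3`-power order. -/

theorem IsIrrChar.exists_degree {G : Type*} [Group G] {χ : G → ℂ} (h : IsIrrChar χ) :
    ∃ m : ℕ, m ≠ 0 ∧ χ 1 = m := by
  obtain ⟨m, ρ, hρ, rfl⟩ := h
  refine ⟨m, ?_, by rw [Representation.char_one]; simp⟩
  rintro rfl
  have := hρ.nontrivial_space
  exact not_subsingleton (Fin 0 → ℂ) inferInstance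

open scoped IsMulCommutative in
-- The transfer into an abelian Sylow subgroup maps a central element to its power by the index,
-- which is prime to `p`.
theorem exists_hom_apply_ne_one_of_central {L : Type*} [Group L] [Finite L] {p : ℕ} [Fact p.Prime]
    (P : Sylow p L) [IsMulCommutative (P : Subgroup L)] {x : L} (hx : x ∈ P) (hx1 : x ≠ 1)
    (hc : ∀ g, g * x = x * g) : ∃ l : L →* ℂˣ, l x ≠ 1 := by
  refine exists_hom_apply_ne_one_of_notMem_commutator fun hmem => hx1 ?_
  have h1 := Abelianization.commutator_subset_ker
    (MonoidHom.transfer (H := (P : Subgroup L)) (A := (P : Subgroup L)) (MonoidHom.id _)) hmem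
  have h2 : ∀ (k : ℕ) (g₀ : L), g₀⁻¹ * x ^ k * g₀ ∈ (P : Subgroup L) →
      g₀⁻¹ * x ^ k * g₀ = x ^ k := fun k g₀ _ => by
    have h3 : Commute g₀ (x ^ k) := Commute.pow_right (show Commute g₀ x from hc g₀) k
    rw [mul_assoc, ← h3.eq, inv_mul_cancel_left]
  rw [MonoidHom.mem_ker, MonoidHom.transfer_eq_pow _ x h2] at h1
  have h4 : x ^ (P : Subgroup L).index = 1 := congrArg Subtype.val h1
  obtain ⟨k, hk⟩ := P.isPGroup'.exists_orderOf_eq_pow ⟨x, hx⟩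
  rw [Subgroup.orderOf_mk] at hk
  have h5 : (orderOf x).Coprime (P : Subgroup L).index := by
    rw [hk]
    exact Nat.Coprime.pow_left _ ((Nat.Prime.coprime_iff_not_dvd Fact.out).2 P.not_dvd_index)
  exact orderOf_eq_one_iff.1 (Nat.eq_one_of_dvd_coprimes h5 dvd_rfl (orderOf_dvd_of_pow_eq_one h4))

/-- `l` is injective on `⟨x⟩` and trivial on commutators, so a nontrivial commutator lies outside
`⟨x⟩` and there is a nonlinear character trivial on `⟨x⟩`. Its value at `x` is its degree, and
twisting by `l` forces `l x = 1`. -/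
theorem RationalValuesAgree.commute_of_central {L : Type*} [Group L] [Finite L]
    (h : RationalValuesAgree L) {x : L} (hx : (orderOf x).Prime) (hc : ∀ g, g * x = x * g)
    {l : L →* ℂˣ} (hl : l x ≠ 1) (a b : L) : a * b = b * a := by
  by_contra hne
  have : (Subgroup.zpowers x).Normal := by
    refine ⟨?_⟩
    rintro _ ⟨n, rfl⟩ g
    change g * x ^ n * g⁻¹ ∈ _
    rw [(Commute.zpow_right (show Commute g x from hc g) n).eq, mul_inv_cancel_right]
    exact ⟨n, rfl⟩
  have hmem : a * b * a⁻¹ * b⁻¹ ∉ Subgroup.zpowers x := by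
    intro hmem
    obtain ⟨n, hn : x ^ n = _⟩ := hmem
    have h1 : l x ^ n = 1 := by
      rw [← map_zpow, hn, map_mul, map_mul, map_mul, map_inv, map_inv, mul_comm (l a)]
      group
    have hd : (orderOf x : ℤ) ∣ n := by
      by_contra hd
      have hcop := (Nat.prime_iff_prime_int.1 hx).coprime_iff_not_dvd.2 hd
      obtain ⟨α, β, hαβ⟩ := hcop
      refine hl ?_
      have h2 : l x ^ (orderOf x : ℤ) = 1 := by
        rw [zpow_natCast, ← map_pow, pow_orderOf_eq_one, map_one]
      rw [← zpow_one (l x), ← hαβ, zpow_add, mul_comm, zpow_mul, zpow_comm, h1, one_zpow, one_mul,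
        mul_comm α, zpow_mul, h2, one_zpow]
    rw [orderOf_dvd_iff_zpow_eq_one.1 hd] at hn
    exact hne (by
      have h3 := eq_mul_inv_iff_mul_eq.1 hn
      rw [one_mul] at h3
      exact (eq_mul_inv_iff_mul_eq.1 h3).symm)
  obtain ⟨χ, hχ, h1, h2⟩ := IsIrrChar.exists_of_commutator_notMem _ hmem
  obtain ⟨m, hm, hm1⟩ := hχ.exists_degree
  exact hl (h.apply_eq_one hχ h1 l (r := m) (by exact_mod_cast hm)
    (by rw [h2 x (Subgroup.mem_zpowers x), hm1]; simp))

/-- An automorphism of prime order `p` of a cyclic group of order prime to `p` is trivial if it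
fixes the elements of prime order. -/
theorem commute_of_commute_prime_order {L : Type*} [Group L] [Finite L] {x w : L} {p : ℕ}
    (hx : x ^ p = 1) (hcop : p.Coprime (orderOf w)) (hw : x * w * x⁻¹ ∈ Subgroup.zpowers w)
    (h : ∀ r : ℕ, r.Prime → r ∣ orderOf w → Commute x (w ^ (orderOf w / r))) : Commute x w := by
  obtain ⟨c, hc : w ^ c = _⟩ := hw
  have h1 : ∀ r : ℕ, r.Prime → r ∣ orderOf w → (r : ℤ) ∣ c - 1 := by
    intro r hr hd
    have h2 := mul_inv_eq_iff_eq_mul.2 (h r hr hd).eq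
    rw [← conj_pow, ← hc, ← zpow_natCast, zpow_comm, zpow_natCast, ← mul_inv_eq_one,
      ← zpow_sub_one, ← orderOf_dvd_iff_zpow_eq_one, orderOf_pow_orderOf_div (orderOf_pos w).ne' hd]
      at h2
    exact h2
  have h3 : ∀ j : ℕ, x ^ j * w * (x ^ j)⁻¹ = w ^ (c ^ j) := by
    intro j
    induction j with
    | zero => simp
    | succ j ih =>
      rw [pow_succ c, mul_comm, zpow_mul, hc, conj_zpow, ← ih, pow_succ']
      group
  have h4 : (orderOf w : ℤ) ∣ (∑ i ∈ Finset.range p, c ^ i) * (c - 1) := by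
    rw [geom_sum_mul, orderOf_dvd_iff_zpow_eq_one, zpow_sub_one, ← h3 p, hx]
    simp
  -- Modulo every prime divisor of the order of `w` the exponent `c` is `1`, so the geometric sum is
  -- `p` there, which is invertible.
  have h5 : IsCoprime (orderOf w : ℤ) (∑ i ∈ Finset.range p, c ^ i) := by
    rw [Int.isCoprime_iff_nat_coprime, Int.natAbs_natCast]
    refine Nat.Coprime.symm (Nat.coprime_of_dvd fun r hr hr1 hr2 => ?_)
    have h6 : (r : ℤ) ∣ ∑ i ∈ Finset.range p, c ^ i := Int.natCast_dvd.2 hr1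
    have h7 : (r : ℤ) ∣ p := by
      have h8 : (r : ℤ) ∣ ∑ i ∈ Finset.range p, (c ^ i - 1) :=
        Finset.dvd_sum fun i _ => (h1 r hr hr2).trans (sub_one_dvd_pow_sub_one c i)
      rw [Finset.sum_sub_distrib] at h8
      have := dvd_sub h6 h8
      simpa using this
    exact Nat.Prime.not_coprime_iff_dvd.2 ⟨r, hr, Int.natCast_dvd_natCast.1 h7, hr2⟩ hcop
  have h9 := h5.dvd_of_dvd_mul_left h4
  rw [orderOf_dvd_iff_zpow_eq_one, zpow_sub_one, mul_inv_eq_one, hc] at h9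
  exact mul_inv_eq_iff_eq_mul.1 h9

/-- `L` is a semidirect product of its cyclic commutator subgroup and a complement of coprime order.
An element of prime order in the complement centralizes the elements of prime order in the
commutator subgroup, hence all of it, and it centralizes the complement since commutators there are
trivial. Being central and detected by a linear character, it forces `L` to be abelian. -/
theorem KillsPrimeSums.isCyclic_of_isZGroup {L A : Type*} [Group L] [Finite L] [Ring A]
    [CharZero A] {σ : L →* A} (hσ : KillsPrimeSums σ) (h : RationalValuesAgree L) [IsZGroup L] :
    IsCyclic L := by
  suffices hcomm : ∀ a b : L, a * b = b * a by
    have : IsMulCommutative L := ⟨⟨hcomm⟩⟩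
    have : Group.IsNilpotent L := by
      let : CommGroup L := { (inferInstance : Group L) with mul_comm := hcomm }
      infer_instance
    infer_instance
  by_cases hL : Nontrivial L
  swap
  · rw [not_nontrivial_iff_subsingleton] at hL
    exact fun a b => Subsingleton.elim _ _
  have hcop := IsZGroup.coprime_commutator_index (G := L)
  have hidx : (commutator L).index ≠ 1 := fun h1 =>
    (IsZGroup.commutator_lt (G := L)).ne (Subgroup.index_eq_one.1 h1)
  obtain ⟨H, hH⟩ := Subgroup.exists_right_complement'_of_coprime hcop
  obtain ⟨p, hp, hpd⟩ := Nat.exists_prime_and_dvd hidx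
  have hpF := Fact.mk hp
  rw [hH.symm.index_eq_card] at hpd hcop
  obtain ⟨⟨x, hxH⟩, hx⟩ := exists_prime_orderOf_dvd_card' p hpd
  rw [Subgroup.orderOf_mk] at hx
  have := IsZGroup.isCyclic_commutator (G := L)
  obtain ⟨⟨w, hw⟩, hgen⟩ := IsCyclic.exists_generator (α := commutator L)
  have hgen' : ∀ y ∈ commutator L, y ∈ Subgroup.zpowers w := by
    intro y hy
    obtain ⟨n, hn⟩ := hgen ⟨y, hy⟩
    exact ⟨n, congrArg Subtype.val hn⟩
  have hwcard : orderOf w ∣ Nat.card (commutator L) := by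
    have := orderOf_dvd_natCard (⟨w, hw⟩ : commutator L)
    rwa [Subgroup.orderOf_mk] at this
  have hxw : Commute x w := by
    refine commute_of_commute_prime_order (p := p) (by rw [← hx, pow_orderOf_eq_one]) ?_
      (hgen' _ ((inferInstance : (commutator L).Normal).conj_mem w hw x)) fun r hr hd => ?_
    · exact (Nat.Coprime.coprime_dvd_left hwcard (hcop.coprime_dvd_right hpd)).symm
    · have hy := orderOf_pow_orderOf_div (orderOf_pos w).ne' hd
      refine hσ.commute_of_orderOf_prime hp hr hx hy ?_
      obtain ⟨c, hc : w ^ c = _⟩ := hgen' _ ((inferInstance : (commutator L).Normal).conj_mem w hw x)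
      refine ⟨c, ?_⟩
      change (w ^ (orderOf w / r)) ^ c = _
      rw [← conj_pow, ← hc, ← zpow_natCast, zpow_comm, zpow_natCast]
  have hcH : ∀ g ∈ H, Commute x g := by
    intro g hg
    have h1 : x * g * x⁻¹ * g⁻¹ ∈ commutator L :=
      Subgroup.commutator_mem_commutator (Subgroup.mem_top x) (Subgroup.mem_top g)
    have h2 : x * g * x⁻¹ * g⁻¹ ∈ H := mul_mem (mul_mem (mul_mem hxH hg) (inv_mem hxH)) (inv_mem hg)
    have h3 := (Subgroup.disjoint_def.1 hH.disjoint) h1 h2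
    rw [mul_inv_eq_one, mul_inv_eq_iff_eq_mul] at h3
    exact h3
  have hc : ∀ g, g * x = x * g := by
    intro g
    obtain ⟨⟨⟨y, hy⟩, ⟨k, hk⟩⟩, rfl⟩ := hH.2 g
    obtain ⟨n, rfl⟩ := hgen' y hy
    exact ((hxw.zpow_right n).mul_right (hcH k hk)).symm.eq
  obtain ⟨P, hP⟩ := (IsPGroup.of_card (n := 1) (by rw [Nat.card_zpowers, hx, pow_one]) :
    IsPGroup p (Subgroup.zpowers x)).exists_le_sylow
  have : IsMulCommutative (P : Subgroup L) := IsCyclic.isMulCommutative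
  obtain ⟨l, hl⟩ := exists_hom_apply_ne_one_of_central P (hP (Subgroup.mem_zpowers x))
    (fun h1 => hp.ne_one (by rw [← hx, h1, orderOf_one])) hc
  exact h.commute_of_central (hx ▸ hp) hc hl

theorem KillsPrimeSums.isCyclic_of_isPGroup {L A : Type*} [Group L] [Finite L] [Ring A]
    [CharZero A] {σ : L →* A} (hσ : KillsPrimeSums σ) {p : ℕ} [Fact p.Prime] (h2 : p ≠ 2)
    {H : Subgroup L} (hH : IsPGroup p H) : IsCyclic H :=
  UniqueCommutingOrder.isCyclic hH (fun _ _ hx hy hxy =>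
    (hσ.comp H.subtype_injective).mem_zpowers_of_commute Fact.out hx hy hxy) h2

theorem KillsPrimeSums.exists_hom_apply_ne_one {L A : Type*} [Group L] [Finite L] [Ring A]
    [CharZero A] {σ : L →* A} (hσ : KillsPrimeSums σ) {p : ℕ} [Fact p.Prime] (h2 : p ≠ 2) {x : L}
    (hx : orderOf x = p) (hc : ∀ g, g * x = x * g) : ∃ l : L →* ℂˣ, l x ≠ 1 := by
  obtain ⟨P, hP⟩ := (IsPGroup.of_card (n := 1) (by rw [Nat.card_zpowers, hx, pow_one]) :
    IsPGroup p (Subgroup.zpowers x)).exists_le_sylow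
  have := hσ.isCyclic_of_isPGroup h2 P.isPGroup'
  have : IsMulCommutative (P : Subgroup L) := IsCyclic.isMulCommutative
  exact exists_hom_apply_ne_one_of_central P (hP (Subgroup.mem_zpowers x))
    (fun h1 => (Fact.out : p.Prime).ne_one (by rw [← hx, h1, orderOf_one])) hc

theorem Subgroup.index_centralizer_eq_two {L : Type*} [Group L] {x t : L}
    (h : ∀ g, g * x * g⁻¹ = x ∨ g * x * g⁻¹ = x⁻¹) (ht : t * x * t⁻¹ ≠ x) :
    (Subgroup.centralizer {x}).index = 2 := by
  have hmem : ∀ g, g ∈ Subgroup.centralizer {x} ↔ g * x * g⁻¹ = x := fun g => by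
    rw [Subgroup.mem_centralizer_singleton_iff, mul_inv_eq_iff_eq_mul]
  have ht' := (h t).resolve_left ht
  rw [Subgroup.index_eq_two_iff]
  refine ⟨t, fun g => ?_⟩
  have h1 : g * t * x * (g * t)⁻¹ = (g * x * g⁻¹)⁻¹ := by
    rw [show g * t * x * (g * t)⁻¹ = g * (t * x * t⁻¹) * g⁻¹ by group, ht']; group
  rw [hmem, hmem, h1]
  have hne : x⁻¹ ≠ x := fun he => ht (ht'.trans he)
  rcases h g with h2 | h2
  · exact Or.inr ⟨h2, by rw [h2]; exact hne⟩
  · exact Or.inl ⟨by rw [h2, inv_inv], by rw [h2]; exact hne⟩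

/-- The element `x` of order three in `⟨t⟩` generates the only subgroup of order three. If `x` is
central, `L` is abelian; otherwise its centralizer has index two. For `t` of order three the
commutator lies in `⟨t⟩`. If `9` divides the order, let `ν` be a linear character of the centralizer
with `ν x ≠ 1`: the characters induced from `ν` and `ν³` are irreducible of degree two with values
`-1` and `2` at `x`. -/
theorem RationalValuesAgree.conj_mul_inv_pow_three {L n : Type*} [Group L] [Finite L] [Fintype n]
    [DecidableEq n] {ρ : L →* Matrix n n ℝ} (hρ : IsFixedPointFreeRep ρ)
    (h : RationalValuesAgree L) {t : L} (i : L) {k : ℕ} (ht : orderOf t = 3 ^ k) :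
    (t * i * t⁻¹ * i⁻¹) ^ 3 = 1 := by
  have := hρ.nonempty
  have : CharZero (Matrix n n ℝ) := algebraRat.charZero _
  have h3F := Fact.mk Nat.prime_three
  have hσ := hρ.killsPrimeSums
  by_cases hab : ∀ a b : L, a * b = b * a
  · rw [hab t i]; simp
  rcases Nat.eq_zero_or_pos k with rfl | hk
  · rw [pow_zero, orderOf_eq_one_iff] at ht
    simp [ht]
  have hpos : 0 < orderOf t := orderOf_pos t
  obtain ⟨x, hx, hxt⟩ : ∃ x, orderOf x = 3 ∧ x = t ^ (3 ^ (k - 1)) := by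
    refine ⟨_, ?_, rfl⟩
    have := orderOf_pow_orderOf_div hpos.ne' (ht ▸ dvd_pow_self 3 hk.ne' : 3 ∣ orderOf t)
    rwa [ht, Nat.pow_div hk (by norm_num)] at this
  have hconj : ∀ g, g * x * g⁻¹ = x ∨ g * x * g⁻¹ = x⁻¹ := fun g =>
    h.eq_or_eq_inv_of_orderOf_three hρ hx (by rw [IsFixedPointFreeRep.orderOf_conj, hx])
  by_cases hcen : ∀ g, g * x = x * g
  · obtain ⟨l, hl⟩ := hσ.exists_hom_apply_ne_one (by norm_num) hx hcen
    exact (hab (h.commute_of_central (hx ▸ Nat.prime_three) hcen hl)).elim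
  push Not at hcen
  obtain ⟨u, hu⟩ := hcen
  have hux : u * x * u⁻¹ ≠ x := fun he => hu (mul_inv_eq_iff_eq_mul.1 he)
  set C := Subgroup.centralizer {x} with hC
  have hidx : C.index = 2 := Subgroup.index_centralizer_eq_two hconj hux
  have hmem : ∀ g, g ∈ C ↔ g * x * g⁻¹ = x := fun g => by
    rw [Subgroup.mem_centralizer_singleton_iff, mul_inv_eq_iff_eq_mul]
  have huC : u ∉ C := fun hm => hux ((hmem u).1 hm)
  have hux' : u⁻¹ * x * u = x⁻¹ := by
    have h1 := hconj u⁻¹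
    rw [inv_inv] at h1
    refine h1.resolve_left fun h2 => hux ?_
    rw [mul_assoc, inv_mul_eq_iff_eq_mul] at h2
    rw [← h2, mul_inv_cancel_right]
  have hxC : x ∈ C := (hmem x).2 (by group)
  obtain ⟨ν, hν⟩ := (hσ.comp C.subtype_injective).exists_hom_apply_ne_one (p := 3) (by norm_num)
    (x := ⟨x, hxC⟩) (by rw [Subgroup.orderOf_mk, hx])
    (fun g => Subtype.ext (Subgroup.mem_centralizer_singleton_iff.1 g.2))
  set ω : ℂˣ := ν ⟨x, hxC⟩ with hω
  have hω3 : ω ^ 3 = 1 := by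
    rw [hω, ← map_pow, show (⟨x, hxC⟩ : C) ^ 3 = 1 from Subtype.ext (by
      change x ^ 3 = 1; rw [← hx, pow_orderOf_eq_one]), map_one]
  have hωinv : ω⁻¹ ≠ ω := by
    intro h1
    have h2 : ω * ω = 1 := by nth_rewrite 1 [← h1]; exact inv_mul_cancel ω
    rw [pow_succ, pow_two, h2, one_mul] at hω3
    exact hν hω3
  have hνinv : ∀ hm : x⁻¹ ∈ C, ν ⟨x⁻¹, hm⟩ = ω⁻¹ := fun hm => by
    rw [hω, ← map_inv]; rfl
  have hxiC : x⁻¹ ∈ C := C.inv_mem hxC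
  have hsum : (ω : ℂ) + (ω⁻¹ : ℂˣ) = -1 := by
    have h1 : (ω : ℂ) ≠ 1 := fun h1 => hν (Units.ext h1)
    have h2 : (ω : ℂ) ^ 3 = 1 := by
      rw [← Units.val_pow_eq_pow_val, hω3, Units.val_one]
    have h3 : ((ω⁻¹ : ℂˣ) : ℂ) = ω ^ 2 := by
      rw [Units.val_inv_eq_inv_val]
      exact inv_eq_of_mul_eq_one_right (by rw [← pow_succ', h2])
    rw [h3]
    have h4 : ((ω : ℂ) - 1) * (ω + ω ^ 2 + 1) = 0 := by linear_combination h2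
    have h5 := (mul_eq_zero.1 h4).resolve_left (sub_ne_zero.2 h1)
    linear_combination h5
  have hone : (1 : L) ∈ C := C.one_mem
  obtain hk1 | hk2 : k = 1 ∨ 2 ≤ k := by omega
  · have htx : x = t := by rw [hxt, hk1]; simp
    rw [← htx]
    have h1 : x * i * x⁻¹ * i⁻¹ = x * (i * x * i⁻¹)⁻¹ := by group
    rw [h1]
    rcases hconj i with h2 | h2 <;> rw [h2]
    · simp
    · rw [inv_inv, ← pow_two, ← pow_mul, mul_comm, pow_mul, ← hx, pow_orderOf_eq_one, one_pow]
  · exfalso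
    obtain ⟨r, hr⟩ : ∃ r : L, r ^ 3 = x :=
      ⟨t ^ 3 ^ (k - 2), by rw [hxt, ← pow_mul, ← pow_succ]; congr 2; omega⟩
    have hrC : r ∈ C := Subgroup.mem_centralizer_singleton_iff.2 (by rw [← hr, ← pow_succ, ← pow_succ'])
    have hCn : C.Normal := Subgroup.normal_of_index_eq_two hidx
    have hr'C : u⁻¹ * r * u ∈ C := by simpa using hCn.conj_mem r hrC u⁻¹
    have hχ : IsIrrChar _ := IsIrrChar.induced_of_index_two C hidx ν huC hxC (by
      rw [hux', extendByZero_of_mem hxiC, extendByZero_of_mem hxC, hνinv]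
      exact fun he => hωinv (Units.ext he))
    have hψ : IsIrrChar _ := IsIrrChar.induced_of_index_two C hidx (ν ^ 3) huC hrC (by
      rw [extendByZero_of_mem hr'C, extendByZero_of_mem hrC, MonoidHom.pow_apply,
        MonoidHom.pow_apply, ← map_pow, ← map_pow]
      have e1 : (⟨u⁻¹ * r * u, hr'C⟩ : C) ^ 3 = ⟨x⁻¹, hxiC⟩ := Subtype.ext (by
        have := conj_pow (a := u⁻¹) (b := r) (i := 3)
        rw [inv_inv, hr, hux'] at this
        exact this)
      have e2 : (⟨r, hrC⟩ : C) ^ 3 = ⟨x, hxC⟩ := Subtype.ext hr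
      rw [e1, e2, hνinv]
      exact fun he => hωinv (Units.ext he))
    have h1 : ∀ μ : C →* ℂˣ, extendByZero C μ 1 + extendByZero C μ (u⁻¹ * 1 * u) = 2 := by
      intro μ
      rw [mul_one, inv_mul_cancel, extendByZero_of_mem hone,
        show (⟨1, hone⟩ : C) = 1 from rfl, map_one]
      norm_num
    have h2 := h _ _ hχ hψ (by rw [h1]; norm_num) (by rw [h1, h1]) x (-1) (by
      rw [hux', extendByZero_of_mem hxiC, extendByZero_of_mem hxC, hνinv, hsum]; norm_num)
    rw [hux', extendByZero_of_mem hxiC, extendByZero_of_mem hxC, MonoidHom.pow_apply,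
      MonoidHom.pow_apply, hνinv, ← hω, inv_pow, hω3] at h2
    norm_num at h2

/-! ### Fusion of involutions in a dihedral Sylow subgroup. -/

section DihedralFusion

variable {D : Type*} [Group D]

/-- An element permuting the involutions of a Klein four-group cyclically has a power of `3`-power
order with the same property. -/
theorem false_of_semiconjBy_cycle [Finite D]
    (h3 : ∀ (t i : D) (k : ℕ), orderOf t = 3 ^ k → (t * i * t⁻¹ * i⁻¹) ^ 3 = 1) {t v w : D}
    (hv : v * v = 1) (hw : w * w = 1) (hvw : v ≠ w) (hcomm : Commute v w)
    (h1 : SemiconjBy t v w) (h2 : SemiconjBy t w (v * w)) : False := by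
  have h4 : SemiconjBy t (v * w) v := by
    have := h1.mul_right h2
    rwa [← mul_assoc, ← hcomm.eq, mul_assoc, hw, mul_one] at this
  have h5 : SemiconjBy (t ^ 3) v v := by
    rw [pow_succ, pow_two]
    exact (h4.mul_left h2).mul_left h1
  have h6 : ∀ q : ℕ, SemiconjBy (t ^ (3 * q + 1)) v w := by
    intro q
    rw [pow_succ', pow_mul]
    exact h1.mul_left (Commute.pow_left (show Commute (t ^ 3) v from h5) q)
  obtain ⟨k, m, hm, hkm⟩ := Nat.exists_eq_pow_mul_and_not_dvd (orderOf_pos t).ne' 3 (by norm_num)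
  -- With `m` the part of the order prime to three, `m²` is `1` modulo `3`, so `t^(m²)` still moves
  -- `v` to `w` and has `3`-power order. Its commutator with `v` is the involution `w v`, whose cube
  -- is not `1`.
  obtain ⟨q, hq⟩ : ∃ q, m * m = 3 * q + 1 := by
    refine ⟨m * m / 3, ?_⟩
    have : m * m % 3 = 1 := by
      rcases (by omega : m % 3 = 1 ∨ m % 3 = 2) with h | h <;> simp [Nat.mul_mod, h]
    omega
  have h7 : orderOf (t ^ (m * m)) ∣ 3 ^ k := by
    refine orderOf_dvd_of_pow_eq_one ?_
    rw [← pow_mul, show m * m * 3 ^ k = orderOf t * m by rw [hkm]; ring, pow_mul,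
      pow_orderOf_eq_one, one_pow]
  obtain ⟨j, -, hj⟩ := (Nat.dvd_prime_pow Nat.prime_three).1 h7
  have h8 := h3 _ v j hj
  have h9 := h6 q
  rw [← hq] at h9
  rw [mul_inv_eq_iff_eq_mul.2 h9, inv_eq_of_mul_eq_one_right hv, pow_succ, pow_two,
    show w * v * (w * v) = 1 by
      rw [← hcomm.eq, mul_assoc, ← mul_assoc w v w, ← hcomm.eq, mul_assoc, hw, mul_one, hv],
    one_mul, mul_eq_one_iff_eq_inv, inv_eq_of_mul_eq_one_right hv] at h8
  exact hvw h8.symm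

theorem eq_pow_of_mul_self_eq_one [Finite D] {a y : D} (h2 : 2 ∣ orderOf a)
    (hy : y ∈ Subgroup.zpowers a) (hy2 : y * y = 1) (hy1 : y ≠ 1) : y = a ^ (orderOf a / 2) := by
  obtain ⟨j, rfl⟩ := (mem_powers_iff_mem_zpowers.2 hy)
  obtain ⟨m, hm⟩ := h2
  have hpos := orderOf_pos a
  change a ^ j * a ^ j = 1 at hy2
  change a ^ j ≠ 1 at hy1
  change a ^ j = _
  rw [← pow_add, ← two_mul, ← orderOf_dvd_iff_pow_eq_one, hm] at hy2
  obtain ⟨c, hc⟩ := Nat.dvd_of_mul_dvd_mul_left two_pos hy2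
  rw [show orderOf a / 2 = m by omega, pow_eq_pow_iff_modEq, hm, hc]
  rcases Nat.even_or_odd' c with ⟨e, he | he⟩
  · refine (hy1 ?_).elim
    rw [← orderOf_dvd_iff_pow_eq_one, hm, hc, he]
    exact ⟨e, by ring⟩
  · rw [he, show m * (2 * e + 1) = 2 * m * e + m by ring]
    simp [Nat.ModEq]

/-- `S` is dihedral with rotations `⟨a⟩`, and all reflections are conjugate to the central rotation
`v` of order two. Such fusion produces an element that permutes `v`, `b`, `v b` cyclically, against
`h3`. -/
theorem false_of_dihedral_fusion [Finite D] (S : Sylow 2 D) {a b : D} (ha : a ∈ S) (hb : b ∈ S)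
    (hbA : b ∉ Subgroup.zpowers a) (heven : 2 ∣ orderOf a)
    (hS : ∀ g ∈ S, g ∉ Subgroup.zpowers a → g * g = 1 ∧ g * a * g⁻¹ = a⁻¹)
    (hprod : ∀ g ∈ S, g ∉ Subgroup.zpowers a → g * b ∈ Subgroup.zpowers a)
    (hfus : ∀ g ∈ S, g ∉ Subgroup.zpowers a → ∃ y, y * g * y⁻¹ ∈ Subgroup.zpowers a)
    (h3 : ∀ (t i : D) (k : ℕ), orderOf t = 3 ^ k → (t * i * t⁻¹ * i⁻¹) ^ 3 = 1) : False := by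
  have h2F := Fact.mk Nat.prime_two
  have hpos := orderOf_pos a
  obtain ⟨v, hvdef⟩ : ∃ v, v = a ^ (orderOf a / 2) := ⟨_, rfl⟩
  have hvA : v ∈ Subgroup.zpowers a := hvdef ▸ Subgroup.pow_mem _ (Subgroup.mem_zpowers a) _
  have hv2 : orderOf v = 2 := hvdef ▸ orderOf_pow_orderOf_div hpos.ne' heven
  have hvv : v * v = 1 := by rw [← pow_two, ← hv2, pow_orderOf_eq_one]
  have hv1 : v ≠ 1 := fun h => by rw [h, orderOf_one] at hv2; omega
  have hAS : Subgroup.zpowers a ≤ (S : Subgroup D) := by rwa [Subgroup.zpowers_le]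
  have hvinv : v⁻¹ = v := inv_eq_of_mul_eq_one_right hvv
  have hinvert : ∀ g ∈ S, g ∉ Subgroup.zpowers a → ∀ j : ℕ, SemiconjBy g (a ^ j) (a ^ j)⁻¹ := by
    intro g hg hgA j
    have h4 : SemiconjBy g a a⁻¹ := mul_inv_eq_iff_eq_mul.1 (hS g hg hgA).2
    rw [← inv_pow]
    exact h4.pow_right j
  have hvS : ∀ g ∈ S, Commute g v := by
    intro g hg
    by_cases hgA : g ∈ Subgroup.zpowers a
    · obtain ⟨j, rfl⟩ := hgA
      rw [hvdef]
      exact ((Commute.refl a).zpow_left j).pow_right _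
    · have h4 := hinvert g hg hgA (orderOf a / 2)
      rwa [← hvdef, hvinv] at h4
  have hbb : b * b = 1 := (hS b hb hbA).1
  have hvb : v ≠ b := fun h => hbA (h ▸ hvA)
  have hcomm : Commute v b := (hvS b hb).symm
  have hconj : ∀ g ∈ S, g ∉ Subgroup.zpowers a → ∃ y, SemiconjBy y g v := by
    intro g hg hgA
    obtain ⟨y, hy⟩ := hfus g hg hgA
    refine ⟨y, mul_inv_eq_iff_eq_mul.1 ?_⟩
    rw [hvdef]
    refine eq_pow_of_mul_self_eq_one heven hy ?_ fun h4 => ?_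
    · rw [show y * g * y⁻¹ * (y * g * y⁻¹) = y * (g * g) * y⁻¹ by group, (hS g hg hgA).1]; group
    · rw [mul_inv_eq_one, mul_eq_left] at h4
      exact hgA (h4 ▸ Subgroup.one_mem _)
  by_cases h4 : 4 ∣ orderOf a
  · obtain ⟨h, hhA, hhh, hhc⟩ : ∃ h ∈ Subgroup.zpowers a, h * h = v ∧
        ∀ c ∈ S, c ∉ Subgroup.zpowers a → SemiconjBy h c (v * c) := by
      refine ⟨a ^ (orderOf a / 4), Subgroup.pow_mem _ (Subgroup.mem_zpowers a) _, ?_, ?_⟩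
      · rw [hvdef, ← pow_add]; congr 1; omega
      · intro c hc hcA
        have h5 := (hinvert c hc hcA (orderOf a / 4)).inv_right
        rw [inv_inv] at h5
        have h6 : v = a ^ (orderOf a / 4) * a ^ (orderOf a / 4) := by
          rw [hvdef, ← pow_add]; congr 1; omega
        rw [h6]
        have h7 : a ^ (orderOf a / 4) * c = c * (a ^ (orderOf a / 4))⁻¹ := h5.eq.symm
        change _ = a ^ (orderOf a / 4) * a ^ (orderOf a / 4) * c * a ^ (orderOf a / 4)
        rw [mul_assoc _ _ c, h7, ← mul_assoc, h7, mul_assoc c, mul_assoc c, inv_mul_cancel_right]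
    have hhv : Commute h v := hvS h (hAS hhA)
    obtain ⟨y, hy⟩ := hconj b hb hbA
    have hSC : (S : Subgroup D) ≤ Subgroup.centralizer {v} := fun g hg =>
      Subgroup.mem_centralizer_singleton_iff.2 (hvS g hg).eq
    have hcC : y * v * y⁻¹ ∈ Subgroup.centralizer {v} := by
      have h5 : SemiconjBy y v (y * v * y⁻¹) := by
        change y * v = y * v * y⁻¹ * y; rw [inv_mul_cancel_right]
      have h6 := (hcomm.symm.eq ▸ (h5.mul_right hy) : SemiconjBy y (b * v) _)
      have h7 := hy.mul_right h5
      exact Subgroup.mem_centralizer_singleton_iff.2 (mul_right_cancel (h6.eq.symm.trans h7.eq))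
    -- `S` is a Sylow subgroup of the centralizer of `v` as well, so the conjugate of `v` can be
    -- moved into `S` by an element commuting with `v`.
    obtain ⟨m, hmv, hmS⟩ : ∃ m, Commute m v ∧ m * (y * v * y⁻¹) * m⁻¹ ∈ S := by
      have hpg : IsPGroup 2 (Subgroup.zpowers (⟨_, hcC⟩ : Subgroup.centralizer {v})) :=
        IsPGroup.of_card (n := 1) (by
          rw [Nat.card_zpowers, Subgroup.orderOf_mk, IsFixedPointFreeRep.orderOf_conj, hv2, pow_one])
      obtain ⟨Q, hQ⟩ := hpg.exists_le_sylow
      obtain ⟨m, hm⟩ := MulAction.exists_smul_eq (Subgroup.centralizer {v}) Q (S.subtype hSC)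
      refine ⟨m, Subgroup.mem_centralizer_singleton_iff.1 m.2, ?_⟩
      have h5 : m * ⟨_, hcC⟩ * m⁻¹ ∈ S.subtype hSC := by
        rw [← hm]
        exact ⟨⟨_, hcC⟩, hQ (Subgroup.mem_zpowers _), rfl⟩
      exact h5
    obtain ⟨g, c, hgb, hgv, hcS⟩ : ∃ g c, SemiconjBy g b v ∧ SemiconjBy g v c ∧ c ∈ S := by
      refine ⟨m * y, _, SemiconjBy.mul_left hmv hy, ?_, hmS⟩
      change m * y * v = m * (y * v * y⁻¹) * m⁻¹ * (m * y)
      group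
    have hcv : c ≠ v := by
      rintro rfl
      exact hvb (mul_left_cancel (hgv.eq.trans hgb.eq.symm))
    have hcc : c * c = 1 := by
      have := hgv.mul_right hgv
      rw [hvv] at this
      exact (mul_right_cancel ((one_mul g).trans ((mul_one g).symm.trans this.eq))).symm
    have hcA : c ∉ Subgroup.zpowers a := fun hcA => hcv (hvdef ▸ eq_pow_of_mul_self_eq_one heven hcA hcc
      (fun hc1 => hv1 (by
        have := hgv.eq
        rw [hc1, one_mul] at this
        exact mul_eq_left.1 this)))
    -- Here `h² = v`. The element `h` fixes `v` and exchanges `b` with `b v`; its conjugate fixes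
    -- `b` and exchanges `v` with `b v`. Their product is a three-cycle.
    have hkb : SemiconjBy (g⁻¹ * h * g) b b := (hgb.inv_symm_left.mul_left hhv).mul_left hgb
    have hkv : SemiconjBy (g⁻¹ * h * g) v (b * v) :=
      ((hgb.inv_symm_left.mul_right hgv.inv_symm_left).mul_left (hhc c hcS hcA)).mul_left hgv
    refine false_of_semiconjBy_cycle h3 (t := g⁻¹ * h * g * h) (v := v) (w := b * v) hvv ?_ ?_ ?_
      (hkv.mul_left hhv) ?_
    · rw [← hcomm.eq, mul_assoc, ← mul_assoc b, ← hcomm.eq, mul_assoc, hbb, mul_one, hvv]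
    · intro h5
      have h6 : b = 1 := by
        have := h5.symm; rwa [mul_eq_right] at this
      exact hbA (h6 ▸ Subgroup.one_mem _)
    · exact Commute.mul_right hcomm (Commute.refl v)
    · have h5 : SemiconjBy h (b * v) b := by
        have := (hhc b hb hbA).mul_right hhv
        rwa [hcomm.eq, mul_assoc, hvv, mul_one] at this
      have h6 := hkb.mul_left h5
      rwa [show v * (b * v) = b by rw [← mul_assoc, hcomm.eq, mul_assoc, hvv, mul_one]]
  -- Now `S` is a Klein four-group. Being abelian, its fusion is realized in its normalizer, and
  -- elements sending `b` and `v b` to `v` combine to a three-cycle.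
  · have ha2 : orderOf a = 2 := by
      obtain ⟨k, hk⟩ := S.isPGroup'.exists_orderOf_eq_pow ⟨a, ha⟩
      rw [Subgroup.orderOf_mk] at hk
      have hk0 : k ≠ 0 := by rintro rfl; omega
      have hk2 : ¬ 2 ≤ k := fun h5 => h4 (hk ▸ (pow_dvd_pow 2 h5 : 2 ^ 2 ∣ 2 ^ k))
      rw [hk, show k = 1 by omega, pow_one]
    have hva : v = a := by rw [hvdef, ha2]; simp
    have hA : ∀ g ∈ Subgroup.zpowers a, g = 1 ∨ g = v := by
      intro g hg
      by_cases hg1 : g = 1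
      · exact Or.inl hg1
      · refine Or.inr (hvdef ▸ eq_pow_of_mul_self_eq_one heven hg ?_ hg1)
        have := pow_card_eq_one' (G := Subgroup.zpowers a) (x := ⟨g, hg⟩)
        rw [Nat.card_zpowers, ha2, pow_two] at this
        exact congrArg Subtype.val this
    have hmem : ∀ g ∈ S, g = 1 ∨ g = v ∨ g = b ∨ g = v * b := by
      intro g hg
      by_cases hgA : g ∈ Subgroup.zpowers a
      · exact (hA g hgA).imp id Or.inl
      · have h5 : g = g * b * b := by rw [mul_assoc, hbb, mul_one]
        rcases hA _ (hprod g hg hgA) with h6 | h6 <;> rw [h6] at h5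
        · rw [one_mul] at h5; exact Or.inr (Or.inr (Or.inl h5))
        · exact Or.inr (Or.inr (Or.inr h5))
    have hsq : ∀ g ∈ S, g * g = 1 := by
      intro g hg
      by_cases hgA : g ∈ Subgroup.zpowers a
      · rcases hA g hgA with h5 | h5 <;> rw [h5]
        · exact one_mul 1
        · exact hvv
      · exact (hS g hg hgA).1
    have hSc : IsMulCommutative S := ⟨⟨fun x y => Subtype.ext (by
      have h5 := inv_eq_of_mul_eq_one_right (hsq _ (mul_mem x.2 y.2))
      rwa [mul_inv_rev, inv_eq_of_mul_eq_one_right (hsq _ x.2),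
        inv_eq_of_mul_eq_one_right (hsq _ y.2), eq_comm] at h5)⟩⟩
    have hvbA : v * b ∉ Subgroup.zpowers a := fun h5 =>
      hbA ((Subgroup.mul_mem_cancel_left _ hvA).1 h5)
    have hvbS : v * b ∈ S := mul_mem (hAS hvA) hb
    have hbring : ∀ x ∈ S, x ∉ Subgroup.zpowers a → ∃ n, n ∈ Subgroup.normalizer (S : Set D) ∧
        SemiconjBy n x v := by
      intro x hx hxA
      obtain ⟨y, hy⟩ := hconj x hx hxA
      obtain ⟨n, hn, h6⟩ := S.conj_eq_normalizer_conj_of_mem x y⁻¹ hx (by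
        rw [inv_inv, mul_inv_eq_iff_eq_mul.2 hy.eq]; exact hAS hvA)
      rw [inv_inv, mul_inv_eq_iff_eq_mul.2 hy.eq] at h6
      exact ⟨n⁻¹, inv_mem hn, by rw [h6]; change n⁻¹ * x = n⁻¹ * x * n * n⁻¹; group⟩
    have hstep : ∀ n x, n ∈ Subgroup.normalizer (S : Set D) → SemiconjBy n x v → x ≠ v →
        SemiconjBy n v b ∨ SemiconjBy n v (v * b) := by
      intro n x hn hx hxv
      have h5 : n * v * n⁻¹ ∈ S := (Subgroup.mem_normalizer_iff.1 hn v).1 (hAS hvA)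
      have h6 : ∀ u, n * v * n⁻¹ = u → SemiconjBy n v u := fun u hu => mul_inv_eq_iff_eq_mul.1 hu
      rcases hmem _ h5 with h7 | h7 | h7 | h7
      · rw [mul_inv_eq_one, mul_eq_left] at h7
        exact (hv1 h7).elim
      · exact (hxv (mul_left_cancel (hx.eq.trans (h6 _ h7).eq.symm))).elim
      · exact Or.inl (h6 _ h7)
      · exact Or.inr (h6 _ h7)
    have hvbv : v * b * v = b := by rw [hcomm.eq, mul_assoc, hvv, mul_one]
    have hvbvb : v * b * (v * b) = 1 := hsq _ hvbS
    have hb1 : b ≠ 1 := fun h5 => hbA (h5 ▸ Subgroup.one_mem _)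
    have hne : v ≠ v * b := fun h5 => hb1 (mul_eq_left.1 h5.symm)
    have hcomm' : Commute v (v * b) := (Commute.refl v).mul_right hcomm
    obtain ⟨n, hn, hnb⟩ := hbring b hb hbA
    obtain ⟨m, hm, hmvb⟩ := hbring (v * b) hvbS hvbA
    rcases hstep n b hn hnb hvb.symm with hnv | hnv
    · rcases hstep m (v * b) hm hmvb hne.symm with hmv | hmv
      · refine false_of_semiconjBy_cycle h3 hvv hbb hvb hcomm hmv ?_
        have h5 := hmvb.mul_right hmv
        rwa [hvbv] at h5
      · refine false_of_semiconjBy_cycle h3 (t := m * n) hvv hbb hvb hcomm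
          (SemiconjBy.mul_left ?_ hnv) (hmv.mul_left hnb)
        have h5 := hmv.mul_right hmvb
        rwa [hvbv, ← mul_assoc, hvv, one_mul] at h5
    · refine false_of_semiconjBy_cycle h3 hvv hvbvb hne hcomm' hnv ?_
      have h5 := hnb.mul_right hnv
      rwa [← hcomm.eq] at h5

end DihedralFusion

/-! ### Elements of odd order in a group with one involution. -/

theorem IsPGroup.exists_quaternion_data {U : Type*} [Group U] [Finite U] {P : Subgroup U}
    (hP : IsPGroup 2 P) (huniq : ∀ x y : U, orderOf x = 2 → orderOf y = 2 → x = y)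
    (hcyc : ¬ IsCyclic P) :
    ∃ a ∈ P, 4 ∣ orderOf a ∧ (∃ b ∈ P, b ∉ Subgroup.zpowers a) ∧
      (∀ x ∈ P, Commute x a → x ∈ Subgroup.zpowers a) ∧
      ∀ g ∈ P, g ∉ Subgroup.zpowers a → g * a * g⁻¹ = a⁻¹ ∧ g * g = a ^ (orderOf a / 2) := by
  obtain ⟨⟨a, ha⟩, h4, htop, hself, hinv⟩ := (isCyclic_or_quaternion_of_unique_involution hP
    (fun x y hx hy => Subtype.ext (huniq x y (by rwa [Subgroup.orderOf_coe])
      (by rwa [Subgroup.orderOf_coe])))).resolve_left hcyc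
  have hmem : ∀ g (hg : g ∈ P), (⟨g, hg⟩ : P) ∈ Subgroup.zpowers (⟨a, ha⟩ : P) ↔
      g ∈ Subgroup.zpowers a := by
    intro g hg
    simp only [Subgroup.mem_zpowers_iff, Subtype.ext_iff, Subgroup.coe_zpow]
  rw [Subgroup.orderOf_mk] at h4
  refine ⟨a, ha, h4, ?_, fun x hx hxa => (hmem x hx).1 (hself ⟨x, hx⟩ (Subtype.ext hxa)),
    fun g hg hgA => ?_⟩
  · by_contra! hcon
    exact htop (eq_top_iff.2 fun x _ => (hmem x x.2).2 (hcon x x.2))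
  · obtain ⟨h1, h2⟩ := hinv ⟨g, hg⟩ (fun h => hgA ((hmem g hg).1 h))
    rw [Subgroup.orderOf_mk] at h2
    exact ⟨congrArg Subtype.val h1, congrArg Subtype.val h2⟩

theorem relIndex_zpowers_eq_two {U : Type*} [Group U] {P : Subgroup U} {a b : U}
    (hb : b ∈ P) (hbA : b ∉ Subgroup.zpowers a)
    (hprod : ∀ g ∈ P, g ∉ Subgroup.zpowers a → g * b ∈ Subgroup.zpowers a) :
    (Subgroup.zpowers a).relIndex P = 2 := by
  rw [Subgroup.relIndex, Subgroup.index_eq_two_iff]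
  refine ⟨⟨b, hb⟩, fun g => ?_⟩
  simp only [Subgroup.mem_subgroupOf, Subgroup.coe_mul]
  by_cases hg : (g : U) ∈ Subgroup.zpowers a
  · exact Or.inr ⟨hg, fun h => hbA ((Subgroup.mul_mem_cancel_left _ hg).1 h)⟩
  · exact Or.inl ⟨hprod g g.2 hg, hg⟩

theorem sign_of_mul_self_eq_one {X : Type*} [Fintype X] [DecidableEq X] {τ : Equiv.Perm X}
    (h1 : τ * τ = 1) (h2 : ∀ x, τ x ≠ x) {m : ℕ} (hm : Odd m) (hX : Fintype.card X = 2 * m) :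
    Equiv.Perm.sign τ = -1 := by
  have h2F := Fact.mk Nat.prime_two
  have hrep := Equiv.Perm.cycleType_of_pow_prime_eq_one (p := 2) (by rw [pow_two, h1])
  have hsupp : τ.support = Finset.univ := by
    ext x; simp [h2 x]
  have hsum := Equiv.Perm.sum_cycleType τ
  rw [hsupp, Finset.card_univ, hX, hrep, Multiset.sum_replicate, smul_eq_mul, mul_comm] at hsum
  have hc : τ.cycleType.card = m := by omega
  rw [Equiv.Perm.sign_of_cycleType, hrep, Multiset.sum_replicate, Multiset.card_replicate, hc]
  obtain ⟨e, rfl⟩ := hm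
  rw [show (2 * e + 1) • 2 + (2 * e + 1) = 2 * (3 * e + 1) + 1 by simp; ring, pow_succ, pow_mul]
  simp

/-- A fixed point free involution on a set of cardinality twice an odd number is odd. -/
theorem exists_lt_top_of_sign {U : Type*} [Group U] [Finite U] {A : Subgroup U} {b : U} {m : ℕ}
    (hm : Odd m) (hA : A.index = 2 * m) (hb2 : ∀ g : U, g⁻¹ * (b * b) * g ∈ A)
    (hb : ∀ g : U, g⁻¹ * b * g ∉ A) :
    ∃ N : Subgroup U, N ≠ ⊤ ∧ ∀ g, Odd (orderOf g) → g ∈ N := by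
  classical
  have := Fintype.ofFinite (U ⧸ A)
  let f : U →* ℤˣ := Equiv.Perm.sign.comp (MulAction.toPermHom U (U ⧸ A))
  have hfb : f b = -1 := by
    refine sign_of_mul_self_eq_one ?_ ?_ hm (by rw [← hA, Subgroup.index, Nat.card_eq_fintype_card])
    · rw [← map_mul]
      ext x
      obtain ⟨g, rfl⟩ := QuotientGroup.mk_surjective x
      have : ((b * b * g : U) : U ⧸ A) = (g : U ⧸ A) := by
        rw [eq_comm, QuotientGroup.eq, ← mul_assoc]; exact hb2 g
      exact this
    · intro x
      obtain ⟨g, rfl⟩ := QuotientGroup.mk_surjective x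
      intro h
      have h1 : ((b * g : U) : U ⧸ A) = (g : U ⧸ A) := h
      rw [eq_comm, QuotientGroup.eq, ← mul_assoc] at h1
      exact hb g h1
  refine ⟨f.ker, fun htop => ?_, fun g hg => ?_⟩
  · have h1 : f b = 1 := MonoidHom.mem_ker.1 (htop ▸ Subgroup.mem_top b)
    rw [hfb] at h1
    exact absurd h1 (by decide)
  · rw [MonoidHom.mem_ker]
    obtain ⟨e, he⟩ := hg
    have h1 : f g ^ (orderOf g) = 1 := by rw [← map_pow, pow_orderOf_eq_one, map_one]
    rw [he, pow_succ, pow_mul, Int.units_sq, one_pow, one_mul] at h1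
    exact h1

/-- Two is the least prime divisor of the order, so a cyclic Sylow `2`-subgroup is central in its
normalizer, and the kernel of the transfer is a normal complement. -/
theorem exists_lt_top_of_isCyclic_sylow {U : Type*} [Group U] [Finite U] (h2 : 2 ∣ Nat.card U)
    (P : Sylow 2 U) (hP : IsCyclic P) :
    ∃ N : Subgroup U, N ≠ ⊤ ∧ ∀ g, Odd (orderOf g) → g ∈ N := by
  have h2F := Fact.mk Nat.prime_two
  have hmin : (Nat.card U).minFac = 2 := (Nat.minFac_eq_two_iff _).2 h2
  have hle := hP.normalizer_le_centralizer hmin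
  have hcomp := MonoidHom.ker_transferSylow_isComplement' P hle
  refine ⟨(MonoidHom.transferSylow P hle).ker, fun htop => ?_, fun g hg => ?_⟩
  · have h1 := hcomp.index_eq_card
    rw [htop, Subgroup.card_top] at h1
    exact P.not_dvd_index (h1 ▸ h2)
  · rw [MonoidHom.mem_ker]
    obtain ⟨k, hk⟩ := P.isPGroup'.exists_orderOf_eq_pow (MonoidHom.transferSylow P hle g)
    have h1 : orderOf (MonoidHom.transferSylow P hle g) ∣ orderOf g := orderOf_map_dvd _ g
    have h3 : (2 ^ k).Coprime (orderOf g) := Nat.Coprime.pow_left k hg.coprime_two_left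
    rw [← orderOf_eq_one_iff]
    exact Nat.eq_one_of_dvd_coprimes h3 (hk ▸ dvd_rfl) h1

/-- Let the Sylow subgroup be generalized quaternion with cyclic half `⟨a⟩`. An element outside
`⟨a⟩` not conjugate into it acts on the cosets of `⟨a⟩`, twice an odd number, as an involution
without fixed points, hence oddly; the sign gives the proper subgroup. If all such elements are
conjugate into `⟨a⟩`, the quotient by the involution has the fusion excluded by
`false_of_dihedral_fusion`. -/
theorem exists_lt_top_of_unique_involution {U : Type*} [Group U] [Finite U]
    (huniq : ∀ x y : U, orderOf x = 2 → orderOf y = 2 → x = y)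
    (h3 : ∀ (t i : U) (k : ℕ), orderOf t = 3 ^ k → (t * i * t⁻¹ * i⁻¹) ^ 3 = 1)
    (h2 : 2 ∣ Nat.card U) : ∃ N : Subgroup U, N ≠ ⊤ ∧ ∀ g, Odd (orderOf g) → g ∈ N := by
  have h2F := Fact.mk Nat.prime_two
  obtain ⟨P⟩ : Nonempty (Sylow 2 U) := inferInstance
  by_cases hcyc : IsCyclic P
  · exact exists_lt_top_of_isCyclic_sylow h2 P hcyc
  obtain ⟨a, ha, h4, ⟨b, hb, hbA⟩, hself, hinv⟩ := P.isPGroup'.exists_quaternion_data huniq hcyc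
  have hpos := orderOf_pos a
  obtain ⟨z, hzdef⟩ : ∃ z, z = a ^ (orderOf a / 2) := ⟨_, rfl⟩
  have hz2 : orderOf z = 2 := hzdef ▸ orderOf_pow_orderOf_div hpos.ne' (dvd_trans (by norm_num) h4)
  have hzA : z ∈ Subgroup.zpowers a := hzdef ▸ Subgroup.pow_mem _ (Subgroup.mem_zpowers a) _
  have hzz : z * z = 1 := by rw [← pow_two, ← hz2, pow_orderOf_eq_one]
  have hzc : ∀ g, g⁻¹ * z * g = z := fun g =>
    huniq _ _ (by rw [IsFixedPointFreeRep.orderOf_conj', hz2]) hz2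
  have hAP : Subgroup.zpowers a ≤ (P : Subgroup U) := by rwa [Subgroup.zpowers_le]
  have hprod' : ∀ g ∈ P, g ∉ Subgroup.zpowers a → ∀ b ∈ P, b ∉ Subgroup.zpowers a →
      g * b ∈ Subgroup.zpowers a := by
    intro g hg hgA b hb hbA
    refine hself _ (mul_mem hg hb) ?_
    have e1 : SemiconjBy g a a⁻¹ := mul_inv_eq_iff_eq_mul.1 (hinv g hg hgA).1
    have e2 : SemiconjBy b a a⁻¹ := mul_inv_eq_iff_eq_mul.1 (hinv b hb hbA).1
    have e3 := e1.inv_right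
    rw [inv_inv] at e3
    exact e3.mul_left e2
  have hprod := fun g hg hgA => hprod' g hg hgA b hb hbA
  by_cases hfus : ∀ g ∈ P, g ∉ Subgroup.zpowers a → ∃ y, y * g * y⁻¹ ∈ Subgroup.zpowers a
  swap
  · push Not at hfus
    obtain ⟨g, hg, hgA, hgy⟩ := hfus
    refine exists_lt_top_of_sign (A := Subgroup.zpowers a) (b := g) (m := (P : Subgroup U).index)
      ?_ ?_ ?_ ?_
    · exact Nat.not_even_iff_odd.1 fun he => P.not_dvd_index he.two_dvd
    · rw [← Subgroup.relIndex_mul_index hAP, relIndex_zpowers_eq_two hb hbA hprod]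
    · intro y
      rw [(hinv g hg hgA).2, ← hzdef, hzc]; exact hzA
    · intro y
      simpa using hgy y⁻¹
  exfalso
  have hzmem : ∀ y ∈ Subgroup.zpowers z, y = 1 ∨ y = z := by
    intro y hy
    by_cases hy1 : y = 1
    · exact Or.inl hy1
    · refine Or.inr ?_
      have h5 := eq_pow_of_mul_self_eq_one (a := z) (hz2 ▸ dvd_rfl) hy (by
        have := pow_card_eq_one' (G := Subgroup.zpowers z) (x := ⟨y, hy⟩)
        rw [Nat.card_zpowers, hz2, pow_two] at this
        exact congrArg Subtype.val this) hy1
      rwa [hz2, Nat.div_self two_pos, pow_one] at h5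
  have hn : (Subgroup.zpowers z).Normal := by
    refine ⟨fun y hy g => ?_⟩
    rcases hzmem y hy with rfl | rfl
    · simp
    · have := hzc g⁻¹
      rw [inv_inv] at this
      rw [this]; exact hy
  let π := QuotientGroup.mk' (Subgroup.zpowers z)
  have hsurj : Function.Surjective π := QuotientGroup.mk'_surjective _
  have hker : ∀ g, π g = 1 ↔ g ∈ Subgroup.zpowers z := fun g => QuotientGroup.eq_one_iff g
  have hzA' : Subgroup.zpowers z ≤ Subgroup.zpowers a := by rwa [Subgroup.zpowers_le]
  have hπA : ∀ g, π g ∈ Subgroup.zpowers (π a) ↔ g ∈ Subgroup.zpowers a := by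
    intro g
    constructor
    · rintro ⟨j, hj : π a ^ j = π g⟩
      rw [← map_zpow, ← inv_mul_eq_one, ← map_inv, ← map_mul, hker] at hj
      exact (Subgroup.mul_mem_cancel_left _
        (inv_mem (Subgroup.zpow_mem _ (Subgroup.mem_zpowers a) j))).1 (hzA' hj)
    · rintro ⟨j, rfl⟩
      exact ⟨j, (map_zpow π a j).symm⟩
  have hπz : π z = 1 := (hker z).2 (Subgroup.mem_zpowers z)
  refine false_of_dihedral_fusion (P.mapSurjective hsurj) (a := π a) (b := π b) ⟨a, ha, rfl⟩
    ⟨b, hb, rfl⟩ (fun h => hbA ((hπA b).1 h)) ?_ ?_ ?_ ?_ ?_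
  · by_contra hodd
    have h5 : π (a ^ orderOf (π a)) = 1 := by rw [map_pow, pow_orderOf_eq_one]
    have h6 : a ^ (orderOf (π a) * 2) = 1 := by
      rw [pow_mul, pow_two]
      rcases hzmem _ ((hker _).1 h5) with h7 | h7 <;> rw [h7]
      · exact one_mul 1
      · exact hzz
    have := h4.trans (orderOf_dvd_of_pow_eq_one h6)
    omega
  · rintro _ ⟨g, hg, rfl⟩ hgA
    have hgA' : g ∉ Subgroup.zpowers a := fun h => hgA ((hπA g).2 h)
    obtain ⟨h5, h6⟩ := hinv g hg hgA'
    constructor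
    · rw [← map_mul, h6, ← hzdef, hπz]
    · rw [← map_inv, ← map_inv, ← map_mul, ← map_mul, h5]
  · rintro _ ⟨g, hg, rfl⟩ hgA
    rw [← map_mul, hπA]
    exact hprod g hg fun h => hgA ((hπA g).2 h)
  · rintro _ ⟨g, hg, rfl⟩ hgA
    obtain ⟨y, hy⟩ := hfus g hg fun h => hgA ((hπA g).2 h)
    refine ⟨π y, ?_⟩
    rwa [← map_inv, ← map_mul, ← map_mul, hπA]
  · intro t i k hk
    obtain ⟨t, rfl⟩ := hsurj t
    obtain ⟨i, rfl⟩ := hsurj i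
    have h5 : π (t ^ 3 ^ k) = 1 := by rw [map_pow, ← hk, pow_orderOf_eq_one]
    have h6 : (t ^ 3 ^ k) * (t ^ 3 ^ k) = 1 := by
      rcases hzmem _ ((hker _).1 h5) with h7 | h7 <;> rw [h7]
      · exact one_mul 1
      · exact hzz
    -- `t^(3^k)` lies in the central subgroup of order two, so `t^(3^k + 1)` is a lift with the same
    -- image and of `3`-power order, and `h3` applies to it.
    have h7 : π (t ^ (3 ^ k + 1)) = π t := by rw [pow_succ, map_mul, h5, one_mul]
    have h8 : orderOf (t ^ (3 ^ k + 1)) ∣ 3 ^ k := by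
      refine orderOf_dvd_of_pow_eq_one ?_
      obtain ⟨e, he⟩ : Odd (3 ^ k) := Odd.pow (by decide)
      rw [← pow_mul, mul_comm, pow_mul, show 3 ^ k + 1 = 2 * (e + 1) by omega, pow_mul, pow_two, h6,
        one_pow]
    obtain ⟨j, -, hj⟩ := (Nat.dvd_prime_pow Nat.prime_three).1 h8
    have h9 := congrArg π (h3 _ i j hj)
    rw [map_one, map_pow, map_mul, map_mul, map_mul, map_inv, map_inv, h7] at h9
    exact h9

/-- In a finite group with a unique involution in which `3`-elements act trivially on
`2`-subgroups, the elements of odd order form a subgroup. -/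
theorem odd_orderOf_mul {U : Type*} [Group U] [Finite U]
    (huniq : ∀ x y : U, orderOf x = 2 → orderOf y = 2 → x = y)
    (h3 : ∀ (t i : U) (k : ℕ), orderOf t = 3 ^ k → (t * i * t⁻¹ * i⁻¹) ^ 3 = 1) {x y : U}
    (hx : Odd (orderOf x)) (hy : Odd (orderOf y)) : Odd (orderOf (x * y)) := by
  induction hc : Nat.card U using Nat.strong_induction_on generalizing U with
  | _ c ih =>
  by_cases h2 : 2 ∣ Nat.card U
  · obtain ⟨N, hN, hodd⟩ := exists_lt_top_of_unique_involution huniq h3 h2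
    have := ih (Nat.card N) (hc ▸ lt_of_le_of_ne (Subgroup.card_le_card_group N)
      fun h => hN (Subgroup.eq_top_of_card_eq N h))
      (U := N) (x := ⟨x, hodd x hx⟩)
      (y := ⟨y, hodd y hy⟩) (fun u v hu hv => Subtype.ext (huniq u v
        (by rwa [Subgroup.orderOf_coe]) (by rwa [Subgroup.orderOf_coe])))
      (fun t i k ht => Subtype.ext (h3 t i k (by rwa [Subgroup.orderOf_coe])))
      (by rwa [Subgroup.orderOf_mk]) (by rwa [Subgroup.orderOf_mk]) rfl
    rwa [← Subgroup.orderOf_coe] at this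
  · rw [← Nat.not_even_iff_odd, even_iff_two_dvd]
    exact fun h => h2 (h.trans (orderOf_dvd_natCard _))

/-! ### Complements with quaternion Sylow subgroups. -/

theorem RationalValuesAgree.of_surjective {L M : Type*} [Group L] [Group M]
    (h : RationalValuesAgree L) {f : L →* M} (hf : Function.Surjective f) :
    RationalValuesAgree M := by
  intro χ ψ hχ hψ h1 h2 g r hg
  obtain ⟨g, rfl⟩ := hf g
  exact h _ _ (hχ.comp hf) (hψ.comp hf) (by simpa using h1) (by simpa using h2) g r hg

/-- Induction of a linear character from a subgroup of index two to an element that is inverted. -/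
theorem IsIrrChar.exists_of_inverted {M : Type*} [Group M] {C : Subgroup M} (hC : C.index = 2)
    {b c : M} (hb : b ∉ C) (ν : C →* ℂˣ) (hc : c ∈ C) (hbc : b⁻¹ * c * b = c⁻¹)
    (hν : ν ⟨c, hc⟩ ^ 2 ≠ 1) :
    ∃ ψ : M → ℂ, IsIrrChar ψ ∧ ψ 1 = 2 ∧
      ∀ (z : M) (hz : z ∈ C), b⁻¹ * z * b = z → ψ z = 2 * ν ⟨z, hz⟩ := by
  have hval : ∀ (z : M) (hz : z ∈ C), b⁻¹ * z * b = z →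
      extendByZero C ν z + extendByZero C ν (b⁻¹ * z * b) = 2 * ν ⟨z, hz⟩ := by
    intro z hz hzb
    rw [hzb, extendByZero_of_mem hz]; ring
  refine ⟨_, IsIrrChar.induced_of_index_two C hC ν hb hc ?_, ?_, hval⟩
  · rw [hbc, extendByZero_of_mem (C.inv_mem hc), extendByZero_of_mem hc]
    intro h
    refine hν ?_
    have h1 : ν ⟨c⁻¹, C.inv_mem hc⟩ = (ν ⟨c, hc⟩)⁻¹ := map_inv ν ⟨c, hc⟩
    rw [pow_two]
    nth_rewrite 1 [← Units.ext h, h1]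
    exact inv_mul_cancel _
  · refine (hval 1 C.one_mem (by simp)).trans ?_
    rw [show (⟨1, C.one_mem⟩ : C) = 1 from rfl, map_one]
    norm_num

theorem exists_hom_zpowers_apply_ne_one {M : Type*} [Group M] [Finite M] (a : M) {z : M}
    (hz : z ∈ Subgroup.zpowers a) (hz1 : z ≠ 1) :
    ∃ ν : Subgroup.zpowers a →* ℂˣ, ν ⟨z, hz⟩ ≠ 1 := by
  refine exists_hom_apply_ne_one_of_notMem_commutator fun h => hz1 ?_
  have h1 : commutator (Subgroup.zpowers a) = ⊥ := by
    rw [eq_bot_iff, commutator_def, Subgroup.commutator_le]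
    rintro x - y -
    rw [Subgroup.mem_bot, commutatorElement_eq_one_iff_commute]
    obtain ⟨_, i, rfl⟩ := x
    obtain ⟨_, j, rfl⟩ := y
    exact Subtype.ext (zpow_mul_comm a i j)
  rw [h1, Subgroup.mem_bot] at h
  exact congrArg Subtype.val h

section Quaternion

variable {M : Type*} [Group M] [Finite M] {a b : M}

/-- A linear character `ν` of `⟨a⟩` with value `-1` at the involution induces a character with value
`-2` there. Its square gives `2`, and still induces irreducibly when there is an element of order
eight to separate `ν²` from its inverse. -/
theorem exists_isIrrChar_of_quaternion (hidx : (Subgroup.zpowers a).index = 2)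
    (hb : b ∉ Subgroup.zpowers a) (hab : b * a * b⁻¹ = a⁻¹) (h4 : 4 ∣ orderOf a) :
    (∃ ψ : M → ℂ, IsIrrChar ψ ∧ ψ 1 = 2 ∧ ψ (a ^ (orderOf a / 2)) = -2) ∧
      (8 ∣ orderOf a → ∃ ψ : M → ℂ, IsIrrChar ψ ∧ ψ 1 = 2 ∧ ψ (a ^ (orderOf a / 2)) = 2) := by
  have hpos := orderOf_pos a
  have hmem : ∀ j : ℕ, a ^ j ∈ Subgroup.zpowers a := fun j =>
    Subgroup.pow_mem _ (Subgroup.mem_zpowers a) j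
  have hz2 : orderOf (a ^ (orderOf a / 2)) = 2 :=
    orderOf_pow_orderOf_div hpos.ne' (dvd_trans (by norm_num) h4)
  obtain ⟨ν, hν⟩ := exists_hom_zpowers_apply_ne_one a (hmem (orderOf a / 2))
    (fun h => by rw [h, orderOf_one] at hz2; omega)
  have hpow : ∀ i j : ℕ, ν ⟨a ^ (i * j), hmem _⟩ = ν ⟨a ^ i, hmem _⟩ ^ j := fun i j => by
    rw [← map_pow]; congr 1; exact Subtype.ext (pow_mul a i j)
  have hinv : ∀ j : ℕ, b⁻¹ * a ^ j * b = (a ^ j)⁻¹ := by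
    intro j
    have h1 : SemiconjBy b a a⁻¹ := mul_inv_eq_iff_eq_mul.1 hab
    have h2 := (h1.inv_right.pow_right j).eq
    rw [inv_inv, inv_pow] at h2
    rw [mul_assoc, ← h2, inv_mul_cancel_left]
  have hzb : b⁻¹ * a ^ (orderOf a / 2) * b = a ^ (orderOf a / 2) := by
    rw [hinv, inv_eq_iff_mul_eq_one, ← pow_two]
    have := pow_orderOf_eq_one (a ^ (orderOf a / 2))
    rwa [hz2] at this
  have hνz : ν ⟨_, hmem (orderOf a / 2)⟩ ^ 2 = 1 := by
    rw [← hpow, Nat.div_mul_cancel (dvd_trans (by norm_num) h4),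
      show (⟨a ^ orderOf a, hmem _⟩ : Subgroup.zpowers a) = 1 from Subtype.ext (pow_orderOf_eq_one a),
      map_one]
  refine ⟨?_, fun h8 => ?_⟩
  · obtain ⟨ψ, h1, h2, h3⟩ := IsIrrChar.exists_of_inverted hidx hb ν (hmem (orderOf a / 4))
      (hinv _) (by rwa [← hpow, show orderOf a / 4 * 2 = orderOf a / 2 by omega])
    refine ⟨ψ, h1, h2, ?_⟩
    rw [h3 _ (hmem _) hzb]
    have h4 : ((ν ⟨_, hmem (orderOf a / 2)⟩ : ℂˣ) : ℂ) ^ 2 = 1 := by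
      rw [← Units.val_pow_eq_pow_val, hνz, Units.val_one]
    rw [(mul_self_eq_one_iff.1 (by rw [← pow_two, h4])).resolve_left fun h => hν (Units.ext h)]
    norm_num
  · obtain ⟨ψ, h1, h2, h3⟩ := IsIrrChar.exists_of_inverted hidx hb (ν ^ 2) (hmem (orderOf a / 8))
      (hinv _) (by
        rwa [MonoidHom.pow_apply, ← hpow, ← hpow,
          show orderOf a / 8 * 2 * 2 = orderOf a / 2 by omega])
    refine ⟨ψ, h1, h2, ?_⟩
    rw [h3 _ (hmem _) hzb, MonoidHom.pow_apply, hνz, Units.val_one, mul_one]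

theorem RationalValuesAgree.not_eight_dvd (h : RationalValuesAgree M)
    (hidx : (Subgroup.zpowers a).index = 2) (hb : b ∉ Subgroup.zpowers a)
    (hab : b * a * b⁻¹ = a⁻¹) : ¬ 8 ∣ orderOf a := by
  intro h8
  obtain ⟨⟨ψ, h1, h2, h3⟩, hψ'⟩ :=
    exists_isIrrChar_of_quaternion hidx hb hab (dvd_trans (by norm_num) h8)
  obtain ⟨ψ', h1', h2', h3'⟩ := hψ' h8
  have := h ψ ψ' h1 h1' (by rw [h2]; norm_num) (by rw [h2, h2']) _ (-2) (by rw [h3]; norm_num)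
  rw [h3'] at this
  norm_num at this

end Quaternion

/-- Transfer into an abelian Sylow subgroup of the centralizer gives a linear character `ν` with `ν
x ≠ 1`. If `x` is central, the group is abelian, against the degree of `ψ`. Otherwise `ν²` induces
an irreducible character of degree two with value `2` at `z`; the square is taken so that `z² = 1`
makes the linear value trivial. -/
theorem RationalValuesAgree.false_of_inverted {R : Type*} [Group R] [Finite R]
    (h : RationalValuesAgree R) {x z : R} {r : ℕ} [Fact r.Prime] (hr2 : r ≠ 2)
    (hx : orderOf x = r) (hconj : ∀ g, g * x * g⁻¹ = x ∨ g * x * g⁻¹ = x⁻¹)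
    (hsyl : ∀ H : Subgroup R, IsPGroup r H → IsMulCommutative H) (hz : z * z = 1)
    (hzc : ∀ g, g * z = z * g) {ψ : R → ℂ} (hψ : IsIrrChar ψ) (hψ1 : ψ 1 = 2) (hψz : ψ z = -2) :
    False := by
  have hrp : r.Prime := Fact.out
  have hx1 : x ≠ 1 := fun h1 => hrp.ne_one (by rw [← hx, h1, orderOf_one])
  set C := Subgroup.centralizer {x} with hC
  have hmem : ∀ g, g ∈ C ↔ g * x = x * g := fun g => Subgroup.mem_centralizer_singleton_iff
  have hxC : x ∈ C := (hmem x).2 rfl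
  have hpg : IsPGroup r (Subgroup.zpowers (⟨x, hxC⟩ : C)) :=
    IsPGroup.of_card (n := 1) (by rw [Nat.card_zpowers, Subgroup.orderOf_mk, hx, pow_one])
  obtain ⟨P, hP⟩ := hpg.exists_le_sylow
  have : IsMulCommutative (P : Subgroup C) := by
    have h1 := hsyl _ (P.isPGroup'.map C.subtype)
    refine ⟨⟨fun u v => Subtype.ext (Subtype.ext ?_)⟩⟩
    exact congrArg (Subtype.val : Subgroup.map C.subtype _ → R) (h1.1.1 ⟨u, Subgroup.mem_map_of_mem _ u.2⟩
      ⟨v, Subgroup.mem_map_of_mem _ v.2⟩)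
  obtain ⟨ν, hν⟩ := exists_hom_apply_ne_one_of_central P (hP (Subgroup.mem_zpowers _))
    (fun h1 => hx1 (congrArg Subtype.val h1)) (fun g => Subtype.ext ((hmem g).1 g.2))
  have hνr : ν ⟨x, hxC⟩ ^ r = 1 := by
    rw [← map_pow, show (⟨x, hxC⟩ : C) ^ r = 1 from Subtype.ext (by
      change x ^ r = 1; rw [← hx, pow_orderOf_eq_one]), map_one]
  have hνord : orderOf (ν ⟨x, hxC⟩) = r := orderOf_eq_prime hνr hν
  by_cases hcen : ∀ g, g * x = x * g
  · have hCtop : ∀ g, g ∈ C := fun g => (hmem g).2 (hcen g)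
    let l : R →* ℂˣ := ν.comp (MonoidHom.codRestrict (MonoidHom.id R) C hCtop)
    have hcomm := h.commute_of_central (hx ▸ hrp) hcen (l := l) hν
    obtain ⟨m, σ, hσ, rfl⟩ := hψ
    have h1 := hσ.finrank_eq_one_of_commute fun a b => by rw [hcomm]
    rw [Representation.char_one, h1] at hψ1
    norm_num at hψ1
  · push Not at hcen
    obtain ⟨u, hu⟩ := hcen
    have hux : u * x * u⁻¹ ≠ x := fun he => hu (mul_inv_eq_iff_eq_mul.1 he)
    have hidx : C.index = 2 := Subgroup.index_centralizer_eq_two hconj hux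
    have hu' : u⁻¹ * x * u = x⁻¹ := by
      have h1 := hconj u⁻¹
      rw [inv_inv] at h1
      refine h1.resolve_left fun h2 => hu ?_
      rw [mul_assoc, inv_mul_eq_iff_eq_mul] at h2
      exact h2.symm
    obtain ⟨ψ', h1, h2, h3⟩ := IsIrrChar.exists_of_inverted hidx (fun hm => hu ((hmem u).1 hm))
      (ν ^ 2) hxC hu' (by
        rw [MonoidHom.pow_apply, ← pow_mul]
        intro h4
        have h5 := orderOf_dvd_of_pow_eq_one h4
        rw [hνord, show 2 * 2 = 2 ^ 2 by norm_num] at h5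
        exact hr2 ((Nat.prime_dvd_prime_iff_eq hrp Nat.prime_two).1 (hrp.dvd_of_dvd_pow h5)))
    have hzC : z ∈ C := (hmem z).2 (hzc x).symm
    have h4 := h3 z hzC (by rw [mul_assoc, ← hzc u, inv_mul_cancel_left])
    rw [MonoidHom.pow_apply, ← map_pow, show (⟨z, hzC⟩ : C) ^ 2 = 1 from Subtype.ext (by
      change z ^ 2 = 1; rw [pow_two, hz]), map_one, Units.val_one, mul_one] at h4
    have h5 := h ψ' ψ h1 hψ (by rw [h2]; norm_num) (by rw [h2, hψ1]) z 2 (by rw [h4]; norm_num)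
    rw [hψz] at h5
    norm_num at h5

theorem exists_eq_pow_of_pow_prime_eq_one {r : ℕ} (hr : r.Prime) {u v : ℂˣ} (hu : u ≠ 1)
    (hur : u ^ r = 1) (hvr : v ^ r = 1) : ∃ j : ℕ, v = u ^ j := by
  have := Fact.mk hr
  have h1 : IsPrimitiveRoot (u : ℂ) r := by
    rw [IsPrimitiveRoot.coe_units_iff, ← orderOf_eq_prime hur hu]
    exact IsPrimitiveRoot.orderOf u
  have : NeZero r := ⟨hr.ne_zero⟩
  obtain ⟨j, -, hj⟩ := h1.eq_pow_of_pow_eq_one (ξ := (v : ℂ)) (by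
    rw [← Units.val_pow_eq_pow_val, hvr, Units.val_one])
  exact ⟨j, Units.ext (by rw [Units.val_pow_eq_pow_val, hj])⟩

section ZGroup

variable {O : Type*} [Group O] [Finite O] [IsZGroup O]

theorem IsZGroup.exists_hom_prime_order [Nontrivial O] :
    ∃ (r : ℕ) (l : O →* ℂˣ), r.Prime ∧ l ≠ 1 ∧ l ^ r = 1 := by
  obtain ⟨x, -, hx⟩ := Set.exists_of_ssubset (IsZGroup.commutator_lt (G := O))
  obtain ⟨l, hl⟩ := exists_hom_apply_ne_one_of_notMem_commutator hx
  have hfin : IsOfFinOrder l := isOfFinOrder_iff_pow_eq_one.2 ⟨Nat.card O, Nat.card_pos, by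
    ext y
    rw [MonoidHom.pow_apply, ← map_pow, pow_card_eq_one', map_one]; rfl⟩
  have hl1 : orderOf l ≠ 1 := by
    rw [Ne, orderOf_eq_one_iff]
    rintro rfl
    exact hl rfl
  obtain ⟨r, hr, hd⟩ := Nat.exists_prime_and_dvd hl1
  have hord : orderOf (l ^ (orderOf l / r)) = r := orderOf_pow_orderOf_div hfin.orderOf_pos.ne' hd
  refine ⟨r, _, hr, fun h1 => hr.ne_one ?_, hord ▸ pow_orderOf_eq_one (l ^ (orderOf l / r))⟩
  rw [← hord, h1, orderOf_one]

/-- The abelianization is cyclic, so a linear character is determined at a generator, and the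
characters killed by `r` are powers of any nontrivial one. Hence the kernel of such a character is
invariant under automorphisms. -/
theorem IsZGroup.exists_eq_pow {r : ℕ} (hr : r.Prime) {l m : O →* ℂˣ} (hl1 : l ≠ 1)
    (hl : l ^ r = 1) (hm : m ^ r = 1) : ∃ j : ℕ, m = l ^ j := by
  obtain ⟨w, hw⟩ := IsCyclic.exists_generator (α := Abelianization O)
  obtain ⟨w, rfl⟩ := QuotientGroup.mk_surjective w
  have hgen : ∀ o, ∃ k : ℤ, ∀ n : O →* ℂˣ, n o = n w ^ k := by
    intro o
    obtain ⟨k, hk : (Abelianization.of w : Abelianization O) ^ k = Abelianization.of o⟩ :=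
      hw (Abelianization.of o)
    refine ⟨k, fun n => ?_⟩
    rw [← Abelianization.lift_apply_of n o, ← Abelianization.lift_apply_of n w, ← hk, map_zpow]
  have hlw : l w ≠ 1 := by
    intro h1
    refine hl1 (MonoidHom.ext fun o => ?_)
    obtain ⟨k, hk⟩ := hgen o
    rw [hk, h1, one_zpow]; rfl
  obtain ⟨j, hj⟩ := exists_eq_pow_of_pow_prime_eq_one hr hlw
    (by rw [← MonoidHom.pow_apply, hl]; rfl) (by rw [← MonoidHom.pow_apply, hm]; rfl : m w ^ r = 1)
  refine ⟨j, MonoidHom.ext fun o => ?_⟩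
  obtain ⟨k, hk⟩ := hgen o
  rw [hk, hk (l ^ j), hj, MonoidHom.pow_apply]

end ZGroup

theorem KillsPrimeSums.isZGroup {L A : Type*} [Group L] [Finite L] [Ring A] [CharZero A]
    {σ : L →* A} (hσ : KillsPrimeSums σ) (h2 : ∀ P : Sylow 2 L, IsCyclic P) : IsZGroup L := by
  refine ⟨fun p hp P => ?_⟩
  have := Fact.mk hp
  by_cases hp2 : p = 2
  · subst hp2; exact h2 P
  · exact hσ.isCyclic_of_isPGroup hp2 P.isPGroup'

/-- A linear character of `O` of prime order `r` has kernel `D` normal in `L`, and `O/D` has order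
`r`. Squares in `L` lie in `O` up to the central `z`, so they centralize `O/D`, and each element of
`L` centralizes or inverts it. `false_of_inverted` applies to `L/D`. -/
theorem RationalValuesAgree.false_of_odd_normal {L A : Type*} [Group L] [Finite L] [Ring A]
    [CharZero A] {σ : L →* A} (hσ : KillsPrimeSums σ) (h : RationalValuesAgree L) {O : Subgroup L}
    [O.Normal] (hO : ∀ g ∈ O, Odd (orderOf g)) (hO1 : O ≠ ⊥) {z : L} (hz : z * z = 1)
    (hzc : ∀ g, g * z = z * g) (hsq : ∀ g, g * g ∈ O ∨ g * g * z ∈ O) {ψ : L ⧸ O → ℂ}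
    (hψ : IsIrrChar ψ) (hψ1 : ψ 1 = 2) (hψz : ψ z = -2) : False := by
  have hnt : Nontrivial O := (Subgroup.nontrivial_iff_ne_bot O).2 hO1
  have hZ : IsZGroup O := (hσ.comp O.subtype_injective).isZGroup fun P => by
    have h2F := Fact.mk Nat.prime_two
    have h1 : Nat.card P = 1 := by
      refine (P.isPGroup'.card_eq_or_dvd).resolve_right fun hd => ?_
      obtain ⟨y, hy⟩ := exists_prime_orderOf_dvd_card' 2 hd
      have h3 := hO y.1 y.1.2
      rw [Subgroup.orderOf_coe, Subgroup.orderOf_coe, hy] at h3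
      exact absurd h3 (by decide)
    have := (Nat.card_eq_one_iff_unique.1 h1).1
    infer_instance
  obtain ⟨r, l, hr, hl1, hlr⟩ := IsZGroup.exists_hom_prime_order (O := O)
  have hrF := Fact.mk hr
  obtain ⟨x, hx⟩ : ∃ x, l x ≠ 1 := by
    by_contra! hcon
    exact hl1 (MonoidHom.ext hcon)
  have hpow : ∀ o, l o ^ r = 1 := fun o => by rw [← MonoidHom.pow_apply, hlr]; rfl
  have hr2 : r ≠ 2 := by
    rintro rfl
    have h1 : 2 ∣ orderOf (x : L) := by
      rw [Subgroup.orderOf_coe, ← orderOf_eq_prime (hpow x) hx]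
      exact orderOf_map_dvd l x
    exact (Nat.not_even_iff_odd.2 (hO x x.2)) (even_iff_two_dvd.2 h1)
  let D := l.ker.map O.subtype
  have hDmem : ∀ o : O, (o : L) ∈ D ↔ l o = 1 := fun o => by
    constructor
    · rintro ⟨o', ho', he⟩
      rwa [← Subtype.ext he]
    · exact fun ho => ⟨o, ho, rfl⟩
  have hDO : D ≤ O := by
    rintro _ ⟨o, -, rfl⟩
    exact o.2
  have hDn : D.Normal := by
    refine ⟨?_⟩
    rintro _ ⟨d, hd, rfl⟩ g
    obtain ⟨j, hj⟩ := IsZGroup.exists_eq_pow hr hl1 hlr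
      (m := l.comp (MulAut.conjNormal g : MulAut O).toMonoidHom)
      (by ext y; rw [MonoidHom.pow_apply, MonoidHom.comp_apply, hpow]; rfl)
    refine ⟨MulAut.conjNormal g d, ?_, rfl⟩
    have h1 := DFunLike.congr_fun hj d
    rw [MonoidHom.pow_apply, MonoidHom.mem_ker.1 hd, one_pow] at h1
    exact h1
  let f := QuotientGroup.mk' D
  have hf : Function.Surjective f := QuotientGroup.mk'_surjective D
  have hf1 : ∀ g, f g = 1 ↔ g ∈ D := fun g => QuotientGroup.eq_one_iff g
  have hfO : ∀ o ∈ O, ∃ j : ℕ, f o = f x ^ j := by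
    intro o ho
    obtain ⟨j, hj⟩ := exists_eq_pow_of_pow_prime_eq_one hr hx (hpow x) (hpow ⟨o, ho⟩)
    refine ⟨j, ?_⟩
    rw [← map_pow, ← mul_inv_eq_one, ← map_inv, ← map_mul, hf1]
    exact (hDmem (⟨o, ho⟩ * (x ^ j)⁻¹)).2 (by rw [map_mul, map_inv, map_pow, hj, mul_inv_cancel])
  have hxr : orderOf (f x) = r := by
    refine orderOf_eq_prime ?_ ?_
    · rw [← map_pow, hf1]
      exact (hDmem (x ^ r)).2 (by rw [map_pow, hpow])
    · rw [Ne, hf1, hDmem]; exact hx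
  have hzc' : ∀ g, g * f z = f z * g := by
    intro g
    obtain ⟨g, rfl⟩ := hf g
    rw [← map_mul, ← map_mul, hzc]
  have hsq' : ∀ g, Commute (f g * f g) (f x) := by
    intro g
    rcases hsq g with h1 | h1
    · obtain ⟨i, hi⟩ := hfO _ h1
      rw [← map_mul, hi]
      exact (Commute.refl _).pow_left i
    · obtain ⟨i, hi⟩ := hfO _ h1
      rw [map_mul, map_mul, ← eq_mul_inv_iff_mul_eq] at hi
      rw [hi]
      exact ((Commute.refl _).pow_left i).mul_left
        (Commute.inv_left (show Commute (f z) (f x) from (hzc' _).symm))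
  refine (h.of_surjective hf).false_of_inverted (r := r) hr2 hxr ?_ ?_ (z := f z)
    (by rw [← map_mul, hz, map_one]) hzc' (hψ.comp (f := QuotientGroup.map D O (MonoidHom.id L) hDO)
      (fun m => by
        obtain ⟨g, rfl⟩ := QuotientGroup.mk_surjective m
        exact ⟨(g : L ⧸ D), rfl⟩)) ?_ ?_
  · intro g
    obtain ⟨g, rfl⟩ := hf g
    obtain ⟨j, hj⟩ := hfO _ ((inferInstance : O.Normal).conj_mem x x.2 g)
    rw [map_mul, map_mul, map_inv] at hj
    have h1 : f x ^ (j * j) = f x := by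
      rw [pow_mul, ← hj, conj_pow, ← hj,
        show f g * (f g * f x * (f g)⁻¹) * (f g)⁻¹ = f g * f g * f x * (f g * f g)⁻¹ by group,
        (hsq' g).eq, mul_inv_cancel_right]
    have h2 : (r : ℤ) ∣ ((j : ℤ) - 1) * (j + 1) := by
      have h3 : f x ^ ((j : ℤ) * j - 1) = 1 := by
        rw [zpow_sub_one, mul_inv_eq_one]; exact_mod_cast h1
      rw [← orderOf_dvd_iff_zpow_eq_one, hxr] at h3
      rwa [show ((j : ℤ) - 1) * (j + 1) = j * j - 1 by ring]
    rw [hj]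
    rcases (Nat.prime_iff_prime_int.1 hr).dvd_or_dvd h2 with h3 | h3
    · rw [← hxr, orderOf_dvd_iff_zpow_eq_one, zpow_sub_one, mul_inv_eq_one] at h3
      exact Or.inl (by exact_mod_cast h3)
    · rw [← hxr, orderOf_dvd_iff_zpow_eq_one, zpow_add_one, mul_eq_one_iff_eq_inv] at h3
      exact Or.inr (by exact_mod_cast h3)
  · intro H hH
    obtain ⟨Q, hQ⟩ := hH.exists_le_sylow
    obtain ⟨P, rfl⟩ := Sylow.mapSurjective_surjective hf r Q
    have := hσ.isCyclic_of_isPGroup hr2 P.isPGroup'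
    have hPc : IsMulCommutative (P : Subgroup L) := IsCyclic.isMulCommutative
    refine ⟨⟨fun u v => Subtype.ext ?_⟩⟩
    obtain ⟨p₁, h1, h2⟩ := hQ u.2
    obtain ⟨p₂, h3, h4⟩ := hQ v.2
    change (u : L ⧸ D) * v = v * u
    rw [← h2, ← h4, ← map_mul, ← map_mul]
    have h5 : p₁ * p₂ = p₂ * p₁ := Subtype.ext_iff.1 (hPc.1.1 ⟨p₁, h1⟩ ⟨p₂, h3⟩)
    rw [h5]
  · simpa using hψ1
  · exact hψz

theorem nonempty_mulEquiv_quaternionGroup {L : Type*} [Group L] [Finite L] {a b : L}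
    (ha : orderOf a = 4) (hb : b ∉ Subgroup.zpowers a) (hab : b * a * b⁻¹ = a⁻¹)
    (hbb : b * b = a ^ 2) (hidx : (Subgroup.zpowers a).index = 2) :
    Nonempty (L ≃* QuaternionGroup 2) := by
  have ha4 : a ^ 4 = 1 := ha ▸ pow_orderOf_eq_one a
  have hperiod : ∀ m n : ℕ, (m : ZMod 4) = n → a ^ m = a ^ n := fun m n h => by
    rw [pow_eq_pow_iff_modEq, ha]; exact (ZMod.natCast_eq_natCast_iff _ _ _).1 h
  let φ : Multiplicative (ZMod (2 * 2)) →* L :=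
    { toFun := fun i => a ^ (Multiplicative.toAdd i).val
      map_one' := by simp
      map_mul' := fun i j => by
        rw [← pow_add]; exact hperiod _ _ (by simp) }
  have hφ : ∀ i j : ZMod (2 * 2), a ^ (i + j).val = a ^ i.val * a ^ j.val := fun i j =>
    φ.map_mul (Multiplicative.ofAdd i) (Multiplicative.ofAdd j)
  have hφinv : ∀ i : ZMod (2 * 2), a ^ (-i).val = (a ^ i.val)⁻¹ := fun i =>
    eq_inv_of_mul_eq_one_left (by rw [← hφ, neg_add_cancel]; simp)
  have hba : ∀ n : ℕ, a ^ n * b = b * (a ^ n)⁻¹ := by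
    intro n
    have h1 : SemiconjBy b a a⁻¹ := mul_inv_eq_iff_eq_mul.1 hab
    have h2 := h1.inv_right.pow_right n
    rw [inv_inv, inv_pow] at h2
    exact h2.eq.symm
  let f : QuaternionGroup 2 →* L := MonoidHom.mk'
    (fun x => match x with
      | .a i => a ^ i.val
      | .xa i => b * a ^ i.val) (by
      rintro (i | i) (j | j)
      · exact hφ i j
      · change b * a ^ (j - i).val = a ^ i.val * (b * a ^ j.val)
        rw [← mul_assoc, hba, mul_assoc, sub_eq_add_neg, add_comm, hφ, hφinv]
      · change b * a ^ (i + j).val = b * a ^ i.val * a ^ j.val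
        rw [mul_assoc, hφ]
      · change a ^ (((2 : ℕ) : ZMod (2 * 2)) + j - i).val = b * a ^ i.val * (b * a ^ j.val)
        rw [mul_assoc, ← mul_assoc (a ^ i.val), hba, mul_assoc, ← mul_assoc b, hbb, sub_eq_add_neg,
          add_assoc, hφ, add_comm j, hφ, hφinv]
        rfl)
  have hinj : Function.Injective f := by
    rw [injective_iff_map_eq_one]
    rintro (i | i) hi
    · have h1 : a ^ i.val = 1 := hi
      rw [← orderOf_dvd_iff_pow_eq_one, ha] at h1
      have h2 := ZMod.val_lt i
      have h3 : i.val = 0 := Nat.eq_zero_of_dvd_of_lt h1 h2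
      rw [(ZMod.val_eq_zero i).1 h3]; rfl
    · have h1 : b * a ^ i.val = 1 := hi
      refine (hb ?_).elim
      rw [eq_inv_of_mul_eq_one_left h1]
      exact inv_mem (Subgroup.pow_mem _ (Subgroup.mem_zpowers a) _)
  have hcard : Nat.card (QuaternionGroup 2) = Nat.card L := by
    rw [← Subgroup.card_mul_index (Subgroup.zpowers a), hidx, Nat.card_zpowers, ha,
      Nat.card_eq_fintype_card, QuaternionGroup.card]
  exact ⟨(MulEquiv.ofBijective f ((Nat.bijective_iff_injective_and_card f).2 ⟨hinj, hcard⟩)).symm⟩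

/-- A finite group with a fixed point free representation satisfying `RationalValuesAgree` is cyclic
or the quaternion group of order eight. -/
theorem RationalValuesAgree.isCyclic_or_quaternion {L n : Type*} [Group L] [Finite L] [Fintype n]
    [DecidableEq n] {ρ : L →* Matrix n n ℝ} (hρ : IsFixedPointFreeRep ρ)
    (h : RationalValuesAgree L) : IsCyclic L ∨ Nonempty (L ≃* QuaternionGroup 2) := by
  have := hρ.nonempty
  have : CharZero (Matrix n n ℝ) := algebraRat.charZero _
  have h2F := Fact.mk Nat.prime_two
  have hσ := hρ.killsPrimeSums
  have huniq : ∀ x y : L, orderOf x = 2 → orderOf y = 2 → x = y := fun x y hx hy =>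
    hσ.eq_of_orderOf_two hy hx
  by_cases hcyc : ∀ P : Sylow 2 L, IsCyclic P
  · have := hσ.isZGroup hcyc
    exact Or.inl (hσ.isCyclic_of_isZGroup h)
  push Not at hcyc
  obtain ⟨P, hP⟩ := hcyc
  obtain ⟨a, ha, h4, ⟨b, hb, hbA⟩, hself, hinv⟩ := P.isPGroup'.exists_quaternion_data huniq hP
  have hpos := orderOf_pos a
  let O : Subgroup L :=
    { carrier := {g | Odd (orderOf g)}
      mul_mem' := odd_orderOf_mul huniq fun t i k ht => h.conj_mul_inv_pow_three hρ i ht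
      one_mem' := by simp
      inv_mem' := fun {g} hg => by
        change Odd (orderOf g⁻¹)
        rw [orderOf_inv]; exact hg }
  have hOmem : ∀ g, g ∈ O ↔ Odd (orderOf g) := fun g => Iff.rfl
  have hOn : O.Normal := ⟨fun g hg x => by
    rw [hOmem, IsFixedPointFreeRep.orderOf_conj]; exact hg⟩
  have hPO : ∀ g ∈ P, g ∈ O → g = 1 := by
    intro g hg hgO
    obtain ⟨k, hk⟩ := P.isPGroup'.exists_orderOf_eq_pow ⟨g, hg⟩
    rw [Subgroup.orderOf_mk] at hk
    rcases Nat.eq_zero_or_pos k with rfl | hk0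
    · rwa [pow_zero, orderOf_eq_one_iff] at hk
    · exact (Nat.not_even_iff_odd.2 hgO
        (even_iff_two_dvd.2 (hk ▸ dvd_pow_self 2 hk0.ne'))).elim
  let π := QuotientGroup.mk' O
  have hπ : Function.Surjective π := QuotientGroup.mk'_surjective O
  have hπ1 : ∀ g, π g = 1 ↔ g ∈ O := fun g => QuotientGroup.eq_one_iff g
  -- Raising an element to the `2`-part of its order gives an element of odd order. Hence `P` maps
  -- isomorphically onto `L/O`, which is generalized quaternion.
  have hM : IsPGroup 2 (L ⧸ O) := by
    intro m
    obtain ⟨g, rfl⟩ := hπ m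
    obtain ⟨k, e, he, hk⟩ := Nat.exists_eq_pow_mul_and_not_dvd (orderOf_pos g).ne' 2 (by norm_num)
    refine ⟨k, ?_⟩
    rw [← map_pow, hπ1, hOmem, orderOf_pow_of_dvd (by positivity) (hk ▸ dvd_mul_right _ _), hk,
      Nat.mul_div_cancel_left _ (by positivity)]
    exact Nat.not_even_iff_odd.1 fun h => he h.two_dvd
  have hPM : ∀ m, ∃ g ∈ P, π g = m := by
    intro m
    have h1 : (P.mapSurjective hπ : Subgroup (L ⧸ O)) = ⊤ := by
      rw [← Subgroup.index_eq_one]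
      obtain ⟨k, hk⟩ := IsPGroup.iff_card.1 hM
      have h2 := Subgroup.index_dvd_card (P.mapSurjective hπ : Subgroup (L ⧸ O))
      rw [hk] at h2
      obtain ⟨j, -, hj⟩ := (Nat.dvd_prime_pow Nat.prime_two).1 h2
      rcases Nat.eq_zero_or_pos j with rfl | hj0
      · simpa using hj
      · exact ((P.mapSurjective hπ).not_dvd_index (hj ▸ dvd_pow_self 2 hj0.ne')).elim
    have h2 : m ∈ (P.mapSurjective hπ : Subgroup (L ⧸ O)) := h1 ▸ Subgroup.mem_top m
    exact h2
  have hPinj : ∀ g ∈ P, ∀ g' ∈ P, π g = π g' → g = g' := by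
    intro g hg g' hg' he
    rw [← mul_inv_eq_one, ← map_inv, ← map_mul, hπ1] at he
    exact mul_inv_eq_one.1 (hPO _ (mul_mem hg (inv_mem hg')) he)
  have hAP : Subgroup.zpowers a ≤ (P : Subgroup L) := by rwa [Subgroup.zpowers_le]
  have hπA : ∀ g ∈ P, π g ∈ Subgroup.zpowers (π a) → g ∈ Subgroup.zpowers a := by
    rintro g hg ⟨j, hj : π a ^ j = π g⟩
    rw [← map_zpow] at hj
    exact ⟨j, hPinj _ (zpow_mem ha j) _ hg hj⟩
  have hπAb : π b ∉ Subgroup.zpowers (π a) := fun hm => hbA (hπA b hb hm)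
  have hord : orderOf (π a) = orderOf a := by
    refine Nat.dvd_antisymm (orderOf_map_dvd π a) (orderOf_dvd_of_pow_eq_one ?_)
    refine hPinj _ (pow_mem ha _) 1 (one_mem P) ?_
    rw [map_pow, pow_orderOf_eq_one, map_one]
  have hprod : ∀ g ∈ P, g ∉ Subgroup.zpowers a → g * b ∈ Subgroup.zpowers a := by
    intro g hg hgA
    refine hself _ (mul_mem hg hb) ?_
    have e1 : SemiconjBy g a a⁻¹ := mul_inv_eq_iff_eq_mul.1 (hinv g hg hgA).1
    have e2 : SemiconjBy b a a⁻¹ := mul_inv_eq_iff_eq_mul.1 (hinv b hb hbA).1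
    have e3 := e1.inv_right
    rw [inv_inv] at e3
    exact e3.mul_left e2
  have hidx : (Subgroup.zpowers (π a)).index = 2 := by
    rw [← Subgroup.relIndex_top_right]
    refine relIndex_zpowers_eq_two (Subgroup.mem_top (π b)) hπAb fun m _ hm => ?_
    obtain ⟨g, hg, rfl⟩ := hPM m
    obtain ⟨j, hj : a ^ j = _⟩ := hprod g hg fun hgA => hm (by
      obtain ⟨j, rfl⟩ := hgA
      exact ⟨j, (map_zpow π a j).symm⟩)
    exact ⟨j, by
      change π a ^ j = π g * π b
      rw [← map_zpow, hj, map_mul]⟩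
  have hab : π b * π a * (π b)⁻¹ = (π a)⁻¹ := by
    rw [← map_inv, ← map_inv, ← map_mul, ← map_mul, (hinv b hb hbA).1]
  have ha4 : orderOf a = 4 := by
    have h8 := (h.of_surjective hπ).not_eight_dvd hidx hπAb hab
    rw [hord] at h8
    obtain ⟨k, hk⟩ := P.isPGroup'.exists_orderOf_eq_pow ⟨a, ha⟩
    rw [Subgroup.orderOf_mk] at hk
    have hk3 : ¬ 3 ≤ k := fun h5 => h8 (hk ▸ (pow_dvd_pow 2 h5 : 2 ^ 3 ∣ 2 ^ k))
    have hk2 : k = 2 := by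
      rw [hk] at h4
      interval_cases k <;> simp_all
    rw [hk, hk2]; norm_num
  obtain ⟨⟨ψ, hψ, hψ1, hψz⟩, -⟩ := exists_isIrrChar_of_quaternion hidx hπAb hab (hord ▸ h4)
  rw [hord, ha4] at hψz
  have hz2 : orderOf (a ^ 2) = 2 := by
    have := orderOf_pow_orderOf_div hpos.ne' (dvd_trans (by norm_num) h4 : 2 ∣ orderOf a)
    rwa [ha4] at this
  have ha2 : (a ^ 2) ^ 2 = 1 := by
    rw [← pow_mul, show 2 * 2 = orderOf a by rw [ha4], pow_orderOf_eq_one]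
  by_cases hO1 : O = ⊥
  · right
    have hπinj : Function.Injective π := by
      rw [injective_iff_map_eq_one]
      intro g hg
      rw [hπ1, hO1] at hg
      exact hg
    refine nonempty_mulEquiv_quaternionGroup ha4 hbA (hinv b hb hbA).1
      (by rw [(hinv b hb hbA).2, ha4]) ?_
    rw [← hidx, ← MonoidHom.map_zpowers π a,
      Subgroup.index_map_of_injective _ hπinj, MonoidHom.range_eq_top.2 hπ, Subgroup.index_top, mul_one]
  -- In the quaternion group of order eight every square is `1` or the involution, which is the
  -- condition on squares required here.
  · refine (h.false_of_odd_normal hσ (O := O) (fun g hg => hg) hO1 (z := a ^ 2) ?_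
      (hσ.commute_of_orderOf_two hz2) ?_ hψ hψ1 hψz).elim
    · rw [← pow_two, ha2]
    · intro g
      obtain ⟨p, hp, hpg⟩ := hPM (π g)
      have hpp : p * p = 1 ∨ p * p = a ^ 2 := by
        by_cases hpA : p ∈ Subgroup.zpowers a
        · obtain ⟨j, rfl⟩ := mem_powers_iff_mem_zpowers.2 hpA
          change a ^ j * a ^ j = 1 ∨ a ^ j * a ^ j = a ^ 2
          rw [← pow_add, ← two_mul, pow_mul]
          rcases Nat.even_or_odd' j with ⟨e, rfl | rfl⟩
          · left; rw [pow_mul, ha2, one_pow]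
          · right; rw [pow_succ, pow_mul, ha2, one_pow, one_mul]
        · right; rw [(hinv p hp hpA).2, ha4]
      rcases hpp with h5 | h5
      · left
        rw [← hπ1, map_mul, ← hpg, ← map_mul, h5, map_one]
      · right
        rw [← hπ1, map_mul, map_mul, ← hpg, ← map_mul, ← map_mul, h5, ← pow_two, ha2, map_one]

/-! ### Linear groups transitive on nonzero vectors up to scalars -/

namespace Representation

/-- No nontrivial element of `L` fixes a nonzero vector. -/
def FixedPointFree {q : ℕ} {L V : Type*} [Group L] [AddCommGroup V] [Module (ZMod q) V]
    (τ : Representation (ZMod q) L V) : Prop :=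
  ∀ l v, τ l v = v → v = 0 ∨ l = 1

/-- `L` permutes transitively the lines spanned by nonzero vectors. -/
def LineTransitive {q : ℕ} {L V : Type*} [Group L] [AddCommGroup V] [Module (ZMod q) V]
    (τ : Representation (ZMod q) L V) : Prop :=
  ∀ v w : V, v ≠ 0 → w ≠ 0 → ∃ (l : L) (a : ZMod q), w = a • τ l v

variable {q : ℕ} {L V : Type*} [Group L] [AddCommGroup V] [Module (ZMod q) V]
  {τ : Representation (ZMod q) L V}

theorem FixedPointFree.killsPrimeSums (h : τ.FixedPointFree) :
    KillsPrimeSums (A := Module.End (ZMod q) V) τ := by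
  intro g p hp hg
  refine LinearMap.ext fun v => (h g _ ?_).resolve_right fun h1 => ?_
  · simp only [LinearMap.sum_apply, map_sum, ← Module.End.mul_apply, ← pow_succ']
    have h2 := Finset.sum_range_succ' (fun i => (τ g ^ i) v) p
    rw [Finset.sum_range_succ, ← map_pow, ← hg, pow_orderOf_eq_one, map_one, pow_zero, hg] at h2
    exact (add_right_cancel h2).symm
  · rw [h1, orderOf_one] at hg
    exact hp.ne_one hg.symm

theorem FixedPointFree.injective (h : τ.FixedPointFree) {v : V} (hv : v ≠ 0) :
    Function.Injective fun l => τ l v := by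
  intro a b hab
  have h1 : τ (b⁻¹ * a) v = v := by
    rw [map_mul, Module.End.mul_apply]
    exact (congrArg (τ b⁻¹) hab).trans (by rw [← Module.End.mul_apply, ← map_mul]; simp)
  exact (inv_mul_eq_one.1 ((h _ _ h1).resolve_left hv)).symm

theorem FixedPointFree.card_lt [Finite V] [Nontrivial V] (h : τ.FixedPointFree) :
    Nat.card L < Nat.card V := by
  obtain ⟨v, hv⟩ := exists_ne (0 : V)
  rw [Nat.card_congr (Equiv.ofInjective _ (h.injective hv)), Nat.card_coe_set_eq]
  refine Set.ncard_lt_card (Set.ne_univ_iff_exists_notMem _ |>.2 ⟨0, fun ⟨l, hl⟩ => hv ?_⟩)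
  simpa [← Module.End.mul_apply, ← map_mul] using congrArg (τ l⁻¹) hl

/-- For `g` of order `q` one has `(g - 1)^q = g^q - 1 = 0` in characteristic `q`, although `g - 1`
is injective. -/
theorem FixedPointFree.not_dvd_card [Finite L] [Finite V] [Nontrivial V] (h : τ.FixedPointFree)
    [hq : Fact q.Prime] : ¬ q ∣ Nat.card L := by
  intro hdvd
  obtain ⟨g, hg⟩ := exists_prime_orderOf_dvd_card' q hdvd
  have hk := h.killsPrimeSums g q hq.out hg
  obtain ⟨v, hv⟩ := exists_ne (0 : V)
  have hq1 : (τ g - 1 : Module.End (ZMod q) V) ^ q = 0 := by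
    have := Module.nontrivial (ZMod q) V
    have : CharP (Module.End (ZMod q) V) q := charP_of_injective_algebraMap
      (FaithfulSMul.algebraMap_injective (ZMod q) (Module.End (ZMod q) V)) q
    have hg1 : g ^ q = 1 := orderOf_dvd_iff_pow_eq_one.1 hg.dvd
    rw [sub_pow_char_of_commute _ (Commute.one_right _), ← map_pow, hg1]
    simp
  have hinj : Function.Injective (τ g - 1 : Module.End (ZMod q) V) := by
    rw [injective_iff_map_eq_zero]
    intro w hw
    refine (h g w (sub_eq_zero.1 hw)).resolve_right fun h1 => ?_
    rw [h1, orderOf_one] at hg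
    exact hq.out.ne_one hg.symm
  have h2 : Function.Injective ((τ g - 1) ^ q : Module.End (ZMod q) V) := by
    rw [Module.End.coe_pow]; exact hinj.iterate q
  exact hv (h2 (by rw [hq1]; simp))

/-- The stabilizer of a vector in the product of `L` and the group of scalars. -/
def scalarStabilizer (τ : Representation (ZMod q) L V) (v : V) : Set (L × (ZMod q)ˣ) :=
  {x | x.2 • τ x.1 v = v}

theorem ncard_mul_ncard_scalarStabilizer [Finite L] [Fact q.Prime] (v : V) :
    (Set.range fun x : L × (ZMod q)ˣ => x.2 • τ x.1 v).ncard * (scalarStabilizer τ v).ncard =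
      Nat.card L * (q - 1) := by
  let f : L × (ZMod q)ˣ →* Module.End (ZMod q) V :=
    { toFun x := (x.2 : ZMod q) • τ x.1
      map_one' := by simp
      map_mul' x y := by simp [smul_smul, mul_comm (y.2 : ZMod q)] }
  let _ : MulAction (L × (ZMod q)ˣ) V := MulAction.compHom V f
  have h1 := Nat.card_congr (MulAction.orbitProdStabilizerEquivGroup (L × (ZMod q)ˣ) v)
  rw [Nat.card_prod, Nat.card_prod, Nat.card_eq_fintype_card (α := (ZMod q)ˣ),
    ZMod.card_units] at h1
  exact h1

theorem scalarStabilizer_injOn [Fact q.Prime] {v : V} (hv : v ≠ 0) : Set.InjOn Prod.fst (scalarStabilizer τ v) := by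
  rintro ⟨l, a⟩ ha ⟨l', b⟩ hb hl
  obtain rfl : l = l' := hl
  have h0 : τ l v ≠ 0 := fun h0 => hv (by rw [← show a • τ l v = v from ha, h0, smul_zero])
  exact Prod.ext rfl (Units.ext (smul_left_injective (ZMod q) h0 (ha.trans hb.symm)))

theorem FixedPointFree.pow_eq_one_of_apply_eq_smul [Fact q.Prime] (h : τ.FixedPointFree) {v : V}
    (hv : v ≠ 0) {l : L} {c : (ZMod q)ˣ} (hl : τ l v = c • v) : l ^ (q - 1) = 1 := by
  have h1 : ∀ i : ℕ, τ (l ^ i) v = c ^ i • v := by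
    intro i
    induction i with
    | zero => simp
    | succ i ih =>
      rw [pow_succ', map_mul, Module.End.mul_apply, ih, pow_succ, mul_smul, ← hl, Units.smul_def,
        map_smul, Units.smul_def]
  refine (h _ v ?_).resolve_left hv
  rw [h1, ZMod.units_pow_card_sub_one_eq_one, one_smul]

theorem _root_.ncard_pow_eq_one {L : Type*} [Group L] [Finite L] [IsCyclic L] (d : ℕ) :
    {l : L | l ^ d = 1}.ncard = (Nat.card L).gcd d := by
  let _ : CommGroup L := IsCyclic.commGroup
  exact IsCyclic.card_powMonoidHom_ker L d

/-- The stabilizer projects injectively to `L`, and its elements act on `v` by scalars, so they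
satisfy `l^(q-1) = 1`; a cyclic group has `gcd(|L|, q - 1)` such elements. -/
theorem FixedPointFree.ncard_scalarStabilizer_le [Finite L] [IsCyclic L] [Fact q.Prime]
    (h : τ.FixedPointFree) {v : V} (hv : v ≠ 0) :
    (scalarStabilizer τ v).ncard ≤ (Nat.card L).gcd (q - 1) := by
  rw [← ncard_pow_eq_one]
  refine Set.ncard_le_ncard_of_injOn Prod.fst (fun x hx => ?_) (scalarStabilizer_injOn hv)
  refine h.pow_eq_one_of_apply_eq_smul hv (c := x.2⁻¹) ?_
  rw [eq_inv_smul_iff]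
  exact hx

theorem smul_apply_ne_zero [Fact q.Prime] {v : V} (hv : v ≠ 0) (x : L × (ZMod q)ˣ) :
    x.2 • τ x.1 v ≠ 0 := by
  rw [Ne, smul_eq_zero_iff_eq]
  intro h0
  exact hv (by simpa [← Module.End.mul_apply, ← map_mul] using congrArg (τ x.1⁻¹) h0)

theorem LineTransitive.range_eq [Fact q.Prime] (ht : τ.LineTransitive) {v : V} (hv : v ≠ 0) :
    (Set.range fun x : L × (ZMod q)ˣ => x.2 • τ x.1 v) = {0}ᶜ := by
  refine Set.Subset.antisymm ?_ fun w hw => ?_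
  · rintro _ ⟨x, rfl⟩ h0
    exact smul_apply_ne_zero hv x h0
  · obtain ⟨l, a, ha⟩ := ht v w hv hw
    have ha0 : a ≠ 0 := by
      rintro rfl
      exact hw (by simpa using ha)
    exact ⟨(l, Units.mk0 a ha0), ha.symm⟩

theorem ncard_compl_zero [Finite V] : ({0}ᶜ : Set V).ncard = Nat.card V - 1 := by
  rw [Set.ncard_compl, Set.ncard_singleton]

/-- The minimal polynomial divides `X^q - X`, which splits over the prime field. -/
theorem exists_eigenvector [Fact q.Prime] [Finite V] [Nontrivial V] {f : Module.End (ZMod q) V}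
    (hf : f ^ (q - 1) = 1) : ∃ (c : ZMod q) (w : V), w ≠ 0 ∧ f w = c • w := by
  have hdvd : minpoly (ZMod q) f ∣ Polynomial.X ^ q - Polynomial.X := by
    refine minpoly.dvd _ _ ?_
    have h1 : f ^ q = f := by
      have h2 : q = q - 1 + 1 := (Nat.sub_add_cancel (Fact.out : q.Prime).one_le).symm
      exact (congrArg (f ^ ·) h2).trans (by rw [pow_succ, hf, one_mul])
    simp [h1]
  have hs : (Polynomial.X ^ q - Polynomial.X : Polynomial (ZMod q)).Splits := by
    simpa using FiniteField.splits_X_pow_card_sub_X (K := ZMod q) q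
  obtain ⟨c, hc⟩ := (hs.of_dvd (FiniteField.X_pow_card_sub_X_ne_zero _
    (Fact.out : q.Prime).one_lt) hdvd).exists_eval_eq_zero
      (minpoly.degree_pos (Algebra.IsIntegral.isIntegral f)).ne'
  obtain ⟨w, hw⟩ := (Module.End.hasEigenvalue_of_isRoot hc).exists_hasEigenvector
  exact ⟨c, w, hw.2, hw.apply_eq_smul⟩

/-- Some vector is an eigenvector of `l`; transitivity carries its line to that of `v`, and
commutativity keeps it an eigenvector. -/
theorem LineTransitive.exists_apply_eq_smul [Fact q.Prime] [Finite V] (ht : τ.LineTransitive)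
    (hc : ∀ a b : L, a * b = b * a) {l : L} (hl : l ^ (q - 1) = 1) {v : V} (hv : v ≠ 0) :
    ∃ c : ZMod q, τ l v = c • v := by
  have : Nontrivial V := ⟨v, 0, hv⟩
  obtain ⟨c, w, hw, hcw⟩ := exists_eigenvector (f := τ l) (by rw [← map_pow, hl, map_one])
  obtain ⟨l', a, rfl⟩ := ht w v hw hv
  refine ⟨c, ?_⟩
  rw [map_smul, ← Module.End.mul_apply, ← map_mul, hc, map_mul, Module.End.mul_apply, hcw,
    map_smul, smul_comm]

theorem LineTransitive.ncard_scalarStabilizer [Finite L] [IsCyclic L] [Fact q.Prime] [Finite V]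
    (h : τ.FixedPointFree) (ht : τ.LineTransitive) {v : V} (hv : v ≠ 0) :
    (scalarStabilizer τ v).ncard = (Nat.card L).gcd (q - 1) := by
  refine (h.ncard_scalarStabilizer_le hv).antisymm ?_
  rw [← ncard_pow_eq_one]
  refine (Set.ncard_le_ncard (fun l hl => ?_) (Set.toFinite _)).trans
    (Set.ncard_image_le (f := Prod.fst))
  let _ : CommGroup L := IsCyclic.commGroup
  obtain ⟨c, hc⟩ := ht.exists_apply_eq_smul (fun a b => mul_comm a b) hl hv
  have hc0 : c ≠ 0 := by
    rintro rfl
    rw [zero_smul] at hc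
    exact hv (by simpa [← Module.End.mul_apply, ← map_mul] using congrArg (τ l⁻¹) hc)
  refine ⟨(l, (Units.mk0 c hc0)⁻¹), ?_, rfl⟩
  change _ • τ l v = v
  rw [inv_smul_eq_iff]
  exact hc

theorem _root_.geom_sum_modEq (q n : ℕ) (hq : 1 ≤ q) :
    ∑ i ∈ Finset.range n, q ^ i ≡ n [MOD q - 1] := by
  have h1 : q ≡ 1 [MOD q - 1] := ((Nat.modEq_iff_dvd' hq).2 dvd_rfl).symm
  induction n with
  | zero => rfl
  | succ n ih =>
    rw [Finset.sum_range_succ]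
    exact ih.add (by simpa using h1.pow n)

/-- A cyclic group that acts freely on the nonzero vectors and transitively on the lines of a space
of order `q ^ n`. -/
theorem LineTransitive.card_of_isCyclic [Finite L] [IsCyclic L] [hq : Fact q.Prime] [Finite V]
    [Nontrivial V] (h : τ.FixedPointFree) (ht : τ.LineTransitive) {n : ℕ}
    (hn : Nat.card V = q ^ n) :
    ∃ d, d ∣ q - 1 ∧ d.Coprime n ∧ Nat.card L = (q ^ n - 1) / d := by
  obtain ⟨v, hv⟩ := exists_ne (0 : V)
  have h1 := ncard_mul_ncard_scalarStabilizer (τ := τ) v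
  rw [ht.range_eq hv, ncard_compl_zero, ht.ncard_scalarStabilizer h hv, hn,
    ← geom_sum_mul_of_one_le hq.out.one_le] at h1
  set e := ∑ i ∈ Finset.range n, q ^ i with he
  have hq1 : 0 < q - 1 := Nat.sub_pos_of_lt hq.out.one_lt
  -- With `t = gcd(|L|, q - 1)` and `q - 1 = t d`, orbit counting gives `|L| = e t`. Then `gcd(e t,
  -- t d) = t` says that `e` is prime to `d`, and `e ≡ n` modulo `d`.
  obtain ⟨d, hd⟩ := Nat.gcd_dvd_right (Nat.card L) (q - 1)
  set t := (Nat.card L).gcd (q - 1) with ht'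
  have ht0 : 0 < t := Nat.gcd_pos_of_pos_right _ hq1
  have hm : Nat.card L = e * t := by
    refine (Nat.eq_of_mul_eq_mul_right hq1 ?_).symm
    rw [← h1]; ring
  have hd0 : 0 < d := Nat.pos_of_ne_zero fun h0 => by simp [h0] at hd; omega
  have hed : e.Coprime d := by
    refine Nat.eq_of_mul_eq_mul_left ht0 ?_
    rw [← Nat.gcd_mul_left, mul_comm t e, ← hm, ← hd, mul_one]
  refine ⟨d, ⟨t, by rw [hd, mul_comm]⟩, ?_, ?_⟩
  · have h2 := (geom_sum_modEq q n hq.out.one_le).of_dvd ⟨t, by rw [hd, mul_comm]⟩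
    rw [Nat.coprime_comm, Nat.Coprime, ← Nat.ModEq.gcd_eq h2]
    exact hed
  · rw [← geom_sum_mul_of_one_le hq.out.one_le, hd, ← mul_assoc, Nat.mul_div_cancel _ hd0, hm]

/-- With `q - 1 = d s` and `|L| = e s`, a stabilizer has at most `gcd(e s, d s) = s` elements, so an
orbit has at least `e (q - 1)` elements and is everything. -/
theorem FixedPointFree.lineTransitive [Finite L] [IsCyclic L] [hq : Fact q.Prime] [Finite V]
    (h : τ.FixedPointFree) {n d : ℕ} (hn : Nat.card V = q ^ n) (hd : d ∣ q - 1)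
    (hdn : d.Coprime n) (hL : Nat.card L = (q ^ n - 1) / d) : τ.LineTransitive := by
  intro v w hv hw
  obtain ⟨s, hs⟩ := hd
  have hq1 : 0 < q - 1 := Nat.sub_pos_of_lt hq.out.one_lt
  have hd0 : 0 < d := Nat.pos_of_ne_zero fun h0 => by simp [h0] at hs; omega
  have hs0 : 0 < s := Nat.pos_of_ne_zero fun h0 => by simp [h0] at hs; omega
  have h1 := ncard_mul_ncard_scalarStabilizer (τ := τ) v
  have h2 := geom_sum_mul_of_one_le hq.out.one_le n
  set e := ∑ i ∈ Finset.range n, q ^ i with he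
  have hed : e.Coprime d := by
    have h3 := (geom_sum_modEq q n hq.out.one_le).of_dvd ⟨s, hs⟩
    rw [Nat.Coprime, Nat.ModEq.gcd_eq h3]
    exact hdn.symm
  have hm : Nat.card L = e * s := by
    rw [hL, ← h2, hs, mul_comm d s, ← mul_assoc, Nat.mul_div_cancel _ hd0]
  have h4 := h.ncard_scalarStabilizer_le hv
  rw [hm, hs, Nat.gcd_mul_right, hed, one_mul] at h4
  have h5 : ({0}ᶜ : Set V).ncard ≤
      (Set.range fun x : L × (ZMod q)ˣ => x.2 • τ x.1 v).ncard := by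
    rw [ncard_compl_zero, hn, ← h2]
    refine Nat.le_of_mul_le_mul_right ?_ hs0
    calc e * (q - 1) * s = Nat.card L * (q - 1) := by rw [hm]; ring
      _ ≤ _ := by rw [← h1]; exact Nat.mul_le_mul_left _ h4
  have h6 : (Set.range fun x : L × (ZMod q)ˣ => x.2 • τ x.1 v) = {0}ᶜ := by
    refine Set.eq_of_subset_of_ncard_le ?_ h5 (Set.toFinite _)
    rintro _ ⟨x, rfl⟩ h0
    exact smul_apply_ne_zero hv x h0
  obtain ⟨x, hx⟩ : w ∈ Set.range fun x : L × (ZMod q)ˣ => x.2 • τ x.1 v := h6 ▸ hw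
  exact ⟨x.1, x.2, hx.symm⟩

/-- A nonabelian group of order `8` with an involution that acts freely on the nonzero vectors and
transitively on the lines of a space of order `q ^ n`. -/
theorem LineTransitive.eq_three_of_card_eq_eight [hq : Fact q.Prime] [Finite V] [Nontrivial V]
    (h : τ.FixedPointFree) (ht : τ.LineTransitive) {n : ℕ} (hn : Nat.card V = q ^ n)
    (hL : Nat.card L = 8) {z a b : L} (hz : orderOf z = 2) (hab : a * b ≠ b * a) :
    q = 3 ∧ n = 2 := by
  have : Finite L := Nat.finite_of_card_ne_zero (by lia)
  obtain ⟨v, hv⟩ := exists_ne (0 : V)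
  have h1 := ncard_mul_ncard_scalarStabilizer (τ := τ) v
  -- The involution acts as `-1`, so `(z, -1)` stabilizes every vector. Orbit counting then gives
  -- `q^n - 1 ≤ 4 (q - 1)`.
  have h2 : 2 ≤ (scalarStabilizer τ v).ncard := by
    rw [← Set.ncard_pair (a := ((1 : L), (1 : (ZMod q)ˣ))) (b := (z, -1))
      (fun e => by
        have h3 : 1 = z := (Prod.ext_iff.1 e).1
        simp [← h3] at hz)]
    refine Set.ncard_le_ncard ?_ (Set.toFinite _)
    rintro _ (rfl | rfl)
    · simp [scalarStabilizer]
    · simp [scalarStabilizer, h.killsPrimeSums.apply_of_orderOf_two hz]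
  have h3 := h.card_lt
  have hq1 := hq.out.one_lt
  rw [ht.range_eq hv, ncard_compl_zero, hn, hL] at h1
  rw [hn, hL] at h3
  have h4 : q ^ n - 1 ≤ 4 * (q - 1) := by nlinarith
  have hn2 : n < 3 := by
    by_contra! h5
    have h6 := Nat.pow_le_pow_right hq1.le h5
    have h7 : q ^ 3 = q * q * q := by ring
    zify [hq1.le, Nat.one_le_pow n q (by lia)] at h4 h6 h7 hq1
    nlinarith
  interval_cases n
  · simp at h3
  · have h5 : Module.finrank (ZMod q) V = 1 := by
      have := Module.natCard_eq_pow_finrank (K := ZMod q) (V := V)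
      rw [hn, Nat.card_zmod] at this
      exact (Nat.pow_right_injective hq1 this).symm
    obtain ⟨u, hu, hs⟩ := finrank_eq_one_iff'.1 h5
    obtain ⟨c, hc⟩ := hs (τ a u)
    obtain ⟨d, hd⟩ := hs (τ b u)
    refine absurd (h.injective hu ?_) hab
    simp only [map_mul, Module.End.mul_apply, ← hc, ← hd, map_smul, smul_comm c d]
  · refine ⟨?_, rfl⟩
    have h5 : q ^ 2 = q * q := sq q
    have h6 : q ≤ 3 := by
      zify [hq1.le, Nat.one_le_pow 2 q (by lia)] at h4 h5 hq1 ⊢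
      nlinarith
    interval_cases q <;> simp_all

end Representation

/-! ### Galois groups of cyclotomic subfields of `ℂ` -/

instance cyclotomicSubfield.isCyclotomicExtension (n : ℕ) [NeZero n] :
    IsCyclotomicExtension {n} ℚ (cyclotomicSubfield n) := by
  have hζ := Complex.isPrimitiveRoot_exp n (NeZero.ne n)
  set ζ := Complex.exp (2 * Real.pi * Complex.I / n)
  have h1 : cyclotomicSubfield n = IntermediateField.adjoin ℚ {ζ} := by
    refine le_antisymm (IntermediateField.adjoin_le_iff.2 fun z hz => ?_)
      (IntermediateField.adjoin.mono ℚ _ _ (Set.singleton_subset_iff.2 hζ.pow_eq_one))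
    obtain ⟨i, -, rfl⟩ := hζ.eq_pow_of_pow_eq_one hz
    exact pow_mem (IntermediateField.mem_adjoin_simple_self ℚ ζ) i
  change IsCyclotomicExtension {n} ℚ (cyclotomicSubfield n).toSubalgebra
  rw [h1, IntermediateField.adjoin_simple_toSubalgebra_of_isAlgebraic
    (hζ.isIntegral (NeZero.pos n)).tower_top.isAlgebraic]
  exact hζ.adjoin_isCyclotomicExtension ℚ

theorem mem_cyclotomicSubfield {n : ℕ} {z : ℂ} (hz : z ^ n = 1) : z ∈ cyclotomicSubfield n :=
  IntermediateField.subset_adjoin ℚ _ hz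

theorem exists_pow_of_gal {n : ℕ} [NeZero n] (α : Gal(cyclotomicSubfield n/ℚ)) :
    ∃ a : ℕ, ∀ z : cyclotomicSubfield n, (z : ℂ) ^ n = 1 → ((α z : _) : ℂ) = (z : ℂ) ^ a := by
  have : NumberField (cyclotomicSubfield n) :=
    IsCyclotomicExtension.numberField {n} ℚ (cyclotomicSubfield n)
  refine ⟨(IsCyclotomicExtension.Rat.galEquivZMod n (cyclotomicSubfield n) α).val.val,
    fun z hz => ?_⟩
  rw [IsCyclotomicExtension.Rat.galEquivZMod_apply_of_pow_eq n _ α (x := z) (Subtype.ext hz)]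
  rfl

/-- Units modulo `q` lift to units modulo `n`, so the power map on `q`-th roots of unity extends to
the larger cyclotomic field. -/
theorem exists_gal_pow {n q a : ℕ} [NeZero n] (hq : q ∣ n) (ha : a.Coprime q) :
    ∃ α : Gal(cyclotomicSubfield n/ℚ), ∀ z : cyclotomicSubfield n, (z : ℂ) ^ q = 1 →
      ((α z : _) : ℂ) = (z : ℂ) ^ a := by
  have : NumberField (cyclotomicSubfield n) :=
    IsCyclotomicExtension.numberField {n} ℚ (cyclotomicSubfield n)
  obtain ⟨u, hu⟩ := ZMod.unitsMap_surjective hq (ZMod.unitOfCoprime a ha)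
  obtain ⟨α, hα⟩ := (IsCyclotomicExtension.Rat.galEquivZMod n (cyclotomicSubfield n)).surjective u
  refine ⟨α, fun z hz => ?_⟩
  rw [IsCyclotomicExtension.Rat.galEquivZMod_apply_of_pow_eq n _ α (x := z)
    (Subtype.ext (show (z : ℂ) ^ n = 1 by
      obtain ⟨c, rfl⟩ := hq
      rw [pow_mul, hz, one_pow])), hα]
  have h1 := congrArg Units.val hu
  rw [ZMod.unitsMap_val, ZMod.coe_unitOfCoprime, ← ZMod.natCast_val,
    ZMod.natCast_eq_natCast_iff] at h1
  exact pow_eq_pow_of_modEq h1 hz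

theorem GaloisConjugate.apply_eq_of_rat {G : Type*} [Group G] {χ ψ : G → ℂ}
    (h : GaloisConjugate χ ψ) {g : G} {r : ℚ} (hr : χ g = r) : ψ g = r := by
  obtain ⟨α, hα⟩ := h
  obtain ⟨z, hz, hz'⟩ := hα g
  have h1 : z = algebraMap ℚ _ r := Subtype.ext (by rw [hz, hr]; rfl)
  rw [← hz', h1, AlgEquiv.commutes]
  rfl

theorem GaloisConjugate.of_mem {G : Type*} [Group G] {χ : G → ℂ}
    (h : ∀ g, χ g ∈ cyclotomicSubfield (Nat.card G)) : GaloisConjugate χ χ :=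
  ⟨1, fun g => ⟨⟨χ g, h g⟩, rfl, rfl⟩⟩

open Representation

/-! ### Characters of Frobenius groups with abelian kernel -/

section Frobenius

variable {G : Type*} [Group G]

/-- The conjugate of a linear character of a normal subgroup. -/
def conjHom {K : Subgroup G} [K.Normal] (g : G) (ν : K →* ℂˣ) : K →* ℂˣ :=
  ν.comp (MulAut.conjNormal g⁻¹ : MulAut K).toMonoidHom

theorem conjHom_apply {K : Subgroup G} [K.Normal] (g : G) (ν : K →* ℂˣ) (k : K) :
    conjHom g ν k = ν (MulAut.conjNormal g⁻¹ k) := rfl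

theorem conjHom_mul {K : Subgroup G} [K.Normal] (g h : G) (ν : K →* ℂˣ) :
    conjHom (g * h) ν = conjHom g (conjHom h ν) := by
  ext k
  simp [conjHom_apply]

theorem conjHom_one {K : Subgroup G} [K.Normal] (ν : K →* ℂˣ) : conjHom 1 ν = ν := by
  ext k
  simp [conjHom_apply]

theorem conjHom_ne_one {K : Subgroup G} [K.Normal] (g : G) {ν : K →* ℂˣ} (hν : ν ≠ 1) :
    conjHom g ν ≠ 1 := by
  intro h
  refine hν ?_
  rw [← conjHom_one ν, ← inv_mul_cancel g, conjHom_mul, h]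
  rfl

theorem extendByZero_conj {K : Subgroup G} [hn : K.Normal] (ν : K →* ℂˣ) (g : G) (k : K) :
    extendByZero K ν (g⁻¹ * k * g) = conjHom g ν k := by
  have h1 : g⁻¹ * k * g ∈ K := by simpa using hn.conj_mem k k.2 g⁻¹
  rw [extendByZero_of_mem h1, conjHom_apply]
  congr 2
  ext
  simp

theorem extendByZero_conj_of_notMem {K : Subgroup G} [hn : K.Normal] (ν : K →* ℂˣ) (g : G) {x : G}
    (hx : x ∉ K) : extendByZero K ν (g⁻¹ * x * g) = 0 :=
  extendByZero_of_notMem fun h => hx (by simpa [mul_assoc] using hn.conj_mem _ h g)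

/-- The character of `G` induced by a linear character of `K`, for a complement `L` of `K`. -/
noncomputable def kernelChar (K L : Subgroup G) [Fintype L] (ν : K →* ℂˣ) (g : G) : ℂ :=
  ∑ l : L, extendByZero K ν ((l : G)⁻¹ * g * l)

theorem kernelChar_apply {K L : Subgroup G} [K.Normal] [Fintype L] (ν : K →* ℂˣ) (k : K) :
    kernelChar K L ν k = ∑ l : L, (conjHom (l : G) ν k : ℂ) :=
  Finset.sum_congr rfl fun _ _ => extendByZero_conj _ _ _

theorem kernelChar_of_notMem {K L : Subgroup G} [K.Normal] [Fintype L] (ν : K →* ℂˣ) {g : G}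
    (hg : g ∉ K) : kernelChar K L ν g = 0 :=
  Finset.sum_eq_zero fun _ _ => extendByZero_conj_of_notMem _ _ hg

theorem kernelChar_one {K L : Subgroup G} [K.Normal] [Fintype L] (ν : K →* ℂˣ) :
    kernelChar K L ν 1 = Fintype.card L := by
  simpa using kernelChar_apply (L := L) ν 1

namespace IsFrobeniusGroup

variable {K L : Subgroup G}

theorem existsUnique_inv_mul_mem (hG : IsFrobeniusGroup K L) (g : G) : ∃! l : L, (l : G)⁻¹ * g ∈ K :=
  Subgroup.isComplement_iff_existsUnique_inv_mul_mem.1 hG.isComplement.symm g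

theorem exists_eq_mul (hG : IsFrobeniusGroup K L) (g : G) : ∃ (l : L) (k : K), g = l * k := by
  obtain ⟨l, hl, -⟩ := hG.existsUnique_inv_mul_mem g
  exact ⟨l, ⟨_, hl⟩, by simp⟩

theorem exists_surjective_hom (hG : IsFrobeniusGroup K L) : ∃ f : G →* L, Function.Surjective f := by
  have := hG.normal
  let e := hG.isComplement.symm.QuotientMulEquiv
  exact ⟨e.toMonoidHom.comp (QuotientGroup.mk' K),
    e.surjective.comp (QuotientGroup.mk'_surjective K)⟩

open scoped IsMulCommutative in
-- For `l ≠ 1` the map `k ↦ k (l⁻¹ k l)⁻¹` is injective on the abelian group `K`, hence onto, and a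
-- character fixed by `l` vanishes on its image.
theorem eq_one_of_conjHom_eq [K.Normal] [Finite K] [IsMulCommutative K]
    (hG : IsFrobeniusGroup K L) {ν : K →* ℂˣ} (hν : ν ≠ 1) {l : L} (h : conjHom (l : G) ν = ν) : l = 1 := by
  by_contra hl
  let c : K → K := fun k => k * (MulAut.conjNormal (l : G)⁻¹ k)⁻¹
  have hc : Function.Injective c := by
    intro k k' hkk
    have h1 : MulAut.conjNormal (l : G)⁻¹ (k * k'⁻¹) = k * k'⁻¹ := by
      rw [map_mul, map_inv (MulAut.conjNormal (l : G)⁻¹) k', mul_inv_eq_mul_inv_iff_mul_eq_mul,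
        mul_comm]
      exact (mul_inv_eq_mul_inv_iff_mul_eq_mul.1 hkk).symm
    have h3 := hG.fixedPointFree (k * k'⁻¹ : K) (k * k'⁻¹ : K).2 (l : G)⁻¹ (L.inv_mem l.2)
      (by rw [← MulAut.conjNormal_apply, h1])
    rw [inv_eq_one, OneMemClass.coe_eq_one, OneMemClass.coe_eq_one] at h3
    exact mul_inv_eq_one.1 (h3.resolve_right hl)
  refine hν (MonoidHom.ext fun k => ?_)
  obtain ⟨k, rfl⟩ := Finite.injective_iff_surjective.1 hc k
  rw [MonoidHom.one_apply, map_mul, map_inv, ← conjHom_apply, h, mul_inv_cancel]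

theorem conjHom_injective [K.Normal] [Finite K] [IsMulCommutative K] (hG : IsFrobeniusGroup K L)
    {ν : K →* ℂˣ} (hν : ν ≠ 1) : Function.Injective fun l : L => conjHom (l : G) ν := by
  intro a b hab
  refine (inv_mul_eq_one.1 (hG.eq_one_of_conjHom_eq (ν := ν) hν (l := b⁻¹ * a) ?_)).symm
  rw [Subgroup.coe_mul, Subgroup.coe_inv, conjHom_mul,
    show conjHom (a : G) ν = conjHom (b : G) ν from hab,
    ← conjHom_mul, inv_mul_cancel, conjHom_one]

theorem isIrreducible_inducedRep [K.Normal] [Finite K] [IsMulCommutative K] [Fintype L] [DecidableEq L]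
    (hG : IsFrobeniusGroup K L) {ν : K →* ℂˣ} (hν : ν ≠ 1) :
    (inducedRep K ν (fun l : L => (l : G)) hG.existsUnique_inv_mul_mem).IsIrreducible := by
  refine inducedRep_isIrreducible K ν _ _ fun i j hij => ?_
  by_contra! h
  refine hij (hG.conjHom_injective hν (MonoidHom.ext fun k => Units.ext ?_))
  simpa only [extendByZero_conj] using h k k.2

theorem isIrrChar_kernelChar [K.Normal] [Finite K] [IsMulCommutative K] [Fintype L]
    (hG : IsFrobeniusGroup K L) {ν : K →* ℂˣ} (hν : ν ≠ 1) : IsIrrChar (kernelChar K L ν) := by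
  classical
  have := IsIrrChar.of_rep (hG.isIrreducible_inducedRep hν)
  convert this using 1
  ext g
  rw [inducedRep_character, kernelChar]

theorem kernelChar_one_ne_one [K.Normal] [Fintype L] (hG : IsFrobeniusGroup K L) (ν : K →* ℂˣ) :
    kernelChar K L ν 1 ≠ 1 := by
  rw [kernelChar_one, ← Nat.card_eq_fintype_card]
  exact_mod_cast mt Subgroup.card_eq_one.1 hG.complement_ne_bot

end IsFrobeniusGroup

/-- The linear combinations of the translates of a vector. -/
noncomputable def orbitMap {V : Type*} [AddCommGroup V] [Module ℂ V] (σ : Representation ℂ G V)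
    (L : Subgroup G) [Fintype L] (v : V) : (L → ℂ) →ₗ[ℂ] V :=
  ∑ l : L, (LinearMap.proj l).smulRight (σ l v)

theorem orbitMap_apply {V : Type*} [AddCommGroup V] [Module ℂ V] (σ : Representation ℂ G V)
    (L : Subgroup G) [Fintype L] (v : V) (f : L → ℂ) :
    orbitMap σ L v f = ∑ l : L, f l • σ l v := by
  simp [orbitMap]

/-- The restriction of a representation to an abelian subgroup has an eigenvector. -/
theorem exists_hom_apply_eq_smul {V : Type*} [AddCommGroup V] [Module ℂ V] [FiniteDimensional ℂ V]
    [Nontrivial V] (σ : Representation ℂ G V) (K : Subgroup G) [hK : IsMulCommutative K] :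
    ∃ (ν : K →* ℂˣ) (v : V), v ≠ 0 ∧ ∀ k : K, σ k v = (ν k : ℂ) • v := by
  obtain ⟨W, ρ, hρ, hW⟩ := exists_irreducible_submodule (σ.comp K.subtype : Representation ℂ K V)
  have h1 := hρ.finrank_eq_one_of_commute fun a b => by rw [hK.is_comm.comm a b]
  obtain ⟨w, hw, hs⟩ := finrank_eq_one_iff'.1 h1
  choose c hc using fun k : K => hs (ρ k w)
  have hinj := smul_left_injective ℂ hw
  let ν : K →* ℂ :=
    { toFun := c
      map_one' := hinj (by simp [hc])
      map_mul' a b := hinj (by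
        change c (a * b) • w = (c a * c b) • w
        rw [hc, map_mul, Module.End.mul_apply, ← hc b, map_smul, ← hc a, smul_smul, mul_comm]) }
  refine ⟨ν.toHomUnits, w, by simpa using hw, fun k => ?_⟩
  rw [MonoidHom.coe_toHomUnits]
  have := congrArg Subtype.val (hc k)
  rw [hW] at this
  exact this.symm

namespace IsFrobeniusGroup

variable {K L : Subgroup G} {V : Type*} [AddCommGroup V] [Module ℂ V] {σ : Representation ℂ G V}

theorem apply_orbitMap [K.Normal] [Fintype L] [DecidableEq L] (hG : IsFrobeniusGroup K L)
    {ν : K →* ℂˣ} {v : V} (hv : ∀ k : K, σ k v = (ν k : ℂ) • v) (g : G) (f : L → ℂ) :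
    σ g (orbitMap σ L v f) = orbitMap σ L v
      (inducedRep K ν (fun l : L => (l : G)) hG.existsUnique_inv_mul_mem g f) := by
  simp only [orbitMap_apply, inducedRep_apply, map_sum, map_smul, Finset.sum_smul]
  rw [Finset.sum_comm]
  refine Finset.sum_congr rfl fun j _ => ?_
  obtain ⟨i, hi, hu⟩ := hG.existsUnique_inv_mul_mem (g * j)
  rw [Finset.sum_eq_single i]
  · have hi' : (i : G)⁻¹ * g * j ∈ K := by rwa [mul_assoc]
    rw [extendByZero_of_mem hi', mul_comm, mul_smul, ← map_smul (σ i), ← hv,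
      ← Module.End.mul_apply (σ i), ← map_mul, ← Module.End.mul_apply, ← map_mul]
    congr 3
    simp [mul_assoc]
  · intro l _ hl
    rw [extendByZero_of_notMem fun h => hl (hu l (by rwa [mul_assoc] at h)), zero_mul, zero_smul]
  · simp

theorem orbitMap_ne_zero [Fintype L] [DecidableEq L] {v : V} (hv : v ≠ 0) : orbitMap σ L v ≠ 0 := by
  intro h
  have h1 := LinearMap.congr_fun h (Pi.single 1 1)
  rw [orbitMap_apply, Finset.sum_eq_single 1 (fun l _ hl => by simp [hl]) (by simp)] at h1
  exact hv (by simpa using h1)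

theorem orbitMap_surjective [K.Normal] [Fintype L] (hG : IsFrobeniusGroup K L)
    (hσ : σ.IsIrreducible) {ν : K →* ℂˣ} {v : V} (hv0 : v ≠ 0)
    (hv : ∀ k : K, σ k v = (ν k : ℂ) • v) : Function.Surjective (orbitMap σ L v) := by
  classical
  rw [← LinearMap.range_eq_top]
  refine hσ.eq_top_of_invariant _ ?_ (mt LinearMap.range_eq_bot.1 (orbitMap_ne_zero hv0))
  rintro g _ ⟨f, rfl⟩
  exact ⟨_, (hG.apply_orbitMap hv g f).symm⟩

/-- An irreducible representation is trivial on the kernel or induced from it. -/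
theorem trivial_or_character_eq [K.Normal] [Finite K] [IsMulCommutative K] [Fintype L]
    [FiniteDimensional ℂ V] (hG : IsFrobeniusGroup K L) (hσ : σ.IsIrreducible) :
    (∀ k : K, σ k = 1) ∨ ∃ ν : K →* ℂˣ, ν ≠ 1 ∧ σ.character = kernelChar K L ν := by
  classical
  have := hσ.nontrivial_space
  obtain ⟨ν, v, hv0, hv⟩ := exists_hom_apply_eq_smul σ K
  have hsurj := hG.orbitMap_surjective hσ hv0 hv
  by_cases hν : ν = 1
  · subst hν
    refine Or.inl fun k => LinearMap.ext fun w => ?_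
    obtain ⟨f, rfl⟩ := hsurj w
    rw [Module.End.one_apply, orbitMap_apply, map_sum]
    refine Finset.sum_congr rfl fun l _ => ?_
    have h1 : (k : G) * l = l * (MulAut.conjNormal (l : G)⁻¹ k : K) := by simp [mul_assoc]
    rw [map_smul, ← Module.End.mul_apply, ← map_mul, h1, map_mul, Module.End.mul_apply, hv]
    simp
  -- The orbit map intertwines the induced representation with `σ`. It is onto because `σ` is
  -- irreducible and injective because the induced representation is.
  · refine Or.inr ⟨ν, hν, ?_⟩
    have hind := hG.isIrreducible_inducedRep hν
    have hinj : Function.Injective (orbitMap σ L v) := by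
      rw [← LinearMap.ker_eq_bot]
      by_contra hne
      refine orbitMap_ne_zero (σ := σ) (L := L) hv0 (LinearMap.ker_eq_top.1
        (hind.eq_top_of_invariant _ (fun g f hf => ?_) hne))
      rw [LinearMap.mem_ker] at hf ⊢
      rw [← hG.apply_orbitMap hv, hf, map_zero]
    let e := LinearEquiv.ofBijective _ ⟨hinj, hsurj⟩
    have he : ∀ f, e f = orbitMap σ L v f := fun _ => rfl
    ext g
    rw [kernelChar, ← inducedRep_character K ν _ hG.existsUnique_inv_mul_mem g,
      Representation.character, Representation.character, ← LinearMap.trace_conj' _ e]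
    congr 1
    refine LinearMap.ext fun w => ?_
    obtain ⟨f, rfl⟩ := e.surjective w
    rw [LinearEquiv.conj_apply_apply, e.symm_apply_apply, he, he, hG.apply_orbitMap hv]

end IsFrobeniusGroup

end Frobenius

open Representation

/-! ### Conjugacy of induced characters and the dual of the kernel. -/

section KernelChar

universe u

variable {G : Type u} [Group G] {K L : Subgroup G}

theorem sum_hom_mul_inv_eq_zero {A : Type*} [Group A] [Fintype A] {a b : A →* ℂˣ} (h : a ≠ b) :
    ∑ k, (a k : ℂ) * ((b k)⁻¹ : ℂˣ) = 0 := by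
  refine sum_hom_units_eq_zero ((Units.coeHom ℂ).comp (a * b⁻¹)) fun h1 => h ?_
  refine mul_inv_eq_one.1 (MonoidHom.ext fun k => Units.ext ?_)
  exact DFunLike.congr_fun h1 k

theorem conjHom_pow [K.Normal] (g : G) (ν : K →* ℂˣ) (a : ℕ) :
    conjHom g (ν ^ a) = conjHom g ν ^ a := rfl

theorem kernelChar_conjHom [K.Normal] [Fintype L] (ν : K →* ℂˣ) (l : L) :
    kernelChar K L (conjHom (l : G) ν) = kernelChar K L ν := by
  ext g
  by_cases hg : g ∈ K
  · lift g to K using hg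
    simp only [kernelChar_apply, ← conjHom_mul]
    exact Fintype.sum_equiv (Equiv.mulRight l) _ _ fun _ => rfl
  · simp [kernelChar_of_notMem _ hg]

/-- Induction commutes with Galois automorphisms: one that raises the values of `ν` to the power `a`
carries the character induced from `ν` to that induced from `ν ^ a`. -/
theorem exists_coe_eq_kernelChar [K.Normal] [Finite G] [Fintype L]
    (α : Gal(cyclotomicSubfield (Nat.card G)/ℚ)) (ν : K →* ℂˣ) (a : ℕ)
    (hα : ∀ z : cyclotomicSubfield (Nat.card G), (∃ k, (z : ℂ) = ν k) →
      ((α z : _) : ℂ) = (z : ℂ) ^ a) (g : G) :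
    ∃ z : cyclotomicSubfield (Nat.card G), (z : ℂ) = kernelChar K L ν g ∧
      ((α z : _) : ℂ) = kernelChar K L (ν ^ a) g := by
  by_cases hg : g ∈ K
  · lift g to K using hg
    have hmem : ∀ k : K, (ν k : ℂ) ∈ cyclotomicSubfield (Nat.card G) := fun k =>
      mem_cyclotomicSubfield (by
        obtain ⟨c, hc⟩ := K.card_subgroup_dvd_card
        rw [← Units.val_pow_eq_pow_val, ← map_pow, hc, pow_mul, pow_card_eq_one']
        simp)
    let z : L → cyclotomicSubfield (Nat.card G) := fun l => ⟨conjHom (l : G) ν g, hmem _⟩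
    refine ⟨∑ l, z l, ?_, ?_⟩
    · rw [kernelChar_apply, IntermediateField.coe_sum]
    · rw [map_sum, IntermediateField.coe_sum, kernelChar_apply]
      refine Finset.sum_congr rfl fun l _ => ?_
      rw [hα _ ⟨_, rfl⟩]
      simp [z, conjHom_pow]
  · exact ⟨0, by simp [kernelChar_of_notMem _ hg]⟩

namespace IsFrobeniusGroup

/-- The multiplicity of `μ` in the restriction to `K` is zero if no conjugate of `ν` equals `μ`, but
it is positive for the character induced from `μ`. -/
theorem exists_conjHom_eq [K.Normal] [Finite K] [IsMulCommutative K] [Fintype L]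
    (hG : IsFrobeniusGroup K L) {ν μ : K →* ℂˣ} (hμ : μ ≠ 1)
    (h : kernelChar K L ν = kernelChar K L μ) : ∃ l : L, μ = conjHom (l : G) ν := by
  have := Fintype.ofFinite K
  by_contra! hne
  have h1 : ∀ θ : K →* ℂˣ, ∑ k : K, kernelChar K L θ k * ((μ k)⁻¹ : ℂˣ) =
      ∑ l : L, ∑ k, (conjHom (l : G) θ k : ℂ) * ((μ k)⁻¹ : ℂˣ) := fun θ => by
    rw [Finset.sum_comm]
    simp only [kernelChar_apply, Finset.sum_mul]
  have h2 := h1 μ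
  rw [← h, h1, Finset.sum_eq_zero fun l _ => sum_hom_mul_inv_eq_zero (hne l).symm,
    Finset.sum_eq_single 1 (fun l _ hl => sum_hom_mul_inv_eq_zero fun e => hl
      (hG.eq_one_of_conjHom_eq hμ e)) (by simp)] at h2
  simp [conjHom_one, eq_comm] at h2

/-- If nonlinear characters of equal degree are conjugate then `L` permutes the nontrivial
characters of `K` transitively up to powers. -/
theorem exists_eq_conjHom_pow [K.Normal] [Finite G] [IsMulCommutative K]
    (hG : IsFrobeniusGroup K L) (h : IsGCStar G) {ν μ : K →* ℂˣ} (hν : ν ≠ 1) (hμ : μ ≠ 1) :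
    ∃ (a : ℕ) (l : L), μ = conjHom (l : G) ν ^ a := by
  have := Fintype.ofFinite L
  obtain ⟨α, hα⟩ := h _ _ (hG.isIrrChar_kernelChar hν) (hG.isIrrChar_kernelChar hμ)
    (hG.kernelChar_one_ne_one ν) (hG.kernelChar_one_ne_one μ) (by simp [kernelChar_one])
  have : NeZero (Nat.card G) := ⟨Nat.card_pos.ne'⟩
  obtain ⟨a, ha⟩ := exists_pow_of_gal α
  obtain ⟨l, hl⟩ := hG.exists_conjHom_eq (ν := ν ^ a) hμ (funext fun g => by
    obtain ⟨z, hz, hz'⟩ := exists_coe_eq_kernelChar (L := L) α ν a (fun z ⟨k, hk⟩ => ha z (by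
      obtain ⟨c, hc⟩ := K.card_subgroup_dvd_card
      rw [hk, ← Units.val_pow_eq_pow_val, ← map_pow, hc, pow_mul, pow_card_eq_one']
      simp)) g
    obtain ⟨w, hw, hw'⟩ := hα g
    rw [← hz', ← hw', Subtype.ext (hz.trans hw.symm)])
  exact ⟨a, l, hl.trans (conjHom_pow _ _ _)⟩

/-- Since `μ` is nontrivial and characters have exponent `q`, the exponent `a` is prime to `q`, so
some automorphism realizes it. Conjugating `ν` by `l` does not change the induced character. -/
theorem galoisConjugate_kernelChar [K.Normal] [Finite G] [Fintype L] {q : ℕ} (hq : q.Prime)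
    (hexp : ∀ ν : K →* ℂˣ, ν ^ q = 1) {ν μ : K →* ℂˣ} (hμ : μ ≠ 1) {a : ℕ} {l : L}
    (h : μ = conjHom (l : G) ν ^ a) :
    GaloisConjugate (kernelChar K L ν) (kernelChar K L μ) := by
  have : NeZero (Nat.card G) := ⟨Nat.card_pos.ne'⟩
  have ha : a.Coprime q := by
    rw [Nat.coprime_comm, hq.coprime_iff_not_dvd]
    rintro ⟨c, rfl⟩
    exact hμ (by rw [h, pow_mul (conjHom (l : G) ν) q c, hexp]; exact one_pow (M := K →* ℂˣ) c)
  have hqn : q ∣ Nat.card G := by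
    have := Fact.mk hq
    rw [← orderOf_eq_prime (G := K →* ℂˣ) (hexp μ) hμ]
    refine (orderOf_dvd_of_pow_eq_one ?_).trans K.card_subgroup_dvd_card
    exact MonoidHom.ext fun k => by
      rw [MonoidHom.pow_apply, ← map_pow, pow_card_eq_one', map_one, MonoidHom.one_apply]
  obtain ⟨α, hα⟩ := exists_gal_pow hqn ha
  refine ⟨α, fun g => ?_⟩
  rw [h, ← conjHom_pow, kernelChar_conjHom]
  refine exists_coe_eq_kernelChar α ν a (fun z ⟨k, hk⟩ => hα z ?_) g
  rw [hk, ← Units.val_pow_eq_pow_val, ← MonoidHom.pow_apply, hexp]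
  simp

/-- The action of the complement on the dual of an elementary abelian kernel. -/
theorem exists_dualRep [K.Normal] [Finite K] [IsMulCommutative K] (hG : IsFrobeniusGroup K L)
    {q : ℕ} (hexp : ∀ ν : K →* ℂˣ, ν ^ q = 1) :
    ∃ (V : Type u) (_ : AddCommGroup V) (_ : Module (ZMod q) V) (τ : Representation (ZMod q) L V)
      (e : (K →* ℂˣ) ≃ V), τ.FixedPointFree ∧ e 1 = 0 ∧
        (∀ l ν, τ l (e ν) = e (conjHom (l : G) ν)) ∧
          ∀ (a : ℕ) ν, e (ν ^ a) = (a : ZMod q) • e ν := by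
  obtain ⟨V, _, e, he⟩ : ∃ (V : Type u) (_ : AddCommGroup V) (e : (K →* ℂˣ) ≃ V),
      ∀ ν μ, e (ν * μ) = e ν + e μ := ⟨Additive (K →* ℂˣ), inferInstance, Additive.ofMul,
        fun _ _ => rfl⟩
  have he1 : e 1 = 0 := left_eq_add.1
    ((congrArg e (one_mul (M := K →* ℂˣ) 1)).symm.trans (he 1 1))
  have hpow : ∀ (a : ℕ) ν, e (ν ^ a) = a • e ν := fun a ν => by
    induction a with
    | zero => rw [zero_smul, ← he1]; exact congrArg e (pow_zero (M := K →* ℂˣ) ν)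
    | succ a ih => rw [pow_succ (M := K →* ℂˣ) ν a, he, ih, succ_nsmul]
  obtain ⟨_⟩ : Nonempty (Module (ZMod q) V) := ⟨AddCommGroup.zmodModule fun v => by
    rw [← e.apply_symm_apply v, ← hpow, hexp, he1]⟩
  let τ : Representation (ZMod q) L V :=
    { toFun l := AddMonoidHom.toZModLinearMap q
        (AddMonoidHom.mk' (fun v => e (conjHom (l : G) (e.symm v))) fun v w => by
          rw [← he, ← e.apply_symm_apply v, ← e.apply_symm_apply w, ← he]
          simp only [e.symm_apply_apply]
          rfl)
      map_one' := LinearMap.ext fun v => by simp [conjHom_one]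
      map_mul' a b := LinearMap.ext fun v => by simp [conjHom_mul] }
  have hτ : ∀ (l : L) (ν : K →* ℂˣ), τ l (e ν) = e (conjHom (l : G) ν) := fun l ν => by simp [τ]
  refine ⟨V, _, _, τ, e, fun l v h => ?_, he1, hτ, fun a ν => ?_⟩
  · obtain ⟨ν, rfl⟩ := e.surjective v
    by_cases hν : ν = 1
    · exact Or.inl (hν ▸ he1)
    · exact Or.inr (hG.eq_one_of_conjHom_eq hν (e.injective ((hτ l ν).symm.trans h)))
  · rw [Nat.cast_smul_eq_nsmul, hpow]

end IsFrobeniusGroup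

end KernelChar

open Representation

/-! ### The quaternion group through its centre. -/

section Quaternion

/-- The relations of the quaternion group that determine its nonlinear characters. -/
structure IsQuaternionCentre {L : Type*} [Group L] (z : L) : Prop where
  ne_one : z ≠ 1
  mul_self : z * z = 1
  comm : ∀ g, g * z = z * g
  mul_eq : ∀ a b : L, a * b = b * a ∨ a * b = z * (b * a)
  conj_eq : ∀ g : L, g = 1 ∨ g = z ∨ ∃ h, h * g * h⁻¹ = z * g
  exists_ne : ∃ a b : L, a * b ≠ b * a

theorem quaternionGroup_isQuaternionCentre :
    IsQuaternionCentre (QuaternionGroup.a 2 : QuaternionGroup 2) where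
  ne_one := by decide
  mul_self := by decide
  comm := by decide
  mul_eq := by decide
  conj_eq := by decide
  exists_ne := by decide

theorem IsQuaternionCentre.map {L M : Type*} [Group L] [Group M] {z : L}
    (h : IsQuaternionCentre z) (e : L ≃* M) : IsQuaternionCentre (e z) where
  ne_one := by simpa using h.ne_one
  mul_self := by rw [← map_mul, h.mul_self, map_one]
  comm g := by
    obtain ⟨g, rfl⟩ := e.surjective g
    rw [← map_mul, h.comm, map_mul]
  mul_eq a b := by
    obtain ⟨a, rfl⟩ := e.surjective a
    obtain ⟨b, rfl⟩ := e.surjective b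
    simpa only [← map_mul, e.injective.eq_iff] using h.mul_eq a b
  conj_eq g := by
    obtain ⟨g, rfl⟩ := e.surjective g
    rcases h.conj_eq g with rfl | rfl | ⟨x, hx⟩
    · simp
    · simp
    · exact Or.inr (Or.inr ⟨e x, by rw [← map_inv, ← map_mul, ← map_mul, hx, map_mul]⟩)
  exists_ne := by
    obtain ⟨a, b, h1⟩ := h.exists_ne
    exact ⟨e a, e b, by simpa only [← map_mul, ne_eq, e.injective.eq_iff] using h1⟩

theorem IsQuaternionCentre.orderOf {L : Type*} [Group L] {z : L} (h : IsQuaternionCentre z) :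
    orderOf z = 2 :=
  orderOf_eq_prime (by rw [sq, h.mul_self]) h.ne_one

end Quaternion

open Representation

/-! ### Necessity of the conditions. -/

section Forward

variable {G : Type*} [Group G] {K L : Subgroup G}

open scoped IsMulCommutative in
theorem card_monoidHom_units [Finite K] [IsMulCommutative K] :
    Nat.card (K →* ℂˣ) = Nat.card K := by
  have : NeZero (Monoid.exponent K) := ⟨Monoid.exponent_ne_zero_of_finite⟩
  exact CommGroup.card_monoidHom_of_hasEnoughRootsOfUnity K ℂ

open scoped IsMulCommutative in
theorem exists_hom_apply_ne_one_of_notMem [Finite K] [IsMulCommutative K] (N : Subgroup K) {k : K}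
    (hk : k ∉ N) : ∃ ν : K →* ℂˣ, ν k ≠ 1 ∧ ∀ x ∈ N, ν x = 1 := by
  have : NeZero (Monoid.exponent (K ⧸ N)) := ⟨Monoid.exponent_ne_zero_of_finite⟩
  obtain ⟨ν, hν⟩ := CommGroup.exists_apply_ne_one_of_hasEnoughRootsOfUnity (K ⧸ N) ℂ
    (a := (k : K ⧸ N)) (by rwa [Ne, QuotientGroup.eq_one_iff])
  refine ⟨ν.comp (QuotientGroup.mk' N), hν, fun x hx => ?_⟩
  rw [MonoidHom.comp_apply, QuotientGroup.mk'_apply, (QuotientGroup.eq_one_iff x).2 hx, map_one]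

theorem nonempty_mulEquiv_of_card_eq_nine {A : Type*} [CommGroup A] (h : ∀ a : A, a ^ 3 = 1)
    (hA : Nat.card A = 9) :
    Nonempty (A ≃* Multiplicative (ZMod 3) × Multiplicative (ZMod 3)) := by
  have : Finite (Additive A) := Nat.finite_of_card_ne_zero (α := A) (by lia)
  have : Fact (Nat.Prime 3) := ⟨Nat.prime_three⟩
  let _ : Module (ZMod 3) (Additive A) := AddCommGroup.zmodModule h
  have h1 : Module.finrank (ZMod 3) (Additive A) = Module.finrank (ZMod 3) (ZMod 3 × ZMod 3) := by
    have h2 := Module.natCard_eq_pow_finrank (K := ZMod 3) (V := Additive A)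
    rw [show Nat.card (Additive A) = 3 ^ 2 from hA, Nat.card_zmod] at h2
    have h3 : 2 = _ := Nat.pow_right_injective (by lia : 2 ≤ 3) h2
    simp [← h3]
  exact ⟨(AddEquiv.toMultiplicativeRight (LinearEquiv.ofFinrankEq _ _ h1).toAddEquiv).trans
    (MulEquiv.prodMultiplicative _ _)⟩

namespace IsFrobeniusGroup

/-- For a proper normal subgroup `N` below `K`, a nontrivial character of `K` trivial on `N` would
have all its conjugates and powers trivial on `N`, but these include every nontrivial character. -/
theorem isMinimalNormal [Finite G] [IsMulCommutative K] (hG : IsFrobeniusGroup K L)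
    (h : IsGCStar G) : IsMinimalNormal K where
  normal := hG.normal
  ne_bot := hG.kernel_ne_bot
  minimal N hN hle := by
    have := hG.normal
    by_contra! hne
    obtain ⟨⟨x, hx⟩, hx1⟩ := N.ne_bot_iff_exists_ne_one.1 hne.1
    obtain ⟨k, hk, hkN⟩ := SetLike.exists_of_lt (lt_of_le_of_ne hle hne.2)
    obtain ⟨ν, hν, hνN⟩ := exists_hom_apply_ne_one_of_notMem (N.subgroupOf K) (k := ⟨k, hk⟩) hkN
    obtain ⟨μ, hμ, -⟩ := exists_hom_apply_ne_one_of_notMem (⊥ : Subgroup K) (k := ⟨x, hle hx⟩)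
      (by simpa using hx1)
    obtain ⟨a, l, rfl⟩ := hG.exists_eq_conjHom_pow h (ν := ν) (μ := μ)
      (fun e => hν (by rw [e]; rfl)) (fun e => hμ (by rw [e]; rfl))
    refine hμ ?_
    rw [MonoidHom.pow_apply, conjHom_apply, hνN, one_pow]
    rw [Subgroup.mem_subgroupOf, MulAut.conjNormal_apply]
    exact hN.conj_mem x hx _

/-- Some character has prime order, and all nontrivial ones are powers of its conjugates. -/
theorem exists_prime_forall_pow_eq_one [Finite G] [IsMulCommutative K]
    (hG : IsFrobeniusGroup K L) (h : IsGCStar G) :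
    ∃ q : ℕ, q.Prime ∧ ∀ ν : K →* ℂˣ, ν ^ q = 1 := by
  have := hG.normal
  have hcard := card_monoidHom_units (K := K)
  have : Finite (K →* ℂˣ) := Nat.finite_of_card_ne_zero (by rw [hcard]; exact Nat.card_pos.ne')
  obtain ⟨q, hq, hdvd⟩ := Nat.exists_prime_and_dvd (mt Subgroup.card_eq_one.1 hG.kernel_ne_bot)
  have := Fact.mk hq
  obtain ⟨ν, hν⟩ := exists_prime_orderOf_dvd_card' (G := K →* ℂˣ) q (hcard ▸ hdvd)
  have hν1 : ν ≠ 1 := by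
    rintro rfl
    exact hq.ne_one (hν.symm.trans (orderOf_one (G := K →* ℂˣ)))
  have hνq : ν ^ q = 1 := (orderOf_dvd_iff_pow_eq_one (G := K →* ℂˣ)).1 hν.dvd
  refine ⟨q, hq, fun μ => ?_⟩
  by_cases hμ : μ = 1
  · rw [hμ]; exact one_pow (M := K →* ℂˣ) q
  · obtain ⟨a, l, rfl⟩ := hG.exists_eq_conjHom_pow h hν1 hμ
    rw [← pow_mul (M := K →* ℂˣ), mul_comm, pow_mul (M := K →* ℂˣ), ← conjHom_pow, hνq]
    exact one_pow (M := K →* ℂˣ) a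

theorem rationalValuesAgree (hG : IsFrobeniusGroup K L) (h : IsGCStar G) :
    RationalValuesAgree L := by
  intro χ ψ hχ hψ h1 h2 g r hr
  obtain ⟨f, hf⟩ := hG.exists_surjective_hom
  obtain ⟨g, rfl⟩ := hf g
  exact (h _ _ (hχ.comp hf) (hψ.comp hf) (by simpa using h1) (by simpa [← h2] using h1)
    (by simpa using h2)).apply_eq_of_rat hr

open scoped IsMulCommutative in
theorem isC3C3Q8 [IsMulCommutative K] (hG : IsFrobeniusGroup K L) (h3 : ∀ k : K, k ^ 3 = 1)
    (hK : Nat.card K = 9) (e : L ≃* QuaternionGroup 2) : IsC3C3Q8 G := by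
  have := hG.normal
  obtain ⟨f⟩ := nonempty_mulEquiv_of_card_eq_nine h3 hK
  refine ⟨_, ?_, ⟨(SemidirectProduct.mulEquivSubgroup hG.isComplement).symm.trans
    (SemidirectProduct.congr' f e)⟩⟩
  rw [injective_iff_map_eq_one]
  intro x hx
  obtain ⟨k, hk⟩ := K.ne_bot_iff_exists_ne_one.1 hG.kernel_ne_bot
  have h1 := (MulAut.congr f).injective (hx.trans (map_one (MulAut.congr f)).symm)
  have h2 := congrArg Subtype.val (DFunLike.congr_fun h1 k)
  exact e.symm.map_eq_one_iff.1 (Subtype.ext ((hG.fixedPointFree k k.2 _ (e.symm x).2 h2).resolve_left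
    (by simpa using hk)))

end IsFrobeniusGroup

theorem IsGCStar.classification [Finite G] [IsMulCommutative K] (hG : IsFrobeniusGroup K L)
    (h : IsGCStar G) : ∃ q n : ℕ, q.Prime ∧ Nat.card K = q ^ n ∧
      (IsC3C3Q8 G ∨ (IsCyclic L ∧
        ∃ d : ℕ, d ∣ q - 1 ∧ Nat.Coprime d n ∧ Nat.card L = (q ^ n - 1) / d)) := by
  have := hG.normal
  obtain ⟨q, hq, hexp⟩ := hG.exists_prime_forall_pow_eq_one h
  have := Fact.mk hq
  obtain ⟨V, _, _, τ, e, hfix, he1, hconj, hpow⟩ := hG.exists_dualRep hexp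
  have hcard : Nat.card V = Nat.card K := by rw [← Nat.card_congr e, card_monoidHom_units]
  have : Finite V := Nat.finite_of_card_ne_zero (hcard ▸ Nat.card_pos.ne')
  have : Nontrivial V := by
    rw [← Finite.one_lt_card_iff_nontrivial, hcard]
    exact (Subgroup.one_lt_card_iff_ne_bot K).2 hG.kernel_ne_bot
  have ht : τ.LineTransitive := by
    intro v w hv hw
    obtain ⟨ν, rfl⟩ := e.surjective v
    obtain ⟨μ, rfl⟩ := e.surjective w
    obtain ⟨a, l, rfl⟩ := hG.exists_eq_conjHom_pow h (ν := ν) (μ := μ)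
      (fun h1 => hv (h1 ▸ he1)) (fun h1 => hw (h1 ▸ he1))
    exact ⟨l, a, by rw [hpow, hconj]⟩
  have hn := Module.natCard_eq_pow_finrank (K := ZMod q) (V := V)
  rw [Nat.card_zmod] at hn
  obtain ⟨m, ρ, hρ⟩ := exists_isFixedPointFreeRep hfix.killsPrimeSums hfix.not_dvd_card
  rcases (hG.rationalValuesAgree h).isCyclic_or_quaternion hρ with hc | ⟨⟨f⟩⟩
  · exact ⟨q, _, hq, hcard.symm.trans hn, Or.inr ⟨hc, ht.card_of_isCyclic hfix hn⟩⟩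
  · have hz := quaternionGroup_isQuaternionCentre.map f.symm
    obtain ⟨a, b, hab⟩ := hz.exists_ne
    obtain ⟨rfl, h2⟩ := ht.eq_three_of_card_eq_eight hfix hn
      (by rw [Nat.card_congr f.toEquiv, Nat.card_eq_fintype_card]; rfl) hz.orderOf hab
    rw [h2, hcard] at hn
    refine ⟨3, 2, hq, hn, Or.inl (hG.isC3C3Q8 (fun k => ?_) hn f)⟩
    -- The characters of `K` have exponent three and separate its points, so `K` has exponent three.
    by_contra hk
    obtain ⟨ν, hν, -⟩ := exists_hom_apply_ne_one_of_notMem (⊥ : Subgroup K) (k := k ^ 3)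
      (by simpa using hk)
    exact hν (by rw [map_pow, ← MonoidHom.pow_apply, hexp, MonoidHom.one_apply])

end Forward

open Representation

/-! ### Characters trivial on the kernel, for a quaternion complement. -/

section Backward

variable {G : Type*} [Group G] {K L : Subgroup G}

/-- The elements of `K` killed by `q` form a nontrivial subgroup that is normal in `G`. -/
theorem IsMinimalNormal.pow_eq_one [Finite K] [hK : IsMulCommutative K] (h : IsMinimalNormal K)
    {q n : ℕ} (hq : q.Prime) (hcard : Nat.card K = q ^ n) (k : K) : k ^ q = 1 := by
  have := Fact.mk hq
  let N : Subgroup G :=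
    { carrier := {x | x ∈ K ∧ x ^ q = 1}
      one_mem' := ⟨K.one_mem, one_pow q⟩
      mul_mem' := fun {a b} ha hb => ⟨K.mul_mem ha.1 hb.1, by
        have hc : Commute a b := congrArg Subtype.val
          (hK.is_comm.comm (⟨a, ha.1⟩ : K) ⟨b, hb.1⟩)
        rw [hc.mul_pow, ha.2, hb.2, one_mul]⟩
      inv_mem' := fun {a} ha => ⟨K.inv_mem ha.1, by rw [inv_pow, ha.2, inv_one]⟩ }
  have hN : N.Normal := ⟨fun x hx g => ⟨h.normal.conj_mem x hx.1 g, by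
    rw [conj_pow, hx.2, mul_one, mul_inv_cancel]⟩⟩
  have hn : n ≠ 0 := by
    rintro rfl
    exact h.ne_bot (Subgroup.card_eq_one.1 (by simpa using hcard))
  obtain ⟨x, hx⟩ := exists_prime_orderOf_dvd_card' (G := K) q (hcard ▸ dvd_pow_self q hn)
  have hxN : (x : G) ∈ N := ⟨x.2, by
    rw [← Subgroup.coe_pow, orderOf_dvd_iff_pow_eq_one.1 hx.dvd, Subgroup.coe_one]⟩
  rcases h.minimal N hN (fun x hx => hx.1) with hb | hb
  · rw [hb, Subgroup.mem_bot, OneMemClass.coe_eq_one] at hxN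
    rw [hxN, orderOf_one] at hx
    exact absurd hx.symm hq.ne_one
  · have hk : (k : G) ∈ N := by rw [hb]; exact k.2
    exact Subtype.ext hk.2

namespace IsFrobeniusGroup

variable {V : Type*} [AddCommGroup V] [Module ℂ V] {σ : Representation ℂ G V}

theorem finrank_eq_one [FiniteDimensional ℂ V] (hG : IsFrobeniusGroup K L)
    (hσ : σ.IsIrreducible) (hK : ∀ k : K, σ k = 1)
    (h : ∀ a b : L, σ (a * b) = σ (b * a)) : Module.finrank ℂ V = 1 := by
  refine hσ.finrank_eq_one_of_commute fun x y => ?_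
  obtain ⟨a, k, rfl⟩ := hG.exists_eq_mul x
  obtain ⟨b, k', rfl⟩ := hG.exists_eq_mul y
  simpa only [map_mul, hK, mul_one] using h a b

/-- The central involution of a quaternion complement acts as `-1` in every nonlinear irreducible
representation that is trivial on the kernel. -/
theorem apply_quaternionCentre [FiniteDimensional ℂ V] (hG : IsFrobeniusGroup K L)
    (hσ : σ.IsIrreducible) (hK : ∀ k : K, σ k = 1) (h1 : Module.finrank ℂ V ≠ 1) {z : L}
    (hz : IsQuaternionCentre z) : σ z = -1 := by
  obtain ⟨c, hc⟩ := hσ.exists_eq_smul (σ z) fun g v => by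
    obtain ⟨a, k, rfl⟩ := hG.exists_eq_mul g
    rw [map_mul, hK, mul_one, ← Module.End.mul_apply, ← Module.End.mul_apply, ← map_mul, ← map_mul]
    exact congrArg (fun x : L => σ x v) (hz.comm a).symm
  have := hσ.nontrivial_space
  obtain ⟨v, hv⟩ := exists_ne (0 : V)
  have hcc : c * c = 1 := by
    refine smul_left_injective ℂ hv ?_
    have : σ z (σ z v) = v := by
      rw [← Module.End.mul_apply, ← map_mul, ← Subgroup.coe_mul, hz.mul_self]
      simp
    simpa [hc, smul_smul] using this
  rcases mul_self_eq_one_iff.1 hcc with rfl | rfl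
  · refine absurd (hG.finrank_eq_one hσ hK fun a b => ?_) h1
    have hz1 : σ z = 1 := LinearMap.ext fun v => by simp [hc]
    rcases hz.mul_eq a b with h | h
    · rw [← Subgroup.coe_mul, h, Subgroup.coe_mul]
    · rw [← Subgroup.coe_mul, h, Subgroup.coe_mul, map_mul, hz1, one_mul, Subgroup.coe_mul]
  · exact LinearMap.ext fun v => by simp [hc]

open Classical in
-- An element outside the centre is conjugate to its product with `z`, which acts as `-1`, so the
-- character vanishes there. The character is thus determined by its degree.
theorem character_of_quaternionCentre [FiniteDimensional ℂ V] (hG : IsFrobeniusGroup K L)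
    (hσ : σ.IsIrreducible) (hK : ∀ k : K, σ k = 1) (h1 : Module.finrank ℂ V ≠ 1) {z : L}
    (hz : IsQuaternionCentre z) (l : L) (k : K) : σ.character (l * k) =
      if l = 1 then σ.character 1 else if l = z then -σ.character 1 else 0 := by
  have hzσ := hG.apply_quaternionCentre hσ hK h1 hz
  have hlk : σ.character (l * k) = σ.character l := by
    rw [character, character, map_mul, hK, mul_one]
  have hneg : ∀ g : G, σ.character (z * g) = -σ.character g := fun g => by
    rw [character, character, map_mul, hzσ, neg_one_mul, map_neg]
  rw [hlk]
  split_ifs with h2 h3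
  · rw [h2, Subgroup.coe_one]
  · rw [h3, ← hneg, mul_one]
  · obtain ⟨x, hx⟩ := ((hz.conj_eq l).resolve_left h2).resolve_left h3
    have h4 := char_conj σ (l : G) x
    rw [← Subgroup.coe_inv, ← Subgroup.coe_mul, ← Subgroup.coe_mul, hx, Subgroup.coe_mul, hneg] at h4
    exact self_eq_neg.1 h4.symm

/-- If the degree were `|L|`, the translates of a vector would be linearly independent, whereas `v +
z v = 0`. -/
theorem finrank_ne_card [K.Normal] [Fintype L] [FiniteDimensional ℂ V] (hG : IsFrobeniusGroup K L)
    (hσ : σ.IsIrreducible) (hK : ∀ k : K, σ k = 1) (h1 : Module.finrank ℂ V ≠ 1) {z : L}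
    (hz : IsQuaternionCentre z) : Module.finrank ℂ V ≠ Fintype.card L := by
  classical
  intro h2
  have := hσ.nontrivial_space
  obtain ⟨v, hv⟩ := exists_ne (0 : V)
  have hsurj := hG.orbitMap_surjective hσ (ν := 1) hv fun k => by simp [hK]
  have hinj := (LinearMap.injective_iff_surjective_of_finrank_eq_finrank (by simp [h2])).2 hsurj
  have h3 : orbitMap σ L v (Pi.single 1 1 + Pi.single z 1) = 0 := by
    simp [orbitMap_apply, add_smul, Finset.sum_add_distrib, Pi.single_apply, ite_smul,
      hG.apply_quaternionCentre hσ hK h1 hz]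
  have h4 := congrFun (hinj (h3.trans (map_zero _).symm)) z
  simp [hz.ne_one] at h4

end IsFrobeniusGroup

end Backward

open Representation

/-! ### Sufficiency of the conditions. -/

section Backward

variable {G : Type*} [Group G] {K L : Subgroup G}

theorem eq_nine_of_mul_eq {q n m : ℕ} (hq : q.Prime) (h : q ^ n * m = 72) (hm : ¬ q ∣ m)
    (hlt : m < q ^ n) : q ^ n = 9 ∧ m = 8 := by
  have hn0 : n ≠ 0 := by
    rintro rfl
    rw [pow_zero] at h hlt
    lia
  have hm0 : 0 < m := Nat.pos_of_ne_zero (by rintro rfl; lia)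
  have hq72 : q ∣ 2 ^ 3 * 3 ^ 2 := (dvd_pow_self q hn0).trans ⟨m, h.symm⟩
  have hn : n < 7 := by
    by_contra! hn
    have h1 := (Nat.pow_le_pow_left hq.two_le 7).trans (Nat.pow_le_pow_right hq.pos hn)
    nlinarith
  have hq23 : q = 2 ∨ q = 3 := ((Nat.Prime.dvd_mul hq).1 hq72).imp
    (fun h => (Nat.prime_dvd_prime_iff_eq hq Nat.prime_two).1 (hq.dvd_of_dvd_pow h))
    (fun h => (Nat.prime_dvd_prime_iff_eq hq Nat.prime_three).1 (hq.dvd_of_dvd_pow h))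
  rcases hq23 with rfl | rfl <;> interval_cases n <;> lia

theorem IsC3C3Q8.card_eq (h : IsC3C3Q8 G) : Nat.card G = 72 := by
  obtain ⟨φ, -, ⟨e⟩⟩ := h
  rw [Nat.card_congr e.toEquiv, SemidirectProduct.card, Nat.card_prod,
    Nat.card_eq_fintype_card (α := QuaternionGroup 2)]
  simp [QuaternionGroup.card]

theorem IsC3C3Q8.nonempty_mulEquiv (h : IsC3C3Q8 G) (hL : Nat.card L = 8) :
    Nonempty (L ≃* QuaternionGroup 2) := by
  obtain ⟨φ, -, ⟨e⟩⟩ := h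
  have : Finite L := Nat.finite_of_card_ne_zero (by lia)
  let f : L →* QuaternionGroup 2 :=
    SemidirectProduct.rightHom.comp (e.toMonoidHom.comp L.subtype)
  have hf : Function.Injective f := by
    rw [injective_iff_map_eq_one]
    intro l hl
    obtain ⟨x, hx⟩ : e l ∈ (SemidirectProduct.inl (φ := φ)).range := by
      rw [SemidirectProduct.range_inl_eq_ker_rightHom]
      exact hl
    have hx3 : ∀ x : Multiplicative (ZMod 3) × Multiplicative (ZMod 3), x ^ 3 = 1 := by decide
    have h3 : l ^ 3 = 1 := Subtype.ext (e.injective (by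
      rw [Subgroup.coe_pow, map_pow, ← hx, ← map_pow, hx3]
      simp))
    have h8 : l ^ 8 = 1 := hL ▸ pow_card_eq_one'
    exact pow_eq_one_iff_of_coprime (show Nat.Coprime 3 8 by decide) |>.1 ⟨h3, h8⟩
  exact ⟨MulEquiv.ofBijective f ((Nat.bijective_iff_injective_and_card f).2
    ⟨hf, by rw [hL, Nat.card_eq_fintype_card]; rfl⟩)⟩

namespace IsFrobeniusGroup

theorem isGCStar_of_isCyclic [K.Normal] [Finite G] [IsMulCommutative K]
    (hG : IsFrobeniusGroup K L) {q : ℕ} (hq : q.Prime) (hexp : ∀ ν : K →* ℂˣ, ν ^ q = 1)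
    [IsCyclic L]
    (ht : ∀ ν μ : K →* ℂˣ, ν ≠ 1 → μ ≠ 1 → ∃ (a : ℕ) (l : L), μ = conjHom (l : G) ν ^ a) :
    IsGCStar G := by
  have := Fintype.ofFinite L
  let _ : CommGroup L := IsCyclic.commGroup
  have key : ∀ χ : G → ℂ, IsIrrChar χ → χ 1 ≠ 1 → ∃ ν : K →* ℂˣ, ν ≠ 1 ∧ χ = kernelChar K L ν := by
    rintro _ ⟨m, ρ, hρ, rfl⟩ h1
    refine (hG.trivial_or_character_eq hρ).resolve_left fun hK => h1 ?_
    rw [char_one, hG.finrank_eq_one hρ hK fun a b => ?_, Nat.cast_one]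
    rw [← Subgroup.coe_mul, mul_comm a b, Subgroup.coe_mul]
  intro χ ψ hχ hψ h1 h2 _
  obtain ⟨ν, hν, rfl⟩ := key χ hχ h1
  obtain ⟨μ, hμ, rfl⟩ := key ψ hψ h2
  obtain ⟨a, l, h⟩ := ht ν μ hν hμ
  exact galoisConjugate_kernelChar hq hexp hμ h

/-- Two nonlinear characters trivial on `K` of equal degree coincide and are integer valued; one
trivial on `K` and one induced have different degrees. There are `|K| - 1 = |L|` nontrivial
characters of `K`, a single free orbit of `L`, so all induced characters are equal and no Galois
action is needed. -/
theorem isGCStar_of_quaternionCentre [K.Normal] [Finite G] [IsMulCommutative K]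
    (hG : IsFrobeniusGroup K L) {q : ℕ} (hq : q.Prime) (hexp : ∀ ν : K →* ℂˣ, ν ^ q = 1)
    (hcard : Nat.card K = Nat.card L + 1) {z : L} (hz : IsQuaternionCentre z) : IsGCStar G := by
  have := Fintype.ofFinite L
  have : Finite (K →* ℂˣ) := Nat.finite_of_card_ne_zero
    (by rw [card_monoidHom_units]; exact Nat.card_pos.ne')
  rintro _ _ ⟨m, ρ, hρ, rfl⟩ ⟨m', ρ', hρ', rfl⟩ h1 h2 h3
  have hfin : ∀ {m : ℕ} {ρ : Representation ℂ G (Fin m → ℂ)}, ρ.character 1 ≠ 1 →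
      Module.finrank ℂ (Fin m → ℂ) ≠ 1 := fun h e => h (by rw [char_one, e, Nat.cast_one])
  rcases hG.trivial_or_character_eq hρ with hK | ⟨ν, hν, h⟩ <;>
    rcases hG.trivial_or_character_eq hρ' with hK' | ⟨μ, hμ, h'⟩
  · have hEq : ρ.character = ρ'.character := by
      ext g
      obtain ⟨l, k, rfl⟩ := hG.exists_eq_mul g
      rw [hG.character_of_quaternionCentre hρ hK (hfin h1) hz,
        hG.character_of_quaternionCentre hρ' hK' (hfin h2) hz, h3]
    rw [← hEq]
    refine GaloisConjugate.of_mem fun g => ?_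
    obtain ⟨l, k, rfl⟩ := hG.exists_eq_mul g
    rw [hG.character_of_quaternionCentre hρ hK (hfin h1) hz, char_one]
    split_ifs
    · exact natCast_mem _ _
    · exact neg_mem (natCast_mem _ _)
    · exact zero_mem _
  · refine absurd ?_ (hG.finrank_ne_card hρ hK (hfin h1) hz)
    rw [h', kernelChar_one, char_one] at h3
    exact_mod_cast h3
  · refine absurd ?_ (hG.finrank_ne_card hρ' hK' (hfin h2) hz)
    rw [h, kernelChar_one, char_one] at h3
    exact_mod_cast h3.symm
  · rw [h, h']
    let f : L → {μ : K →* ℂˣ // μ ≠ 1} := fun l => ⟨conjHom (l : G) ν, conjHom_ne_one _ hν⟩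
    have hf : Function.Bijective f := by
      refine (Nat.bijective_iff_injective_and_card f).2
        ⟨fun a b hab => hG.conjHom_injective hν (congrArg Subtype.val hab), ?_⟩
      have h4 : Nat.card {μ : K →* ℂˣ // μ ≠ 1} = ({1}ᶜ : Set (K →* ℂˣ)).ncard := rfl
      rw [h4, Set.ncard_compl, Set.ncard_singleton, card_monoidHom_units, hcard,
        Nat.add_sub_cancel]
    obtain ⟨l, hl⟩ := hf.2 ⟨μ, hμ⟩
    exact galoisConjugate_kernelChar hq hexp hμ (a := 1) (l := l)
      ((congrArg Subtype.val hl).symm.trans (pow_one (M := K →* ℂˣ) _).symm)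

theorem isGCStar [Finite G] [IsMulCommutative K] (hG : IsFrobeniusGroup K L)
    (hmin : IsMinimalNormal K) {q n : ℕ} (hq : q.Prime) (hcard : Nat.card K = q ^ n)
    (h : IsC3C3Q8 G ∨ (IsCyclic L ∧
      ∃ d : ℕ, d ∣ q - 1 ∧ Nat.Coprime d n ∧ Nat.card L = (q ^ n - 1) / d)) : IsGCStar G := by
  have := hG.normal
  have := Fact.mk hq
  have hexp : ∀ ν : K →* ℂˣ, ν ^ q = 1 := fun ν => MonoidHom.ext fun k => by
    rw [MonoidHom.pow_apply, ← map_pow, hmin.pow_eq_one hq hcard, map_one, MonoidHom.one_apply]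
  obtain ⟨V, _, _, τ, e, hfix, he1, hconj, hpow⟩ := hG.exists_dualRep hexp
  have hV : Nat.card V = Nat.card K := by rw [← Nat.card_congr e, card_monoidHom_units]
  have : Finite V := Nat.finite_of_card_ne_zero (hV ▸ Nat.card_pos.ne')
  have : Nontrivial V := by
    rw [← Finite.one_lt_card_iff_nontrivial, hV]
    exact (Subgroup.one_lt_card_iff_ne_bot K).2 hG.kernel_ne_bot
  rcases h with h | ⟨hc, d, hd, hdn, hL⟩
  · have h1 := hfix.card_lt
    have h2 := hG.isComplement.card_mul_card
    rw [h.card_eq, hcard] at h2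
    rw [hV, hcard] at h1
    obtain ⟨h9, h8⟩ := eq_nine_of_mul_eq hq h2 hfix.not_dvd_card h1
    obtain ⟨f⟩ := h.nonempty_mulEquiv h8
    exact hG.isGCStar_of_quaternionCentre hq hexp (by rw [hcard, h9, h8])
      (quaternionGroup_isQuaternionCentre.map f.symm)
  · have ht := hfix.lineTransitive (hV.trans hcard) hd hdn hL
    refine hG.isGCStar_of_isCyclic hq hexp fun ν μ hν hμ => ?_
    obtain ⟨l, a, h⟩ := ht (e ν) (e μ) (fun h1 => hν (e.injective (h1.trans he1.symm)))
      (fun h1 => hμ (e.injective (h1.trans he1.symm)))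
    refine ⟨a.val, l, e.injective ?_⟩
    rw [h, hpow, hconj, ZMod.natCast_zmod_val]

end IsFrobeniusGroup

end Backward

theorem theorem3p5 {G : Type*} [Group G] [Finite G] (K L : Subgroup G)
    (hG : IsFrobeniusGroup K L) (hK : IsMulCommutative K) :
    IsGCStar G ↔
      IsMinimalNormal K ∧
        ∃ q n : ℕ, q.Prime ∧ Nat.card K = q ^ n ∧
          (IsC3C3Q8 G ∨
            (IsCyclic L ∧
              ∃ d : ℕ, d ∣ q - 1 ∧ Nat.Coprime d n ∧ Nat.card L = (q ^ n - 1) / d)) :=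
  ⟨fun h => ⟨hG.isMinimalNormal h, h.classification hG⟩,
    fun ⟨hmin, _, _, hq, hcard, h⟩ => hG.isGCStar hmin hq hcard h⟩
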